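/- **Setting.** Let $J>0$, $T>0$, $h\in\mathbb R$, $\eta\in\mathbb C$ with $\Delta=\cosh\eta$ real, $\Delta>-1$, and suppose that $q=e^\eta$ is not a root of unity. Let $\lambda_1,\dots,\lambda_n\in\mathbb C$ with $\sinh(\lambda_i-\lambda_j)\ne0$ and $\sinh(\lambda_i-\lambda_j\pm\eta)\neq 0$ for $i\ne j$; put $\xi_j=e^{\lambda_j}$, $\zeta=e^{\mu}$. *Functions.* Let $C$ be a closed rectifiable contour going once, in the positive sense, around $0$ and around every $\lambda_j$, such that $\sinh z$, $\sinh(z+\eta)$, $\sinh(z-\lambda_j)$, $\sinh(z-\lambda_j\pm\eta)$, $\sinh(z-w\pm\eta)$ do not vanish for $z,w\in C$. Let $\mathfrak a$ solve on $C$ $$\ln\mathfrak a(z)=-\frac hT-\frac{2J\sinh^2\eta}{T\sinh z\,\sinh(z+\eta)}-\int_C\frac{dw}{2\pi i}\frac{\sinh(2\eta)\ln(1+\mathfrak a(w))}{\sinh(z-w+\eta)\sinh(z-w-\eta)},$$ with $\ln(1+\mathfrak a)$ continuous on $C$. With $K(x;\alpha)=e^{\alpha\eta}\coth(x-\eta)-e^{-\alpha\eta}\coth(x+\eta)$,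 let $G(\cdot,\mu;\alpha)$, for $\mu\in\{\lambda_1,\dots,\lambda_n\}$ and complex $\alpha$ near $0$, be a continuous solution on $C$ of $$G(z,\mu;\alpha)=-\coth(z-\mu)+e^{\alpha\eta}\coth(z-\mu-\eta)+\int_C\frac{dw\,G(w,\mu;\alpha)}{2\pi i(1+\mathfrak a(w))}K(z-w;\alpha),$$ and assume that at $\alpha=0$ this linear equation has at most one continuous solution. Put $$\varphi(\mu;\alpha)=1+\int_C\frac{dw\,G(w,\mu;\alpha)}{\pi i(1+\mathfrak a(w))},\qquad \psi(\mu_1,\mu_2;\alpha)=\int_C\frac{dw\,G(w,\mu_1;\alpha)}{\pi i(1+\mathfrak a(w))}\bigl(-\coth(w-\mu_2)+e^{-\alpha\eta}\coth(w-\mu_2-\eta)\bigr),$$ $$\omega(\mu_1,\mu_2;\alpha)=-e^{\alpha(\mu_1-\mu_2)}\psi(\mu_1,\mu_2;\alpha)-\frac{e^{\alpha(\mu_1-\mu_2)}}{2\cosh^2(\alpha\eta/2)}K(\mu_1-\mu_2;-\alpha).$$ *Operators.* All act on $\mathrm{End}(\mathcal V)$, $\mathcal V=(\mathbb C^2)^{\otimes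 n}$; $\mathbb S=[S^z,\cdot\,]$ with $S^z=\frac12\sum_j\sigma^z_j$. Let $R(\zeta)=(q\zeta-q^{-1}\zeta^{-1})\left(\begin{smallmatrix}1&0&0&0\\0&\beta&\gamma&0\\0&\gamma&\beta&0\\0&0&0&1\end{smallmatrix}\right)$ with $\beta=\frac{(1-\zeta^2)q}{1-q^2\zeta^2}$, $\gamma=\frac{(1-q^2)\zeta}{1-q^2\zeta^2}$. Let $a,a^*,q^{\pm D}$ generate the $q$-oscillator algebra, with modules $W^+=\bigoplus_{k\ge0}\mathbb C|k\rangle$, $W^-=\bigoplus_{k\le-1}\mathbb C|k\rangle$, $q^D|k\rangle=q^k|k\rangle$, $a|k\rangle=(1-q^{2k})|k-1\rangle$, $a^*|k\rangle=(1-\delta_{k,-1})|k+1\rangle$; traces $\mathrm{tr}^\pm$ over $W^\pm$ of expressions weighted by powers $q^{\pm2\alpha D}$ are continued meromorphically in $\alpha$. Let $$L^+(\zeta)=i\zeta^{-1/2}q^{-1/4}(1-\zeta a^*\sigma^+-\zeta a\sigma^--\zeta^2q^{2D+2}\sigma^-\sigma^+)q^{\sigma^zD},\quad L^-=\sigma^xL^+\sigma^x,\quad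 G^\pm=q^{\mp\sigma^z_aD}(1+a^*\sigma_a^\pm),$$ $T_A^\pm(\zeta)=L_n^\pm(\zeta/\xi_n)\cdots L_1^\pm(\zeta/\xi_1)$, $T_a(\zeta)=R_{a,n}(\zeta/\xi_n)\cdots R_{a,1}(\zeta/\xi_1)$ and $T^\pm_{\{A,a\}}=(G^\pm)^{-1}T_A^\pm T_aG^\pm$. Let $\mathbb C^+(\zeta)(X)$ be the lower left entry of $(T^+_{\{A,a\}})^{-1}XT^+_{\{A,a\}}$ and $\mathbb B^-(\zeta)(X)$ the upper right entry of $(T^-_{\{A,a\}})^{-1}XT^-_{\{A,a\}}$, as $2\times2$ matrices on the auxiliary space $a$. Define, up to terms regular at the $\xi_j$ in the case of $\mathbf c$ and $\mathbf b$, $$\mathbf c(\zeta,\alpha)=q^{\alpha-\mathbb S}(1-q^{2(\alpha-\mathbb S)})\,\zeta^{\alpha-\mathbb S}\,\mathrm{tr}^+_A\bigl(q^{2\alpha D}\mathbb C^+(\zeta)\bigr),\qquad \mathbf b(\zeta,\alpha)=q^{2\mathbb S}\zeta^{-\alpha+\mathbb S}\,\mathrm{tr}^-_A\bigl(q^{-2\alpha(D+1)}\mathbb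 B^-(\zeta)\bigr),$$ $$\mathbf H(\zeta;\alpha)(X)=\mathrm{tr}_a\,\mathrm{tr}^+_A\bigl(q^{2\alpha D}\,T_a^{-1}(T_A^+)^{-1}X\,T_A^+T_a\bigr).$$ **Proposition.** For all complex $\alpha\neq0$ close to $0$ the operators $\mathbf b(e^\mu,\alpha-1)$, $\mathbf c(e^\mu,\alpha)$, $\mathbf H(e^\mu;\alpha)$ have at most simple poles at $\mu=\lambda_j$, and the limits $$\Omega_1=-\lim_{\alpha\to0}\int\!\!\int\frac{d\mu_1}{2\pi i}\frac{d\mu_2}{2\pi i}\,\omega(\mu_1,\mu_2;\alpha)\,\mathbf b(e^{\mu_1},\alpha-1)\,\mathbf c(e^{\mu_2},\alpha),\qquad \Omega_2=-\lim_{\alpha\to0}\int\frac{d\mu}{2\pi i}\,\varphi(\mu;\alpha)\,\mathbf H(e^{\mu};\alpha)$$ exist as linear operators on $\mathrm{End}(\mathcal V)$ (in all spin sectors), where the integrals mean summing the residues at the simple poles $\mu_1,\mu_2,\mu\in\{\lambda_1,\dots,\lambda_n\}$ of $\mathbf b$, $\mathbf c$, $\mathbf H$; that is, they stand for $\sum_{i,j}\omega(\lambda_i,\lambda_j;\alpha)\,\mathbf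 b_i(\alpha-1)\mathbf c_j(\alpha)$ and $\sum_j\varphi(\lambda_j;\alpha)\,\mathbf H_j(\alpha)$, with $\mathbf b_i,\mathbf c_j,\mathbf H_j$ the residues. -/

import Mathlib

open Filter Topology

noncomputable section

namespace XXZ

/-! ### The physical part: contour integrals, auxiliary function, the functions `φ` and `ω` -/

/-- `∮_C f(w) dw` along a Lipschitz curve `γ` parametrised by `[0,1]`. -/
def contourIntegral (γ : ℝ → ℂ) (f : ℂ → ℂ) : ℂ :=
  ∫ t in (0 : ℝ)..1, f (γ t) * deriv γ t

/-- The point set of the contour. -/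
def contourSet (γ : ℝ → ℂ) : Set ℂ := γ '' Set.Icc 0 1

/-- `γ` runs around `z` once in the positive sense. -/
def Encloses (γ : ℝ → ℂ) (z : ℂ) : Prop :=
  z ∉ contourSet γ ∧ contourIntegral γ (fun w => (w - z)⁻¹) = 2 * Real.pi * Complex.I

def coth (z : ℂ) : ℂ := Complex.cosh z / Complex.sinh z

/-- The kernel `K(x;α) = e^{αη} coth(x-η) - e^{-αη} coth(x+η)`. -/
def kernelK (η x α : ℂ) : ℂ :=
  Complex.exp (α * η) * coth (x - η) - Complex.exp (-(α * η)) * coth (x + η)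

/-- A closed rectifiable contour enclosing the origin and the inhomogeneities, on which the kernel
`K` and all driving terms of the integral equations are regular. -/
structure IsContour {n : ℕ} (η : ℂ) (lam : Fin n → ℂ) (γ : ℝ → ℂ) : Prop where
  lipschitz : ∃ M, LipschitzOnWith M γ (Set.Icc 0 1)
  closed : γ 0 = γ 1
  encloses_zero : Encloses γ 0
  encloses_lam : ∀ j, Encloses γ (lam j)
  kernel_regular : ∀ z ∈ contourSet γ, ∀ w ∈ contourSet γ, Complex.sinh (z - w + η) ≠ 0
  driving_regular : ∀ z ∈ contourSet γ, Complex.sinh z ≠ 0 ∧ Complex.sinh (z + η) ≠ 0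
  lam_regular : ∀ z ∈ contourSet γ, ∀ j, Complex.sinh (z - lam j) ≠ 0 ∧
    Complex.sinh (z - lam j - η) ≠ 0 ∧ Complex.sinh (z - lam j + η) ≠ 0

/-- `a` solves on the contour the non-linear integral equation
`ln a(z) = -h/T - 2J sh²(η)/(T sh(z) sh(z+η))
  - ∮ dw/(2πi) sh(2η) ln(1+a(w)) / (sh(z-w+η) sh(z-w-η))`,
where `ln(1+a)` is a continuous logarithm of `1+a` along the contour. -/
def IsAuxiliary (γ : ℝ → ℂ) (η : ℂ) (J T h : ℝ) (a : ℂ → ℂ) : Prop :=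
  ∃ ℓ : ℂ → ℂ, ContinuousOn ℓ (contourSet γ) ∧
    (∀ w ∈ contourSet γ, Complex.exp (ℓ w) = 1 + a w) ∧
    ∀ z ∈ contourSet γ, a z = Complex.exp
      (-(h / T) - 2 * J * Complex.sinh η ^ 2 / (T * Complex.sinh z * Complex.sinh (z + η))
        - contourIntegral γ (fun w => 1 / (2 * Real.pi * Complex.I) *
            (Complex.sinh (2 * η) * ℓ w /
              (Complex.sinh (z - w + η) * Complex.sinh (z - w - η)))))

/-- The integral operator `f ↦ ∮ dw/(2πi(1+a(w))) f(w) K(z-w;α)`. -/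
def kernelOp (γ : ℝ → ℂ) (η : ℂ) (a : ℂ → ℂ) (α : ℂ) (f : ℂ → ℂ) (z : ℂ) : ℂ :=
  contourIntegral γ (fun w => f w / (2 * Real.pi * Complex.I * (1 + a w)) * kernelK η (z - w) α)

/-- `g = G(·,μ;α)` is a continuous solution on the contour of the linear integral equation
`G(z,μ;α) = -coth(z-μ) + e^{αη} coth(z-μ-η) + ∮ dw G(w,μ;α)/(2πi(1+a(w))) K(z-w;α)`. -/
def IsDensity (γ : ℝ → ℂ) (η : ℂ) (a : ℂ → ℂ) (μ α : ℂ) (g : ℂ → ℂ) : Prop :=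
  ContinuousOn g (contourSet γ) ∧
    ∀ z ∈ contourSet γ,
      g z = -coth (z - μ) + Complex.exp (α * η) * coth (z - μ - η) + kernelOp γ η a α g z

/-- The linear integral equation has at most one continuous solution at `α = 0`. -/
def UniquelySolvable (γ : ℝ → ℂ) (η : ℂ) (a : ℂ → ℂ) : Prop :=
  ∀ f : ℂ → ℂ, ContinuousOn f (contourSet γ) →
    (∀ z ∈ contourSet γ, f z = kernelOp γ η a 0 f z) → ∀ z ∈ contourSet γ, f z = 0

/-- `φ(μ;α)`, with `G z μ α` the function `G(z,μ;α)`. -/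
def phi (γ : ℝ → ℂ) (a : ℂ → ℂ) (G : ℂ → ℂ → ℂ → ℂ) (μ α : ℂ) : ℂ :=
  1 + contourIntegral γ (fun w => G w μ α / (Real.pi * Complex.I * (1 + a w)))

/-- `ψ(μ₁,μ₂;α)`. -/
def psi (γ : ℝ → ℂ) (η : ℂ) (a : ℂ → ℂ) (G : ℂ → ℂ → ℂ → ℂ) (μ₁ μ₂ α : ℂ) : ℂ :=
  contourIntegral γ (fun w => G w μ₁ α / (Real.pi * Complex.I * (1 + a w)) *
    (-coth (w - μ₂) + Complex.exp (-(α * η)) * coth (w - μ₂ - η)))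

/-- `ω(μ₁,μ₂;α)`. -/
def omega (γ : ℝ → ℂ) (η : ℂ) (a : ℂ → ℂ) (G : ℂ → ℂ → ℂ → ℂ) (μ₁ μ₂ α : ℂ) : ℂ :=
  -Complex.exp (α * (μ₁ - μ₂)) * psi γ η a G μ₁ μ₂ α
    - Complex.exp (α * (μ₁ - μ₂)) / (2 * Complex.cosh (α * η / 2) ^ 2) * kernelK η (μ₁ - μ₂) (-α)

/-! ### The `q`-oscillator algebra and its weighted traces

With `q = e^η`, the algebra acts on the free `ℂ[Q,Q⁻¹]`-module with basis `|k⟩`, `k ∈ ℤ`, by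
`q^D|k⟩ = q^k Q|k⟩`, `a|k⟩ = (1 - q^{2k}Q²)|k-1⟩`, `a*|k⟩ = |k+1⟩`. At `Q = 1` the span of the `|k⟩`
with `k ≥ 0` is the submodule `W⁺`, and the quotient by it is `W⁻`. A matrix element `⟨0|x|0⟩` is a
Laurent polynomial `f(Q)`, and `⟨k|x|k⟩ = f(q^k)` in `W⁺` for `k ≥ 0`, in `W⁻` for `k ≤ -1`. -/

abbrev LPoly := LaurentPolynomial ℂ

/-- Operators on the universal `q`-oscillator module. -/
abbrev OscEnd := Module.End LPoly (ℤ →₀ LPoly)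

/-- The operator `|k⟩ ↦ f(k) |k+d⟩`. -/
def band (d : ℤ) (f : ℤ → LPoly) : OscEnd :=
  Finsupp.lsum LPoly fun k => LinearMap.toSpanSingleton LPoly _ (Finsupp.single (k + d) (f k))

/-- `q^{mD}`. -/
def qD (η : ℂ) (m : ℤ) : OscEnd :=
  band 0 fun k => LaurentPolynomial.C (Complex.exp (η * (m * k))) * LaurentPolynomial.T m

/-- The generator `a`. -/
def oscA (η : ℂ) : OscEnd :=
  band (-1) fun k => 1 - LaurentPolynomial.C (Complex.exp (η * (2 * k))) * LaurentPolynomial.T 2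

/-- The generator `a*`. -/
def oscAstar : OscEnd := band 1 fun _ => 1

/-- The Laurent polynomial `f` with `⟨k|x|k⟩ = f(q^k)`. -/
def diagPart (x : OscEnd) : LPoly := (x (Finsupp.single 0 1)) 0

/-- `tr⁺(q^{2αD} x)`: the trace over `W⁺`, continued meromorphically in `α`. -/
def trPlus (η α : ℂ) (x : OscEnd) : ℂ :=
  (diagPart x).coeff.sum fun m c => c / (1 - Complex.exp (η * (2 * α + m)))

/-- `tr⁻(q^{-2α(D+1)} x)`: the trace over `W⁻`, continued meromorphically in `α`. -/
def trMinus (η α : ℂ) (x : OscEnd) : ℂ :=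
  (diagPart x).coeff.sum fun m c =>
    c * Complex.exp (-(η * m)) / (1 - Complex.exp (η * (2 * α - m)))

/-- Where the trace series over `W⁺` converges, `trPlus` is its sum. -/
theorem hasSum_trPlus (η α : ℂ) (x : OscEnd)
    (hx : ∀ m ∈ (diagPart x).coeff.support, ‖Complex.exp (η * (2 * α + m))‖ < 1) :
    HasSum (fun k : ℕ => Complex.exp (η * (2 * α * k)) *
      (diagPart x).coeff.sum fun m c => c * Complex.exp (η * (m * k))) (trPlus η α x) := by
  simp only [trPlus, Finsupp.sum, Finset.mul_sum]
  refine hasSum_sum fun m hm => ?_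
  have h := (hasSum_geometric_of_norm_lt_one (hx m hm)).mul_left ((diagPart x).coeff m)
  rw [div_eq_mul_inv]
  refine HasSum.congr_fun h fun k => ?_
  rw [← Complex.exp_nat_mul, mul_left_comm, ← Complex.exp_add]
  congr 2
  ring

/-- Where the trace series over `W⁻` converges, `trMinus` is its sum; the term `k` belongs to the
basis vector `|-1-k⟩`. -/
theorem hasSum_trMinus (η α : ℂ) (x : OscEnd)
    (hx : ∀ m ∈ (diagPart x).coeff.support, ‖Complex.exp (η * (2 * α - m))‖ < 1) :
    HasSum (fun k : ℕ => Complex.exp (η * (2 * α * k)) *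
      (diagPart x).coeff.sum fun m c => c * Complex.exp (η * (m * (-1 - k)))) (trMinus η α x) := by
  simp only [trMinus, Finsupp.sum, Finset.mul_sum]
  refine hasSum_sum fun m hm => ?_
  have h := (hasSum_geometric_of_norm_lt_one (hx m hm)).mul_left
    ((diagPart x).coeff m * Complex.exp (-(η * m)))
  rw [div_eq_mul_inv]
  refine HasSum.congr_fun h fun k => ?_
  rw [← Complex.exp_nat_mul, mul_left_comm, ← Complex.exp_add, mul_assoc ((diagPart x).coeff m),
    ← Complex.exp_add]
  congr 2
  ring

/-! ### `L`-operators and monodromy matrices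

Spectral parameters are written additively, `ζ = e^μ` and `ξ_j = e^{λ_j}`.  The spin index `0` stands
for `+` and `1` for `-`. -/

/-- The six-vertex `R`-matrix at `ζ = e^μ`. -/
def Rmat (η μ : ℂ) : Matrix (Fin 2 × Fin 2) (Fin 2 × Fin 2) ℂ :=
  let q := Complex.exp η
  let ζ := Complex.exp μ
  let β := (1 - ζ ^ 2) * q / (1 - q ^ 2 * ζ ^ 2)
  let c := (1 - q ^ 2) * ζ / (1 - q ^ 2 * ζ ^ 2)
  Matrix.of fun x y => (q * ζ - q⁻¹ * ζ⁻¹) *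
    (if x.1 = x.2 then (if y = x then 1 else 0)
      else if y = x then β else if y = (x.2, x.1) then c else 0)

/-- `L⁺(ζ) = i ζ^{-1/2} q^{-1/4} (1 - ζ a* σ⁺ - ζ a σ⁻ - ζ² q^{2D+2} σ⁻σ⁺) q^{σᶻD}` at `ζ = e^μ`. -/
def Lplus (η μ : ℂ) : Matrix (Fin 2) (Fin 2) OscEnd :=
  (Complex.I * Complex.exp (-(μ / 2)) * Complex.exp (-(η / 4))) •
    (!![1, -(Complex.exp μ • oscAstar);
        -(Complex.exp μ • oscA η), 1 - Complex.exp (2 * μ + 2 * η) • qD η 2] *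
      !![qD η 1, 0; 0, qD η (-1)])

/-- `L⁻ = σˣ L⁺ σˣ`. -/
def Lminus (η μ : ℂ) : Matrix (Fin 2) (Fin 2) OscEnd :=
  !![0, 1; 1, 0] * Lplus η μ * !![0, 1; 1, 0]

/-- Spin configurations of a segment of `n` sites. -/
abbrev Cfg (n : ℕ) := Fin n → Fin 2

/-- `End(V₁ ⊗ ⋯ ⊗ V_n)`. -/
abbrev SpinOp (n : ℕ) := Matrix (Cfg n) (Cfg n) ℂ

/-- A `2 × 2` matrix acting on site `j`. -/
def siteOp {n : ℕ} (j : Fin n) (ℓ : Matrix (Fin 2) (Fin 2) OscEnd) :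
    Matrix (Cfg n) (Cfg n) OscEnd :=
  Matrix.of fun s t => if ∀ k, k ≠ j → s k = t k then ℓ (s j) (t j) else 0

/-- A `4 × 4` matrix acting on the auxiliary space `V_a` and on site `j`. -/
def auxSiteOp {n : ℕ} (j : Fin n) (r : Matrix (Fin 2 × Fin 2) (Fin 2 × Fin 2) ℂ) :
    Matrix (Fin 2 × Cfg n) (Fin 2 × Cfg n) ℂ :=
  Matrix.of fun x y =>
    if ∀ k, k ≠ j → x.2 k = y.2 k then r (x.1, x.2 j) (y.1, y.2 j) else 0

/-- `T_A(ζ) = L_{A,n}(ζ/ξ_n) ⋯ L_{A,1}(ζ/ξ_1)` for `L = L⁺` or `L = L⁻`. -/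
def monA {n : ℕ} (L : ℂ → Matrix (Fin 2) (Fin 2) OscEnd) (lam : Fin n → ℂ) (μ : ℂ) :
    Matrix (Cfg n) (Cfg n) OscEnd :=
  (List.ofFn fun j => siteOp j (L (μ - lam j))).reverse.prod

/-- `T_a(ζ) = R_{a,n}(ζ/ξ_n) ⋯ R_{a,1}(ζ/ξ_1)`. -/
def monR {n : ℕ} (η : ℂ) (lam : Fin n → ℂ) (μ : ℂ) :
    Matrix (Fin 2 × Cfg n) (Fin 2 × Cfg n) ℂ :=
  (List.ofFn fun j => auxSiteOp j (Rmat η (μ - lam j))).reverse.prod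

/-- `G⁺ = q^{-σᶻD} (1 + a* σ⁺)`. -/
def Gplus (η : ℂ) : Matrix (Fin 2) (Fin 2) OscEnd :=
  !![qD η (-1), 0; 0, qD η 1] * !![1, oscAstar; 0, 1]

/-- `G⁻ = q^{σᶻD} (1 + a* σ⁻)`. -/
def Gminus (η : ℂ) : Matrix (Fin 2) (Fin 2) OscEnd :=
  !![qD η 1, 0; 0, qD η (-1)] * !![1, 0; oscAstar, 1]

open scoped Kronecker in
/-- The fused monodromy matrix `T_{A,a} = G⁻¹ T_A T_a G`. -/
def fused {n : ℕ} (G : Matrix (Fin 2) (Fin 2) OscEnd) (L : ℂ → Matrix (Fin 2) (Fin 2) OscEnd)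
    (η : ℂ) (lam : Fin n → ℂ) (μ : ℂ) : Matrix (Fin 2 × Cfg n) (Fin 2 × Cfg n) OscEnd :=
  (Ring.inverse G ⊗ₖ (1 : Matrix (Cfg n) (Cfg n) OscEnd)) *
    ((1 : Matrix (Fin 2) (Fin 2) OscEnd) ⊗ₖ monA L lam μ) *
    (monR η lam μ).map (algebraMap ℂ OscEnd) *
    (G ⊗ₖ (1 : Matrix (Cfg n) (Cfg n) OscEnd))

open scoped Kronecker in
/-- `T_{A,a}⁻¹ X T_{A,a}`. -/
def fusedAdj {n : ℕ} (G : Matrix (Fin 2) (Fin 2) OscEnd) (L : ℂ → Matrix (Fin 2) (Fin 2) OscEnd)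
    (η : ℂ) (lam : Fin n → ℂ) (μ : ℂ) (X : SpinOp n) :
    Matrix (Fin 2 × Cfg n) (Fin 2 × Cfg n) OscEnd :=
  Ring.inverse (fused G L η lam μ) *
    ((1 : Matrix (Fin 2) (Fin 2) OscEnd) ⊗ₖ X.map (algebraMap ℂ OscEnd)) *
    fused G L η lam μ

/-- The lower left entry `ℂ⁺(ζ)(X)` of `T⁺_{A,a}⁻¹ X T⁺_{A,a}` as a matrix on `V_a`. -/
def CplusOp {n : ℕ} (η : ℂ) (lam : Fin n → ℂ) (μ : ℂ) (X : SpinOp n) :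
    Matrix (Cfg n) (Cfg n) OscEnd :=
  Matrix.of fun s t => fusedAdj (Gplus η) (Lplus η) η lam μ X (1, s) (0, t)

/-- The upper right entry `𝔹⁻(ζ)(X)` of `T⁻_{A,a}⁻¹ X T⁻_{A,a}` as a matrix on `V_a`. -/
def BminusOp {n : ℕ} (η : ℂ) (lam : Fin n → ℂ) (μ : ℂ) (X : SpinOp n) :
    Matrix (Cfg n) (Cfg n) OscEnd :=
  Matrix.of fun s t => fusedAdj (Gminus η) (Lminus η) η lam μ X (0, s) (1, t)

/-! ### The operators `b`, `c`, `H` and their residues -/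

/-- The eigenvalue of `𝕊 = [Sᶻ, ·]` on the matrix unit with row `s` and column `t`. -/
def spinDiff {n : ℕ} (s t : Cfg n) : ℤ := ∑ j, (((t j : ℕ) : ℤ) - ((s j : ℕ) : ℤ))

/-- `c(ζ,α)` at `ζ = e^μ`, before taking the singular part (which does not change residues):
`q^{α-𝕊} (1 - q^{2(α-𝕊)}) ζ^{α-𝕊} tr⁺(q^{2αD} ℂ⁺(ζ))`. -/
def cOp {n : ℕ} (η : ℂ) (lam : Fin n → ℂ) (α μ : ℂ) (X : SpinOp n) : SpinOp n :=
  Matrix.of fun s t =>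
    Complex.exp (η * (α - spinDiff s t)) * (1 - Complex.exp (2 * η * (α - spinDiff s t))) *
      (Complex.exp (μ * (α - spinDiff s t)) * trPlus η α (CplusOp η lam μ X s t))

/-- `b(ζ,α)` at `ζ = e^μ`, before taking the singular part (which does not change residues):
`q^{2𝕊} ζ^{-α+𝕊} tr⁻(q^{-2α(D+1)} 𝔹⁻(ζ))`. -/
def bOp {n : ℕ} (η : ℂ) (lam : Fin n → ℂ) (α μ : ℂ) (X : SpinOp n) : SpinOp n :=
  Matrix.of fun s t =>
    Complex.exp (2 * η * spinDiff s t) *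
      (Complex.exp (μ * (-α + spinDiff s t)) * trMinus η α (BminusOp η lam μ X s t))

/-- `Q(ζ,α)(X) = tr⁺(q^{2αD} T⁺_A(ζ)⁻¹ X T⁺_A(ζ))`. -/
def QOp {n : ℕ} (η : ℂ) (lam : Fin n → ℂ) (α μ : ℂ) (X : SpinOp n) : SpinOp n :=
  Matrix.of fun s t => trPlus η α
    ((Ring.inverse (monA (Lplus η) lam μ) * X.map (algebraMap ℂ OscEnd) *
      monA (Lplus η) lam μ) s t)

open scoped Kronecker in
/-- `t(ζ)(X) = tr_a (T_a(ζ)⁻¹ X T_a(ζ))`. -/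
def tOp {n : ℕ} (η : ℂ) (lam : Fin n → ℂ) (μ : ℂ) (X : SpinOp n) : SpinOp n :=
  Matrix.of fun s t => ∑ i : Fin 2,
    ((monR η lam μ)⁻¹ * ((1 : Matrix (Fin 2) (Fin 2) ℂ) ⊗ₖ X) * monR η lam μ) (i, s) (i, t)

/-- `H(ζ,α)(X) = tr_{A,a}(q^{2αD} (T_A T_a)⁻¹ X (T_A T_a))`: first the adjoint action of `T_A`,
then that of `T_a`. -/
def HOp {n : ℕ} (η : ℂ) (lam : Fin n → ℂ) (α μ : ℂ) (X : SpinOp n) : SpinOp n :=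
  tOp η lam μ (QOp η lam α μ X)

/-- `f` has at most a simple pole at `z₀`. -/
def HasSimplePole {n : ℕ} (f : ℂ → SpinOp n) (z₀ : ℂ) : Prop :=
  ∃ r, Tendsto (fun z => (z - z₀) • f z) (𝓝[≠] z₀) (𝓝 r)

/-- The residue at a simple pole. -/
def simpleResidue {n : ℕ} (f : ℂ → SpinOp n) (z₀ : ℂ) : SpinOp n :=
  limUnder (𝓝[≠] z₀) fun z => (z - z₀) • f z

/-- The double integral
`-∫∫ dμ₁/(2πi) dμ₂/(2πi) ω(μ₁,μ₂;α) b(ζ₁;α-1) c(ζ₂;α)` applied to `X`, that is, the sum over the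
residues at the simple poles `μ₁ = λ_i` of `b` and `μ₂ = λ_j` of `c`; `w` is the function `ω`. -/
def Omega1At {n : ℕ} (η : ℂ) (lam : Fin n → ℂ) (w : ℂ → ℂ → ℂ → ℂ) (α : ℂ) (X : SpinOp n) :
    SpinOp n :=
  -∑ i, ∑ j, w (lam i) (lam j) α •
    simpleResidue
      (fun μ₁ => bOp η lam (α - 1) μ₁
        (simpleResidue (fun μ₂ => cOp η lam α μ₂ X) (lam j))) (lam i)

/-- The integral `-∫ dμ₁/(2πi) φ(μ₁;α) H(ζ₁;α)` applied to `X`, that is, the sum over the residues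
at the simple poles `μ₁ = λ_j` of `H`; `p` is the function `φ`. -/
def Omega2At {n : ℕ} (η : ℂ) (lam : Fin n → ℂ) (p : ℂ → ℂ → ℂ) (α : ℂ) (X : SpinOp n) :
    SpinOp n :=
  -∑ j, p (lam j) α • simpleResidue (fun μ => HOp η lam α μ X) (lam j)

end XXZ

end

/-! Both limits are statements about cancellation of poles at `α = 0`.

Residues in `μ`. At `ζ = ξ_j` the matrix `R_{a,j}` is a multiple of the permutation, and the inverse
of the Lax matrix at site `j` has a simple pole, because `L N = (1 - z²)` with `z = ζ/ξ_j`. If `j`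
stands last in the ordered product, the residue is therefore, up to conjugation by R-matrices, an
operator acting trivially at `j`: the matrix element at the auxiliary site turns into a matrix
element at `j` (`auxEntry_residue`, `aOp_residue`, `Kind.core`). The Yang-Baxter and RLL relations
bring any site to the last position (`Exch.adL_move`, `Kind.res_move`). They also show that an
operator trivial at the last site makes that site drop out of the next dressing (`Exch.adL_reduce`,
`Kind.res_reduce`). Consequently `b_j c_j = 0` (`Kind.res_res_self`), and `b_i c_j` is a conjugate
of an iterated core.

Poles in `α`. The oscillator traces depend on `α` through the weights `1/(1 - q^{2α+m})`. As `q` is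
not a root of unity, only `m = 0` is singular at `α = 0`, and the coefficient of the pole is
proportional to the functional `wtr wZero`, which is cyclic under `q^D` and `a*`. For `H` this
functional is applied to a trace in which the Lax matrix at `j` and its inverse have degenerated to
rank one, and cyclicity gives zero (`trace_degenerate`). So every `H_j` is regular at `α = 0`.

The product `b_i(α-1) c_j(α)` is a double trace `tr⁺ ⊗ tr⁻`. The entries of `L⁺ ⊗ L⁻` are
polynomials in generators `F, e, a, K` obeying the relations `IsTwo`. A functional that is
twisted-cyclic for `F` is determined by its values on monomials without `F`
(`IsTwo.functional_eq_zero`). A second realisation of the same relations, the graded one, carries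
the functional `tr⁺ ⊗ tr⁺` with the same values (`OscRep.trTwo_eq_of_generic`). There the second
oscillator enters the Lax matrices only through powers of a central element. Hence on operators of
fixed spin `m` the double trace is the scalar `1/(1 - q^{2(α-m-1)})` times a single trace over a
quantum torus (`OscRep.nested_eventually`). This scalar is cancelled by the prefactor of `c`, so
`b_i c_j` has at most a simple pole at `α = 0` (`core_core_eventually`).

Its coefficient is the `wZero`-trace on the torus, which is invariant under rescaling the torus
generators. One such rescaling interchanges `ξ_i` and `ξ_j` (`OscRep.trZero_symm`). Together with
Yang-Baxter (`OscRep.trZero_swap`) and the scalar identity `pairCoef_antisymm`, it follows that `b_i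
c_j` and `b_j c_i` have opposite poles (`polesCancel_res`).

The weights. The integral operator with kernel `K(·;α)` is compact, so uniqueness at `α = 0` gives
an inverse depending differentiably on `α`. This makes `φ` continuous and `ω` differentiable at `0`.
Since `K(·;0)` is even, Fubini gives `ω(λ_i,λ_j;0) = ω(λ_j,λ_i;0)` (`regular_density`,
`omega_zero_symm`). Opposite poles with weights that agree at `α = 0` leave a finite limit
(`PolesCancel.tendsto`). -/

open Filter Topology

noncomputable section

namespace XXZ

set_option linter.unusedSectionVars false
set_option linter.unusedSimpArgs false

/-! ### Operators on tensor products of two-dimensional spaces -/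

/-- Operators with entries in `S` on the tensor product of copies of `ℂ²` indexed by `ι`. -/
abbrev SiteMat (ι S : Type*) := Matrix (ι → Fin 2) (ι → Fin 2) S

section Embedding

variable {ι κ τ S : Type*} [Fintype ι] [DecidableEq ι] [Fintype κ] [DecidableEq κ]
  [Fintype τ] [DecidableEq τ]

/-- Let an operator on the sites `κ` act on the sites `f κ` of a larger system. -/
def emb [Zero S] (f : κ → ι) (m : SiteMat κ S) : SiteMat ι S :=
  Matrix.of fun s t => if ∀ k, (∀ i, f i ≠ k) → s k = t k then m (s ∘ f) (t ∘ f) else 0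

theorem emb_apply [Zero S] (f : κ → ι) (m : SiteMat κ S) (s t : ι → Fin 2) :
    emb f m s t = if ∀ k, (∀ i, f i ≠ k) → s k = t k then m (s ∘ f) (t ∘ f) else 0 := rfl

theorem emb_zero [Zero S] (f : κ → ι) : emb f (0 : SiteMat κ S) = 0 := by
  ext s t; simp [emb_apply]

theorem emb_add [AddZeroClass S] (f : κ → ι) (m m' : SiteMat κ S) :
    emb f (m + m') = emb f m + emb f m' := by
  ext s t; simp only [emb_apply, Matrix.add_apply]; split_ifs <;> simp

theorem emb_smul {R : Type*} [Zero S] [SMulZeroClass R S] (f : κ → ι) (c : R) (m : SiteMat κ S) :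
    emb f (c • m) = c • emb f m := by
  ext s t; simp only [emb_apply, Matrix.smul_apply]; split_ifs <;> simp

theorem emb_map {S' F : Type*} [Zero S] [Zero S'] [FunLike F S S'] [ZeroHomClass F S S']
    (f : κ → ι) (m : SiteMat κ S) (φ : F) :
    (emb f m).map φ = emb f (m.map φ) := by
  ext s t; simp only [emb_apply, Matrix.map_apply]; split_ifs <;> simp

theorem emb_one [Zero S] [One S] {f : κ → ι} :
    emb f (1 : SiteMat κ S) = 1 := by
  ext s t
  simp only [emb_apply, Matrix.one_apply]
  by_cases h : s = t
  · subst h; simp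
  · rw [if_neg h]
    split_ifs with h1 h2
    · exfalso; apply h; funext k
      by_cases hk : ∃ i, f i = k
      · obtain ⟨i, rfl⟩ := hk; exact congrFun h2 i
      · exact h1 k (by simpa using hk)
    · rfl
    · rfl

theorem emb_mul [NonUnitalNonAssocSemiring S] {f : κ → ι} (hf : Function.Injective f)
    (m m' : SiteMat κ S) : emb f (m * m') = emb f m * emb f m' := by
  ext s t
  simp only [emb_apply, Matrix.mul_apply]
  by_cases h : ∀ k, (∀ i, f i ≠ k) → s k = t k
  · rw [if_pos h]
    -- Only intermediate configurations that agree with `s` off the range of `f` contribute; they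
    -- are parametrised by their restriction `ρ` to `κ`.
    refine Fintype.sum_of_injective (fun ρ : κ → Fin 2 => Function.extend f ρ s) ?_ _ _ ?_ ?_
    · intro ρ ρ' e
      funext i
      have := congrFun e (f i)
      simpa [hf.extend_apply] using this
    · intro r hr
      rw [if_neg, zero_mul]
      intro hr'
      apply hr
      refine ⟨r ∘ f, ?_⟩
      funext k
      by_cases hk : ∃ i, f i = k
      · obtain ⟨i, rfl⟩ := hk; simp [hf.extend_apply]
      · dsimp only
        rw [Function.extend_apply' _ _ _ hk]
        exact hr' k (by simpa using hk)
    · intro ρ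
      have e1 : Function.extend f ρ s ∘ f = ρ := by
        funext i; simp [hf.extend_apply]
      have e2 : ∀ k, (∀ i, f i ≠ k) → Function.extend f ρ s k = s k := by
        intro k hk
        exact Function.extend_apply' _ _ _ (by simpa using hk)
      change _ = (if ∀ k, (∀ i, f i ≠ k) → s k = Function.extend f ρ s k then
          m (s ∘ f) (Function.extend f ρ s ∘ f) else 0) *
        (if ∀ k, (∀ i, f i ≠ k) → Function.extend f ρ s k = t k then
          m' (Function.extend f ρ s ∘ f) (t ∘ f) else 0)
      rw [e1, if_pos fun k hk => (e2 k hk).symm, if_pos fun k hk => (e2 k hk).trans (h k hk)]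
  · rw [if_neg h]
    symm
    refine Finset.sum_eq_zero fun r _ => ?_
    split_ifs with h1 h2
    · exact absurd (fun k hk => (h1 k hk).trans (h2 k hk)) h
    all_goals simp

theorem emb_emb [Zero S] {f : κ → ι} (hf : Function.Injective f) (g : τ → κ) (m : SiteMat τ S) :
    emb f (emb g m) = emb (f ∘ g) m := by
  ext s t
  simp only [emb_apply, Function.comp_def]
  rw [← ite_and]
  refine if_congr ?_ rfl rfl
  constructor
  · rintro ⟨h1, h2⟩ k hk
    by_cases h : ∃ i, f i = k
    · obtain ⟨i, rfl⟩ := h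
      exact h2 i fun j e => hk j (by rw [e])
    · exact h1 k (by simpa using h)
  · intro h
    refine ⟨fun k hk => h k fun j => hk _, fun i hi => h _ fun j e => hi j (hf e)⟩

/-- When the two sets of sites are disjoint, the matrix product has a single surviving intermediate
configuration: `t` on the range of `f` and `s` elsewhere. -/
theorem emb_mul_emb_apply [NonUnitalNonAssocSemiring S] {f : κ → ι} {g : τ → ι}
    (hfg : ∀ i j, f i ≠ g j) (m : SiteMat κ S) (m' : SiteMat τ S) (s t : ι → Fin 2) :
    (emb f m * emb g m') s t = if ∀ k, (∀ i, f i ≠ k) → (∀ j, g j ≠ k) → s k = t k then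
      m (s ∘ f) (t ∘ f) * m' (s ∘ g) (t ∘ g) else 0 := by
  classical
  simp only [emb_apply, Matrix.mul_apply]
  set r₀ : ι → Fin 2 := fun k => if ∃ i, f i = k then t k else s k with hr₀
  have ef : r₀ ∘ f = t ∘ f := by funext i; simp [hr₀]
  have eg : r₀ ∘ g = s ∘ g := by
    funext j
    have : ¬ ∃ i, f i = g j := by rintro ⟨i, hi⟩; exact hfg i j hi
    simp [hr₀, this]
  rw [Finset.sum_eq_single r₀]
  · have h1 : ∀ k, (∀ i, f i ≠ k) → s k = r₀ k := by
      intro k hk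
      have : ¬ ∃ i, f i = k := by simpa using hk
      simp [hr₀, this]
    rw [if_pos h1, ef, eg]
    by_cases h : ∀ k, (∀ i, f i ≠ k) → (∀ j, g j ≠ k) → s k = t k
    · rw [if_pos h, if_pos]
      intro k hk
      by_cases h' : ∃ i, f i = k
      · simp [hr₀, h']
      · rw [← h1 k (by simpa using h')]
        exact h k (by simpa using h') hk
    · rw [if_neg h, if_neg, mul_zero]
      intro h2
      apply h
      intro k hk hk'
      rw [h1 k hk]; exact h2 k hk'
  · intro r _ hr
    split_ifs with h1 h2
    · exfalso; apply hr; funext k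
      by_cases h' : ∃ i, f i = k
      · simp only [hr₀, h', if_true]
        obtain ⟨i, rfl⟩ := h'
        exact h2 _ fun j e => hfg i j e.symm
      · simp only [hr₀, h', if_false]
        exact (h1 k (by simpa using h')).symm
    all_goals simp
  · simp

/-- Entries may lie in a noncommutative ring, so disjointness of the sites must be supplemented by
commutation of the entries. -/
theorem emb_commute [NonUnitalNonAssocSemiring S] {f : κ → ι} {g : τ → ι}
    (hfg : ∀ i j, f i ≠ g j) (m : SiteMat κ S) (m' : SiteMat τ S)
    (h : ∀ s t s' t', Commute (m s t) (m' s' t')) : Commute (emb f m) (emb g m') := by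
  rw [Commute, SemiconjBy]
  ext s t
  rw [emb_mul_emb_apply hfg, emb_mul_emb_apply fun i j => (hfg j i).symm]
  by_cases hk : ∀ k, (∀ i, f i ≠ k) → (∀ j, g j ≠ k) → s k = t k
  · rw [if_pos hk, if_pos fun k h1 h2 => hk k h2 h1, (h _ _ _ _).eq]
  · rw [if_neg hk, if_neg fun h' => hk fun k h1 h2 => h' k h2 h1]

end Embedding

/-! ### Operators acting on one or two sites. -/

section Sites

variable {ι κ S : Type*} [Fintype ι] [DecidableEq ι] [Fintype κ] [DecidableEq κ]

/-- A `2 × 2` matrix acting on site `j`. -/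
def site1 [Zero S] (j : ι) (m : Matrix (Fin 2) (Fin 2) S) : SiteMat ι S :=
  emb (fun _ : Fin 1 => j) (Matrix.of fun s t => m (s 0) (t 0))

/-- A `4 × 4` matrix acting on the sites `j` and `k`. -/
def site2 [Zero S] (j k : ι) (r : Matrix (Fin 2 × Fin 2) (Fin 2 × Fin 2) S) : SiteMat ι S :=
  emb ![j, k] (Matrix.of fun s t => r (s 0, s 1) (t 0, t 1))

theorem inj_const (j : ι) : Function.Injective fun _ : Fin 1 => j :=
  fun _ _ _ => Subsingleton.elim _ _

theorem inj_pair {j k : ι} (h : j ≠ k) : Function.Injective ![j, k] := by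
  intro a b
  fin_cases a <;> fin_cases b <;> simp [h, h.symm]

theorem site1_apply [Zero S] (j : ι) (m : Matrix (Fin 2) (Fin 2) S) (s t : ι → Fin 2) :
    site1 j m s t = if ∀ k, k ≠ j → s k = t k then m (s j) (t j) else 0 := by
  simp [site1, emb_apply, eq_comm]

theorem site2_apply [Zero S] (j k : ι) (r : Matrix (Fin 2 × Fin 2) (Fin 2 × Fin 2) S)
    (s t : ι → Fin 2) :
    site2 j k r s t =
      if ∀ l, l ≠ j → l ≠ k → s l = t l then r (s j, s k) (t j, t k) else 0 := by
  simp [site2, emb_apply, Fin.forall_fin_two, eq_comm]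

theorem site1_mul [NonUnitalNonAssocSemiring S] (j : ι) (m m' : Matrix (Fin 2) (Fin 2) S) :
    site1 j (m * m') = site1 j m * site1 j m' := by
  rw [site1, site1, site1, ← emb_mul (inj_const j)]
  refine congrArg _ (Matrix.ext fun s t => ?_)
  simp only [Matrix.mul_apply, Matrix.of_apply]
  exact (Equiv.sum_comp (Equiv.funUnique (Fin 1) (Fin 2))
    (fun r => m (s 0) r * m' r (t 0))).symm

theorem site2_mul [NonUnitalNonAssocSemiring S] {j k : ι} (h : j ≠ k)
    (r r' : Matrix (Fin 2 × Fin 2) (Fin 2 × Fin 2) S) :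
    site2 j k (r * r') = site2 j k r * site2 j k r' := by
  rw [site2, site2, site2, ← emb_mul (inj_pair h)]
  refine congrArg _ (Matrix.ext fun s t => ?_)
  simp only [Matrix.mul_apply, Matrix.of_apply]
  exact (Equiv.sum_comp (finTwoArrowEquiv (Fin 2))
    (fun x => r (s 0, s 1) x * r' x (t 0, t 1))).symm

theorem site1_one [Zero S] [One S] (j : ι) : site1 j (1 : Matrix (Fin 2) (Fin 2) S) = 1 := by
  ext s t
  simp only [site1_apply, Matrix.one_apply]
  by_cases h : s = t
  · subst h; simp
  · rw [if_neg h, ← ite_and, if_neg]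
    rintro ⟨h1, h2⟩
    exact h (funext fun k => if hk : k = j then hk ▸ h2 else h1 k hk)

theorem site2_one [Zero S] [One S] {j k : ι} :
    site2 j k (1 : Matrix (Fin 2 × Fin 2) (Fin 2 × Fin 2) S) = 1 := by
  ext s t
  simp only [site2_apply, Matrix.one_apply]
  by_cases h : s = t
  · subst h; simp
  · rw [if_neg h, ← ite_and, if_neg]
    rintro ⟨h1, h2⟩
    simp only [Prod.mk.injEq] at h2
    refine h (funext fun l => ?_)
    by_cases hj : l = j
    · rw [hj, h2.1]
    · by_cases hk : l = k
      · rw [hk, h2.2]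
      · exact h1 l hj hk

theorem site1_smul {R : Type*} [Zero S] [SMulZeroClass R S] (j : ι) (c : R)
    (m : Matrix (Fin 2) (Fin 2) S) : site1 j (c • m) = c • site1 j m := by
  rw [site1, site1, ← emb_smul]; rfl

theorem site1_add [AddZeroClass S] (j : ι) (m m' : Matrix (Fin 2) (Fin 2) S) :
    site1 j (m + m') = site1 j m + site1 j m' := by
  rw [site1, site1, site1, ← emb_add]; rfl

theorem site2_smul {R : Type*} [Zero S] [SMulZeroClass R S] (j k : ι) (c : R)
    (m : Matrix (Fin 2 × Fin 2) (Fin 2 × Fin 2) S) : site2 j k (c • m) = c • site2 j k m := by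
  rw [site2, site2, ← emb_smul]; rfl

theorem site2_add [AddZeroClass S] (j k : ι) (m m' : Matrix (Fin 2 × Fin 2) (Fin 2 × Fin 2) S) :
    site2 j k (m + m') = site2 j k m + site2 j k m' := by
  rw [site2, site2, site2, ← emb_add]; rfl

theorem site1_map {S' F : Type*} [Zero S] [Zero S'] [FunLike F S S'] [ZeroHomClass F S S']
    (j : ι) (m : Matrix (Fin 2) (Fin 2) S) (φ : F) :
    (site1 j m).map φ = site1 j (m.map φ) := by
  rw [site1, emb_map]; rfl

theorem site2_map {S' F : Type*} [Zero S] [Zero S'] [FunLike F S S'] [ZeroHomClass F S S']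
    (j k : ι) (m : Matrix (Fin 2 × Fin 2) (Fin 2 × Fin 2) S) (φ : F) :
    (site2 j k m).map φ = site2 j k (m.map φ) := by
  rw [site2, emb_map]; rfl

theorem emb_site1 [Zero S] {f : ι → κ} (hf : Function.Injective f) (j : ι)
    (m : Matrix (Fin 2) (Fin 2) S) : emb f (site1 j m) = site1 (f j) m := by
  rw [site1, emb_emb hf]; rfl

theorem emb_site2 [Zero S] {f : ι → κ} (hf : Function.Injective f) (j k : ι)
    (m : Matrix (Fin 2 × Fin 2) (Fin 2 × Fin 2) S) :
    emb f (site2 j k m) = site2 (f j) (f k) m := by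
  rw [site2, emb_emb hf, site2]
  congr 1
  funext i; fin_cases i <;> rfl

theorem site1_commute [NonUnitalNonAssocSemiring S] {j k : ι} (h : j ≠ k)
    (m m' : Matrix (Fin 2) (Fin 2) S) (hc : ∀ s t s' t', Commute (m s t) (m' s' t')) :
    Commute (site1 j m) (site1 k m') :=
  emb_commute (fun _ _ => h) _ _ fun _ _ _ _ => hc _ _ _ _

theorem site2_commute_site1 [NonUnitalNonAssocSemiring S] {i j k : ι} (h : i ≠ k) (h' : j ≠ k)
    (r : Matrix (Fin 2 × Fin 2) (Fin 2 × Fin 2) S)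
    (m : Matrix (Fin 2) (Fin 2) S) (hc : ∀ s t s' t', Commute (r s t) (m s' t')) :
    Commute (site2 i j r) (site1 k m) :=
  emb_commute (fun a _ => by fin_cases a <;> simpa) _ _ fun _ _ _ _ => hc _ _ _ _

theorem site2_commute_site2 [NonUnitalNonAssocSemiring S] {i j k l : ι} (h : i ≠ k) (h' : j ≠ k)
    (h'' : i ≠ l) (h''' : j ≠ l) (r r' : Matrix (Fin 2 × Fin 2) (Fin 2 × Fin 2) S)
    (hc : ∀ s t s' t', Commute (r s t) (r' s' t')) :
    Commute (site2 i j r) (site2 k l r') :=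
  emb_commute (fun a b => by fin_cases a <;> fin_cases b <;> simpa) _ _
    fun _ _ _ _ => hc _ _ _ _

/-- A `2 × 2` matrix on the first factor of `ℂ² ⊗ ℂ²`. -/
def onFst [Zero S] (m : Matrix (Fin 2) (Fin 2) S) : Matrix (Fin 2 × Fin 2) (Fin 2 × Fin 2) S :=
  Matrix.of fun x y => if x.2 = y.2 then m x.1 y.1 else 0

/-- A `2 × 2` matrix on the second factor of `ℂ² ⊗ ℂ²`. -/
def onSnd [Zero S] (m : Matrix (Fin 2) (Fin 2) S) : Matrix (Fin 2 × Fin 2) (Fin 2 × Fin 2) S :=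
  Matrix.of fun x y => if x.1 = y.1 then m x.2 y.2 else 0

theorem site2_onFst [Zero S] {j k : ι} (h : j ≠ k) (m : Matrix (Fin 2) (Fin 2) S) :
    site2 j k (onFst m) = site1 j m := by
  ext s t
  simp only [site2_apply, site1_apply, onFst, Matrix.of_apply]
  rw [← ite_and]
  refine if_congr ⟨?_, ?_⟩ rfl rfl
  · rintro ⟨h1, h2⟩ l hl
    by_cases hk : l = k
    · rw [hk, h2]
    · exact h1 l hl hk
  · intro h1
    exact ⟨fun l hl _ => h1 l hl, h1 k h.symm⟩

theorem site2_onSnd [Zero S] {j k : ι} (h : j ≠ k) (m : Matrix (Fin 2) (Fin 2) S) :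
    site2 j k (onSnd m) = site1 k m := by
  ext s t
  simp only [site2_apply, site1_apply, onSnd, Matrix.of_apply]
  rw [← ite_and]
  refine if_congr ⟨?_, ?_⟩ rfl rfl
  · rintro ⟨h1, h2⟩ l hl
    by_cases hk : l = j
    · rw [hk, h2]
    · exact h1 l hk hl
  · intro h1
    exact ⟨fun l _ hl => h1 l hl, h1 j h⟩

end Sites

/-! ### Matrix elements at a single site and operators trivial there. -/

section PartialEntry

variable {ι S : Type*} [Fintype ι] [DecidableEq ι]

/-- The matrix element with indices `b`, `c` at site `j`, as an operator that is trivial at `j`. -/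
def pe [Zero S] (j : ι) (b c : Fin 2) (Z : SiteMat ι S) : SiteMat ι S :=
  Matrix.of fun s t =>
    if s j = t j then Z (Function.update s j b) (Function.update t j c) else 0

/-- `Z` acts trivially at site `j`. -/
def Triv [Zero S] (j : ι) (Z : SiteMat ι S) : Prop :=
  ∀ (s t : ι → Fin 2) (b c : Fin 2),
    Z (Function.update s j b) (Function.update t j c) =
      if b = c then Z (Function.update s j 0) (Function.update t j 0) else 0

theorem triv_pe [Zero S] (j : ι) (b c : Fin 2) (Z : SiteMat ι S) : Triv j (pe j b c Z) := by
  intro s t b' c'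
  simp [pe]

theorem pe_of_triv [Zero S] {j : ι} {Z : SiteMat ι S} (h : Triv j Z) (b c : Fin 2) :
    pe j b c Z = if b = c then Z else 0 := by
  ext s t
  simp only [pe, Matrix.of_apply]
  rw [h]
  have h2 := h s t (s j) (t j)
  simp only [Function.update_eq_self] at h2
  by_cases hbc : b = c <;> simp [hbc, h2]

theorem pe_smul {R : Type*} [Zero S] [SMulZeroClass R S] (j : ι) (b c : Fin 2) (r : R)
    (Z : SiteMat ι S) : pe j b c (r • Z) = r • pe j b c Z := by
  ext s t; simp only [pe, Matrix.of_apply, Matrix.smul_apply]; split_ifs <;> simp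

theorem pe_map {S' F : Type*} [Zero S] [Zero S'] [FunLike F S S'] [ZeroHomClass F S S']
    (j : ι) (b c : Fin 2) (Z : SiteMat ι S) (φ : F) :
    (pe j b c Z).map φ = pe j b c (Z.map φ) := by
  ext s t; simp only [pe, Matrix.of_apply, Matrix.map_apply]; split_ifs <;> simp

/-- Reindexes a sum concentrated on `r j = c` by representatives with value `0` at `j`, so that two
sums with different fixed values at `j` can be compared term by term. -/
theorem sum_update {M : Type*} [AddCommMonoid M] (j : ι) (F : (ι → Fin 2) → M)
    (c : Fin 2) (hF : ∀ r, r j ≠ c → F r = 0) :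
    ∑ r, F r = ∑ r, if r j = 0 then F (Function.update r j c) else 0 := by
  rw [← Finset.sum_filter]
  symm
  refine Finset.sum_bij_ne_zero (fun r _ _ => Function.update r j c) ?_ ?_ ?_ ?_
  · intros; simp
  · intro r h _ r' h' _ e
    simp only [Finset.mem_filter, Finset.mem_univ, true_and] at h h'
    funext k
    by_cases hk : k = j
    · rw [hk, h, h']
    · simpa [hk] using congrFun e k
  · intro r _ hr
    have hc : r j = c := by by_contra hne; exact hr (hF r hne)
    have e : Function.update (Function.update r j 0) j c = r := by
      rw [Function.update_idem, ← hc, Function.update_eq_self]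
    refine ⟨Function.update r j 0, ?_, ?_, ?_⟩
    · simp
    · rwa [e]
    · exact e
  · intros; rfl

/-- A factor trivial at `j` is diagonal there with equal diagonal blocks, so the value at `j` is
frozen along the summation on both sides. -/
theorem pe_mul_right [NonUnitalNonAssocSemiring S] (j : ι) (b c : Fin 2) (Z : SiteMat ι S)
    {W : SiteMat ι S} (h : Triv j W) : pe j b c (Z * W) = pe j b c Z * W := by
  ext s t
  simp only [pe, Matrix.of_apply, Matrix.mul_apply]
  by_cases hst : s j = t j
  · rw [if_pos hst]
    rw [sum_update j _ c, sum_update j (fun r => (if s j = r j then _ else _) * _) (s j)]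
    · refine Finset.sum_congr rfl fun r _ => ?_
      split_ifs with h0
      · simp only [Function.update_idem, Function.update_self, if_true]
        congr 1
        have h1 := h r t c c
        have h2 := h r t (s j) (t j)
        rw [Function.update_eq_self] at h2
        rw [h1, h2, if_pos hst, if_pos rfl]
      · simp_all
      · rfl
    · intro r hr; simp [hr.symm]
    · intro r hr
      have := h r t (r j) c
      rw [Function.update_eq_self] at this
      rw [this, if_neg hr, mul_zero]
  · rw [if_neg hst]
    symm
    refine Finset.sum_eq_zero fun r _ => ?_
    split_ifs with h1
    · have := h r t (r j) (t j)
      rw [Function.update_eq_self, Function.update_eq_self] at this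
      rw [this, if_neg (h1 ▸ hst), mul_zero]
    · simp

theorem pe_mul_left [NonUnitalNonAssocSemiring S] (j : ι) (b c : Fin 2) (Z : SiteMat ι S)
    {W : SiteMat ι S} (h : Triv j W) : pe j b c (W * Z) = W * pe j b c Z := by
  ext s t
  simp only [pe, Matrix.of_apply, Matrix.mul_apply]
  by_cases hst : s j = t j
  · rw [if_pos hst]
    rw [sum_update j _ b, sum_update j (fun r => _ * (if r j = t j then _ else _)) (t j)]
    · refine Finset.sum_congr rfl fun r _ => ?_
      split_ifs with h0
      · simp only [Function.update_idem, Function.update_self, if_true]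
        congr 1
        have h1 := h s r b b
        have h2 := h s r (s j) (t j)
        rw [Function.update_eq_self] at h2
        rw [h1, h2, if_pos hst, if_pos rfl]
      · simp_all
      · rfl
    · intro r hr; simp [hr]
    · intro r hr
      have := h s r b (r j)
      rw [Function.update_eq_self] at this
      rw [this, if_neg (Ne.symm hr), zero_mul]
  · rw [if_neg hst]
    symm
    refine Finset.sum_eq_zero fun r _ => ?_
    split_ifs with h1
    · have := h s r (s j) (r j)
      rw [Function.update_eq_self, Function.update_eq_self] at this
      rw [this, if_neg (h1 ▸ hst), zero_mul]
    · simp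

theorem site1_mul_apply [NonUnitalNonAssocSemiring S] (j : ι) (m : Matrix (Fin 2) (Fin 2) S)
    (Z : SiteMat ι S) (s t : ι → Fin 2) :
    (site1 j m * Z) s t = ∑ b, m (s j) b * Z (Function.update s j b) t := by
  simp only [Matrix.mul_apply, site1_apply]
  symm
  refine Fintype.sum_of_injective (fun b => Function.update s j b)
    (Function.update_injective s j) _ _ ?_ ?_
  · intro r hr
    rw [if_neg, zero_mul]
    intro h
    exact hr ⟨r j, by
      funext k
      by_cases hk : k = j
      · rw [hk]; simp
      · simp [hk, h k hk]⟩
  · intro b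
    rw [if_pos]
    · simp
    · intro k hk; simp [hk]

theorem mul_site1_apply [NonUnitalNonAssocSemiring S] (j : ι) (m : Matrix (Fin 2) (Fin 2) S)
    (Z : SiteMat ι S) (s t : ι → Fin 2) :
    (Z * site1 j m) s t = ∑ b, Z s (Function.update t j b) * m b (t j) := by
  simp only [Matrix.mul_apply, site1_apply]
  symm
  refine Fintype.sum_of_injective (fun b => Function.update t j b)
    (Function.update_injective t j) _ _ ?_ ?_
  · intro r hr
    rw [if_neg, mul_zero]
    intro h
    exact hr ⟨r j, by
      funext k
      by_cases hk : k = j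
      · rw [hk]; simp
      · simp [hk, h k hk]⟩
  · intro b
    rw [if_pos]
    · simp
    · intro k hk; simp [hk]

/-- Multiply all entries from the left and from the right. -/
def lr [Mul S] (a b : S) (Z : SiteMat ι S) : SiteMat ι S := Matrix.of fun s t => a * Z s t * b

/-- The site factors enter through left and right multiplication (`lr`), because the entries do not
commute. -/
theorem pe_site1_mul_site1 [NonUnitalSemiring S] (j : ι) (b c : Fin 2) (Z : SiteMat ι S)
    (m m' : Matrix (Fin 2) (Fin 2) S) :
    pe j b c (site1 j m * Z * site1 j m') =
      ∑ b', ∑ c', lr (m b b') (m' c' c) (pe j b' c' Z) := by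
  ext s t
  simp only [pe, Matrix.of_apply, Matrix.sum_apply, lr]
  split_ifs with h
  · rw [mul_site1_apply]
    simp only [site1_mul_apply, Function.update_self, Function.update_idem, Finset.sum_mul]
    rw [Finset.sum_comm]
  · simp

theorem pe_lr [NonUnitalSemiring S] (j : ι) (b c : Fin 2) (a a' : S) (Z : SiteMat ι S) :
    pe j b c (lr a a' Z) = lr a a' (pe j b c Z) := by
  ext s t; simp only [pe, lr, Matrix.of_apply]; split_ifs <;> simp

theorem triv_site1 [Zero S] {j k : ι} (h : k ≠ j) (m : Matrix (Fin 2) (Fin 2) S) :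
    Triv j (site1 k m) := by
  intro s t b c
  simp only [site1_apply, Function.update_of_ne h]
  rw [← ite_and]
  refine if_congr ⟨fun h1 => ⟨by simpa using h1 j h.symm, fun l hl => ?_⟩, fun h1 l hl => ?_⟩
    rfl rfl
  · by_cases hj : l = j
    · subst hj; simp
    · simpa [hj] using h1 l hl
  · by_cases hj : l = j
    · subst hj; simpa using h1.1
    · simpa [hj] using h1.2 l hl

/-- Being fixed by `pe j 0 0` makes closure of `Triv j` under products a consequence of
`pe_mul_right`. -/
theorem triv_iff [Zero S] {j : ι} {Z : SiteMat ι S} : Triv j Z ↔ pe j 0 0 Z = Z :=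
  ⟨fun h => by rw [pe_of_triv h, if_pos rfl], fun h => h ▸ triv_pe j 0 0 Z⟩

theorem Triv.mul [NonUnitalNonAssocSemiring S] {j : ι} {Z W : SiteMat ι S} (hZ : Triv j Z)
    (hW : Triv j W) : Triv j (Z * W) := by
  rw [triv_iff, pe_mul_right j 0 0 Z hW, triv_iff.1 hZ]

theorem triv_one [Zero S] [One S] (j : ι) : Triv j (1 : SiteMat ι S) := by
  intro s t b c
  simp only [Matrix.one_apply]
  rw [← ite_and]
  refine if_congr ⟨fun h => ⟨by simpa using congrFun h j, ?_⟩, fun h => ?_⟩ rfl rfl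
  · funext k
    by_cases hk : k = j
    · subst hk; simp
    · simpa [hk] using congrFun h k
  · funext k
    by_cases hk : k = j
    · subst hk; simpa using h.1
    · simpa [hk] using congrFun h.2 k

theorem triv_list_prod [Semiring S] {j : ι} (l : List (SiteMat ι S))
    (h : ∀ Z ∈ l, Triv j Z) : Triv j l.prod := by
  induction l with
  | nil => exact triv_one j
  | cons a l ih =>
    rw [List.prod_cons]
    exact (h a (by simp)).mul (ih fun Z hZ => h Z (by simp [hZ]))

theorem Triv.map {S' F : Type*} [Zero S] [Zero S'] [FunLike F S S'] [ZeroHomClass F S S']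
    {j : ι} {Z : SiteMat ι S} (h : Triv j Z) (φ : F) : Triv j (Z.map φ) := by
  intro s t b c
  simp only [Matrix.map_apply]
  rw [h]; split_ifs <;> simp

theorem Triv.commute_site1 [NonUnitalNonAssocSemiring S] {j : ι} {Z : SiteMat ι S} (h : Triv j Z)
    (m : Matrix (Fin 2) (Fin 2) S) (hc : ∀ s t b c, Commute (Z s t) (m b c)) :
    Commute Z (site1 j m) := by
  rw [Commute, SemiconjBy]
  ext s t
  rw [site1_mul_apply, mul_site1_apply]
  rw [Finset.sum_eq_single (s j), Finset.sum_eq_single (t j)]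
  · have h1 := h s t (s j) (s j)
    have h2 := h s t (t j) (t j)
    rw [if_pos rfl, Function.update_eq_self] at h1 h2
    rw [h1, h2]
    exact (hc _ _ _ _).eq
  · intro b _ hb
    have := h s t b (t j)
    rw [Function.update_eq_self] at this
    rw [this, if_neg hb, mul_zero]
  · simp
  · intro b _ hb
    have := h s t (s j) b
    rw [Function.update_eq_self] at this
    rw [this, if_neg hb.symm, zero_mul]
  · simp

end PartialEntry

/-! ### The `q`-oscillator relations and the exchange relations -/

/-- `u = q^D`, `v = q^{-D}`, `x = a*` and `a` satisfy the relations of the `q`-oscillator algebra. -/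
structure IsOsc {S : Type*} [Ring S] [Algebra ℂ S] (q : ℂ) (u v x a : S) : Prop where
  uv : u * v = 1
  vu : v * u = 1
  ux : u * x = q • (x * u)
  ua : u * a = q⁻¹ • (a * u)
  ax : a * x = 1 - q ^ 2 • (u * u)
  xa : x * a = 1 - u * u

namespace IsOsc

variable {S : Type*} [Ring S] [Algebra ℂ S] {q : ℂ} {u v x a : S}

theorem vx (h : IsOsc q u v x a) (hq : q ≠ 0) : v * x = q⁻¹ • (x * v) := by
  calc v * x = v * (x * (u * v)) := by rw [h.uv, mul_one]
    _ = q⁻¹ • (v * (q • (x * u)) * v) := by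
        rw [mul_smul_comm, smul_mul_assoc, smul_smul, inv_mul_cancel₀ hq, one_smul]
        simp only [mul_assoc]
    _ = q⁻¹ • (x * v) := by
        rw [← h.ux, ← mul_assoc, h.vu, one_mul]

theorem va (h : IsOsc q u v x a) (hq : q ≠ 0) : v * a = q • (a * v) := by
  calc v * a = v * (a * (u * v)) := by rw [h.uv, mul_one]
    _ = q • (v * (q⁻¹ • (a * u)) * v) := by
        rw [mul_smul_comm, smul_mul_assoc, smul_smul, mul_inv_cancel₀ hq, one_smul]
        simp only [mul_assoc]
    _ = q • (a * v) := by
        rw [← h.ua, ← mul_assoc, h.vu, one_mul]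

/-- This and the following primed lemmas are right-associated forms of the relations. They let
`simp` move `u` and `v` to the right and eliminate `a * x` and `x * a` inside longer words. -/
theorem uv' (h : IsOsc q u v x a) (w : S) : u * (v * w) = w := by
  rw [← mul_assoc, h.uv, one_mul]

theorem vu' (h : IsOsc q u v x a) (w : S) : v * (u * w) = w := by
  rw [← mul_assoc, h.vu, one_mul]

theorem ux' (h : IsOsc q u v x a) (w : S) : u * (x * w) = q • (x * (u * w)) := by
  rw [← mul_assoc, h.ux, smul_mul_assoc, mul_assoc]

theorem ua' (h : IsOsc q u v x a) (w : S) : u * (a * w) = q⁻¹ • (a * (u * w)) := by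
  rw [← mul_assoc, h.ua, smul_mul_assoc, mul_assoc]

theorem vx' (h : IsOsc q u v x a) (hq : q ≠ 0) (w : S) :
    v * (x * w) = q⁻¹ • (x * (v * w)) := by
  rw [← mul_assoc, h.vx hq, smul_mul_assoc, mul_assoc]

theorem va' (h : IsOsc q u v x a) (hq : q ≠ 0) (w : S) :
    v * (a * w) = q • (a * (v * w)) := by
  rw [← mul_assoc, h.va hq, smul_mul_assoc, mul_assoc]

theorem ax' (h : IsOsc q u v x a) (w : S) : a * (x * w) = w - q ^ 2 • (u * (u * w)) := by
  rw [← mul_assoc, h.ax, sub_mul, one_mul, smul_mul_assoc, mul_assoc]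

theorem xa' (h : IsOsc q u v x a) (w : S) : x * (a * w) = w - u * (u * w) := by
  rw [← mul_assoc, h.xa, sub_mul, one_mul, mul_assoc]

end IsOsc

section Lax

variable {S : Type*} [Ring S] [Algebra ℂ S]

/-- The operator `L⁺(ζ)` without its scalar prefactor. -/
def Lh (q z : ℂ) (u v x a : S) : Matrix (Fin 2) (Fin 2) S :=
  !![u, -(z • (x * v)); -(z • (a * u)), v - (z ^ 2 * q ^ 2) • u]

/-- The numerator `(1 - ζ²) L⁺(ζ)⁻¹`. -/
def Nh (z : ℂ) (u v x a : S) : Matrix (Fin 2) (Fin 2) S :=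
  !![v - z ^ 2 • u, z • (v * x); z • (u * a), u]

/-- Conjugation by `σˣ`. -/
def flip2 (m : Matrix (Fin 2) (Fin 2) S) : Matrix (Fin 2) (Fin 2) S :=
  !![m 1 1, m 1 0; m 0 1, m 0 0]

theorem flip2_mul (m m' : Matrix (Fin 2) (Fin 2) S) : flip2 (m * m') = flip2 m * flip2 m' := by
  ext i j
  fin_cases i <;> fin_cases j <;>
    simp [flip2, Matrix.mul_apply, Fin.sum_univ_two, add_comm]

theorem flip2_smul (c : ℂ) (m : Matrix (Fin 2) (Fin 2) S) : flip2 (c • m) = c • flip2 m := by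
  ext i j
  fin_cases i <;> fin_cases j <;> simp [flip2]

theorem flip2_one : flip2 (1 : Matrix (Fin 2) (Fin 2) S) = 1 := by
  ext i j
  fin_cases i <;> fin_cases j <;> simp [flip2]

variable {q : ℂ} {u v x a : S}

/-- The zero of `1 - z²` at `z = 1` is the only source of poles in the spectral parameter at `ζ =
ξ_j`. -/
theorem Lh_mul_Nh (h : IsOsc q u v x a) (hq : q ≠ 0) (z : ℂ) :
    Lh q z u v x a * Nh z u v x a = (1 - z ^ 2) • 1 := by
  ext i j
  fin_cases i <;> fin_cases j <;>
    simp [Lh, Nh, Matrix.mul_apply, Fin.sum_univ_two, mul_add, add_mul, mul_sub, sub_mul,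
      mul_assoc, smul_smul, smul_sub, smul_add, h.uv, h.vu, h.ux, h.ua, h.ax, h.xa, h.vx hq,
      h.va hq, h.uv', h.vu', h.ux', h.ua', h.ax', h.xa', h.vx' hq, h.va' hq] <;>
    match_scalars <;> field_simp <;> ring

theorem Nh_mul_Lh (h : IsOsc q u v x a) (hq : q ≠ 0) (z : ℂ) :
    Nh z u v x a * Lh q z u v x a = (1 - z ^ 2) • 1 := by
  ext i j
  fin_cases i <;> fin_cases j <;>
    simp [Lh, Nh, Matrix.mul_apply, Fin.sum_univ_two, mul_add, add_mul, mul_sub, sub_mul,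
      mul_assoc, smul_smul, smul_sub, smul_add, h.uv, h.vu, h.ux, h.ua, h.ax, h.xa, h.vx hq,
      h.va hq, h.uv', h.vu', h.ux', h.ua', h.ax', h.xa', h.vx' hq, h.va' hq] <;>
    match_scalars <;> field_simp <;> ring

/-- The six-vertex `R`-matrix as a Laurent polynomial in `w`. -/
def Rp (q w : ℂ) : Matrix (Fin 2 × Fin 2) (Fin 2 × Fin 2) ℂ :=
  Matrix.of fun x y =>
    if x.1 = x.2 then (if y = x then q * w - q⁻¹ * w⁻¹ else 0)
      else if y = x then w - w⁻¹ else if y = (x.2, x.1) then q - q⁻¹ else 0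

/-- Checked entry by entry: normal ordering by the oscillator relations leaves scalar identities in
`q`, `w`, `z`. -/
theorem RLL (h : IsOsc q u v x a) (hq : q ≠ 0) {w : ℂ} (hw : w ≠ 0) (z : ℂ) :
    (Rp q w).map (algebraMap ℂ S) * onSnd (Lh q (w * z) u v x a) * onFst (Lh q z u v x a) =
      onFst (Lh q z u v x a) * onSnd (Lh q (w * z) u v x a) *
        (Rp q w).map (algebraMap ℂ S) := by
  ext ⟨i, i'⟩ ⟨j, j'⟩
  fin_cases i <;> fin_cases i' <;> fin_cases j <;> fin_cases j' <;>
    simp [Rp, Lh, onFst, onSnd, Matrix.mul_apply, Fintype.sum_prod_type, Fin.sum_univ_two,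
      Algebra.algebraMap_eq_smul_one, mul_add, add_mul, mul_sub, sub_mul,
      mul_assoc, smul_smul, smul_sub, smul_add, h.uv, h.vu, h.ux, h.ua, h.ax, h.xa, h.vx hq,
      h.va hq, h.uv', h.vu', h.ux', h.ua', h.ax', h.xa', h.vx' hq, h.va' hq] <;>
    match_scalars <;> field_simp <;> ring

end Lax

/-! ### The concrete oscillator operators -/

theorem band_single (d : ℤ) (f : ℤ → LPoly) (k : ℤ) (c : LPoly) :
    band d f (Finsupp.single k c) = Finsupp.single (k + d) (c * f k) := by
  simp [band, LinearMap.toSpanSingleton_apply]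

theorem osc_ext {x y : OscEnd} (h : ∀ k, x (Finsupp.single k 1) = y (Finsupp.single k 1)) :
    x = y := by
  apply Finsupp.lhom_ext
  intro k c
  have : Finsupp.single k c = c • Finsupp.single k (1 : LPoly) := by simp
  rw [this, map_smul, map_smul, h]

theorem band_mul (d e : ℤ) (f g : ℤ → LPoly) :
    band d f * band e g = band (e + d) fun k => f (k + e) * g k := by
  apply osc_ext; intro k
  simp [band_single, add_assoc, mul_comm]

theorem band_smul (c : ℂ) (d : ℤ) (f : ℤ → LPoly) :
    c • band d f = band d fun k => LaurentPolynomial.C c * f k := by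
  apply osc_ext; intro k
  simp [band_single, LaurentPolynomial.smul_eq_C_mul]

theorem band_add (d : ℤ) (f g : ℤ → LPoly) :
    band d f + band d g = band d fun k => f k + g k := by
  apply osc_ext; intro k
  simp [band_single]

theorem band_sub (d : ℤ) (f g : ℤ → LPoly) :
    band d f - band d g = band d fun k => f k - g k := by
  apply osc_ext; intro k
  simp [band_single]

theorem one_eq_band : (1 : OscEnd) = band 0 fun _ => 1 := by
  apply osc_ext; intro k
  simp [band_single]
theorem band_congr {d : ℤ} {f g : ℤ → LPoly} (h : ∀ k, f k = g k) : band d f = band d g := by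
  rw [funext h]

open LaurentPolynomial in
theorem qD_mul (η : ℂ) (m m' : ℤ) : qD η m * qD η m' = qD η (m + m') := by
  rw [qD, qD, qD, band_mul]
  refine band_congr fun k => ?_
  rw [mul_mul_mul_comm, ← map_mul, ← Complex.exp_add, ← T_add]
  congr 3
  push_cast; ring

theorem qD_zero (η : ℂ) : qD η 0 = 1 := by
  rw [qD, one_eq_band]
  refine band_congr fun k => ?_
  simp
open LaurentPolynomial in
theorem isOsc (η : ℂ) : IsOsc (Complex.exp η) (qD η 1) (qD η (-1)) oscAstar (oscA η) where
  uv := by rw [qD_mul]; simp [qD_zero]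
  vu := by rw [qD_mul]; simp [qD_zero]
  ux := by
    rw [qD, oscAstar, band_mul, band_mul, band_smul]
    refine band_congr fun k => ?_
    have : C (Complex.exp (η * ((1 : ℤ) * ((k + 1 : ℤ))))) =
        C (Complex.exp η) * C (Complex.exp (η * ((1 : ℤ) * k))) := by
      rw [← map_mul, ← Complex.exp_add]; congr 2; push_cast; ring
    rw [this]; ring
  ua := by
    rw [qD, oscA, band_mul, band_mul, band_smul]
    refine band_congr fun k => ?_
    have : C (Complex.exp (η * ((1 : ℤ) * ((k + -1 : ℤ))))) =
        C (Complex.exp η)⁻¹ * C (Complex.exp (η * ((1 : ℤ) * k))) := by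
      rw [← Complex.exp_neg, ← map_mul, ← Complex.exp_add]; congr 2; push_cast; ring
    rw [this, add_zero]; ring
  ax := by
    rw [qD_mul, qD, oscA, oscAstar, band_mul, one_eq_band, band_smul, band_sub]
    refine band_congr fun k => ?_
    have : C (Complex.exp (η * (2 * ((k + 1 : ℤ))))) =
        C (Complex.exp η ^ 2) * C (Complex.exp (η * ((1 + 1 : ℤ) * k))) := by
      rw [← Complex.exp_nat_mul, ← map_mul, ← Complex.exp_add]; congr 2; push_cast; ring
    rw [this]; ring_nf
  xa := by
    rw [qD_mul, qD, oscA, oscAstar, band_mul, one_eq_band, band_sub]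
    refine band_congr fun k => ?_
    simp


/-! ### Weighted traces as linear functionals -/

/-- The linear functional `T^m ↦ w m` on Laurent polynomials. -/
def wt (w : ℤ → ℂ) : LPoly →ₗ[ℂ] ℂ where
  toFun f := f.coeff.sum fun m c => c * w m
  map_add' f g := by
    exact Finsupp.sum_add_index' (fun _ => zero_mul _) (fun _ _ _ => add_mul _ _ _)
  map_smul' c f := by
    simp only [AddMonoidAlgebra.coeff_smul, RingHom.id_apply, smul_eq_mul, Finsupp.mul_sum]
    refine (Finsupp.sum_smul_index fun _ => zero_mul _).trans ?_
    simp [mul_assoc]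

theorem wt_C_mul_T (w : ℤ → ℂ) (c : ℂ) (m : ℤ) :
    wt w (LaurentPolynomial.C c * LaurentPolynomial.T m) = c * w m := by
  rw [← LaurentPolynomial.single_eq_C_mul_T]
  change (Finsupp.single m c).sum (fun m c => c * w m) = _
  simp

theorem wt_T (w : ℤ → ℂ) (m : ℤ) : wt w (LaurentPolynomial.T m) = w m := by
  simpa using wt_C_mul_T w 1 m

/-- `diagPart` as a linear map. -/
def diagL : OscEnd →ₗ[ℂ] LPoly where
  toFun := diagPart
  map_add' x y := by simp [diagPart]
  map_smul' c x := by simp [diagPart]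

theorem diagL_band (d : ℤ) (f : ℤ → LPoly) : diagL (band d f) = if d = 0 then f 0 else 0 := by
  change (band d f (Finsupp.single 0 1)) 0 = _
  rw [band_single, Finsupp.single_apply]
  simp

/-- The functional `x ↦ ∑ w m c_m` with `⟨k|x|k⟩ = ∑ c_m q^{mk}`. -/
def wtr (w : ℤ → ℂ) : OscEnd →ₗ[ℂ] ℂ := wt w ∘ₗ diagL

/-- The sum of the geometric series `∑ q^{(2α+m)k}`, `k ≥ 0`, that is, the weighted trace of
`q^{mD}` over `W⁺`. -/
def wPlus (η α : ℂ) (m : ℤ) : ℂ := (1 - Complex.exp (η * (2 * α + m)))⁻¹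

/-- The weighted trace of `q^{mD}` over `W⁻`: with basis vectors `|-1-k⟩` it is `∑ q^{2αk}
q^{-m(1+k)}`, `k ≥ 0`. -/
def wMinus (η α : ℂ) (m : ℤ) : ℂ :=
  Complex.exp (-(η * m)) * (1 - Complex.exp (η * (2 * α - m)))⁻¹

theorem trPlus_eq (η α : ℂ) (x : OscEnd) : trPlus η α x = wtr (wPlus η α) x := rfl

theorem trMinus_eq (η α : ℂ) (x : OscEnd) : trMinus η α x = wtr (wMinus η α) x := by
  simp only [trMinus, wtr, wt, wMinus, diagL, LinearMap.comp_apply, LinearMap.coe_mk,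
    AddHom.coe_mk]
  exact Finsupp.sum_congr fun m _ => by rw [mul_div_assoc, ← div_eq_mul_inv]

theorem wtr_band_ne (w : ℤ → ℂ) {d : ℤ} (hd : d ≠ 0) (f : ℤ → LPoly) : wtr w (band d f) = 0 := by
  rw [wtr, LinearMap.comp_apply, diagL_band, if_neg hd, map_zero]

theorem wtr_qD (w : ℤ → ℂ) (η : ℂ) (m : ℤ) : wtr w (qD η m) = w m := by
  rw [wtr, LinearMap.comp_apply, qD, diagL_band, if_pos rfl]
  simp [wt_T]

/-- Operators of charge `d`. -/
def Deg (d : ℤ) : Submodule ℂ OscEnd where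
  carrier := {x | ∃ f, x = band d f}
  add_mem' := by rintro _ _ ⟨f, rfl⟩ ⟨g, rfl⟩; exact ⟨_, band_add _ _ _⟩
  zero_mem' := ⟨fun _ => 0, osc_ext fun k => by simp [band_single]⟩
  smul_mem' := by rintro c _ ⟨f, rfl⟩; exact ⟨_, band_smul _ _ _⟩

theorem band_mem_Deg (d : ℤ) (f : ℤ → LPoly) : band d f ∈ Deg d := ⟨f, rfl⟩

theorem mul_mem_Deg {d e : ℤ} {x y : OscEnd} (hx : x ∈ Deg d) (hy : y ∈ Deg e) :
    x * y ∈ Deg (d + e) := by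
  obtain ⟨f, rfl⟩ := hx
  obtain ⟨g, rfl⟩ := hy
  rw [band_mul, add_comm]
  exact band_mem_Deg _ _

theorem one_mem_Deg : (1 : OscEnd) ∈ Deg 0 := one_eq_band ▸ band_mem_Deg _ _

theorem pow_mem_Deg {d : ℤ} {x : OscEnd} (hx : x ∈ Deg d) (n : ℕ) : x ^ n ∈ Deg (n * d) := by
  induction n with
  | zero => simpa using one_mem_Deg
  | succ n ih =>
    rw [pow_succ]
    have := mul_mem_Deg ih hx
    convert this using 2; push_cast; ring

theorem wtr_of_mem_Deg (w : ℤ → ℂ) {d : ℤ} (hd : d ≠ 0) {x : OscEnd} (hx : x ∈ Deg d) :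
    wtr w x = 0 := by
  obtain ⟨f, rfl⟩ := hx
  exact wtr_band_ne w hd f

theorem qD_mem_Deg (η : ℂ) (m : ℤ) : qD η m ∈ Deg 0 := band_mem_Deg _ _

theorem oscA_mem_Deg (η : ℂ) : oscA η ∈ Deg (-1) := band_mem_Deg _ _

theorem oscAstar_mem_Deg : oscAstar ∈ Deg 1 := band_mem_Deg _ _

theorem qD_mul_oscAstar (η : ℂ) (m : ℤ) :
    qD η m * oscAstar = Complex.exp (η * m) • (oscAstar * qD η m) := by
  rw [qD, oscAstar, band_mul, band_mul, band_smul]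
  refine band_congr fun k => ?_
  have : LaurentPolynomial.C (Complex.exp (η * (m * ((k + 1 : ℤ))))) =
      LaurentPolynomial.C (Complex.exp (η * m)) *
        LaurentPolynomial.C (Complex.exp (η * (m * k))) := by
    rw [← map_mul, ← Complex.exp_add]; congr 2; push_cast; ring
  rw [this]; ring

theorem osc_one_sub_mul (y z : OscEnd) : (1 - y) * z = z - y * z := by
  exact (sub_mul 1 y z).trans (by rw [one_mul])

theorem osc_map_sub {M : Type*} [AddCommGroup M] [Module ℂ M] (φ : OscEnd →ₗ[ℂ] M) (y z : OscEnd) :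
    φ (y - z) = φ y - φ z := by
  exact map_sub φ y z

theorem osc_sub_mem (M : Submodule ℂ OscEnd) {y z : OscEnd} (hy : y ∈ M) (hz : z ∈ M) :
    y - z ∈ M := by
  have h := M.add_mem hy (M.smul_mem (-1 : ℂ) hz)
  convert h using 1
  apply LinearMap.ext
  intro v
  simp [sub_eq_add_neg]

theorem qD_mul_oscA (η : ℂ) (m : ℤ) :
    qD η m * oscA η = Complex.exp (-(η * m)) • (oscA η * qD η m) := by
  rw [qD, oscA, band_mul, band_mul, band_smul]
  refine band_congr fun k => ?_
  have : LaurentPolynomial.C (Complex.exp (η * (m * ((k + -1 : ℤ))))) =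
      LaurentPolynomial.C (Complex.exp (-(η * m))) *
        LaurentPolynomial.C (Complex.exp (η * (m * k))) := by
    rw [← map_mul, ← Complex.exp_add]; congr 2; push_cast; ring
  rw [this, add_zero]; ring

theorem oscA_mul_oscAstar (η : ℂ) :
    oscA η * oscAstar = 1 - Complex.exp (2 * η) • qD η 2 := by
  rw [(isOsc η).ax, qD_mul, ← Complex.exp_nat_mul]; norm_num

theorem oscAstar_mul_oscA (η : ℂ) : oscAstar * oscA η = 1 - qD η 2 := by
  rw [(isOsc η).xa, qD_mul]; norm_num

/-- The subalgebra generated by `a`, `a*` and `q^{±D}`. -/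
def oscAlg (η : ℂ) : Subalgebra ℂ OscEnd :=
  Algebra.adjoin ℂ {qD η 1, qD η (-1), oscAstar, oscA η}

/-- Normal ordering: `q^{mD}` quasi-commutes with `a` and `a*`, and both `a a*` and `a* a` are
affine in `q^{2D}`, so words containing both `a` and `a*` collapse. -/
theorem oscAlg_le_span (η : ℂ) :
    Subalgebra.toSubmodule (oscAlg η) ≤ Submodule.span ℂ
      ({z | ∃ (j : ℕ) (m : ℤ), z = oscAstar ^ j * qD η m} ∪
        {z | ∃ (j : ℕ) (m : ℤ), z = oscA η ^ (j + 1) * qD η m}) := by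
  set M := Submodule.span ℂ
      ({z | ∃ (j : ℕ) (m : ℤ), z = oscAstar ^ j * qD η m} ∪
        {z | ∃ (j : ℕ) (m : ℤ), z = oscA η ^ (j + 1) * qD η m}) with hM
  have hx : ∀ (j : ℕ) (m : ℤ), oscAstar ^ j * qD η m ∈ M := fun j m =>
    Submodule.subset_span (Or.inl ⟨j, m, rfl⟩)
  have ha : ∀ (j : ℕ) (m : ℤ), oscA η ^ j * qD η m ∈ M := fun j m => by
    cases j with
    | zero => simpa using hx 0 m
    | succ j => exact Submodule.subset_span (Or.inr ⟨j, m, rfl⟩)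
  have hqx : ∀ (k : ℤ) (j : ℕ), ∃ c : ℂ, qD η k * oscAstar ^ j = c • (oscAstar ^ j * qD η k) := by
    intro k j
    induction j with
    | zero => exact ⟨1, by simp⟩
    | succ j ih =>
      obtain ⟨c, hc⟩ := ih
      exact ⟨c * Complex.exp (η * k), by
        rw [pow_succ, ← mul_assoc, hc, smul_mul_assoc, mul_assoc, qD_mul_oscAstar, mul_smul_comm,
          smul_smul, mul_assoc]⟩
  have hqa : ∀ (k : ℤ) (j : ℕ), ∃ c : ℂ, qD η k * oscA η ^ j = c • (oscA η ^ j * qD η k) := by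
    intro k j
    induction j with
    | zero => exact ⟨1, by simp⟩
    | succ j ih =>
      obtain ⟨c, hc⟩ := ih
      exact ⟨c * Complex.exp (-(η * k)), by
        rw [pow_succ, ← mul_assoc, hc, smul_mul_assoc, mul_assoc, qD_mul_oscA, mul_smul_comm,
          smul_smul, mul_assoc]⟩
  have hqxm : ∀ (k : ℤ) (j : ℕ) (m : ℤ), qD η k * (oscAstar ^ j * qD η m) ∈ M := by
    intro k j m
    obtain ⟨c, hc⟩ := hqx k j
    rw [← mul_assoc, hc, smul_mul_assoc, mul_assoc, qD_mul]
    exact M.smul_mem _ (hx _ _)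
  have hqam : ∀ (k : ℤ) (j : ℕ) (m : ℤ), qD η k * (oscA η ^ j * qD η m) ∈ M := by
    intro k j m
    obtain ⟨c, hc⟩ := hqa k j
    rw [← mul_assoc, hc, smul_mul_assoc, mul_assoc, qD_mul]
    exact M.smul_mem _ (ha _ _)
  -- The span is stable under left multiplication by each generator and contains `1`, hence it
  -- contains the algebra they generate.
  have key : ∀ g ∈ ({qD η 1, qD η (-1), oscAstar, oscA η} : Set OscEnd), ∀ y ∈ M, g * y ∈ M := by
    intro g hg y hy
    induction hy using Submodule.span_induction with
    | zero => simp
    | add y y' _ _ h h' => rw [mul_add]; exact M.add_mem h h'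
    | smul c y _ h => rw [mul_smul_comm]; exact M.smul_mem _ h
    | mem y hy =>
      have hq : ∀ k : ℤ, qD η k * y ∈ M := by
        intro k
        rcases hy with ⟨j, m, rfl⟩ | ⟨j, m, rfl⟩
        · exact hqxm k j m
        · exact hqam k (j + 1) m
      rcases hg with rfl | rfl | rfl | rfl
      · exact hq 1
      · exact hq (-1)
      · rcases hy with ⟨j, m, rfl⟩ | ⟨j, m, rfl⟩
        · rw [← mul_assoc, ← pow_succ']; exact hx _ _
        · rw [pow_succ', ← mul_assoc, ← mul_assoc, oscAstar_mul_oscA, mul_assoc, osc_one_sub_mul]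
          exact osc_sub_mem M (ha _ _) (hqam _ _ _)
      · rcases hy with ⟨j, m, rfl⟩ | ⟨j, m, rfl⟩
        · cases j with
          | zero => simpa using ha 1 m
          | succ j =>
            rw [pow_succ', ← mul_assoc, ← mul_assoc, oscA_mul_oscAstar, mul_assoc,
              osc_one_sub_mul, smul_mul_assoc]
            exact osc_sub_mem M (hx _ _) (M.smul_mem _ (hqxm _ _ _))
        · rw [← mul_assoc, ← pow_succ']; exact ha _ _
  have h1 : (1 : OscEnd) ∈ M := by simpa [qD_zero] using hx 0 0
  have : ∀ y ∈ oscAlg η, ∀ z ∈ M, y * z ∈ M := by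
    intro y hy
    induction hy using Algebra.adjoin_induction with
    | mem g hg => exact key g hg
    | algebraMap c =>
      intro z hz
      rw [Algebra.algebraMap_eq_smul_one, smul_mul_assoc, one_mul]
      exact M.smul_mem _ hz
    | add y y' _ _ h h' => intro z hz; rw [add_mul]; exact M.add_mem (h z hz) (h' z hz)
    | mul y y' _ _ h h' => intro z hz; rw [mul_assoc]; exact h _ (h' z hz)
  intro y hy
  simpa using this y hy 1 h1

/-- To compare two linear functionals on `oscAlg` look at normally ordered monomials. -/
theorem oscAlg_ext (η : ℂ) {φ ψ : OscEnd →ₗ[ℂ] ℂ}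
    (hx : ∀ (j : ℕ) (m : ℤ), φ (oscAstar ^ j * qD η m) = ψ (oscAstar ^ j * qD η m))
    (ha : ∀ (j : ℕ) (m : ℤ), φ (oscA η ^ (j + 1) * qD η m) = ψ (oscA η ^ (j + 1) * qD η m))
    {z : OscEnd} (hz : z ∈ oscAlg η) : φ z = ψ z := by
  have hz' := oscAlg_le_span η hz
  clear hz
  induction hz' using Submodule.span_induction with
  | zero => simp
  | add y y' _ _ h h' => simp [h, h']
  | smul c y _ h => simp [h]
  | mem y hy =>
    rcases hy with ⟨j, m, rfl⟩ | ⟨j, m, rfl⟩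
    · exact hx j m
    · exact ha j m

theorem xpow_mem (η : ℂ) (j : ℕ) (m : ℤ) : oscAstar ^ j * qD η m ∈ Deg j := by
  simpa using mul_mem_Deg (pow_mem_Deg oscAstar_mem_Deg j) (qD_mem_Deg η m)

theorem apow_mem (η : ℂ) (j : ℕ) (m : ℤ) : oscA η ^ j * qD η m ∈ Deg (-j) := by
  simpa using mul_mem_Deg (pow_mem_Deg (oscA_mem_Deg η) j) (qD_mem_Deg η m)

/-- Both sides vanish on monomials of nonzero charge, and the monomials of charge zero are powers of
`q^D`. -/
theorem wtr_qD_comm (η : ℂ) (w : ℤ → ℂ) (k : ℤ) {z : OscEnd} (hz : z ∈ oscAlg η) :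
    wtr w (qD η k * z) = wtr w (z * qD η k) := by
  refine oscAlg_ext η (φ := wtr w ∘ₗ LinearMap.mulLeft ℂ (qD η k))
    (ψ := wtr w ∘ₗ LinearMap.mulRight ℂ (qD η k)) ?_ ?_ hz
  · intro j m
    simp only [LinearMap.comp_apply, LinearMap.mulLeft_apply, LinearMap.mulRight_apply]
    by_cases hj : j = 0
    · subst hj; simp [qD_mul, add_comm]
    · rw [wtr_of_mem_Deg w (d := j) (by exact_mod_cast hj)
        (by simpa using mul_mem_Deg (qD_mem_Deg η k) (xpow_mem η j m)),
        wtr_of_mem_Deg w (d := j) (by exact_mod_cast hj)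
        (by simpa using mul_mem_Deg (xpow_mem η j m) (qD_mem_Deg η k))]
  · intro j m
    simp only [LinearMap.comp_apply, LinearMap.mulLeft_apply, LinearMap.mulRight_apply]
    rw [wtr_of_mem_Deg w (d := -((j + 1 : ℕ) : ℤ)) (by push_cast; omega)
        (by simpa only [zero_add] using mul_mem_Deg (qD_mem_Deg η k) (apow_mem η (j + 1) m)),
        wtr_of_mem_Deg w (d := -((j + 1 : ℕ) : ℤ)) (by push_cast; omega)
        (by simpa only [add_zero] using mul_mem_Deg (apow_mem η (j + 1) m) (qD_mem_Deg η k))]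

/-- By charge only `z = a q^{mD}` matters. There `a* a` and `a a*` are affine in `q^{2D}`, and the
claim becomes the difference equation `hw` for the weights. It holds for `tr⁺` with `A = q^{2α}` and
for `wZero` with `A = 1`. -/
theorem wtr_oscAstar_comm (η : ℂ) {w : ℤ → ℂ} {A : ℂ}
    (hw : ∀ m : ℤ, w m - w (m + 2) =
      A * (Complex.exp (η * m) * (w m - Complex.exp (2 * η) * w (m + 2))))
    {z : OscEnd} (hz : z ∈ oscAlg η) :
    wtr w (oscAstar * z) = A * wtr w (z * oscAstar) := by
  refine oscAlg_ext η (φ := wtr w ∘ₗ LinearMap.mulLeft ℂ oscAstar)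
    (ψ := A • wtr w ∘ₗ LinearMap.mulRight ℂ oscAstar) ?_ ?_ hz
  · intro j m
    simp only [LinearMap.comp_apply, LinearMap.mulLeft_apply, LinearMap.mulRight_apply,
      LinearMap.smul_apply]
    rw [wtr_of_mem_Deg w (d := 1 + j) (by omega) (mul_mem_Deg oscAstar_mem_Deg (xpow_mem η j m)),
      wtr_of_mem_Deg w (d := j + 1) (by omega) (mul_mem_Deg (xpow_mem η j m) oscAstar_mem_Deg),
      smul_zero]
  · intro j m
    simp only [LinearMap.comp_apply, LinearMap.mulLeft_apply, LinearMap.mulRight_apply,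
      LinearMap.smul_apply]
    by_cases hj : j = 0
    · subst hj
      rw [zero_add, pow_one, ← mul_assoc, oscAstar_mul_oscA, mul_assoc, qD_mul_oscAstar,
        mul_smul_comm, ← mul_assoc, oscA_mul_oscAstar, osc_one_sub_mul, osc_one_sub_mul, qD_mul,
        smul_mul_assoc, qD_mul, osc_map_sub, map_smul, osc_map_sub, map_smul, wtr_qD, wtr_qD, add_comm 2 m,
        hw]
      simp
    · rw [wtr_of_mem_Deg w (d := 1 + -((j + 1 : ℕ) : ℤ)) (by push_cast; omega)
          (mul_mem_Deg oscAstar_mem_Deg (apow_mem η (j + 1) m)),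
        wtr_of_mem_Deg w (d := -((j + 1 : ℕ) : ℤ) + 1) (by push_cast; omega)
          (mul_mem_Deg (apow_mem η (j + 1) m) oscAstar_mem_Deg), smul_zero]

/-- As for `a*`, with `z = a* q^{mD}` as the only monomial that contributes. It serves the trace
over `W⁻`. -/
theorem wtr_oscA_comm (η : ℂ) {w : ℤ → ℂ} {A : ℂ}
    (hw : ∀ m : ℤ, w m - Complex.exp (2 * η) * w (m + 2) =
      A * (Complex.exp (-(η * m)) * (w m - w (m + 2))))
    {z : OscEnd} (hz : z ∈ oscAlg η) :
    wtr w (oscA η * z) = A * wtr w (z * oscA η) := by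
  refine oscAlg_ext η (φ := wtr w ∘ₗ LinearMap.mulLeft ℂ (oscA η))
    (ψ := A • wtr w ∘ₗ LinearMap.mulRight ℂ (oscA η)) ?_ ?_ hz
  · intro j m
    simp only [LinearMap.comp_apply, LinearMap.mulLeft_apply, LinearMap.mulRight_apply,
      LinearMap.smul_apply]
    by_cases hj : j = 1
    · subst hj
      rw [pow_one, ← mul_assoc, oscA_mul_oscAstar, mul_assoc, qD_mul_oscA,
        mul_smul_comm, ← mul_assoc, oscAstar_mul_oscA, osc_one_sub_mul, osc_one_sub_mul, qD_mul,
        smul_mul_assoc, qD_mul, osc_map_sub, map_smul, map_smul, osc_map_sub, wtr_qD, wtr_qD, add_comm 2 m,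
        smul_eq_mul, hw]
      simp
    · rw [wtr_of_mem_Deg w (d := -1 + j) (by omega) (mul_mem_Deg (oscA_mem_Deg η) (xpow_mem η j m)),
        wtr_of_mem_Deg w (d := j + -1) (by omega) (mul_mem_Deg (xpow_mem η j m) (oscA_mem_Deg η)),
        smul_zero]
  · intro j m
    simp only [LinearMap.comp_apply, LinearMap.mulLeft_apply, LinearMap.mulRight_apply,
      LinearMap.smul_apply]
    rw [wtr_of_mem_Deg w (d := -1 + -((j + 1 : ℕ) : ℤ)) (by push_cast; omega)
          (mul_mem_Deg (oscA_mem_Deg η) (apow_mem η (j + 1) m)),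
        wtr_of_mem_Deg w (d := -((j + 1 : ℕ) : ℤ) + -1) (by push_cast; omega)
          (mul_mem_Deg (apow_mem η (j + 1) m) (oscA_mem_Deg η)), smul_zero]

/-! ### The `R`-matrix on pairs of sites -/

theorem Rp_mul_Rp_inv {q w : ℂ} (hq : q ≠ 0) (hw : w ≠ 0) :
    Rp q w * Rp q w⁻¹ = ((q * w - q⁻¹ * w⁻¹) * (q * w⁻¹ - q⁻¹ * w)) • 1 := by
  ext ⟨i, i'⟩ ⟨j, j'⟩
  fin_cases i <;> fin_cases i' <;> fin_cases j <;> fin_cases j' <;>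
    simp [Rp, Matrix.mul_apply, Fintype.sum_prod_type, Fin.sum_univ_two] <;>
    field_simp <;> ring

/-- The permutation of the two factors. -/
def Pm : Matrix (Fin 2 × Fin 2) (Fin 2 × Fin 2) ℂ :=
  Matrix.of fun x y => if y = (x.2, x.1) then 1 else 0

/-- The regular point of the R-matrix; it is what converts the auxiliary site into a quantum site at
`ζ = ξ_j`. -/
theorem Rp_one (q : ℂ) : Rp q 1 = (q - q⁻¹) • Pm := by
  ext ⟨i, i'⟩ ⟨j, j'⟩
  fin_cases i <;> fin_cases i' <;> fin_cases j <;> fin_cases j' <;>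
    simp [Rp, Pm]

/-- The overall normalisation `qζ - q⁻¹ζ⁻¹` cancels the denominators of `β` and `γ`, wherever these
do not vanish. -/
theorem Rmat_eq {η μ : ℂ} (h : 1 - Complex.exp η ^ 2 * Complex.exp μ ^ 2 ≠ 0) :
    Rmat η μ = Rp (Complex.exp η) (Complex.exp μ) := by
  have hq := Complex.exp_ne_zero η
  have hz := Complex.exp_ne_zero μ
  ext ⟨i, i'⟩ ⟨j, j'⟩
  fin_cases i <;> fin_cases i' <;> fin_cases j <;> fin_cases j' <;>
    simp [Rp, Rmat] <;> field_simp <;> ring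

/-! ### The Yang-Baxter equation and permutations of sites. -/

section YangBaxter

variable {ι S : Type*} [Fintype ι] [DecidableEq ι]

abbrev Tri := Fin 2 × Fin 2 × Fin 2

/-- An `8 × 8` matrix acting on the sites `i`, `j`, `k`. -/
def site3 (i j k : ι) (r : Matrix Tri Tri ℂ) : SiteMat ι ℂ :=
  emb ![i, j, k] (Matrix.of fun s t => r (s 0, s 1, s 2) (t 0, t 1, t 2))

theorem inj_triple {i j k : ι} (h : i ≠ j) (h' : i ≠ k) (h'' : j ≠ k) :
    Function.Injective ![i, j, k] := by
  intro a b
  fin_cases a <;> fin_cases b <;> simp [h, h', h'', h.symm, h'.symm, h''.symm]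

def triEquiv : (Fin 3 → Fin 2) ≃ Tri where
  toFun s := (s 0, s 1, s 2)
  invFun x := ![x.1, x.2.1, x.2.2]
  left_inv s := by funext i; fin_cases i <;> rfl
  right_inv x := rfl

theorem site3_mul {i j k : ι} (h : i ≠ j) (h' : i ≠ k) (h'' : j ≠ k) (r r' : Matrix Tri Tri ℂ) :
    site3 i j k (r * r') = site3 i j k r * site3 i j k r' := by
  rw [site3, site3, site3, ← emb_mul (inj_triple h h' h'')]
  refine congrArg _ (Matrix.ext fun s t => ?_)
  simp only [Matrix.mul_apply, Matrix.of_apply]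
  exact (Equiv.sum_comp triEquiv (fun x => r (s 0, s 1, s 2) x * r' x (t 0, t 1, t 2))).symm

abbrev Duo := Fin 2 × Fin 2

def r12 (r : Matrix Duo Duo ℂ) : Matrix Tri Tri ℂ :=
  Matrix.of fun x y => if x.2.2 = y.2.2 then r (x.1, x.2.1) (y.1, y.2.1) else 0
def r13 (r : Matrix Duo Duo ℂ) : Matrix Tri Tri ℂ :=
  Matrix.of fun x y => if x.2.1 = y.2.1 then r (x.1, x.2.2) (y.1, y.2.2) else 0
def r23 (r : Matrix Duo Duo ℂ) : Matrix Tri Tri ℂ :=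
  Matrix.of fun x y => if x.1 = y.1 then r (x.2.1, x.2.2) (y.2.1, y.2.2) else 0

theorem site3_r12 {i j k : ι} (h' : i ≠ k) (h'' : j ≠ k) (r : Matrix Duo Duo ℂ) :
    site3 i j k (r12 r) = site2 i j r := by
  ext s t
  rw [site3, emb_apply, site2_apply]
  have hP : (∀ l, (∀ a, ![i, j, k] a ≠ l) → s l = t l) ↔
      ∀ l, ¬(i = l ∨ j = l ∨ k = l) → s l = t l := by simp [Fin.forall_fin_succ]
  simp only [hP]
  change (if _ then (if s k = t k then r (s i, s j) (t i, t j) else 0)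
    else 0) = _
  rw [← ite_and]
  refine if_congr ⟨?_, ?_⟩ rfl rfl
  · rintro ⟨h1, h2⟩ l hi hj
    by_cases hk : l = k
    · rw [hk, h2]
    · exact h1 l (by simp [Ne.symm hi, Ne.symm hj, Ne.symm hk])
  · intro h1
    exact ⟨fun l hl => h1 l (fun e => hl (by simp [e])) fun e => hl (by simp [e]), h1 k h'.symm h''.symm⟩

theorem site3_r13 {i j k : ι} (h : i ≠ j) (h'' : j ≠ k) (r : Matrix Duo Duo ℂ) :
    site3 i j k (r13 r) = site2 i k r := by
  ext s t
  rw [site3, emb_apply, site2_apply]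
  have hP : (∀ l, (∀ a, ![i, j, k] a ≠ l) → s l = t l) ↔
      ∀ l, ¬(i = l ∨ j = l ∨ k = l) → s l = t l := by simp [Fin.forall_fin_succ]
  simp only [hP]
  change (if _ then (if s j = t j then r (s i, s k) (t i, t k) else 0)
    else 0) = _
  rw [← ite_and]
  refine if_congr ⟨?_, ?_⟩ rfl rfl
  · rintro ⟨h1, h2⟩ l hi hk
    by_cases hj : l = j
    · rw [hj, h2]
    · exact h1 l (by simp [Ne.symm hi, Ne.symm hj, Ne.symm hk])
  · intro h1
    exact ⟨fun l hl => h1 l (fun e => hl (by simp [e])) fun e => hl (by simp [e]), h1 j h.symm h''⟩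

theorem site3_r23 {i j k : ι} (h : i ≠ j) (h' : i ≠ k) (r : Matrix Duo Duo ℂ) :
    site3 i j k (r23 r) = site2 j k r := by
  ext s t
  rw [site3, emb_apply, site2_apply]
  have hP : (∀ l, (∀ a, ![i, j, k] a ≠ l) → s l = t l) ↔
      ∀ l, ¬(i = l ∨ j = l ∨ k = l) → s l = t l := by simp [Fin.forall_fin_succ]
  simp only [hP]
  change (if _ then (if s i = t i then r (s j, s k) (t j, t k) else 0)
    else 0) = _
  rw [← ite_and]
  refine if_congr ⟨?_, ?_⟩ rfl rfl
  · rintro ⟨h1, h2⟩ l hj hk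
    by_cases hi : l = i
    · rw [hi, h2]
    · exact h1 l (by simp [Ne.symm hi, Ne.symm hj, Ne.symm hk])
  · intro h1
    exact ⟨fun l hl => h1 l (fun e => hl (by simp [e])) fun e => hl (by simp [e]), h1 i h h'⟩

theorem r12_mul_apply (r : Matrix Duo Duo ℂ) (m : Matrix Tri Tri ℂ) (a b c : Fin 2) (y : Tri) :
    (r12 r * m) (a, b, c) y = ∑ d : Fin 2, ∑ e : Fin 2, r (a, b) (d, e) * m (d, e, c) y := by
  simp only [Matrix.mul_apply, r12, Matrix.of_apply, Fintype.sum_prod_type, ite_mul, zero_mul,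
    Finset.sum_ite_eq, Finset.mem_univ, if_true]

theorem r13_mul_apply (r : Matrix Duo Duo ℂ) (m : Matrix Tri Tri ℂ) (a b c : Fin 2) (y : Tri) :
    (r13 r * m) (a, b, c) y = ∑ d : Fin 2, ∑ e : Fin 2, r (a, c) (d, e) * m (d, b, e) y := by
  simp only [Matrix.mul_apply, r13, Matrix.of_apply, Fintype.sum_prod_type, ite_mul, zero_mul,
    Finset.sum_ite_irrel, Finset.sum_const_zero, Finset.sum_ite_eq, Finset.mem_univ, if_true]

theorem r23_mul_apply (r : Matrix Duo Duo ℂ) (m : Matrix Tri Tri ℂ) (a b c : Fin 2) (y : Tri) :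
    (r23 r * m) (a, b, c) y = ∑ d : Fin 2, ∑ e : Fin 2, r (b, c) (d, e) * m (a, d, e) y := by
  simp only [Matrix.mul_apply, r23, Matrix.of_apply, Fintype.sum_prod_type, ite_mul, zero_mul,
    Finset.sum_ite_irrel, Finset.sum_const_zero, Finset.sum_ite_eq, Finset.mem_univ, if_true]

set_option maxHeartbeats 2000000 in
-- A finite check of the 64 entries; expanding each product one row at a time keeps every entry a
-- short sum.
theorem ybe_tri {q w z : ℂ} (hq : q ≠ 0) (hw : w ≠ 0) (hz : z ≠ 0) :
    r23 (Rp q w) * r13 (Rp q (w * z)) * r12 (Rp q z) =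
      r12 (Rp q z) * r13 (Rp q (w * z)) * r23 (Rp q w) := by
  ext ⟨a, b, c⟩ ⟨a', b', c'⟩
  simp only [mul_assoc, r12_mul_apply, r13_mul_apply, r23_mul_apply, Fin.sum_univ_two]
  simp only [r12, r13, r23, Rp, Matrix.of_apply]
  fin_cases a <;> fin_cases b <;> fin_cases c <;> fin_cases a' <;> fin_cases b' <;>
    fin_cases c' <;> simp <;> field_simp <;> ring

theorem ybe {i j k : ι} (h : i ≠ j) (h' : i ≠ k) (h'' : j ≠ k) {q w z : ℂ} (hq : q ≠ 0)
    (hw : w ≠ 0) (hz : z ≠ 0) :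
    site2 j k (Rp q w) * site2 i k (Rp q (w * z)) * site2 i j (Rp q z) =
      site2 i j (Rp q z) * site2 i k (Rp q (w * z)) * site2 j k (Rp q w) := by
  have := congrArg (site3 i j k) (ybe_tri hq hw hz)
  rwa [site3_mul h h' h'', site3_mul h h' h'', site3_mul h h' h'', site3_mul h h' h'',
    site3_r12 h' h'', site3_r13 h h'', site3_r23 h h'] at this

theorem site2_Pm_apply {j k : ι} (s t : ι → Fin 2) :
    site2 j k Pm s t = if s ∘ Equiv.swap j k = t then 1 else 0 := by
  simp only [site2_apply, Pm, Matrix.of_apply, Prod.mk.injEq]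
  rw [← ite_and]
  refine if_congr ⟨?_, ?_⟩ rfl rfl
  · rintro ⟨h1, h2, h3⟩
    funext l
    by_cases hj : l = j
    · subst hj; simp [h2]
    · by_cases hk : l = k
      · subst hk; simp [h3]
      · simp [Equiv.swap_apply_of_ne_of_ne hj hk, h1 l hj hk]
  · rintro rfl
    exact ⟨fun l hj hk => by simp [Equiv.swap_apply_of_ne_of_ne hj hk], by simp, by simp⟩

theorem emb_equiv_apply [Zero S] (π : ι ≃ ι) (M : SiteMat ι S) (s t : ι → Fin 2) :
    emb π M s t = M (s ∘ π) (t ∘ π) := by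
  rw [emb_apply, if_pos]
  intro k hk
  exact absurd (π.apply_symm_apply k) (hk _)

theorem Pm_conj [Ring S] [Algebra ℂ S] {j k : ι} (M : SiteMat ι S) :
    (site2 j k Pm).map (algebraMap ℂ S) * M * (site2 j k Pm).map (algebraMap ℂ S) =
      emb (Equiv.swap j k) M := by
  have hsw : ∀ s : ι → Fin 2, (s ∘ Equiv.swap j k) ∘ Equiv.swap j k = s := by
    intro s; funext l; simp
  ext s t
  rw [emb_equiv_apply, Matrix.mul_apply]
  rw [Finset.sum_eq_single (t ∘ Equiv.swap j k)]
  · rw [Matrix.mul_apply, Finset.sum_eq_single (s ∘ Equiv.swap j k)]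
    · simp [site2_Pm_apply, hsw]
    · intro r _ hr
      simp [site2_Pm_apply, hr.symm]
    · simp
  · intro r _ hr
    have : r ∘ Equiv.swap j k ≠ t := by
      rintro rfl
      exact hr (hsw r).symm
    simp [site2_Pm_apply, this]
  · simp

end YangBaxter

/-! ### Exchange of factors -/

section Exchange

variable {M ι : Type*} [Monoid M]

theorem commute_list_prod {l : List ι} {X : ι → M} {Y : M} (h : ∀ k ∈ l, Commute Y (X k)) :
    Commute Y (l.map X).prod := by
  induction l with
  | nil => simp
  | cons k l ih =>
    rw [List.map_cons, List.prod_cons]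
    exact (h k (by simp)).mul_right (ih fun m hm => h m (by simp [hm]))

/-- The factor `Y` is carried through the product one index at a time by the local relation, while
factors with different indices commute and can be regrouped. -/
theorem exchange_list (R X : ι → M) (Y : M) {l : List ι} (hl : l.Nodup)
    (hc : ∀ k ∈ l, ∀ m ∈ l, k ≠ m → Commute (R k) (X m))
    (h : ∀ k ∈ l, R k * X k * Y = Y * X k * R k) :
    (l.map R).prod * (l.map X).prod * Y = Y * (l.map X).prod * (l.map R).prod := by
  induction l with
  | nil => simp
  | cons k l ih =>
    have hk := List.nodup_cons.1 hl
    simp only [List.map_cons, List.prod_cons]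
    have ih' := ih hk.2 (fun a ha b hb => hc a (by simp [ha]) b (by simp [hb]))
      fun a ha => h a (by simp [ha])
    have c1 : Commute (X k) (l.map R).prod := commute_list_prod fun m hm =>
      (hc m (by simp [hm]) k (by simp) (by rintro rfl; exact hk.1 hm)).symm
    have c2 : Commute (R k) (l.map X).prod := commute_list_prod fun m hm =>
      hc k (by simp) m (by simp [hm]) (by rintro rfl; exact hk.1 hm)
    calc R k * (l.map R).prod * (X k * (l.map X).prod) * Y
        = R k * ((l.map R).prod * X k) * (l.map X).prod * Y := by simp only [mul_assoc]
      _ = R k * X k * ((l.map R).prod * (l.map X).prod * Y) := by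
          rw [← c1.eq]; simp only [mul_assoc]
      _ = (R k * X k * Y) * (l.map X).prod * (l.map R).prod := by
          rw [ih']; simp only [mul_assoc]
      _ = Y * X k * (R k * (l.map X).prod) * (l.map R).prod := by
          rw [h k (by simp)]; simp only [mul_assoc]
      _ = _ := by rw [c2.eq]; simp only [mul_assoc]

end Exchange

/-! ### Ordered products over lists of sites -/

section ListMonoid

variable {M ι : Type*} [Monoid M]

theorem list_prod_mul_inv {l : List ι} {X Y : ι → M} (h : ∀ k ∈ l, X k * Y k = 1) :
    (l.map X).prod * (l.reverse.map Y).prod = 1 := by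
  induction l with
  | nil => simp
  | cons k l ih =>
    have ih' := ih fun m hm => h m (by simp [hm])
    simp only [List.map_cons, List.prod_cons, List.reverse_cons, List.map_append, List.prod_append,
      List.map_nil, List.prod_nil, mul_one]
    rw [mul_assoc, ← mul_assoc (l.map X).prod, ih', one_mul]
    exact h k (by simp)

theorem list_inv_mul_prod {l : List ι} {X Y : ι → M} (h : ∀ k ∈ l, Y k * X k = 1) :
    (l.reverse.map Y).prod * (l.map X).prod = 1 := by
  have := list_prod_mul_inv (l := l.reverse) (X := Y) (Y := X) fun k hk => h k (by simpa using hk)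
  rwa [List.reverse_reverse] at this

theorem list_prod_mul_of_commute {l : List ι} {X Y : ι → M} (hl : l.Nodup)
    (h : ∀ k ∈ l, ∀ m ∈ l, k ≠ m → Commute (X k) (Y m)) :
    (l.map fun k => X k * Y k).prod = (l.map X).prod * (l.map Y).prod := by
  induction l with
  | nil => simp
  | cons k l ih =>
    have hk := List.nodup_cons.1 hl
    simp only [List.map_cons, List.prod_cons]
    rw [ih hk.2 fun a ha b hb => h a (by simp [ha]) b (by simp [hb])]
    have : Commute (Y k) (l.map X).prod := commute_list_prod fun m hm =>
      (h m (by simp [hm]) k (by simp) (by rintro rfl; exact hk.1 hm)).symm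
    rw [mul_assoc, mul_assoc, ← mul_assoc (Y k), this.eq]
    simp only [mul_assoc]

/-- Conjugation by an ordered product. -/
def adL (X Xi : ι → M) (l : List ι) (Z : M) : M := (l.reverse.map Xi).prod * Z * (l.map X).prod

theorem adL_nil (X Xi : ι → M) (Z : M) : adL X Xi [] Z = Z := by simp [adL]

theorem adL_append (X Xi : ι → M) (l l' : List ι) (Z : M) :
    adL X Xi (l ++ l') Z = adL X Xi l' (adL X Xi l Z) := by
  simp [adL, mul_assoc]

theorem adL_singleton (X Xi : ι → M) (j : ι) (Z : M) : adL X Xi [j] Z = Xi j * Z * X j := by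
  simp [adL]

/-- The family `X`, with inverses `Xi`, satisfies exchange relations with the `R j k`. -/
structure Exch (R Ri : ι → ι → M) (X Xi : ι → M) : Prop where
  r_mul : ∀ j k, j ≠ k → R j k * Ri j k = 1
  mul_r : ∀ j k, j ≠ k → Ri j k * R j k = 1
  x_mul : ∀ k, X k * Xi k = 1
  mul_x : ∀ k, Xi k * X k = 1
  exch : ∀ j k, j ≠ k → R j k * X k * X j = X j * X k * R j k
  comm : ∀ j k m, j ≠ k → m ≠ j → m ≠ k → Commute (R j k) (X m)

variable {R Ri : ι → ι → M} {X Xi : ι → M}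

theorem Exch.prod (h : Exch R Ri X Xi) {l : List ι} {j : ι} (hl : l.Nodup) (hj : j ∉ l) :
    (l.map (R j)).prod * (l.map X).prod * X j = X j * (l.map X).prod * (l.map (R j)).prod :=
  exchange_list (R j) X (X j) hl
    (fun k hk m hm hkm => h.comm j k m (by rintro rfl; exact hj hk) (by rintro rfl; exact hj hm)
      hkm.symm)
    fun k hk => h.exch j k (by rintro rfl; exact hj hk)

theorem Exch.rprod_mul (h : Exch R Ri X Xi) {l : List ι} {j : ι} (hj : j ∉ l) :
    (l.map (R j)).prod * (l.reverse.map (Ri j)).prod = 1 :=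
  list_prod_mul_inv fun k hk => h.r_mul j k (by rintro rfl; exact hj hk)

theorem Exch.mul_rprod (h : Exch R Ri X Xi) {l : List ι} {j : ι} (hj : j ∉ l) :
    (l.reverse.map (Ri j)).prod * (l.map (R j)).prod = 1 :=
  list_inv_mul_prod fun k hk => h.mul_r j k (by rintro rfl; exact hj hk)

/-- Moving `X j` past the factors of `l₂` conjugates the whole ordered product by `ρ`, the product
of the `R j k` with `k ∈ l₂`; the factors of `l₁` commute with `ρ`. -/
theorem Exch.adL_move (h : Exch R Ri X Xi) {l₁ l₂ : List ι} {j : ι} (hl : (l₁ ++ j :: l₂).Nodup)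
    (Z : M) :
    adL X Xi (l₁ ++ j :: l₂) Z =
      (l₂.map (R j)).prod * adL X Xi (l₁ ++ l₂ ++ [j])
        ((l₂.reverse.map (Ri j)).prod * Z * (l₂.map (R j)).prod) *
        (l₂.reverse.map (Ri j)).prod := by
  have hd := List.nodup_append.1 hl
  have hj2 := (List.nodup_cons.1 hd.2.1)
  have hj1 : ∀ m ∈ l₁, m ≠ j := fun m hm => hd.2.2 m hm j (by simp)
  set ρ := (l₂.map (R j)).prod with hρ
  set ρ' := (l₂.reverse.map (Ri j)).prod with hρ'
  have e1 : ρ * ρ' = 1 := h.rprod_mul hj2.1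
  have e2 : ρ' * ρ = 1 := h.mul_rprod hj2.1
  have hx := h.prod hj2.2 hj2.1
  have hc : Commute ρ (l₁.map X).prod := commute_list_prod fun m hm => by
    refine (commute_list_prod fun k hk => ?_).symm
    exact (h.comm j k m (by rintro rfl; exact hj2.1 hk) (hj1 m hm)
      (hd.2.2 m hm k (by simp [hk]))).symm
  have key : ((l₁ ++ j :: l₂).map X).prod = ρ * ((l₁ ++ l₂ ++ [j]).map X).prod * ρ' := by
    simp only [List.map_append, List.map_cons, List.prod_append, List.prod_cons, List.map_nil,
      List.prod_nil, mul_one]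
    calc (l₁.map X).prod * (X j * (l₂.map X).prod)
        = (l₁.map X).prod * (X j * (l₂.map X).prod * (ρ * ρ')) := by rw [e1, mul_one]
      _ = (l₁.map X).prod * (X j * (l₂.map X).prod * ρ) * ρ' := by simp only [mul_assoc]
      _ = ((l₁.map X).prod * ρ) * (l₂.map X).prod * X j * ρ' := by
          rw [← hx, ← hρ]; simp only [mul_assoc]
      _ = _ := by rw [← hc.eq]; simp only [mul_assoc]
  -- The product of inverses transforms in the same way, by uniqueness of inverses.
  have key' : ((l₁ ++ j :: l₂).reverse.map Xi).prod =
      ρ * ((l₁ ++ l₂ ++ [j]).reverse.map Xi).prod * ρ' := by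
    have a1 : ((l₁ ++ j :: l₂).reverse.map Xi).prod * ((l₁ ++ j :: l₂).map X).prod = 1 :=
      list_inv_mul_prod fun k _ => h.mul_x k
    have a2 : ((l₁ ++ l₂ ++ [j]).map X).prod * ((l₁ ++ l₂ ++ [j]).reverse.map Xi).prod = 1 :=
      list_prod_mul_inv fun k _ => h.x_mul k
    refine left_inv_eq_right_inv a1 ?_
    rw [key]
    calc ρ * ((l₁ ++ l₂ ++ [j]).map X).prod * ρ' *
          (ρ * ((l₁ ++ l₂ ++ [j]).reverse.map Xi).prod * ρ')
        = ρ * ((l₁ ++ l₂ ++ [j]).map X).prod * (ρ' * ρ) *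
          (((l₁ ++ l₂ ++ [j]).reverse.map Xi).prod * ρ') := by simp only [mul_assoc]
      _ = ρ * (((l₁ ++ l₂ ++ [j]).map X).prod * ((l₁ ++ l₂ ++ [j]).reverse.map Xi).prod) * ρ' := by
          rw [e2, mul_one]; simp only [mul_assoc]
      _ = 1 := by rw [a2, mul_one, e1]
  rw [adL, key, key', adL]
  simp only [mul_assoc]

/-- With `T` the product over `l`, the exchange relation reads `T X_j = ρ⁻¹ X_j T ρ`. Conjugating
`ρ⁻¹ W ρ` by `T X_j` thus produces `X_j⁻¹ W X_j` in the middle, which is `W`, and the site `j`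
disappears. -/
theorem Exch.adL_reduce (h : Exch R Ri X Xi) {l : List ι} {j : ι} (hl : l.Nodup) (hj : j ∉ l)
    {W : M} (hW : Commute (X j) W) :
    adL X Xi (l ++ [j]) ((l.reverse.map (Ri j)).prod * W * (l.map (R j)).prod) =
      (l.reverse.map (Ri j)).prod * adL X Xi l W * (l.map (R j)).prod := by
  set ρ := (l.map (R j)).prod with hρ
  set ρ' := (l.reverse.map (Ri j)).prod with hρ'
  set T := (l.map X).prod with hT
  set T' := (l.reverse.map Xi).prod with hT'
  have e1 : ρ * ρ' = 1 := h.rprod_mul hj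
  have e2 : ρ' * ρ = 1 := h.mul_rprod hj
  have t1 : T * T' = 1 := list_prod_mul_inv fun k _ => h.x_mul k
  have t2 : T' * T = 1 := list_inv_mul_prod fun k _ => h.mul_x k
  have hx : ρ * T * X j = X j * T * ρ := h.prod hl hj
  have hx' : Xi j * T' * ρ' = ρ' * T' * Xi j := by
    have a1 : Xi j * T' * ρ' * (ρ * T * X j) = 1 := by
      calc Xi j * T' * ρ' * (ρ * T * X j) = Xi j * T' * (ρ' * ρ) * T * X j := by
            simp only [mul_assoc]
        _ = Xi j * (T' * T) * X j := by rw [e2, mul_one]; simp only [mul_assoc]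
        _ = 1 := by rw [t2, mul_one, h.mul_x]
    have a2 : (X j * T * ρ) * (ρ' * T' * Xi j) = 1 := by
      calc (X j * T * ρ) * (ρ' * T' * Xi j) = X j * T * (ρ * ρ') * T' * Xi j := by
            simp only [mul_assoc]
        _ = X j * (T * T') * Xi j := by rw [e1, mul_one]; simp only [mul_assoc]
        _ = 1 := by rw [t1, mul_one, h.x_mul]
    rw [← hx] at a2
    exact left_inv_eq_right_inv a1 a2
  have hW' : Xi j * W * X j = W := by rw [mul_assoc, ← hW.eq, ← mul_assoc, h.mul_x, one_mul]
  simp only [adL, List.reverse_append, List.map_append, List.prod_append, List.reverse_singleton,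
    List.map_singleton, List.prod_singleton, ← hT, ← hT', ← hρ, ← hρ']
  calc Xi j * T' * (ρ' * W * ρ) * (T * X j)
      = (Xi j * T' * ρ') * W * (ρ * T * X j) := by simp only [mul_assoc]
    _ = ρ' * T' * (Xi j * W * X j) * T * ρ := by rw [hx', hx]; simp only [mul_assoc]
    _ = _ := by rw [hW']; simp only [mul_assoc]

end ListMonoid

/-! ### The auxiliary site -/

section Aux

variable {ι S : Type*} [Fintype ι] [DecidableEq ι]

/-- The configuration `s` together with the value `b` at the auxiliary site. -/
def ocons (b : Fin 2) (s : ι → Fin 2) : Option ι → Fin 2 := fun o => o.elim b s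

theorem ocons_none (b : Fin 2) (s : ι → Fin 2) : ocons b s none = b := rfl
theorem ocons_some (b : Fin 2) (s : ι → Fin 2) (k : ι) : ocons b s (some k) = s k := rfl

/-- Configurations with an auxiliary site as pairs. -/
def oconsEquiv : Fin 2 × (ι → Fin 2) ≃ (Option ι → Fin 2) where
  toFun x := ocons x.1 x.2
  invFun s := (s none, fun k => s (some k))
  left_inv _ := rfl
  right_inv s := by funext o; cases o <;> rfl

theorem sum_ocons {V : Type*} [AddCommMonoid V] (F : (Option ι → Fin 2) → V) :
    ∑ r, F r = ∑ b, ∑ s, F (ocons b s) := by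
  rw [← Fintype.sum_prod_type']
  exact (Equiv.sum_comp oconsEquiv F).symm

/-- The entry `(b,c)` with respect to the auxiliary site. -/
def auxEntry (b c : Fin 2) (M : SiteMat (Option ι) S) : SiteMat ι S :=
  Matrix.of fun s t => M (ocons b s) (ocons c t)

theorem emb_some_apply [Zero S] (Z : SiteMat ι S) (b c : Fin 2) (s t : ι → Fin 2) :
    emb some Z (ocons b s) (ocons c t) = if b = c then Z s t else 0 := by
  rw [emb_apply]
  refine if_congr ⟨fun h => h none (by simp), fun h k hk => ?_⟩ rfl rfl
  cases k with
  | none => exact h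
  | some k => exact absurd rfl (hk k)

theorem auxEntry_emb_mul [NonUnitalNonAssocSemiring S] (b c : Fin 2) (Z : SiteMat ι S)
    (M : SiteMat (Option ι) S) : auxEntry b c (emb some Z * M) = Z * auxEntry b c M := by
  ext s t
  simp only [auxEntry, Matrix.of_apply, Matrix.mul_apply, sum_ocons, emb_some_apply, ite_mul,
    zero_mul]
  rw [Finset.sum_eq_single b] <;> simp +contextual [eq_comm]

theorem auxEntry_mul_emb [NonUnitalNonAssocSemiring S] (b c : Fin 2) (Z : SiteMat ι S)
    (M : SiteMat (Option ι) S) : auxEntry b c (M * emb some Z) = auxEntry b c M * Z := by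
  ext s t
  simp only [auxEntry, Matrix.of_apply, Matrix.mul_apply, sum_ocons, emb_some_apply, mul_ite,
    mul_zero]
  rw [Finset.sum_eq_single c] <;> simp +contextual [eq_comm]

/-- The mechanism behind the residues: exchanging the auxiliary site with `j` turns an auxiliary
entry into a matrix element at `j`, and the result is trivial at `j`. -/
theorem auxEntry_swap [Zero S] (j : ι) (b c : Fin 2) (Z : SiteMat ι S) :
    auxEntry b c (emb (Equiv.swap none (some j)) (emb some Z)) = pe j b c Z := by
  ext s t
  rw [auxEntry, Matrix.of_apply, emb_equiv_apply]
  have h : ∀ (b : Fin 2) (s : ι → Fin 2), ocons b s ∘ Equiv.swap none (some j) =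
      ocons (s j) (Function.update s j b) := by
    intro b s
    funext o
    cases o with
    | none => simp [ocons]
    | some k =>
      by_cases hk : k = j
      · subst hk; simp [ocons]
      · rw [Function.comp_apply, Equiv.swap_apply_of_ne_of_ne (by simp) (by simpa using hk)]
        simp [ocons, hk]
  rw [h, h, emb_some_apply, pe, Matrix.of_apply]

end Aux

/-! ### Vertex operators and the adjoint action of the fused monodromy matrix -/

section Vertex

variable {ι S : Type*} [Fintype ι] [DecidableEq ι] [Ring S] [Algebra ℂ S]

/-- Scalar operators as operators with coefficients in an algebra. -/
def castM : SiteMat ι ℂ →+* SiteMat ι S := (algebraMap ℂ S).mapMatrix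

theorem castM_apply (Z : SiteMat ι ℂ) (s t : ι → Fin 2) :
    castM (S := S) Z s t = algebraMap ℂ S (Z s t) := rfl

theorem castM_eq (Z : SiteMat ι ℂ) : castM (S := S) Z = Z.map (algebraMap ℂ S) := rfl

theorem castM_smul (c : ℂ) (Z : SiteMat ι ℂ) : castM (S := S) (c • Z) = c • castM Z := by
  ext s t
  rw [castM_apply, Matrix.smul_apply, Matrix.smul_apply, castM_apply, smul_eq_mul, map_mul,
    Algebra.smul_def]

/-- Extension by a trivial action on the auxiliary site. -/
def embO : SiteMat ι S →+* SiteMat (Option ι) S where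
  toFun := emb some
  map_one' := emb_one
  map_mul' := emb_mul (Option.some_injective _)
  map_zero' := emb_zero _
  map_add' := emb_add _

theorem embO_eq (Z : SiteMat ι S) : embO Z = emb some Z := rfl

theorem castM_emb {κ : Type*} [Fintype κ] [DecidableEq κ] (f : κ → ι) (Z : SiteMat κ ℂ) :
    castM (S := S) (emb f Z) = emb f (castM Z) := emb_map f Z (algebraMap ℂ S)

theorem commute_alg {m n : Type*} (r : Matrix m m ℂ) (Z : Matrix n n S) (s t s' t') :
    Commute (r.map (algebraMap ℂ S) s t) (Z s' t') := Algebra.commutes _ _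

/-- The `R`-matrix at the sites `j` and `k`. -/
def rr (q : ℂ) (ξ : ι → ℂ) (j k : ι) : SiteMat ι ℂ := site2 j k (Rp q (ξ j / ξ k))

/-- The inverse of the `R`-matrix at the sites `j` and `k`. -/
def rri (q : ℂ) (ξ : ι → ℂ) (j k : ι) : SiteMat ι ℂ :=
  ((q * (ξ j / ξ k) - q⁻¹ * (ξ j / ξ k)⁻¹) * (q * (ξ k / ξ j) - q⁻¹ * (ξ k / ξ j)⁻¹))⁻¹ •
    site2 j k (Rp q (ξ k / ξ j))

/-- `R(ξ_j/ξ_k)` is invertible. -/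
def RReg (q : ℂ) (ξ : ι → ℂ) (j k : ι) : Prop :=
  q * (ξ j / ξ k) - q⁻¹ * (ξ j / ξ k)⁻¹ ≠ 0 ∧ q * (ξ k / ξ j) - q⁻¹ * (ξ k / ξ j)⁻¹ ≠ 0

variable {q : ℂ} {ξ : ι → ℂ}

theorem rr_mul_rri (hq : q ≠ 0) (hξ : ∀ k, ξ k ≠ 0) {j k : ι} (h : j ≠ k) (hr : RReg q ξ j k) :
    rr q ξ j k * rri q ξ j k = 1 := by
  have e := Rp_mul_Rp_inv hq (div_ne_zero (hξ j) (hξ k))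
  rw [inv_div] at e
  rw [rr, rri, mul_smul_comm, ← site2_mul h, e, site2_smul, site2_one, smul_smul, inv_div, inv_div]
  have h1 := hr.1; have h2 := hr.2
  rw [inv_div] at h1 h2
  rw [inv_mul_cancel₀ (mul_ne_zero h1 h2), one_smul]

theorem rri_mul_rr (hq : q ≠ 0) (hξ : ∀ k, ξ k ≠ 0) {j k : ι} (h : j ≠ k) (hr : RReg q ξ j k) :
    rri q ξ j k * rr q ξ j k = 1 := by
  have e := Rp_mul_Rp_inv hq (div_ne_zero (hξ k) (hξ j))
  rw [inv_div] at e
  rw [rr, rri, smul_mul_assoc, ← site2_mul h, e, site2_smul, site2_one, smul_smul, inv_div, inv_div]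
  have h1 := hr.1; have h2 := hr.2
  rw [inv_div] at h1 h2
  rw [mul_comm (q * (ξ k / ξ j) - _), inv_mul_cancel₀ (mul_ne_zero h1 h2), one_smul]

/-- `L` is a family of Lax matrices at the sites, with inverses `N`. -/
structure LaxFam (q : ℂ) (ξ : ι → ℂ) (L N : ι → Matrix (Fin 2) (Fin 2) S) : Prop where
  mul : ∀ k, L k * N k = 1
  mul' : ∀ k, N k * L k = 1
  rll : ∀ j k, j ≠ k → (Rp q (ξ j / ξ k)).map (algebraMap ℂ S) * onSnd (L k) * onFst (L j) =
    onFst (L j) * onSnd (L k) * (Rp q (ξ j / ξ k)).map (algebraMap ℂ S)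

variable {L N : ι → Matrix (Fin 2) (Fin 2) S}

theorem castM_rr (j k : ι) :
    castM (S := S) (rr q ξ j k) = site2 j k ((Rp q (ξ j / ξ k)).map (algebraMap ℂ S)) :=
  site2_map j k _ (algebraMap ℂ S)

theorem rll_site2 {κ : Type*} [Fintype κ] [DecidableEq κ] (h : LaxFam q ξ L N) {j k : ι}
    (hjk : j ≠ k) {j' k' : κ} (hjk' : j' ≠ k') :
    site2 j' k' ((Rp q (ξ j / ξ k)).map (algebraMap ℂ S)) * site1 k' (L k) * site1 j' (L j) =
      site1 j' (L j) * site1 k' (L k) * site2 j' k' ((Rp q (ξ j / ξ k)).map (algebraMap ℂ S)) := by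
  have := congrArg (site2 j' k') (h.rll j k hjk)
  rwa [site2_mul hjk', site2_mul hjk', site2_mul hjk', site2_mul hjk', site2_onFst hjk',
    site2_onSnd hjk'] at this

/-- The spectral parameters with the auxiliary one added. -/
def oξ (ζ : ℂ) (ξ : ι → ℂ) : Option ι → ℂ := fun o => o.elim ζ ξ

/-- The product of the Lax matrix and the `R`-matrix at the site `k`. -/
def vtx (q ζ : ℂ) (ξ : ι → ℂ) (L : ι → Matrix (Fin 2) (Fin 2) S) (k : ι) :
    SiteMat (Option ι) S :=
  site1 (some k) (L k) * castM (rr q (oξ ζ ξ) none (some k))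

/-- The inverse of `vtx`. -/
def vtxi (q ζ : ℂ) (ξ : ι → ℂ) (N : ι → Matrix (Fin 2) (Fin 2) S) (k : ι) :
    SiteMat (Option ι) S :=
  castM (rri q (oξ ζ ξ) none (some k)) * site1 (some k) (N k)

theorem rr_some (ζ : ℂ) (j k : ι) : rr q (oξ ζ ξ) (some j) (some k) = emb some (rr q ξ j k) :=
  (emb_site2 (Option.some_injective _) j k _).symm

theorem embO_castM (Z : SiteMat ι ℂ) : embO (castM (S := S) Z) = castM (emb some Z) :=
  (castM_emb some Z).symm

theorem rr_ybe (hq : q ≠ 0) (hξ : ∀ k, ξ k ≠ 0) {a j k : ι} (haj : a ≠ j) (hak : a ≠ k)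
    (hjk : j ≠ k) :
    rr q ξ j k * rr q ξ a k * rr q ξ a j = rr q ξ a j * rr q ξ a k * rr q ξ j k := by
  have := ybe haj hak hjk hq (div_ne_zero (hξ j) (hξ k)) (div_ne_zero (hξ a) (hξ j))
  have e : ξ j / ξ k * (ξ a / ξ j) = ξ a / ξ k := by
    have := hξ j; have := hξ k; field_simp
  rwa [e] at this

theorem rr_commute {i j k l : ι} (h : i ≠ k) (h' : j ≠ k) (h'' : i ≠ l) (h''' : j ≠ l) :
    Commute (rr q ξ i j) (rr q ξ k l) :=
  site2_commute_site2 h h' h'' h''' _ _ fun _ _ _ _ => mul_comm _ _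

theorem castM_rr_commute_site1 {i j k : ι} (h : i ≠ k) (h' : j ≠ k)
    (m : Matrix (Fin 2) (Fin 2) S) : Commute (castM (rr q ξ i j)) (site1 k m) := by
  rw [castM_rr]
  exact site2_commute_site1 h h' _ _ (commute_alg _ _)

/-- A vertex is a Lax matrix times an R-matrix with the auxiliary site. The exchange relation
combines RLL for the first factor with Yang-Baxter for the second; the exchanging `R j k` acts on
quantum sites only, so it does not involve the auxiliary site. -/
theorem vtx_exch (hq : q ≠ 0) {ζ : ℂ} (hζ : ζ ≠ 0) (hξ : ∀ k, ξ k ≠ 0)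
    (hR : ∀ j k, j ≠ k → RReg q ξ j k) (hR' : ∀ k, RReg q (oξ ζ ξ) none (some k))
    (h : LaxFam q ξ L N) :
    Exch (fun j k => embO (castM (S := S) (rr q ξ j k))) (fun j k => embO (castM (rri q ξ j k)))
      (vtx q ζ ξ L) (vtxi q ζ ξ N) where
  r_mul j k hjk := by rw [← map_mul, ← map_mul, rr_mul_rri hq hξ hjk (hR j k hjk), map_one, map_one]
  mul_r j k hjk := by rw [← map_mul, ← map_mul, rri_mul_rr hq hξ hjk (hR j k hjk), map_one, map_one]
  x_mul k := by
    have hξ' : ∀ o, oξ ζ ξ o ≠ 0 := by rintro (_ | k); exacts [hζ, hξ k]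
    rw [vtx, vtxi, mul_assoc, ← mul_assoc (castM _) (castM _), ← map_mul,
      rr_mul_rri hq hξ' (by simp) (hR' k), map_one, one_mul, ← site1_mul, h.mul, site1_one]
  mul_x k := by
    have hξ' : ∀ o, oξ ζ ξ o ≠ 0 := by rintro (_ | k); exacts [hζ, hξ k]
    rw [vtx, vtxi, mul_assoc, ← mul_assoc (site1 _ _) (site1 _ _), ← site1_mul, h.mul', site1_one,
      one_mul, ← map_mul, rri_mul_rr hq hξ' (by simp) (hR' k), map_one]
  exch j k hjk := by
    have hξ' : ∀ o, oξ ζ ξ o ≠ 0 := by rintro (_ | k); exacts [hζ, hξ k]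
    have hjk' : some j ≠ some k := by simpa using hjk
    rw [embO_castM, ← rr_some ζ]
    have y := congrArg (castM (S := S)) (rr_ybe hq hξ' (a := none) (j := some j) (k := some k)
      (by simp) (by simp) hjk')
    simp only [map_mul] at y
    have e := rll_site2 h hjk hjk'
    rw [show Rp q (ξ j / ξ k) = Rp q (oξ ζ ξ (some j) / oξ ζ ξ (some k)) from rfl,
      ← castM_rr (ξ := oξ ζ ξ)] at e
    have c1 : Commute (castM (rr q (oξ ζ ξ) none (some k))) (site1 (some j) (L j)) :=
      castM_rr_commute_site1 (by simp) hjk'.symm _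
    have c2 : Commute (castM (rr q (oξ ζ ξ) none (some j))) (site1 (some k) (L k)) :=
      castM_rr_commute_site1 (by simp) hjk' _
    simp only [vtx]
    set R := castM (S := S) (rr q (oξ ζ ξ) (some j) (some k))
    set Rk := castM (S := S) (rr q (oξ ζ ξ) none (some k))
    set Rj := castM (S := S) (rr q (oξ ζ ξ) none (some j))
    set Lk := site1 (some k) (L k)
    set Lj := site1 (some j) (L j)
    calc R * (Lk * Rk) * (Lj * Rj) = R * Lk * (Rk * Lj) * Rj := by simp only [mul_assoc]
      _ = R * Lk * Lj * (Rk * Rj) := by rw [c1.eq]; simp only [mul_assoc]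
      _ = Lj * Lk * (R * Rk * Rj) := by rw [e]; simp only [mul_assoc]
      _ = Lj * (Lk * Rj) * Rk * R := by rw [y]; simp only [mul_assoc]
      _ = _ := by rw [← c2.eq]; simp only [mul_assoc]
  comm j k m hjk hj hk := by
    rw [embO_castM, ← rr_some ζ]
    refine Commute.mul_right (castM_rr_commute_site1 (by simpa using hj.symm)
      (by simpa using hk.symm) _) ?_
    have : Commute (rr q (oξ ζ ξ) (some j) (some k)) (rr q (oξ ζ ξ) none (some m)) :=
      rr_commute (by simp) (by simp) (by simpa using hj.symm) (by simpa using hk.symm)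
    exact this.map castM

/-- The entries with respect to the auxiliary site of the adjoint action of the fused monodromy
matrix over the list `l`. -/
def aOp (q ζ : ℂ) (ξ : ι → ℂ) (L N : ι → Matrix (Fin 2) (Fin 2) S) (l : List ι) (b c : Fin 2)
    (Z : SiteMat ι ℂ) : SiteMat ι S :=
  auxEntry b c (adL (vtx q ζ ξ L) (vtxi q ζ ξ N) l (embO (castM Z)))

/-- The product of the `R`-matrices at `j` and the elements of `l`. -/
def rL (q : ℂ) (ξ : ι → ℂ) (l : List ι) (j : ι) : SiteMat ι ℂ := (l.map (rr q ξ j)).prod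

/-- The inverse of `rL`. -/
def rLi (q : ℂ) (ξ : ι → ℂ) (l : List ι) (j : ι) : SiteMat ι ℂ :=
  (l.reverse.map (rri q ξ j)).prod

theorem map_rL {M : Type*} [Monoid M] (f : SiteMat ι ℂ →* M) (l : List ι) (j : ι) :
    f (rL q ξ l j) = (l.map fun k => f (rr q ξ j k)).prod := by
  rw [rL, map_list_prod, List.map_map]; rfl

theorem map_rLi {M : Type*} [Monoid M] (f : SiteMat ι ℂ →* M) (l : List ι) (j : ι) :
    f (rLi q ξ l j) = (l.reverse.map fun k => f (rri q ξ j k)).prod := by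
  rw [rLi, map_list_prod, List.map_map]; rfl

/-- The R-matrices of `Exch.adL_move` are trivial at the auxiliary site, so they can be pulled out
of the auxiliary entry. -/
theorem aOp_move (hq : q ≠ 0) {ζ : ℂ} (hζ : ζ ≠ 0) (hξ : ∀ k, ξ k ≠ 0)
    (hR : ∀ j k, j ≠ k → RReg q ξ j k) (hR' : ∀ k, RReg q (oξ ζ ξ) none (some k))
    (h : LaxFam q ξ L N) {l₁ l₂ : List ι} {j : ι} (hl : (l₁ ++ j :: l₂).Nodup) (b c : Fin 2)
    (Z : SiteMat ι ℂ) :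
    aOp q ζ ξ L N (l₁ ++ j :: l₂) b c Z =
      castM (rL q ξ l₂ j) * aOp q ζ ξ L N (l₁ ++ l₂ ++ [j]) b c (rLi q ξ l₂ j * Z * rL q ξ l₂ j) *
        castM (rLi q ξ l₂ j) := by
  have e := (vtx_exch hq hζ hξ hR hR' h).adL_move hl (embO (castM Z))
  have e1 := map_rL (q := q) (ξ := ξ) ((embO.comp (castM (S := S))).toMonoidHom) l₂ j
  have e2 := map_rLi (q := q) (ξ := ξ) ((embO.comp (castM (S := S))).toMonoidHom) l₂ j
  rw [aOp, e]
  change auxEntry b c (((l₂.map fun k => (embO.comp (castM (S := S))).toMonoidHom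
    (rr q ξ j k)).prod) * adL _ _ _ (((l₂.reverse.map fun k =>
      (embO.comp (castM (S := S))).toMonoidHom (rri q ξ j k)).prod) * _ *
      ((l₂.map fun k => (embO.comp (castM (S := S))).toMonoidHom (rr q ξ j k)).prod)) *
      ((l₂.reverse.map fun k => (embO.comp (castM (S := S))).toMonoidHom (rri q ξ j k)).prod)) = _
  rw [← e1, ← e2]
  change auxEntry b c (embO (castM _) * adL _ _ _ (embO (castM _) * _ * embO (castM _)) *
    embO (castM _)) = _
  rw [embO_eq (castM (rLi q ξ l₂ j)), embO_eq (castM (rL q ξ l₂ j)), auxEntry_mul_emb,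
    auxEntry_emb_mul, ← embO_eq, ← embO_eq, ← map_mul, ← map_mul, ← map_mul, ← map_mul]
  rfl

/-- Realises `W` on the remaining sites, so that `emb_commute` for disjoint sites applies. -/
theorem triv_eq_emb {j : ι} {W : SiteMat ι S} (hW : Triv j W) :
    ∃ W' : SiteMat {k // k ≠ j} S, W = emb Subtype.val W' := by
  refine ⟨Matrix.of fun s t => W (fun k => if h : k = j then 0 else s ⟨k, h⟩)
    (fun k => if h : k = j then 0 else t ⟨k, h⟩), ?_⟩
  have e : ∀ s : ι → Fin 2, (fun k => if h : k = j then 0 else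
      (s ∘ Subtype.val) (⟨k, h⟩ : {k // k ≠ j})) = Function.update s j 0 := by
    intro s; funext k
    by_cases h : k = j
    · subst h; simp
    · simp [h]
  rw [triv_iff] at hW
  ext s t
  rw [emb_apply, Matrix.of_apply, e, e]
  conv_lhs => rw [← hW, pe, Matrix.of_apply]
  refine if_congr ⟨fun h k hk => ?_, fun h => h j fun i => i.2⟩ ?_ rfl
  · by_cases hkj : k = j
    · rw [hkj, h]
    · exact absurd rfl (hk ⟨k, hkj⟩)
  · rfl

theorem vtx_commute_triv {j : ι} {W : SiteMat ι ℂ} (hW : Triv j W) (ζ : ℂ) :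
    Commute (vtx q ζ ξ L j) (embO (castM (S := S) W)) := by
  obtain ⟨W', rfl⟩ := triv_eq_emb hW
  rw [embO_castM, emb_emb (Option.some_injective _)]
  refine Commute.mul_left ?_ ?_
  · rw [castM_emb, site1]
    exact emb_commute (fun _ i h => i.2 (Option.some_injective _ h).symm) _ _
      fun _ _ _ _ => (Algebra.commutes _ _).symm
  · refine Commute.map ?_ castM
    rw [rr, site2]
    refine emb_commute (fun i k => ?_) _ _ fun _ _ _ _ => mul_comm _ _
    have := k.2
    fin_cases i
    · simp
    · simpa using this.symm

theorem aOp_reduce (hq : q ≠ 0) {ζ : ℂ} (hζ : ζ ≠ 0) (hξ : ∀ k, ξ k ≠ 0)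
    (hR : ∀ j k, j ≠ k → RReg q ξ j k) (hR' : ∀ k, RReg q (oξ ζ ξ) none (some k))
    (h : LaxFam q ξ L N) {l : List ι} {j : ι} (hl : l.Nodup) (hj : j ∉ l) (b c : Fin 2)
    {W : SiteMat ι ℂ} (hW : Triv j W) :
    aOp q ζ ξ L N (l ++ [j]) b c (rLi q ξ l j * W * rL q ξ l j) =
      castM (rLi q ξ l j) * aOp q ζ ξ L N l b c W * castM (rL q ξ l j) := by
  have e := (vtx_exch hq hζ hξ hR hR' h).adL_reduce hl hj
    (vtx_commute_triv (q := q) (ξ := ξ) (L := L) hW ζ)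
  have e1 := map_rL (q := q) (ξ := ξ) ((embO.comp (castM (S := S))).toMonoidHom) l j
  have e2 := map_rLi (q := q) (ξ := ξ) ((embO.comp (castM (S := S))).toMonoidHom) l j
  change embO (castM (rL q ξ l j)) = _ at e1
  change embO (castM (rLi q ξ l j)) = _ at e2
  change adL _ _ _ ((l.reverse.map fun k => (embO.comp (castM (S := S))).toMonoidHom
    (rri q ξ j k)).prod * _ * (l.map fun k => (embO.comp (castM (S := S))).toMonoidHom
      (rr q ξ j k)).prod) = (l.reverse.map fun k => (embO.comp (castM (S := S))).toMonoidHom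
    (rri q ξ j k)).prod * _ * (l.map fun k => (embO.comp (castM (S := S))).toMonoidHom
      (rr q ξ j k)).prod at e
  rw [← e1, ← e2] at e
  rw [aOp, map_mul, map_mul, map_mul, map_mul, e, embO_eq (castM (rLi q ξ l j)),
    embO_eq (castM (rL q ξ l j)), auxEntry_mul_emb, auxEntry_emb_mul]
  rfl

end Vertex

/-! ### Convergence with values in a vector space without topology -/

/-- `f` is along `l` a combination of fixed vectors with convergent coefficients, and `v` is the
corresponding limit. -/
inductive FT (l : Filter ℂ) {V : Type*} [AddCommGroup V] [Module ℂ V] : (ℂ → V) → V → Prop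
  | smul {c : ℂ → ℂ} {c₀ : ℂ} (h : Tendsto c l (𝓝 c₀)) (v : V) : FT l (fun z => c z • v) (c₀ • v)
  | add {f g : ℂ → V} {v w : V} (hf : FT l f v) (hg : FT l g w) :
      FT l (fun z => f z + g z) (v + w)
  | congr {f g : ℂ → V} {v : V} (hf : FT l f v) (h : f =ᶠ[l] g) : FT l g v

namespace FT

variable {l : Filter ℂ} {V W : Type*} [AddCommGroup V] [Module ℂ V] [AddCommGroup W] [Module ℂ W]

theorem const (v : V) : FT l (fun _ => v) v := by
  simpa using FT.smul (l := l) (c := fun _ => 1) tendsto_const_nhds v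

theorem map {f : ℂ → V} {v : V} (h : FT l f v) {φ : V → W} (hφ : IsLinearMap ℂ φ) :
    FT l (fun z => φ (f z)) (φ v) := by
  induction h with
  | smul h v =>
    simp only [hφ.map_smul]
    exact FT.smul h _
  | add hf hg ihf ihg =>
    simp only [hφ.map_add]
    exact ihf.add ihg
  | congr hf h ih => exact ih.congr (h.fun_comp φ)

theorem smul' {f : ℂ → V} {v : V} (h : FT l f v) {c : ℂ → ℂ} {c₀ : ℂ}
    (hc : Tendsto c l (𝓝 c₀)) : FT l (fun z => c z • f z) (c₀ • v) := by
  induction h with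
  | smul h v =>
    simp only [smul_smul]
    exact FT.smul (hc.mul h) v
  | add hf hg ihf ihg =>
    simp only [smul_add]
    exact ihf.add ihg
  | congr hf h ih => exact ih.congr (h.mono fun z hz => by simp only [hz])

/-- Once a functional with scalar values has been applied, formal convergence becomes convergence in
`ℂ`. -/
theorem tendsto {f : ℂ → ℂ} {v : ℂ} (h : FT l f v) : Tendsto f l (𝓝 v) := by
  induction h with
  | smul h v => exact h.smul_const v
  | add hf hg ihf ihg => exact ihf.add ihg
  | congr hf h ih => exact ih.congr' h

theorem mul {A : Type*} [Ring A] [Algebra ℂ A] {f g : ℂ → A} {v w : A} (hf : FT l f v)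
    (hg : FT l g w) : FT l (fun z => f z * g z) (v * w) := by
  induction hf with
  | smul h v =>
    simp only [smul_mul_assoc]
    refine FT.smul' (FT.map hg (φ := fun x => v * x) ⟨mul_add v, fun c x => ?_⟩) h
    exact mul_smul_comm c v x
  | add hf hg ihf ihg =>
    simp only [add_mul]
    exact ihf.add ihg
  | congr hf h ih => exact ih.congr (h.mono fun z hz => by simp only [hz])

theorem list_prod {A κ : Type*} [Ring A] [Algebra ℂ A] {m : List κ} {f : ℂ → κ → A} {v : κ → A}
    (h : ∀ k ∈ m, FT l (fun z => f z k) (v k)) :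
    FT l (fun z => (m.map (f z)).prod) (m.map v).prod := by
  induction m with
  | nil => simpa using FT.const (1 : A)
  | cons k m ih =>
    simp only [List.map_cons, List.prod_cons]
    exact (h k (by simp)).mul (ih fun a ha => h a (by simp [ha]))

end FT

/-! ### Residues of the adjoint action -/

section Residue

variable {ι S : Type*} [Fintype ι] [DecidableEq ι] [Ring S] [Algebra ℂ S]

/-- `Lz` is a Lax matrix with inverse `(1 - z²)⁻¹ Nz`, depending continuously on `z`. -/
structure IsLax (q : ℂ) (Lz Nz : ℂ → Matrix (Fin 2) (Fin 2) S) : Prop where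
  mul : ∀ z, Lz z * Nz z = (1 - z ^ 2) • (1 : Matrix (Fin 2) (Fin 2) S)
  mul' : ∀ z, Nz z * Lz z = (1 - z ^ 2) • (1 : Matrix (Fin 2) (Fin 2) S)
  rll : ∀ w z, w ≠ 0 → (Rp q w).map (algebraMap ℂ S) * onSnd (Lz (w * z)) * onFst (Lz z) =
    onFst (Lz z) * onSnd (Lz (w * z)) * (Rp q w).map (algebraMap ℂ S)
  ft : ∀ (l : Filter ℂ) (f : ℂ → ℂ) (z : ℂ), Tendsto f l (𝓝 z) → FT l (fun x => Lz (f x)) (Lz z)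
  ft' : ∀ (l : Filter ℂ) (f : ℂ → ℂ) (z : ℂ), Tendsto f l (𝓝 z) → FT l (fun x => Nz (f x)) (Nz z)

variable {q : ℂ} {ξ : ι → ℂ} {Lz Nz : ℂ → Matrix (Fin 2) (Fin 2) S}

/-- The Lax matrices at the sites. -/
def laxL (Lz : ℂ → Matrix (Fin 2) (Fin 2) S) (ξ : ι → ℂ) (ζ : ℂ) (k : ι) :
    Matrix (Fin 2) (Fin 2) S := Lz (ζ / ξ k)

/-- The inverse Lax matrices at the sites. -/
def laxN (Nz : ℂ → Matrix (Fin 2) (Fin 2) S) (ξ : ι → ℂ) (ζ : ℂ) (k : ι) :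
    Matrix (Fin 2) (Fin 2) S := (1 - (ζ / ξ k) ^ 2)⁻¹ • Nz (ζ / ξ k)

theorem IsLax.fam (h : IsLax q Lz Nz) (hξ : ∀ k, ξ k ≠ 0) {ζ : ℂ}
    (hζ : ∀ k, 1 - (ζ / ξ k) ^ 2 ≠ 0) : LaxFam q ξ (laxL Lz ξ ζ) (laxN Nz ξ ζ) where
  mul k := by rw [laxL, laxN, mul_smul_comm, h.mul, smul_smul, inv_mul_cancel₀ (hζ k), one_smul]
  mul' k := by rw [laxL, laxN, smul_mul_assoc, h.mul', smul_smul, inv_mul_cancel₀ (hζ k), one_smul]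
  rll j k _ := by
    have := h.rll (ξ j / ξ k) (ζ / ξ j) (div_ne_zero (hξ j) (hξ k))
    have e : ξ j / ξ k * (ζ / ξ j) = ζ / ξ k := by
      have := hξ j; have := hξ k; field_simp
    rwa [e] at this

theorem isLinear_site1 (j : ι) : IsLinearMap ℂ (site1 (S := S) j) :=
  ⟨site1_add j, fun c m => site1_smul j c m⟩

theorem isLinear_castM : IsLinearMap ℂ (castM (ι := ι) (S := S)) :=
  ⟨map_add _, castM_smul⟩

theorem isLinear_site2 (j k : ι) : IsLinearMap ℂ (site2 (S := S) j k) :=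
  ⟨site2_add j k, fun c m => site2_smul j k c m⟩

theorem isLinear_auxEntry (b c : Fin 2) : IsLinearMap ℂ (auxEntry (ι := ι) (S := S) b c) :=
  ⟨fun _ _ => rfl, fun _ _ => rfl⟩

theorem ft_Rp {l : Filter ℂ} {f : ℂ → ℂ} {w : ℂ} (hf : Tendsto f l (𝓝 w)) (hw : w ≠ 0) :
    FT l (fun x => Rp q (f x)) (Rp q w) := by
  have e : ∀ w, Rp q w = w • (Matrix.of fun x y : Fin 2 × Fin 2 => if x.1 = x.2 then
      (if y = x then q else 0) else if y = x then (1 : ℂ) else 0) + w⁻¹ •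
      (Matrix.of fun x y : Fin 2 × Fin 2 => if x.1 = x.2 then
      (if y = x then -q⁻¹ else 0) else if y = x then (-1 : ℂ) else 0) +
      Matrix.of fun x y : Fin 2 × Fin 2 => if x.1 = x.2 then 0 else if y = x then 0 else
        if y = (x.2, x.1) then q - q⁻¹ else 0 := by
    intro w
    ext x y
    simp only [Rp, Matrix.add_apply, Matrix.smul_apply, Matrix.of_apply, smul_eq_mul]
    split_ifs <;> ring
  rw [e w]
  refine FT.congr (((FT.smul hf _).add (FT.smul (hf.inv₀ hw) _)).add (FT.const _))
    (Eventually.of_forall fun x => (e (f x)).symm)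

theorem ft_rr {l : Filter ℂ} {f : ℂ → ℂ} {z : ℂ} (hf : Tendsto f l (𝓝 z)) (hz : z ≠ 0)
    (hξ : ∀ k, ξ k ≠ 0) (k : ι) :
    FT l (fun x => rr q (oξ (f x) ξ) none (some k)) (rr q (oξ z ξ) none (some k)) :=
  (ft_Rp (hf.div_const _) (div_ne_zero hz (hξ k))).map (isLinear_site2 none (some k))

theorem ft_rri {l : Filter ℂ} {f : ℂ → ℂ} {z : ℂ} (hf : Tendsto f l (𝓝 z)) (hz : z ≠ 0)
    (hξ : ∀ k, ξ k ≠ 0) {k : ι} (hr : RReg q (oξ z ξ) none (some k)) :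
    FT l (fun x => rri q (oξ (f x) ξ) none (some k)) (rri q (oξ z ξ) none (some k)) := by
  have h1 : Tendsto (fun x => f x / ξ k) l (𝓝 (z / ξ k)) := hf.div_const _
  have h2 : Tendsto (fun x => ξ k / f x) l (𝓝 (ξ k / z)) := tendsto_const_nhds.div hf hz
  refine ((ft_Rp h2 (div_ne_zero (hξ k) hz)).map (isLinear_site2 none (some k))).smul'
    (Tendsto.inv₀ (((h1.const_mul q).sub ((h1.inv₀ (div_ne_zero hz (hξ k))).const_mul q⁻¹)).mul
      ((h2.const_mul q).sub ((h2.inv₀ (div_ne_zero (hξ k) hz)).const_mul q⁻¹))) ?_)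
  exact mul_ne_zero hr.1 hr.2

theorem ft_vtx (h : IsLax q Lz Nz) {l : Filter ℂ} {f : ℂ → ℂ} {z : ℂ} (hf : Tendsto f l (𝓝 z))
    (hz : z ≠ 0) (hξ : ∀ k, ξ k ≠ 0) (k : ι) :
    FT l (fun x => vtx q (f x) ξ (laxL Lz ξ (f x)) k) (vtx q z ξ (laxL Lz ξ z) k) :=
  ((h.ft l _ _ (hf.div_const _)).map (isLinear_site1 (some k))).mul
    ((ft_rr hf hz hξ k).map isLinear_castM)

theorem ft_vtxi (h : IsLax q Lz Nz) {l : Filter ℂ} {f : ℂ → ℂ} {z : ℂ} (hf : Tendsto f l (𝓝 z))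
    (hz : z ≠ 0) (hξ : ∀ k, ξ k ≠ 0) {k : ι} (hr : RReg q (oξ z ξ) none (some k))
    (hk : 1 - (z / ξ k) ^ 2 ≠ 0) :
    FT l (fun x => vtxi q (f x) ξ (laxN Nz ξ (f x)) k) (vtxi q z ξ (laxN Nz ξ z) k) :=
  ((ft_rri hf hz hξ hr).map isLinear_castM).mul
    (((h.ft' l _ _ (hf.div_const _)).smul'
      ((((hf.div_const _).pow 2).const_sub 1).inv₀ hk)).map (isLinear_site1 (some k)))

/-- The function `1 - e^{2(μ-λ)}` has derivative `-2` at `λ`. This is the origin of the factors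
`-1/2` and `1/4` in the residues below. -/
theorem tendsto_residue_factor (lam : ℂ) :
    Tendsto (fun μ => (μ - lam) * (1 - (Complex.exp μ / Complex.exp lam) ^ 2)⁻¹) (𝓝[≠] lam)
      (𝓝 (-(1 / 2))) := by
  have hd : HasDerivAt (fun μ => 1 - (Complex.exp μ / Complex.exp lam) ^ 2) (-2) lam := by
    have := (((Complex.hasDerivAt_exp lam).div_const (Complex.exp lam)).pow 2).const_sub 1
    exact this.congr_deriv (by rw [div_self (Complex.exp_ne_zero lam)]; norm_num)
  have hs := (hasDerivAt_iff_tendsto_slope.1 hd).inv₀ (by norm_num)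
  have e : (-(1 / 2) : ℂ) = (-2)⁻¹ := by norm_num
  rw [e]
  refine hs.congr fun μ => ?_
  rw [slope_def_field, div_self (Complex.exp_ne_zero _)]
  simp [div_eq_mul_inv]

theorem rr_diag {z : ℂ} (hz : z ≠ 0) {j : ι} (hj : z = ξ j) :
    rr q (oξ z ξ) none (some j) = (q - q⁻¹) • site2 none (some j) Pm := by
  rw [rr, show oξ z ξ none / oξ z ξ (some j) = 1 from by
    change z / ξ j = 1; rw [← hj, div_self hz], Rp_one, site2_smul]

theorem rri_diag {z : ℂ} (hz : z ≠ 0) {j : ι} (hj : z = ξ j) (hq : q - q⁻¹ ≠ 0) :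
    rri q (oξ z ξ) none (some j) = (q - q⁻¹)⁻¹ • site2 none (some j) Pm := by
  rw [rri, show oξ z ξ none / oξ z ξ (some j) = 1 from by
    change z / ξ j = 1; rw [← hj, div_self hz], show oξ z ξ (some j) / oξ z ξ none = 1 from by
    change ξ j / z = 1; rw [← hj, div_self hz], Rp_one, site2_smul, smul_smul]
  congr 1
  simp only [inv_one, mul_one]
  rw [mul_inv, mul_assoc, inv_mul_cancel₀ hq, mul_one]

/-- Lax factors and R-factors attached to different sites commute, so the product of vertices splits
into a Lax product and an R-product. -/
theorem vtx_prod (ζ : ℂ) (L : ι → Matrix (Fin 2) (Fin 2) S) {l : List ι} (hl : l.Nodup) :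
    (l.map (vtx q ζ ξ L)).prod =
      embO ((l.map fun k => site1 k (L k)).prod) *
        castM ((l.map fun k => rr q (oξ ζ ξ) none (some k)).prod) := by
  rw [map_list_prod, map_list_prod, List.map_map, List.map_map]
  refine (list_prod_mul_of_commute hl fun k _ m _ hkm => ?_).trans ?_
  · exact (castM_rr_commute_site1 (by simp) (by simpa using hkm.symm) _).symm
  · congr 2
    refine List.map_congr_left fun k _ => ?_
    exact (emb_site1 (Option.some_injective _) k (L k)).symm

theorem castM_rri_commute_site1 {i j k : ι} (h : i ≠ k) (h' : j ≠ k)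
    (m : Matrix (Fin 2) (Fin 2) S) : Commute (castM (rri q ξ i j)) (site1 k m) := by
  rw [rri, castM_smul]
  refine Commute.smul_left ?_ _
  rw [castM_eq, site2_map]
  exact site2_commute_site1 h h' _ _ (commute_alg _ _)

theorem vtxi_prod (ζ : ℂ) (N : ι → Matrix (Fin 2) (Fin 2) S) {l : List ι} (hl : l.Nodup) :
    (l.map (vtxi q ζ ξ N)).prod =
      castM ((l.map fun k => rri q (oξ ζ ξ) none (some k)).prod) *
      embO ((l.map fun k => site1 k (N k)).prod) := by
  rw [map_list_prod, map_list_prod, List.map_map, List.map_map]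
  refine (list_prod_mul_of_commute hl fun k _ m _ hkm => ?_).trans ?_
  · exact castM_rri_commute_site1 (by simp) (by simpa using hkm) _
  · congr 2
    refine List.map_congr_left fun k _ => ?_
    exact (emb_site1 (Option.some_injective _) k (N k)).symm

theorem swap_rr {z : ℂ} {j k : ι} (hj : z = ξ j) (hk : k ≠ j) :
    emb (Equiv.swap none (some j)) (rr q (oξ z ξ) none (some k)) = emb some (rr q ξ j k) := by
  rw [rr, emb_site2 (Equiv.injective _), Equiv.swap_apply_left,
    Equiv.swap_apply_of_ne_of_ne (by simp) (by simpa using hk), rr,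
    emb_site2 (Option.some_injective _), ← hj]
  rfl

theorem swap_rri {z : ℂ} {j k : ι} (hj : z = ξ j) (hk : k ≠ j) :
    emb (Equiv.swap none (some j)) (rri q (oξ z ξ) none (some k)) = emb some (rri q ξ j k) := by
  rw [rri, emb_smul, emb_site2 (Equiv.injective _), Equiv.swap_apply_left,
    Equiv.swap_apply_of_ne_of_ne (by simp) (by simpa using hk), rri, emb_smul,
    emb_site2 (Option.some_injective _), ← hj]
  rfl

/-- The action of a permutation of the sites as a ring homomorphism. -/
def embE (π : ι ≃ ι) : SiteMat ι S →+* SiteMat ι S where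
  toFun := emb π
  map_one' := emb_one
  map_mul' := emb_mul π.injective
  map_zero' := emb_zero _
  map_add' := emb_add _

/-- At `z = ξ_j` the matrix `R_{a,j}` and its inverse are `q - q⁻¹` and its reciprocal times the
permutation `P`. The constants cancel, and conjugation by `P` turns `R_{a,k}` into `R_{j,k}` and the
auxiliary entry into `pe j`. -/
theorem auxEntry_residue {z : ℂ} (hz : z ≠ 0) {j : ι} (hj : z = ξ j) (hq : q - q⁻¹ ≠ 0)
    {l : List ι} (hl : l.Nodup) (hjl : j ∉ l) (L N : ι → Matrix (Fin 2) (Fin 2) S)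
    (m m' : Matrix (Fin 2) (Fin 2) S) (b c : Fin 2) (Z : SiteMat ι S) :
    auxEntry b c (castM (rri q (oξ z ξ) none (some j)) * site1 (some j) m *
      adL (vtx q z ξ L) (vtxi q z ξ N) l (embO Z) *
      (site1 (some j) m' * castM (rr q (oξ z ξ) none (some j)))) =
      castM (rLi q ξ l j) * pe j b c (site1 j m *
        adL (fun k => site1 k (L k)) (fun k => site1 k (N k)) l Z * site1 j m') *
        castM (rL q ξ l j) := by
  set P := castM (S := S) (site2 none (some j) Pm) with hP
  set A := castM (S := S) ((l.reverse.map fun k => rri q (oξ z ξ) none (some k)).prod) with hA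
  set B := castM (S := S) ((l.map fun k => rr q (oξ z ξ) none (some k)).prod) with hB
  have hs : ∀ m : Matrix (Fin 2) (Fin 2) S, site1 (some j) m = embO (site1 j m) := fun m =>
    (emb_site1 (Option.some_injective _) j m).symm
  have c1 : Commute (embO (site1 j m)) A := by
    rw [hA, map_list_prod, List.map_map]
    refine commute_list_prod fun k hk => ?_
    rw [← hs]
    exact (castM_rri_commute_site1 (by simp)
      (by rintro h; exact hjl (by simpa [← Option.some_injective _ h] using hk)) _).symm
  have c2 : Commute (embO (site1 j m')) B := by
    rw [hB, map_list_prod, List.map_map]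
    refine commute_list_prod fun k hk => ?_
    rw [← hs]
    exact (castM_rr_commute_site1 (by simp)
      (by rintro h; exact hjl (by simpa [← Option.some_injective _ h] using hk)) _).symm
  rw [rri_diag hz hj hq, rr_diag hz hj, castM_smul, castM_smul, ← hP, adL,
    vtx_prod z L hl, vtxi_prod z N (List.nodup_reverse.2 hl), ← hA, ← hB, hs, hs]
  set T := (l.map fun k => site1 k (L k)).prod
  set T' := (l.reverse.map fun k => site1 k (N k)).prod
  have e1 : (q - q⁻¹)⁻¹ • P * embO (site1 j m) * (A * embO T' * embO Z * (embO T * B)) *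
      (embO (site1 j m') * (q - q⁻¹) • P) =
      P * (A * embO (site1 j m * (T' * Z * T) * site1 j m') * B) * P := by
    simp only [smul_mul_assoc, mul_smul_comm, smul_smul, inv_mul_cancel₀ hq, one_smul,
      mul_inv_cancel₀ hq, map_mul]
    calc P * embO (site1 j m) * (A * embO T' * embO Z * (embO T * B)) * (embO (site1 j m') * P)
        = P * (embO (site1 j m) * A) * (embO T' * embO Z * embO T) * (B * embO (site1 j m')) * P
          := by simp only [mul_assoc]
      _ = _ := by rw [c1.eq, ← c2.eq]; simp only [mul_assoc]
  rw [e1, hP, castM_eq, Pm_conj]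
  change auxEntry b c (embE (Equiv.swap none (some j)) _) = _
  rw [map_mul, map_mul]
  have e2 : embE (Equiv.swap none (some j)) A = embO (castM (rLi q ξ l j)) := by
    change emb _ (castM _) = _
    rw [← castM_emb, embO_castM]
    congr 1
    change embE _ _ = embO _
    rw [rLi, map_list_prod, map_list_prod, List.map_map, List.map_map]
    congr 1
    refine List.map_congr_left fun k hk => ?_
    exact swap_rri hj (by rintro rfl; exact hjl (by simpa using hk))
  have e3 : embE (Equiv.swap none (some j)) B = embO (castM (rL q ξ l j)) := by
    change emb _ (castM _) = _
    rw [← castM_emb, embO_castM]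
    congr 1
    change embE _ _ = embO _
    rw [rL, map_list_prod, map_list_prod, List.map_map, List.map_map]
    congr 1
    refine List.map_congr_left fun k hk => ?_
    exact swap_rr hj (by rintro rfl; exact hjl (by simpa using hk))
  rw [e2, e3, embO_eq (castM (rLi q ξ l j)), embO_eq (castM (rL q ξ l j)), auxEntry_mul_emb,
    auxEntry_emb_mul]
  congr 2
  exact auxEntry_swap j b c _

theorem ft_adL (h : IsLax q Lz Nz) {F : Filter ℂ} {f : ℂ → ℂ} {z : ℂ} (hf : Tendsto f F (𝓝 z))
    (hz : z ≠ 0) (hξ : ∀ k, ξ k ≠ 0) {l : List ι} (hr : ∀ k ∈ l, RReg q (oξ z ξ) none (some k))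
    (hk : ∀ k ∈ l, 1 - (z / ξ k) ^ 2 ≠ 0) (Z : SiteMat (Option ι) S) :
    FT F (fun x => adL (vtx q (f x) ξ (laxL Lz ξ (f x))) (vtxi q (f x) ξ (laxN Nz ξ (f x))) l Z)
      (adL (vtx q z ξ (laxL Lz ξ z)) (vtxi q z ξ (laxN Nz ξ z)) l Z) :=
  ((FT.list_prod fun k hk' => ft_vtxi h hf hz hξ (hr k (by simpa using hk'))
    (hk k (by simpa using hk'))).mul (FT.const Z)).mul
    (FT.list_prod fun k _ => ft_vtx h hf hz hξ k)

/-- Only the inverse Lax matrix at `j` is singular at `λ_j`; it contributes `-1/2`, and all other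
factors converge to their values there. -/
theorem aOp_residue (h : IsLax q Lz Nz) (lam : ι → ℂ) (hq : q - q⁻¹ ≠ 0) {l : List ι}
    (hl : l.Nodup) {j : ι} (hj : j ∉ l)
    (hr : ∀ k ∈ l, RReg q (fun k => Complex.exp (lam k)) j k)
    (hk : ∀ k ∈ l, 1 - (Complex.exp (lam j) / Complex.exp (lam k)) ^ 2 ≠ 0) (b c : Fin 2)
    (Z : SiteMat ι ℂ) :
    FT (𝓝[≠] (lam j)) (fun μ => (μ - lam j) • aOp q (Complex.exp μ) (fun k => Complex.exp (lam k))
        (laxL Lz (fun k => Complex.exp (lam k)) (Complex.exp μ))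
        (laxN Nz (fun k => Complex.exp (lam k)) (Complex.exp μ)) (l ++ [j]) b c Z)
      ((-(1 / 2) : ℂ) • (castM (rLi q (fun k => Complex.exp (lam k)) l j) *
        pe j b c (site1 j (Nz 1) *
        adL (fun k => site1 k (laxL Lz (fun k => Complex.exp (lam k)) (Complex.exp (lam j)) k))
          (fun k => site1 k (laxN Nz (fun k => Complex.exp (lam k)) (Complex.exp (lam j)) k)) l
          (castM Z) * site1 j (Lz 1)) * castM (rL q (fun k => Complex.exp (lam k)) l j))) := by
  set ξ : ι → ℂ := fun k => Complex.exp (lam k) with hξd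
  have hξ : ∀ k, ξ k ≠ 0 := fun k => Complex.exp_ne_zero _
  have hf : Tendsto Complex.exp (𝓝[≠] (lam j)) (𝓝 (ξ j)) :=
    (Complex.continuous_exp.tendsto _).mono_left nhdsWithin_le_nhds
  have h1 := ft_adL h hf (hξ j) hξ (l := l) hr hk (embO (castM Z))
  have h2 := ft_vtx h hf (hξ j) hξ j
  have hrj : RReg q (oξ (ξ j) ξ) none (some j) := by
    simp only [RReg]
    rw [show oξ (ξ j) ξ none / oξ (ξ j) ξ (some j) = 1 from div_self (hξ j),
      show oξ (ξ j) ξ (some j) / oξ (ξ j) ξ none = 1 from div_self (hξ j)]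
    simpa using hq
  have h3 := ((ft_rri hf (hξ j) hξ hrj).map (isLinear_castM (S := S))).mul
    (((h.ft' _ _ _ (hf.div_const (ξ j))).smul'
      (tendsto_residue_factor (lam j))).map (isLinear_site1 (some j)))
  have h4 := FT.map (V := SiteMat (Option ι) S) (W := SiteMat ι S) ((h3.mul h1).mul h2)
    (isLinear_auxEntry b c)
  rw [show (ξ j / ξ j) = 1 from div_self (hξ j)] at h4
  rw [← auxEntry_residue (hξ j) rfl hq hl hj]
  convert h4.congr (Eventually.of_forall fun μ => ?_) using 1
  · rw [← (isLinear_auxEntry b c).map_smul]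
    congr 1
    rw [site1_smul]
    simp only [mul_smul_comm, smul_mul_assoc]
    rw [vtx, laxL, div_self (hξ j)]
  · rw [aOp, adL_append, adL_singleton, ← (isLinear_auxEntry b c).map_smul]
    simp only [vtxi, laxN, site1_smul, mul_smul_comm, smul_mul_assoc, smul_smul, mul_assoc]
    rfl

end Residue

/-! ### The fused monodromy matrix in terms of vertex operators -/

section Lax

variable {S : Type*} [Ring S] [Algebra ℂ S] {q : ℂ} {u v x a : S}

theorem ft_Lh {l : Filter ℂ} {f : ℂ → ℂ} {z : ℂ} (hf : Tendsto f l (𝓝 z)) :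
    FT l (fun y => Lh q (f y) u v x a) (Lh q z u v x a) := by
  have e : ∀ z, Lh q z u v x a = !![u, 0; 0, v] + z • !![0, -(x * v); -(a * u), 0] +
      z ^ 2 • !![0, 0; 0, -(q ^ 2 • u)] := by
    intro z
    ext i j
    fin_cases i <;> fin_cases j <;> simp [Lh, smul_smul, sub_eq_add_neg]
  rw [e z]
  exact (((FT.const _).add (FT.smul hf _)).add (FT.smul (hf.pow 2) _)).congr
    (Eventually.of_forall fun y => (e (f y)).symm)

theorem ft_Nh {l : Filter ℂ} {f : ℂ → ℂ} {z : ℂ} (hf : Tendsto f l (𝓝 z)) :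
    FT l (fun y => Nh (f y) u v x a) (Nh z u v x a) := by
  have e : ∀ z, Nh z u v x a = !![v, 0; 0, u] + z • !![0, v * x; u * a, 0] +
      z ^ 2 • !![-u, 0; 0, 0] := by
    intro z
    ext i j
    fin_cases i <;> fin_cases j <;> simp [Nh, smul_smul, sub_eq_add_neg]
  rw [e z]
  exact (((FT.const _).add (FT.smul hf _)).add (FT.smul (hf.pow 2) _)).congr
    (Eventually.of_forall fun y => (e (f y)).symm)

theorem isLax (h : IsOsc q u v x a) (hq : q ≠ 0) :
    IsLax q (fun z => Lh q z u v x a) (fun z => Nh z u v x a) where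
  mul := Lh_mul_Nh h hq
  mul' := Nh_mul_Lh h hq
  rll _ z hw := RLL h hq hw z
  ft _ _ _ hf := ft_Lh hf
  ft' _ _ _ hf := ft_Nh hf

/-- Conjugation by `σˣ ⊗ σˣ`. -/
def flip4 (r : Matrix (Fin 2 × Fin 2) (Fin 2 × Fin 2) S) :
    Matrix (Fin 2 × Fin 2) (Fin 2 × Fin 2) S :=
  r.submatrix (Prod.map (Equiv.swap 0 1) (Equiv.swap 0 1))
    (Prod.map (Equiv.swap 0 1) (Equiv.swap 0 1))

theorem flip4_mul (r r' : Matrix (Fin 2 × Fin 2) (Fin 2 × Fin 2) S) :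
    flip4 (r * r') = flip4 r * flip4 r' :=
  (Matrix.submatrix_mul_equiv r r' _ (Equiv.prodCongr (Equiv.swap 0 1) (Equiv.swap 0 1)) _).symm

theorem flip2_eq (m : Matrix (Fin 2) (Fin 2) S) :
    flip2 m = m.submatrix (Equiv.swap 0 1) (Equiv.swap 0 1) := by
  ext i j
  fin_cases i <;> fin_cases j <;> simp [flip2]

theorem flip4_onFst (m : Matrix (Fin 2) (Fin 2) S) : flip4 (onFst m) = onFst (flip2 m) := by
  ext ⟨i, i'⟩ ⟨j, j'⟩
  simp [flip4, onFst, flip2_eq]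

theorem flip4_onSnd (m : Matrix (Fin 2) (Fin 2) S) : flip4 (onSnd m) = onSnd (flip2 m) := by
  ext ⟨i, i'⟩ ⟨j, j'⟩
  simp [flip4, onSnd, flip2_eq]

theorem flip4_Rp (q w : ℂ) :
    flip4 ((Rp q w).map (algebraMap ℂ S)) = (Rp q w).map (algebraMap ℂ S) := by
  ext ⟨i, i'⟩ ⟨j, j'⟩
  simp [flip4, Rp, Matrix.map_apply]

theorem isLinear_flip2 : IsLinearMap ℂ (flip2 (S := S)) :=
  ⟨fun m m' => by simp only [flip2_eq]; rfl, fun c m => flip2_smul c m⟩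

/-- The R-matrix is invariant under `σˣ ⊗ σˣ`, so the relations for `L⁺` pass to `L⁻`. -/
theorem IsLax.flip {Lz Nz : ℂ → Matrix (Fin 2) (Fin 2) S} (h : IsLax q Lz Nz) :
    IsLax q (fun z => flip2 (Lz z)) (fun z => flip2 (Nz z)) where
  mul z := by rw [← flip2_mul, h.mul, flip2_smul, flip2_one]
  mul' z := by rw [← flip2_mul, h.mul', flip2_smul, flip2_one]
  rll w z hw := by
    have := congrArg flip4 (h.rll w z hw)
    simpa only [flip4_mul, flip4_onFst, flip4_onSnd, flip4_Rp] using this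
  ft l f z hf := (h.ft l f z hf).map isLinear_flip2
  ft' l f z hf := (h.ft' l f z hf).map isLinear_flip2

end Lax

/-- `L⁺` without prefactor. -/
def Lp (η z : ℂ) : Matrix (Fin 2) (Fin 2) OscEnd :=
  Lh (Complex.exp η) z (qD η 1) (qD η (-1)) oscAstar (oscA η)

/-- The numerator of the inverse of `L⁺`. -/
def Np (η z : ℂ) : Matrix (Fin 2) (Fin 2) OscEnd :=
  Nh z (qD η 1) (qD η (-1)) oscAstar (oscA η)

theorem isLax_Lp (η : ℂ) : IsLax (Complex.exp η) (Lp η) (Np η) :=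
  isLax (isOsc η) (Complex.exp_ne_zero η)

theorem isLax_Lm (η : ℂ) :
    IsLax (Complex.exp η) (fun z => flip2 (Lp η z)) (fun z => flip2 (Np η z)) :=
  (isLax_Lp η).flip

/-- The scalar prefactor of `L⁺`. -/
def lpre (η μ : ℂ) : ℂ := Complex.I * Complex.exp (-(μ / 2)) * Complex.exp (-(η / 4))

theorem lpre_ne (η μ : ℂ) : lpre η μ ≠ 0 :=
  mul_ne_zero (mul_ne_zero Complex.I_ne_zero (Complex.exp_ne_zero _)) (Complex.exp_ne_zero _)

theorem osc_neg_mul (y z : OscEnd) : -y * z = -(y * z) := by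
  exact LinearMap.neg_comp z y

theorem Lplus_eq (η μ : ℂ) : Lplus η μ = lpre η μ • Lp η (Complex.exp μ) := by
  rw [Lplus, Lp, lpre]
  congr 1
  ext i j : 1
  have e : Complex.exp (2 * μ + 2 * η) = Complex.exp μ ^ 2 * Complex.exp η ^ 2 := by
    rw [Complex.exp_add, ← Complex.exp_nat_mul, ← Complex.exp_nat_mul]; norm_num
  fin_cases i <;> fin_cases j <;> simp [Lh, Matrix.mul_apply, Fin.sum_univ_two]
  · exact (osc_neg_mul _ _).trans (congrArg (fun z : OscEnd => -z)
      (smul_mul_assoc (Complex.exp μ) oscAstar (qD η (-1))))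
  · exact (osc_neg_mul _ _).trans (congrArg (fun z : OscEnd => -z)
      (smul_mul_assoc (Complex.exp μ) (oscA η) (qD η 1)))
  rw [osc_one_sub_mul, smul_mul_assoc, qD_mul, e]
  norm_num

theorem Lminus_eq (η μ : ℂ) : Lminus η μ = lpre η μ • flip2 (Lp η (Complex.exp μ)) := by
  rw [Lminus, Lplus_eq, Matrix.mul_smul, Matrix.smul_mul]
  congr 1
  ext i j : 1
  fin_cases i <;> fin_cases j <;> simp [flip2, Matrix.mul_apply, Matrix.vecMul, dotProduct, Fin.sum_univ_two]

/-! ### The fused monodromy matrices expressed by vertices. -/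

section Link

variable {n : ℕ}

theorem siteOp_eq (j : Fin n) (m : Matrix (Fin 2) (Fin 2) OscEnd) : siteOp j m = site1 j m := by
  refine Matrix.ext fun s t => ?_
  rw [site1_apply]
  simp only [siteOp, Matrix.of_apply]
  split_ifs <;> rfl

/-- Operators on `V_a ⊗ V` as operators with an auxiliary site. -/
def toO {S : Type*} [Ring S] [Algebra ℂ S] :
    Matrix (Fin 2 × Cfg n) (Fin 2 × Cfg n) S ≃ₐ[ℂ] SiteMat (Option (Fin n)) S :=
  Matrix.reindexAlgEquiv ℂ S oconsEquiv

theorem toO_apply {S : Type*} [Ring S] [Algebra ℂ S] (M : Matrix (Fin 2 × Cfg n) (Fin 2 × Cfg n) S)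
    (s t : Option (Fin n) → Fin 2) :
    toO M s t = M (s none, fun k => s (some k)) (t none, fun k => t (some k)) := rfl

theorem toO_aux (j : Fin n) (r : Matrix (Fin 2 × Fin 2) (Fin 2 × Fin 2) ℂ) :
    toO (auxSiteOp j r) = site2 none (some j) r := by
  ext s t
  rw [toO_apply, site2_apply, auxSiteOp, Matrix.of_apply]
  refine if_congr ⟨fun h l hl hl' => ?_, fun h k hk => h (some k) (by simp) (by simpa using hk)⟩
    rfl rfl
  cases l with
  | none => exact absurd rfl hl
  | some k => exact h k (by simpa using hl')

open scoped Kronecker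

theorem toO_fst {S : Type*} [Ring S] [Algebra ℂ S] (m : Matrix (Fin 2) (Fin 2) S) :
    toO (m ⊗ₖ (1 : Matrix (Cfg n) (Cfg n) S)) = site1 none m := by
  ext s t
  rw [toO_apply, site1_apply, Matrix.kroneckerMap_apply, Matrix.one_apply, mul_ite, mul_one,
    mul_zero]
  refine if_congr ⟨fun h l hl => ?_, fun h => funext fun k => h (some k) (by simp)⟩ rfl rfl
  cases l with
  | none => exact absurd rfl hl
  | some k => exact congrFun h k

theorem toO_snd {S : Type*} [Ring S] [Algebra ℂ S] (Z : SiteMat (Fin n) S) :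
    toO ((1 : Matrix (Fin 2) (Fin 2) S) ⊗ₖ Z) = embO Z := by
  ext s t
  have e : ∀ s : Option (Fin n) → Fin 2, s = ocons (s none) (fun k => s (some k)) := by
    intro s; funext o; cases o <;> rfl
  rw [toO_apply, Matrix.kroneckerMap_apply, Matrix.one_apply, ite_mul, one_mul, zero_mul]
  conv_rhs => rw [e s, e t, embO_eq, emb_some_apply]

theorem toO_map {S : Type*} [Ring S] [Algebra ℂ S] (M : Matrix (Fin 2 × Cfg n) (Fin 2 × Cfg n) ℂ) :
    toO (M.map (algebraMap ℂ S)) = castM (toO M) := rfl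

theorem monA_eq (L : ℂ → Matrix (Fin 2) (Fin 2) OscEnd) (lam : Fin n → ℂ) (μ : ℂ) :
    monA L lam μ = ((List.finRange n).reverse.map fun k => site1 k (L (μ - lam k))).prod := by
  rw [monA, List.ofFn_eq_map, ← List.map_reverse]
  simp only [siteOp_eq]

theorem list_smul_prod {A κ : Type*} [Ring A] [Algebra ℂ A] (l : List κ) (c : κ → ℂ) (X : κ → A) :
    (l.map fun k => c k • X k).prod = (l.map c).prod • (l.map X).prod := by
  induction l with
  | nil => simp
  | cons k l ih =>
    simp only [List.map_cons, List.prod_cons, ih, smul_mul_smul_comm]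

variable {η μ : ℂ} {lam : Fin n → ℂ}

theorem monR_eq (hμ : ∀ k, 1 - Complex.exp η ^ 2 * Complex.exp (μ - lam k) ^ 2 ≠ 0) :
    toO (monR η lam μ) = ((List.finRange n).reverse.map fun k =>
      rr (Complex.exp η) (oξ (Complex.exp μ) fun k => Complex.exp (lam k)) none (some k)).prod := by
  rw [monR, List.ofFn_eq_map, ← List.map_reverse, map_list_prod, List.map_map]
  congr 1
  refine List.map_congr_left fun k _ => ?_
  rw [Function.comp_apply, toO_aux, Rmat_eq (hμ k), Complex.exp_sub]
  rfl

/-- The spectral parameter `μ` is regular. -/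
structure SpecReg {ι : Type*} (η : ℂ) (lam : ι → ℂ) (μ : ℂ) : Prop where
  rreg : ∀ k, RReg (Complex.exp η) (oξ (Complex.exp μ) fun k => Complex.exp (lam k)) none (some k)
  lreg : ∀ k, 1 - (Complex.exp μ / Complex.exp (lam k)) ^ 2 ≠ 0

theorem SpecReg.rmat (h : SpecReg η lam μ) (k : Fin n) :
    1 - Complex.exp η ^ 2 * Complex.exp (μ - lam k) ^ 2 ≠ 0 := by
  intro h0
  refine (h.rreg k).1 ?_
  change Complex.exp η * (Complex.exp μ / Complex.exp (lam k)) -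
    (Complex.exp η)⁻¹ * (Complex.exp μ / Complex.exp (lam k))⁻¹ = 0
  rw [← Complex.exp_sub]
  have h1 := Complex.exp_ne_zero η
  have h2 := Complex.exp_ne_zero (μ - lam k)
  field_simp
  linear_combination -h0

theorem ring_inverse_eq {A : Type*} [MonoidWithZero A] {x y : A} (h : x * y = 1) (h' : y * x = 1) :
    Ring.inverse x = y := by
  have := Ring.inverse_unit (⟨x, y, h, h'⟩ : Aˣ)
  exact this

theorem conj_inv {A : Type*} [Ring A] [Algebra ℂ A] {g g' t t' : A} {c : ℂ} (h : g * g' = 1)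
    (h' : g' * g = 1) (ht : t * t' = 1) (ht' : t' * t = 1) (hc : c ≠ 0) :
    (c • (g' * t * g)) * (c⁻¹ • (g' * t' * g)) = 1 ∧
      (c⁻¹ • (g' * t' * g)) * (c • (g' * t * g)) = 1 := by
  have e : ∀ x y : A, g' * x * g * (g' * y * g) = g' * (x * y) * g := fun x y => by
    calc g' * x * g * (g' * y * g) = g' * x * (g * g') * y * g := by simp only [mul_assoc]
      _ = _ := by rw [h, mul_one]; simp only [mul_assoc]
  rw [smul_mul_smul_comm, smul_mul_smul_comm, e, e, ht, ht', mul_one, h', mul_inv_cancel₀ hc,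
    inv_mul_cancel₀ hc, one_smul]
  exact ⟨rfl, rfl⟩

theorem conj_conj {A : Type*} [Ring A] [Algebra ℂ A] {g g' t t' x : A} {c : ℂ} (h : g * g' = 1)
    (hx : Commute x g') (hc : c ≠ 0) :
    (c⁻¹ • (g' * t' * g)) * x * (c • (g' * t * g)) = g' * (t' * x * t) * g := by
  rw [smul_mul_assoc, smul_mul_smul_comm, inv_mul_cancel₀ hc, one_smul]
  calc g' * t' * g * x * (g' * t * g) = g' * t' * g * (x * g') * t * g := by simp only [mul_assoc]
    _ = g' * t' * (g * g') * x * t * g := by rw [hx.eq]; simp only [mul_assoc]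
    _ = _ := by rw [h, mul_one]; simp only [mul_assoc]

/-- The scalar prefactors of the Lax operators cancel in the adjoint action. The gauge matrix `G`
sits at the auxiliary site and its inverse commutes with `X`, so `G` only conjugates the final
result. -/
theorem fused_conj {ι S : Type*} [Fintype ι] [DecidableEq ι] [Ring S] [Algebra ℂ S] {q ζ : ℂ}
    {ξ : ι → ℂ} (hq : q ≠ 0) (hζ : ζ ≠ 0) (hξ : ∀ k, ξ k ≠ 0)
    (hR' : ∀ k, RReg q (oξ ζ ξ) none (some k)) {L N : ι → Matrix (Fin 2) (Fin 2) S}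
    (hL : LaxFam q ξ L N) {G Gi : Matrix (Fin 2) (Fin 2) S} (hG : G * Gi = 1) (hG' : Gi * G = 1)
    {c : ι → ℂ} (hc : ∀ k, c k ≠ 0) {l : List ι} (hl : l.Nodup) (X : SiteMat ι ℂ)
    {F : SiteMat (Option ι) S} (hF : F = site1 none Gi *
      embO ((l.map fun k => c k • site1 k (L k)).prod) *
      castM ((l.map fun k => rr q (oξ ζ ξ) none (some k)).prod) * site1 none G) :
    ∃ Fi, F * Fi = 1 ∧ Fi * F = 1 ∧ Fi * embO (castM X) * F =
      site1 none Gi * adL (vtx q ζ ξ L) (vtxi q ζ ξ N) l (embO (castM X)) * site1 none G := by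
  have hξ' : ∀ o, oξ ζ ξ o ≠ 0 := by rintro (_ | k); exacts [hζ, hξ k]
  have hx : ∀ k, vtx q ζ ξ L k * vtxi q ζ ξ N k = 1 := by
    intro k
    rw [vtx, vtxi, mul_assoc, ← mul_assoc (castM _) (castM _), ← map_mul,
      rr_mul_rri hq hξ' (by simp) (hR' k), map_one, one_mul, ← site1_mul, hL.mul, site1_one]
  have hx' : ∀ k, vtxi q ζ ξ N k * vtx q ζ ξ L k = 1 := by
    intro k
    rw [vtx, vtxi, mul_assoc, ← mul_assoc (site1 _ _) (site1 _ _), ← site1_mul, hL.mul',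
      site1_one, one_mul, ← map_mul, rri_mul_rr hq hξ' (by simp) (hR' k), map_one]
  have hTT : (l.map (vtx q ζ ξ L)).prod * (l.reverse.map (vtxi q ζ ξ N)).prod = 1 :=
    list_prod_mul_inv fun k _ => hx k
  have hTT' : (l.reverse.map (vtxi q ζ ξ N)).prod * (l.map (vtx q ζ ξ L)).prod = 1 :=
    list_inv_mul_prod fun k _ => hx' k
  have hc' : (l.map c).prod ≠ 0 := List.prod_ne_zero (by simp [hc])
  have hF' : F = (l.map c).prod • (site1 none Gi * (l.map (vtx q ζ ξ L)).prod * site1 none G) := by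
    rw [hF, list_smul_prod, vtx_prod _ _ hl,
      show embO ((l.map c).prod • (l.map fun k => site1 k (L k)).prod) =
        (l.map c).prod • embO ((l.map fun k => site1 k (L k)).prod) from emb_smul some _ _]
    simp only [mul_smul_comm, smul_mul_assoc, mul_assoc]
  have hs : site1 (none : Option ι) G * site1 none Gi = 1 := by rw [← site1_mul, hG, site1_one]
  have hs' : site1 (none : Option ι) Gi * site1 none G = 1 := by rw [← site1_mul, hG', site1_one]
  have hcomm : Commute (embO (castM (S := S) X)) (site1 none Gi) := by
    rw [embO_castM, castM_emb, site1]
    exact emb_commute (fun i _ => by simp) _ _ (commute_alg _ _)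
  obtain ⟨g1, g2⟩ := conj_inv hs hs' hTT hTT' hc'
  rw [hF']
  exact ⟨_, g1, g2, conj_conj hs hcomm hc'⟩

theorem update_ocons_none {ι : Type*} [DecidableEq ι] (b b' : Fin 2) (s : ι → Fin 2) :
    Function.update (ocons b s) none b' = ocons b' s := by
  funext o
  cases o <;> simp [ocons]

theorem site1_none_conj {ι S : Type*} [Fintype ι] [DecidableEq ι] [Ring S] [Algebra ℂ S]
    (g g' : Matrix (Fin 2) (Fin 2) S) (Z : SiteMat (Option ι) S) (b c : Fin 2)
    (s t : ι → Fin 2) :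
    (site1 none g * Z * site1 none g' : SiteMat (Option ι) S) (ocons b s) (ocons c t) =
      ∑ c', (∑ b', g b b' * auxEntry b' c' Z s t) * g' c' c := by
  simp only [mul_site1_apply, site1_mul_apply, ocons_none, update_ocons_none]
  rfl

theorem entry_of_conj {ι S : Type*} [Fintype ι] [DecidableEq ι] [Ring S] [Algebra ℂ S]
    {g g' : Matrix (Fin 2) (Fin 2) S} {F Z : SiteMat (Option ι) S}
    (e : F = site1 none g * Z * site1 none g') (b c : Fin 2) (s t : ι → Fin 2) :
    F (ocons b s) (ocons c t) =
      ∑ c', (∑ b', g b b' * auxEntry b' c' Z s t) * g' c' c := by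
  rw [e]
  exact site1_none_conj g g' Z b c s t

theorem fusedAdj_entry {G Gi : Matrix (Fin 2) (Fin 2) OscEnd} (hG : G * Gi = 1) (hG' : Gi * G = 1)
    {Lz Nz : ℂ → Matrix (Fin 2) (Fin 2) OscEnd} (hL : IsLax (Complex.exp η) Lz Nz)
    {L : ℂ → Matrix (Fin 2) (Fin 2) OscEnd} (hL' : ∀ ν, L ν = lpre η ν • Lz (Complex.exp ν))
    (hμ : SpecReg η lam μ) (X : SpinOp n) (b c : Fin 2) (s t : Cfg n) :
    toO (fusedAdj G L η lam μ X) (ocons b s) (ocons c t) = ∑ c', (∑ b', Gi b b' *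
      aOp (Complex.exp η) (Complex.exp μ) (fun k => Complex.exp (lam k))
        (laxL Lz (fun k => Complex.exp (lam k)) (Complex.exp μ))
        (laxN Nz (fun k => Complex.exp (lam k)) (Complex.exp μ))
        (List.finRange n).reverse b' c' X s t) * G c' c := by
  have hF : toO (fused G L η lam μ) = site1 none Gi * embO (((List.finRange n).reverse.map fun k =>
      lpre η (μ - lam k) •
        site1 k (laxL Lz (fun k => Complex.exp (lam k)) (Complex.exp μ) k)).prod) *
      castM (((List.finRange n).reverse.map fun k => rr (Complex.exp η)
        (oξ (Complex.exp μ) fun k => Complex.exp (lam k)) none (some k)).prod) *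
      site1 none G := by
    rw [fused, ring_inverse_eq hG hG', map_mul, map_mul, map_mul, toO_fst, toO_fst, toO_snd,
      toO_map, monR_eq hμ.rmat, monA_eq]
    simp only [hL', site1_smul, laxL, Complex.exp_sub]
  obtain ⟨Fi, h1, h2, h3⟩ := fused_conj (Complex.exp_ne_zero η) (Complex.exp_ne_zero μ)
    (fun k => Complex.exp_ne_zero _) hμ.rreg
    (hL.fam (fun k => Complex.exp_ne_zero _) hμ.lreg) hG hG' (fun k => lpre_ne η (μ - lam k))
    (List.nodup_reverse.2 (List.nodup_finRange n)) X hF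
  have hI : toO (Ring.inverse (fused G L η lam μ)) = Fi := by
    rw [ring_inverse_eq (x := fused G L η lam μ) (y := toO.symm Fi)
      (toO.injective (by rw [map_mul, AlgEquiv.apply_symm_apply, map_one]; exact h1))
      (toO.injective (by rw [map_mul, AlgEquiv.apply_symm_apply, map_one]; exact h2)),
      AlgEquiv.apply_symm_apply]
  have h4 := entry_of_conj h3 b c s t
  have h5 : toO (fusedAdj G L η lam μ X) = Fi * embO (castM X) * toO (fused G L η lam μ) := by
    rw [fusedAdj, map_mul, map_mul, hI, toO_snd]
    rfl
  rw [h5]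
  exact h4

end Link

/-! ### Spin-preserving operators and spin-dependent prefactors -/

section Spin

variable {ι : Type*} [Fintype ι] [DecidableEq ι]

/-- The eigenvalue of `[Sᶻ, ·]` on matrix units. -/
def sd (s t : ι → Fin 2) : ℤ := ∑ j, (((t j : ℕ) : ℤ) - ((s j : ℕ) : ℤ))

theorem sd_add (s t r : ι → Fin 2) : sd s t + sd t r = sd s r := by
  rw [sd, sd, sd, ← Finset.sum_add_distrib]
  exact Finset.sum_congr rfl fun _ _ => by ring

theorem sd_self (s : ι → Fin 2) : sd s s = 0 := by simp [sd]

/-- `Z` commutes with the total spin. -/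
def SP (Z : SiteMat ι ℂ) : Prop := ∀ s t, sd s t ≠ 0 → Z s t = 0

theorem SP.mul {Z W : SiteMat ι ℂ} (hZ : SP Z) (hW : SP W) : SP (Z * W) := by
  intro s t h
  rw [Matrix.mul_apply]
  refine Finset.sum_eq_zero fun r _ => ?_
  by_cases h1 : sd s r = 0
  · rw [hW r t (by rw [← sd_add s r t, h1, zero_add] at h; exact h), mul_zero]
  · rw [hZ s r h1, zero_mul]

theorem SP.one : SP (1 : SiteMat ι ℂ) := by
  intro s t h
  rw [Matrix.one_apply_ne]
  rintro rfl
  exact h (sd_self s)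

theorem SP.smul {Z : SiteMat ι ℂ} (h : SP Z) (c : ℂ) : SP (c • Z) := fun s t hs => by
  rw [Matrix.smul_apply, h s t hs, smul_zero]

theorem SP.list_prod {κ : Type*} {l : List κ} {X : κ → SiteMat ι ℂ} (h : ∀ k ∈ l, SP (X k)) :
    SP (l.map X).prod := by
  induction l with
  | nil => exact SP.one
  | cons k l ih =>
    rw [List.map_cons, List.prod_cons]
    exact (h k (by simp)).mul (ih fun m hm => h m (by simp [hm]))

/-- The ice rule: the R-matrix conserves the sum of the two spins. -/
theorem sp_site2 {j k : ι} (h : j ≠ k) (q w : ℂ) : SP (site2 j k (Rp q w)) := by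
  intro s t hs
  rw [site2_apply]
  split_ifs with h1
  · have e : sd s t = ((t j : ℕ) : ℤ) - (s j : ℕ) + (((t k : ℕ) : ℤ) - (s k : ℕ)) := by
      rw [sd, ← Finset.sum_pair h (f := fun l => ((t l : ℕ) : ℤ) - (s l : ℕ))]
      refine (Finset.sum_subset (Finset.subset_univ _) fun l _ hl => ?_).symm
      simp only [Finset.mem_insert, Finset.mem_singleton, not_or] at hl
      rw [h1 l hl.1 hl.2, sub_self]
    rw [e] at hs
    generalize s j = a at *
    generalize s k = b at *
    generalize t j = c at *
    generalize t k = d at *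
    fin_cases a <;> fin_cases b <;> fin_cases c <;> fin_cases d <;> simp [Rp] at hs ⊢
  · rfl

/-- Multiplication of the components of spin `m` by `f m`. -/
def pref (f : ℤ → ℂ) (Z : SiteMat ι ℂ) : SiteMat ι ℂ := Matrix.of fun s t => f (sd s t) * Z s t

theorem pref_mul_left (f : ℤ → ℂ) {A : SiteMat ι ℂ} (hA : SP A) (Z : SiteMat ι ℂ) :
    pref f (A * Z) = A * pref f Z := by
  ext s t
  simp only [pref, Matrix.of_apply, Matrix.mul_apply, Finset.mul_sum]
  refine Finset.sum_congr rfl fun r _ => ?_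
  by_cases h : sd s r = 0
  · rw [← sd_add s r t, h, zero_add]; ring
  · rw [hA s r h]; ring

theorem pref_mul_right (f : ℤ → ℂ) {A : SiteMat ι ℂ} (hA : SP A) (Z : SiteMat ι ℂ) :
    pref f (Z * A) = pref f Z * A := by
  ext s t
  simp only [pref, Matrix.of_apply, Matrix.mul_apply, Finset.mul_sum]
  refine Finset.sum_congr rfl fun r _ => ?_
  by_cases h : sd r t = 0
  · rw [← sd_add s r t, h, add_zero]; ring
  · rw [hA r t h]; ring

theorem pref_smul (f : ℤ → ℂ) (c : ℂ) (Z : SiteMat ι ℂ) : pref f (c • Z) = c • pref f Z := by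
  ext s t; simp only [pref, Matrix.of_apply, Matrix.smul_apply, smul_eq_mul]; ring

theorem triv_pref (f : ℤ → ℂ) {j : ι} {Z : SiteMat ι ℂ} (h : Triv j Z) : Triv j (pref f Z) := by
  have e : ∀ (s t : ι → Fin 2) (b : Fin 2), sd (Function.update s j b) (Function.update t j b) =
      sd (Function.update s j 0) (Function.update t j 0) := by
    intro s t b
    refine Finset.sum_congr rfl fun k _ => ?_
    by_cases hk : k = j
    · subst hk; simp
    · simp [hk]
  intro s t b c
  simp only [pref, Matrix.of_apply]
  rw [h s t b c]
  split_ifs with hbc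
  · subst hbc; rw [e]
  · rw [mul_zero]

variable {q : ℂ} {ξ : ι → ℂ}

theorem sp_rL {l : List ι} {j : ι} (hj : j ∉ l) : SP (rL q ξ l j) :=
  SP.list_prod fun k hk => sp_site2 (by rintro rfl; exact hj hk) _ _

theorem sp_rLi {l : List ι} {j : ι} (hj : j ∉ l) : SP (rLi q ξ l j) :=
  SP.list_prod fun k hk => (sp_site2 (by rintro rfl; exact hj (by simpa using hk)) _ _).smul _

theorem rLi_mul_rL (hq : q ≠ 0) (hξ : ∀ k, ξ k ≠ 0) (hR : ∀ j k, j ≠ k → RReg q ξ j k)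
    {l : List ι} {j : ι} (hj : j ∉ l) : rLi q ξ l j * rL q ξ l j = 1 :=
  list_inv_mul_prod fun k hk => by
    have : j ≠ k := by rintro rfl; exact hj hk
    exact rri_mul_rr hq hξ this (hR j k this)

end Spin

/-! ### Operators defined by a functional on the oscillator algebra, and their residues -/

section General

variable {ι S : Type*} [Fintype ι] [DecidableEq ι] [Ring S] [Algebra ℂ S]

theorem map_castM_mul (φ : S →ₗ[ℂ] ℂ) (A : SiteMat ι ℂ) (Z : SiteMat ι S) :
    (castM A * Z).map φ = A * Z.map φ := by
  ext s t
  simp only [Matrix.map_apply, Matrix.mul_apply, map_sum, castM_apply]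
  refine Finset.sum_congr rfl fun r _ => ?_
  rw [← Algebra.smul_def, map_smul, smul_eq_mul]

theorem map_mul_castM (φ : S →ₗ[ℂ] ℂ) (A : SiteMat ι ℂ) (Z : SiteMat ι S) :
    (Z * castM A).map φ = Z.map φ * A := by
  ext s t
  simp only [Matrix.map_apply, Matrix.mul_apply, map_sum, castM_apply]
  refine Finset.sum_congr rfl fun r _ => ?_
  rw [← Algebra.commutes, ← Algebra.smul_def, map_smul, smul_eq_mul, mul_comm]

variable (η : ℂ) (lam : ι → ℂ)

/-- The inhomogeneities are in general position. -/
structure Gen : Prop where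
  hq : Complex.exp η - (Complex.exp η)⁻¹ ≠ 0
  rreg : ∀ j k, j ≠ k → RReg (Complex.exp η) (fun k => Complex.exp (lam k)) j k
  lreg : ∀ j k, j ≠ k → 1 - (Complex.exp (lam j) / Complex.exp (lam k)) ^ 2 ≠ 0

variable {η lam}

/-- Most conditions are open and hold at `λ_j` itself. The exception is the factor `1 - (ζ/ξ_j)²`,
which vanishes at `λ_j` but, as a simple zero, not in a punctured neighbourhood. -/
theorem Gen.sreg (h : Gen η lam) (j : ι) : ∀ᶠ μ in 𝓝[≠] (lam j), SpecReg η lam μ := by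
  have hexp : Tendsto Complex.exp (𝓝[≠] (lam j)) (𝓝 (Complex.exp (lam j))) :=
    (Complex.continuous_exp.tendsto _).mono_left nhdsWithin_le_nhds
  have h1 : ∀ᶠ μ in 𝓝[≠] (lam j), ∀ k, RReg (Complex.exp η)
      (oξ (Complex.exp μ) fun k => Complex.exp (lam k)) none (some k) := by
    refine eventually_all.2 fun k => ?_
    have hr : RReg (Complex.exp η) (fun k => Complex.exp (lam k)) j k := by
      by_cases hjk : j = k
      · subst hjk
        simp only [RReg]
        rw [div_self (Complex.exp_ne_zero _)]
        simpa using h.hq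
      · exact h.rreg j k hjk
    have t1 := hexp.div_const (Complex.exp (lam k))
    have t2 : Tendsto (fun μ => Complex.exp (lam k) / Complex.exp μ) (𝓝[≠] (lam j))
      (𝓝 (Complex.exp (lam k) / Complex.exp (lam j))) :=
        tendsto_const_nhds.div hexp (Complex.exp_ne_zero _)
    have e1 := ((t1.const_mul (Complex.exp η)).sub ((t1.inv₀ (div_ne_zero (Complex.exp_ne_zero _)
      (Complex.exp_ne_zero _))).const_mul (Complex.exp η)⁻¹)).eventually_ne hr.1
    have e2 := ((t2.const_mul (Complex.exp η)).sub ((t2.inv₀ (div_ne_zero (Complex.exp_ne_zero _)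
      (Complex.exp_ne_zero _))).const_mul (Complex.exp η)⁻¹)).eventually_ne hr.2
    filter_upwards [e1, e2] with μ h1 h2 using ⟨h1, h2⟩
  have h2 : ∀ᶠ μ in 𝓝[≠] (lam j), ∀ k, 1 - (Complex.exp μ / Complex.exp (lam k)) ^ 2 ≠ 0 := by
    refine eventually_all.2 fun k => ?_
    by_cases hjk : j = k
    · subst hjk
      have t := (tendsto_residue_factor (lam j)).eventually_ne (by norm_num : (-(1 / 2) : ℂ) ≠ 0)
      filter_upwards [t] with μ hμ h0
      exact hμ (by rw [h0]; simp)
    · exact (((hexp.div_const _).pow 2).const_sub 1).eventually_ne (h.lreg j k hjk)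
  filter_upwards [h1, h2] with μ a b using ⟨a, b⟩

variable (η lam) in
/-- The operator with spin-dependent prefactor `p` obtained by applying `φ` to an entry of the
adjoint action of the fused monodromy matrix over `l`. -/
def genOp (Lz Nz : ℂ → Matrix (Fin 2) (Fin 2) S) (l : List ι) (b c : Fin 2) (φ : S →ₗ[ℂ] ℂ)
    (p : ℂ → ℤ → ℂ) (μ : ℂ) (X : SiteMat ι ℂ) : SiteMat ι ℂ :=
  pref (p μ) ((aOp (Complex.exp η) (Complex.exp μ) (fun k => Complex.exp (lam k))
    (laxL Lz (fun k => Complex.exp (lam k)) (Complex.exp μ))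
    (laxN Nz (fun k => Complex.exp (lam k)) (Complex.exp μ)) l b c X).map φ)

variable (η lam) in
/-- The residue of the adjoint action over `l ++ [j]` at `λ_j`, up to conjugation. -/
def genRes (Lz Nz : ℂ → Matrix (Fin 2) (Fin 2) S) (l : List ι) (j : ι) (b c : Fin 2)
    (φ : S →ₗ[ℂ] ℂ) (X : SiteMat ι ℂ) : SiteMat ι ℂ :=
  (pe j b c (site1 j (Nz 1) *
        adL (fun k => site1 k (laxL Lz (fun k => Complex.exp (lam k)) (Complex.exp (lam j)) k))
          (fun k => site1 k (laxN Nz (fun k => Complex.exp (lam k)) (Complex.exp (lam j)) k)) l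
          (castM X) * site1 j (Lz 1))).map φ

theorem triv_genRes (Lz Nz : ℂ → Matrix (Fin 2) (Fin 2) S) (l : List ι) (j : ι) (b c : Fin 2)
    (φ : S →ₗ[ℂ] ℂ) (X : SiteMat ι ℂ) : Triv j (genRes lam Lz Nz l j b c φ X) :=
  (triv_pe j b c _).map φ

variable {Lz Nz : ℂ → Matrix (Fin 2) (Fin 2) S} {φ : S →ₗ[ℂ] ℂ} {p : ℂ → ℤ → ℂ}

theorem tendsto_pref {F : Filter ℂ} {f : ℂ → SiteMat ι S} {Z : SiteMat ι S} (hf : FT F f Z)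
    {g : ℂ → ℤ → ℂ} {g₀ : ℤ → ℂ} (hg : ∀ m, Tendsto (fun μ => g μ m) F (𝓝 (g₀ m))) :
    Tendsto (fun μ => pref (g μ) ((f μ).map φ)) F (𝓝 (pref g₀ (Z.map φ))) := by
  refine tendsto_pi_nhds.2 fun s => tendsto_pi_nhds.2 fun t => ?_
  refine (hg _).mul ?_
  exact (hf.map (φ := fun Z : SiteMat ι S => φ (Z s t)) ⟨fun x y => map_add φ _ _,
    fun c x => map_smul φ c (x s t)⟩).tendsto

/-- The R-matrices preserve spin and have scalar entries, so they come out of both the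
spin-dependent prefactor and the functional `φ`. -/
theorem genOp_residue (hG : Gen η lam) (hL : IsLax (Complex.exp η) Lz Nz)
    (hp : ∀ m, Continuous fun μ => p μ m) {l : List ι} (hl : l.Nodup) {j : ι} (hj : j ∉ l)
    (b c : Fin 2) (X : SiteMat ι ℂ) :
    Tendsto (fun μ => (μ - lam j) • genOp η lam Lz Nz (l ++ [j]) b c φ p μ X) (𝓝[≠] (lam j))
      (𝓝 ((-(1 / 2) : ℂ) • (rLi (Complex.exp η) (fun k => Complex.exp (lam k)) l j *
        pref (p (lam j)) (genRes lam Lz Nz l j b c φ X) *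
          rL (Complex.exp η) (fun k => Complex.exp (lam k)) l j))) := by
  have h := aOp_residue hL lam hG.hq hl hj
    (fun k hk => hG.rreg j k (by rintro rfl; exact hj hk))
    (fun k hk => hG.lreg j k (by rintro rfl; exact hj hk)) b c X
  have t := tendsto_pref (φ := φ) h (g := p) (g₀ := p (lam j))
    fun m => ((hp m).tendsto _).mono_left nhdsWithin_le_nhds
  have e : ∀ (c : ℂ) (Z : SiteMat ι S), (c • Z).map φ = c • Z.map φ := fun c Z => by
    ext s t; exact map_smul φ c _
  rw [e, map_mul_castM, map_castM_mul, pref_smul, pref_mul_right _ (sp_rL hj),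
    pref_mul_left _ (sp_rLi hj)] at t
  refine t.congr fun μ => ?_
  rw [e, pref_smul, genOp]

theorem genOp_regular (hG : Gen η lam) (hL : IsLax (Complex.exp η) Lz Nz)
    (hp : ∀ m, Continuous fun μ => p μ m) {l : List ι} {j : ι} (hj : j ∉ l)
    (b c : Fin 2) (X : SiteMat ι ℂ) :
    Tendsto (fun μ => (μ - lam j) • genOp η lam Lz Nz l b c φ p μ X) (𝓝[≠] (lam j)) (𝓝 0) := by
  have hf : Tendsto Complex.exp (𝓝[≠] (lam j)) (𝓝 (Complex.exp (lam j))) :=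
    (Complex.continuous_exp.tendsto _).mono_left nhdsWithin_le_nhds
  have h := FT.map (V := SiteMat (Option ι) S) (W := SiteMat ι S)
    (ft_adL (ξ := fun k => Complex.exp (lam k)) hL hf (Complex.exp_ne_zero _)
    (fun k => Complex.exp_ne_zero _)
    (fun k hk => hG.rreg j k (by rintro rfl; exact hj hk))
    (fun k hk => hG.lreg j k (by rintro rfl; exact hj hk)) (embO (castM X)))
    (isLinear_auxEntry b c)
  have t := tendsto_pref (φ := φ) h (g := p) (g₀ := p (lam j))
    fun m => ((hp m).tendsto _).mono_left nhdsWithin_le_nhds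
  have h0 : Tendsto (fun μ => μ - lam j) (𝓝[≠] (lam j)) (𝓝 0) := by
    have : Tendsto (fun μ => μ - lam j) (𝓝 (lam j)) (𝓝 (lam j - lam j)) :=
      (continuous_id.sub continuous_const).tendsto _
    rw [sub_self] at this
    exact this.mono_left nhdsWithin_le_nhds
  have := h0.smul t
  rw [zero_smul] at this
  exact this

theorem genOp_move (hG : Gen η lam) (hL : IsLax (Complex.exp η) Lz Nz) {μ : ℂ}
    (hμ : SpecReg η lam μ) {l₁ l₂ : List ι} {j : ι} (hl : (l₁ ++ j :: l₂).Nodup) (b c : Fin 2)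
    (X : SiteMat ι ℂ) :
    genOp η lam Lz Nz (l₁ ++ j :: l₂) b c φ p μ X =
      rL (Complex.exp η) (fun k => Complex.exp (lam k)) l₂ j *
        genOp η lam Lz Nz (l₁ ++ l₂ ++ [j]) b c φ p μ
          (rLi (Complex.exp η) (fun k => Complex.exp (lam k)) l₂ j * X *
            rL (Complex.exp η) (fun k => Complex.exp (lam k)) l₂ j) *
        rLi (Complex.exp η) (fun k => Complex.exp (lam k)) l₂ j := by
  have hj : j ∉ l₂ := (List.nodup_cons.1 (List.nodup_append.1 hl).2.1).1
  rw [genOp, aOp_move (Complex.exp_ne_zero η) (Complex.exp_ne_zero μ)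
    (fun k => Complex.exp_ne_zero _) hG.rreg hμ.rreg
    (hL.fam (fun k => Complex.exp_ne_zero _) hμ.lreg) hl, map_mul_castM, map_castM_mul,
    pref_mul_right _ (sp_rLi hj), pref_mul_left _ (sp_rL hj)]
  rfl

theorem genOp_reduce (hG : Gen η lam) (hL : IsLax (Complex.exp η) Lz Nz) {μ : ℂ}
    (hμ : SpecReg η lam μ) {l : List ι} (hl : l.Nodup) {j : ι} (hj : j ∉ l) (b c : Fin 2)
    {W : SiteMat ι ℂ} (hW : Triv j W) :
    genOp η lam Lz Nz (l ++ [j]) b c φ p μ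
        (rLi (Complex.exp η) (fun k => Complex.exp (lam k)) l j * W *
          rL (Complex.exp η) (fun k => Complex.exp (lam k)) l j) =
      rLi (Complex.exp η) (fun k => Complex.exp (lam k)) l j * genOp η lam Lz Nz l b c φ p μ W *
        rL (Complex.exp η) (fun k => Complex.exp (lam k)) l j := by
  rw [genOp, aOp_reduce (Complex.exp_ne_zero η) (Complex.exp_ne_zero μ)
    (fun k => Complex.exp_ne_zero _) hG.rreg hμ.rreg
    (hL.fam (fun k => Complex.exp_ne_zero _) hμ.lreg) hl hj b c hW, map_mul_castM, map_castM_mul,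
    pref_mul_right _ (sp_rL hj), pref_mul_left _ (sp_rLi hj)]
  rfl

end General

/-! ### Iterated residues -/

section Kinds

variable {ι : Type*} [Fintype ι] [DecidableEq ι]

/-- The data defining one of the operators `b`, `c`, `H`. -/
structure Kind where
  Lz : ℂ → Matrix (Fin 2) (Fin 2) OscEnd
  Nz : ℂ → Matrix (Fin 2) (Fin 2) OscEnd
  b : Fin 2
  c : Fin 2
  φ : OscEnd →ₗ[ℂ] ℂ
  p : ℂ → ℤ → ℂ

/-- The Lax matrices satisfy the exchange relations, and the prefactor is continuous. -/
structure Kind.Valid (K : Kind) (η : ℂ) : Prop where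
  lax : IsLax (Complex.exp η) K.Lz K.Nz
  cont : ∀ m, Continuous fun μ => K.p μ m

/-- The operator over the list `l`. -/
def Kind.op (K : Kind) (η : ℂ) (lam : ι → ℂ) (l : List ι) (μ : ℂ) (X : SiteMat ι ℂ) :
    SiteMat ι ℂ := genOp η lam K.Lz K.Nz l K.b K.c K.φ K.p μ X

/-- The residue at `λ_j`. -/
def Kind.res (K : Kind) (η : ℂ) (lam : ι → ℂ) (l : List ι) (j : ι) (X : SiteMat ι ℂ) :
    SiteMat ι ℂ :=
  limUnder (𝓝[≠] (lam j)) fun μ => (μ - lam j) • K.op η lam l μ X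

/-- The residue at `λ_j` over `l ++ [j]`, without conjugation. -/
def Kind.core (K : Kind) (lam : ι → ℂ) (l : List ι) (j : ι) (X : SiteMat ι ℂ) :
    SiteMat ι ℂ := pref (K.p (lam j)) (genRes lam K.Lz K.Nz l j K.b K.c K.φ X)

variable {η : ℂ} {lam : ι → ℂ} {K : Kind}

theorem Kind.triv_core (l : List ι) (j : ι) (X : SiteMat ι ℂ) : Triv j (K.core lam l j X) :=
  triv_pref _ (triv_genRes _ _ _ _ _ _ _ _)

theorem Kind.tendsto_last (hG : Gen η lam) (hK : K.Valid η) {l : List ι} {j : ι}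
    (hl : (l ++ [j]).Nodup) (X : SiteMat ι ℂ) :
    Tendsto (fun μ => (μ - lam j) • K.op η lam (l ++ [j]) μ X) (𝓝[≠] (lam j))
      (𝓝 ((-(1 / 2) : ℂ) • (rLi (Complex.exp η) (fun k => Complex.exp (lam k)) l j *
        K.core lam l j X * rL (Complex.exp η) (fun k => Complex.exp (lam k)) l j))) := by
  have h := List.nodup_append.1 hl
  exact genOp_residue hG hK.lax hK.cont h.1 (fun hj => h.2.2 j hj j (by simp) rfl) _ _ X

theorem Kind.tendsto_conj {l l' : List ι} {j : ι} {A B : SiteMat ι ℂ} {X X' Y : SiteMat ι ℂ}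
    (h : ∀ᶠ μ in 𝓝[≠] (lam j), K.op η lam l μ X = A * K.op η lam l' μ X' * B)
    (h' : Tendsto (fun μ => (μ - lam j) • K.op η lam l' μ X') (𝓝[≠] (lam j)) (𝓝 Y)) :
    Tendsto (fun μ => (μ - lam j) • K.op η lam l μ X) (𝓝[≠] (lam j)) (𝓝 (A * Y * B)) := by
  have hc : Continuous fun Y : SiteMat ι ℂ => A * Y * B :=
    (continuous_const.matrix_mul continuous_id).matrix_mul continuous_const
  refine ((hc.tendsto Y).comp h').congr' ?_
  filter_upwards [h] with μ hμ
  rw [hμ, Function.comp_apply, mul_smul_comm, smul_mul_assoc]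

theorem Kind.tendsto_res (hG : Gen η lam) (hK : K.Valid η) {l : List ι} (hl : l.Nodup) (j : ι)
    (X : SiteMat ι ℂ) :
    Tendsto (fun μ => (μ - lam j) • K.op η lam l μ X) (𝓝[≠] (lam j))
      (𝓝 (K.res η lam l j X)) := by
  refine tendsto_nhds_limUnder ?_
  by_cases hj : j ∈ l
  · obtain ⟨l₁, l₂, rfl⟩ := List.append_of_mem hj
    have hl' : (l₁ ++ l₂ ++ [j]).Nodup := by
      rw [List.append_assoc]
      exact (List.Perm.nodup_iff (List.Perm.append_left l₁
        (List.perm_append_comm (l₁ := [j]) (l₂ := l₂)))).1 hl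
    exact ⟨_, Kind.tendsto_conj ((hG.sreg j).mono fun μ hμ => genOp_move hG hK.lax hμ hl _ _ X)
      (Kind.tendsto_last hG hK hl' _)⟩
  · exact ⟨0, genOp_regular hG hK.lax hK.cont hj _ _ X⟩

theorem Kind.res_last (hG : Gen η lam) (hK : K.Valid η) {l : List ι} {j : ι}
    (hl : (l ++ [j]).Nodup) (X : SiteMat ι ℂ) :
    K.res η lam (l ++ [j]) j X =
      (-(1 / 2) : ℂ) • (rLi (Complex.exp η) (fun k => Complex.exp (lam k)) l j *
        K.core lam l j X * rL (Complex.exp η) (fun k => Complex.exp (lam k)) l j) :=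
  (Kind.tendsto_last hG hK hl X).limUnder_eq

theorem Kind.res_not_mem (hG : Gen η lam) (hK : K.Valid η) {l : List ι} {j : ι}
    (hj : j ∉ l) (X : SiteMat ι ℂ) : K.res η lam l j X = 0 :=
  (genOp_regular hG hK.lax hK.cont hj _ _ X).limUnder_eq

theorem Kind.res_move (hG : Gen η lam) (hK : K.Valid η) {l₁ l₂ : List ι} {i : ι}
    (hl : (l₁ ++ i :: l₂).Nodup) (j : ι) (X : SiteMat ι ℂ) :
    K.res η lam (l₁ ++ i :: l₂) j X = rL (Complex.exp η) (fun k => Complex.exp (lam k)) l₂ i *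
      K.res η lam (l₁ ++ l₂ ++ [i]) j (rLi (Complex.exp η) (fun k => Complex.exp (lam k)) l₂ i * X *
        rL (Complex.exp η) (fun k => Complex.exp (lam k)) l₂ i) *
      rLi (Complex.exp η) (fun k => Complex.exp (lam k)) l₂ i := by
  have hl' : (l₁ ++ l₂ ++ [i]).Nodup := by
    rw [List.append_assoc]
    exact (List.Perm.nodup_iff (List.Perm.append_left l₁
      (List.perm_append_comm (l₁ := [i]) (l₂ := l₂)))).1 hl
  exact (Kind.tendsto_conj ((hG.sreg j).mono fun μ hμ => genOp_move hG hK.lax hμ hl _ _ X)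
    (Kind.tendsto_res hG hK hl' j _)).limUnder_eq

/-- Lets an outer residue be evaluated on a chain shortened by the site of the inner one, since
inner residues have the form required of the argument. -/
theorem Kind.res_reduce (hG : Gen η lam) (hK : K.Valid η) {l : List ι} {i : ι}
    (hl : (l ++ [i]).Nodup) (j : ι) {W : SiteMat ι ℂ} (hW : Triv i W) :
    K.res η lam (l ++ [i]) j (rLi (Complex.exp η) (fun k => Complex.exp (lam k)) l i * W *
        rL (Complex.exp η) (fun k => Complex.exp (lam k)) l i) =
      rLi (Complex.exp η) (fun k => Complex.exp (lam k)) l i * K.res η lam l j W *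
      rL (Complex.exp η) (fun k => Complex.exp (lam k)) l i := by
  have h := List.nodup_append.1 hl
  exact (Kind.tendsto_conj ((hG.sreg j).mono fun μ hμ =>
    genOp_reduce hG hK.lax hμ h.1 (fun hj => h.2.2 i hj i (by simp) rfl) _ _ hW)
    (Kind.tendsto_res hG hK h.1 j _)).limUnder_eq

theorem aOp_add (q ζ : ℂ) (ξ : ι → ℂ) (L N : ι → Matrix (Fin 2) (Fin 2) OscEnd) (l : List ι)
    (b c : Fin 2) (Z W : SiteMat ι ℂ) :
    aOp q ζ ξ L N l b c (Z + W) = aOp q ζ ξ L N l b c Z + aOp q ζ ξ L N l b c W := by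
  simp only [aOp, adL, map_add, mul_add, add_mul]
  rfl

theorem aOp_smul (q ζ : ℂ) (ξ : ι → ℂ) (L N : ι → Matrix (Fin 2) (Fin 2) OscEnd) (l : List ι)
    (b c : Fin 2) (r : ℂ) (Z : SiteMat ι ℂ) :
    aOp q ζ ξ L N l b c (r • Z) = r • aOp q ζ ξ L N l b c Z := by
  have : embO (r • castM (S := OscEnd) Z) = r • embO (castM Z) := emb_smul some _ _
  simp only [aOp, adL, castM_smul, this, mul_smul_comm, smul_mul_assoc]
  rfl

theorem Kind.op_add (l : List ι) (μ : ℂ) (X Y : SiteMat ι ℂ) :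
    K.op η lam l μ (X + Y) = K.op η lam l μ X + K.op η lam l μ Y := by
  ext s t
  simp only [Kind.op, genOp, aOp_add, pref, Matrix.of_apply, Matrix.map_apply, Matrix.add_apply,
    map_add, mul_add]

theorem Kind.op_smul (l : List ι) (μ : ℂ) (c : ℂ) (X : SiteMat ι ℂ) :
    K.op η lam l μ (c • X) = c • K.op η lam l μ X := by
  ext s t
  simp only [Kind.op, genOp, aOp_smul, pref, Matrix.of_apply, Matrix.map_apply, Matrix.smul_apply,
    map_smul, smul_eq_mul]
  ring

theorem Kind.isLinear_res (hG : Gen η lam) (hK : K.Valid η) {l : List ι} (hl : l.Nodup) (j : ι) :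
    IsLinearMap ℂ (K.res η lam l j) where
  map_add X Y := by
    refine Tendsto.limUnder_eq (((Kind.tendsto_res hG hK hl j X).add
      (Kind.tendsto_res hG hK hl j Y)).congr fun μ => ?_)
    rw [Kind.op_add, smul_add]
  map_smul c X := by
    refine Tendsto.limUnder_eq (((Kind.tendsto_res hG hK hl j X).const_smul c).congr fun μ => ?_)
    rw [Kind.op_smul, smul_comm]

/-- After moving `j` to the end, the inner residue is the conjugate of an operator trivial at `j`.
The outer operator then reduces to the chain without `j`, which has no pole at `λ_j`. -/
theorem Kind.res_res_self {K' : Kind} (hG : Gen η lam) (hK : K.Valid η) (hK' : K'.Valid η)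
    {l : List ι} (hl : l.Nodup) (j : ι) (X : SiteMat ι ℂ) :
    K.res η lam l j (K'.res η lam l j X) = 0 := by
  by_cases hj : j ∈ l
  · obtain ⟨l₁, l₂, rfl⟩ := List.append_of_mem hj
    have hl' : (l₁ ++ l₂ ++ [j]).Nodup := by
      rw [List.append_assoc]
      exact (List.Perm.nodup_iff (List.Perm.append_left l₁
        (List.perm_append_comm (l₁ := [j]) (l₂ := l₂)))).1 hl
    have hj2 : j ∉ l₂ := (List.nodup_cons.1 (List.nodup_append.1 hl).2.1).1
    have hj3 : j ∉ l₁ ++ l₂ := fun h => (List.nodup_append.1 hl').2.2 j h j (by simp) rfl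
    set q := Complex.exp η
    set ξ : ι → ℂ := fun k => Complex.exp (lam k)
    have e2 : rLi q ξ l₂ j * rL q ξ l₂ j = 1 :=
      rLi_mul_rL (Complex.exp_ne_zero η) (fun _ => Complex.exp_ne_zero _) hG.rreg hj2
    have e : ∀ Y, rLi q ξ l₂ j * (rL q ξ l₂ j * Y * rLi q ξ l₂ j) * rL q ξ l₂ j = Y := by
      intro Y
      calc _ = (rLi q ξ l₂ j * rL q ξ l₂ j) * Y * (rLi q ξ l₂ j * rL q ξ l₂ j) := by
            simp only [mul_assoc]
        _ = Y := by rw [e2, one_mul, mul_one]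
    rw [Kind.res_move hG hK hl, Kind.res_move hG hK' hl, e, Kind.res_last hG hK' hl',
      (Kind.isLinear_res hG hK hl' j).map_smul, Kind.res_reduce hG hK hl' j (Kind.triv_core _ _ _),
      Kind.res_not_mem hG hK hj3]
    simp
  · exact Kind.res_not_mem hG hK hj _

/-- The iterated residue for the two last sites. -/
theorem Kind.res_res_last {K' : Kind} (hG : Gen η lam) (hK : K.Valid η) (hK' : K'.Valid η)
    {l : List ι} {i j : ι} (hl : (l ++ [i] ++ [j]).Nodup) (X : SiteMat ι ℂ) :
    K.res η lam (l ++ [i] ++ [j]) i (K'.res η lam (l ++ [i] ++ [j]) j X) =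
      (1 / 4 : ℂ) • (rLi (Complex.exp η) (fun k => Complex.exp (lam k)) (l ++ [i]) j *
        (rLi (Complex.exp η) (fun k => Complex.exp (lam k)) l i *
          K.core lam l i (K'.core lam (l ++ [i]) j X) *
          rL (Complex.exp η) (fun k => Complex.exp (lam k)) l i) *
        rL (Complex.exp η) (fun k => Complex.exp (lam k)) (l ++ [i]) j) := by
  have hl' := (List.nodup_append.1 hl).1
  rw [Kind.res_last hG hK' hl, (Kind.isLinear_res hG hK hl i).map_smul,
    Kind.res_reduce hG hK hl i (Kind.triv_core _ _ _), Kind.res_last hG hK hl', mul_smul_comm,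
    smul_mul_assoc, smul_smul]
  norm_num

/-- The order of the sites can be changed at the cost of a conjugation. -/
theorem exists_reorder (hG : Gen η lam) {l : List ι} (hl : l.Nodup) {i j : ι} (hi : i ∈ l)
    (hj : j ∈ l) (hij : i ≠ j) :
    ∃ (l' : List ι) (ρ ρ' : SiteMat ι ℂ), (l' ++ [i] ++ [j]).Perm l ∧ SP ρ ∧ SP ρ' ∧ ρ' * ρ = 1 ∧
      ∀ (K : Kind), K.Valid η → ∀ k X, K.res η lam l k X =
        ρ * K.res η lam (l' ++ [i] ++ [j]) k (ρ' * X * ρ) * ρ' := by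
  set q := Complex.exp η
  set ξ : ι → ℂ := fun k => Complex.exp (lam k)
  have hperm : ∀ (l₁ l₂ : List ι) (k : ι), (l₁ ++ l₂ ++ [k]).Perm (l₁ ++ k :: l₂) := by
    intro l₁ l₂ k
    rw [List.append_assoc]
    exact List.Perm.append_left l₁ (List.perm_append_comm (l₁ := l₂) (l₂ := [k]))
  obtain ⟨l₁, l₂, rfl⟩ := List.append_of_mem hi
  have p1 := hperm l₁ l₂ i
  have hl1 := p1.nodup_iff.2 hl
  have hi2 : i ∉ l₂ := (List.nodup_cons.1 (List.nodup_append.1 hl).2.1).1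
  have hj' : j ∈ l₁ ++ l₂ := by
    have := p1.mem_iff.2 hj
    rw [List.mem_append] at this
    exact this.resolve_right (by simpa using hij.symm)
  obtain ⟨l₃, l₄, h34⟩ := List.append_of_mem hj'
  rw [h34, show l₃ ++ j :: l₄ ++ [i] = l₃ ++ j :: (l₄ ++ [i]) by simp] at p1 hl1
  have p2 := hperm l₃ (l₄ ++ [i]) j
  have hj4 : j ∉ l₄ ++ [i] := (List.nodup_cons.1 (List.nodup_append.1 hl1).2.1).1
  have e1 : rLi q ξ l₂ i * rL q ξ l₂ i = 1 :=
    rLi_mul_rL (Complex.exp_ne_zero η) (fun _ => Complex.exp_ne_zero _) hG.rreg hi2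
  have e2 : rLi q ξ (l₄ ++ [i]) j * rL q ξ (l₄ ++ [i]) j = 1 :=
    rLi_mul_rL (Complex.exp_ne_zero η) (fun _ => Complex.exp_ne_zero _) hG.rreg hj4
  refine ⟨l₃ ++ l₄, rL q ξ l₂ i * rL q ξ (l₄ ++ [i]) j, rLi q ξ (l₄ ++ [i]) j * rLi q ξ l₂ i, ?_,
    (sp_rL hi2).mul (sp_rL hj4), (sp_rLi hj4).mul (sp_rLi hi2), ?_, fun K hK k X => ?_⟩
  · have := p2.trans p1
    simpa using this
  · calc _ = rLi q ξ (l₄ ++ [i]) j * (rLi q ξ l₂ i * rL q ξ l₂ i) * rL q ξ (l₄ ++ [i]) j := by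
          simp only [mul_assoc]
      _ = 1 := by rw [e1, mul_one, e2]
  · rw [Kind.res_move hG hK hl, h34, show l₃ ++ j :: l₄ ++ [i] = l₃ ++ j :: (l₄ ++ [i]) by simp,
      Kind.res_move hG hK hl1, show l₃ ++ (l₄ ++ [i]) ++ [j] = l₃ ++ l₄ ++ [i] ++ [j] by simp]
    simp only [mul_assoc]
    rfl

/-- Interchange of the two last sites. -/
theorem Kind.res_swap (hG : Gen η lam) (hK : K.Valid η) {l : List ι} {i j : ι}
    (hl : (l ++ [i] ++ [j]).Nodup) (k : ι) (X : SiteMat ι ℂ) :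
    K.res η lam (l ++ [i] ++ [j]) k X =
      rr (Complex.exp η) (fun k => Complex.exp (lam k)) i j *
        K.res η lam (l ++ [j] ++ [i]) k (rri (Complex.exp η) (fun k => Complex.exp (lam k)) i j * X *
          rr (Complex.exp η) (fun k => Complex.exp (lam k)) i j) *
        rri (Complex.exp η) (fun k => Complex.exp (lam k)) i j := by
  have hl' : (l ++ i :: [j]).Nodup := by simpa using hl
  have := Kind.res_move hG hK hl' k X
  rw [show l ++ [i] ++ [j] = l ++ i :: [j] by simp, this]
  simp [rL, rLi]

end Kinds

/-! ### The operators `b`, `c`, `H` -/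

/-- The functional `x ↦ w(q^{-D} x q^{-D})`. -/
def sandwich (η : ℂ) (w : ℤ → ℂ) : OscEnd →ₗ[ℂ] ℂ :=
  wtr w ∘ₗ LinearMap.mulLeft ℂ (qD η (-1)) ∘ₗ LinearMap.mulRight ℂ (qD η (-1))

theorem sandwich_apply (η : ℂ) (w : ℤ → ℂ) (x : OscEnd) :
    sandwich η w x = wtr w (qD η (-1) * (x * qD η (-1))) := rfl

/-- The data of `c(ζ,α)`. -/
def kindC (η α : ℂ) : Kind where
  Lz := Lp η
  Nz := Np η
  b := 1
  c := 0
  φ := sandwich η (wPlus η α)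
  p μ m := Complex.exp (η * (α - m)) * (1 - Complex.exp (2 * η * (α - m))) *
    Complex.exp (μ * (α - m))

/-- The data of `b(ζ,α)`. -/
def kindB (η α : ℂ) : Kind where
  Lz z := flip2 (Lp η z)
  Nz z := flip2 (Np η z)
  b := 0
  c := 1
  φ := sandwich η (wMinus η α)
  p μ m := Complex.exp (2 * η * m) * Complex.exp (μ * (-α + m))

/-- The data of the diagonal entries in the definition of `H(ζ;α)`. -/
def kindH (η α : ℂ) (i : Fin 2) : Kind where
  Lz := Lp η
  Nz := Np η
  b := i
  c := i
  φ := wtr (wPlus η α)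
  p _ _ := 1

theorem kindC_valid (η α : ℂ) : (kindC η α).Valid η where
  lax := isLax_Lp η
  cont m := by unfold kindC; dsimp only; fun_prop

theorem kindB_valid (η α : ℂ) : (kindB η α).Valid η where
  lax := isLax_Lm η
  cont m := by unfold kindB; dsimp only; fun_prop

theorem kindH_valid (η α : ℂ) (i : Fin 2) : (kindH η α i).Valid η where
  lax := isLax_Lp η
  cont _ := continuous_const

theorem gplus_eq (η : ℂ) :
    Gplus η = !![qD η (-1), qD η (-1) * oscAstar; 0, qD η 1] := by
  ext i j : 1
  fin_cases i <;> fin_cases j <;> simp [Gplus, Matrix.mul_apply, Fin.sum_univ_two]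

theorem gminus_eq (η : ℂ) :
    Gminus η = !![qD η 1, 0; qD η (-1) * oscAstar, qD η (-1)] := by
  ext i j : 1
  fin_cases i <;> fin_cases j <;> simp [Gminus, Matrix.mul_apply, Fin.sum_univ_two]

theorem gplus_inv {S : Type*} [Ring S] {u v x : S} (huv : u * v = 1) (hvu : v * u = 1) :
    (!![v, v * x; 0, u] : Matrix (Fin 2) (Fin 2) S) * !![u, -(x * v); 0, v] = 1 ∧
      (!![u, -(x * v); 0, v] : Matrix (Fin 2) (Fin 2) S) * !![v, v * x; 0, u] = 1 := by
  constructor <;> ext i j <;> fin_cases i <;> fin_cases j <;>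
    simp [Matrix.mul_apply, Fin.sum_univ_two, huv, hvu, ← mul_assoc]
  simp [mul_assoc, hvu]

theorem gminus_inv {S : Type*} [Ring S] {u v x : S} (huv : u * v = 1) (hvu : v * u = 1) :
    (!![u, 0; v * x, v] : Matrix (Fin 2) (Fin 2) S) * !![v, 0; -(x * v), u] = 1 ∧
      (!![v, 0; -(x * v), u] : Matrix (Fin 2) (Fin 2) S) * !![u, 0; v * x, v] = 1 := by
  constructor <;> ext i j <;> fin_cases i <;> fin_cases j <;>
    simp [Matrix.mul_apply, Fin.sum_univ_two, huv, hvu, ← mul_assoc]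
  simp [mul_assoc, hvu]

theorem inverse_smul_conj {A : Type*} [Ring A] [Algebra ℂ A] {t t' x : A} {c : ℂ} (hc : c ≠ 0)
    (ht : t * t' = 1) (ht' : t' * t = 1) :
    Ring.inverse (c • t) * x * (c • t) = t' * x * t := by
  rw [ring_inverse_eq (x := c • t) (y := c⁻¹ • t'), smul_mul_assoc, smul_mul_smul_comm,
    inv_mul_cancel₀ hc, one_smul]
  · rw [smul_mul_smul_comm, mul_inv_cancel₀ hc, ht, one_smul]
  · rw [smul_mul_smul_comm, inv_mul_cancel₀ hc, ht', one_smul]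

theorem LaxFam.inverse_conj {ι S : Type*} [Fintype ι] [DecidableEq ι] [Ring S] [Algebra ℂ S] {q : ℂ}
    {ξ : ι → ℂ} {L N : ι → Matrix (Fin 2) (Fin 2) S} (hL : LaxFam q ξ L N) {c : ι → ℂ}
    (hc : ∀ k, c k ≠ 0) (l : List ι) (X F : SiteMat ι S)
    (hF : F = (l.map fun k => c k • site1 k (L k)).prod) :
    Ring.inverse F * X * F = adL (fun k => site1 k (L k)) (fun k => site1 k (N k)) l X := by
  rw [hF, list_smul_prod, inverse_smul_conj (t' := (l.reverse.map fun k => site1 k (N k)).prod)]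
  · rfl
  · exact List.prod_ne_zero (by simpa using fun k _ => hc k)
  · exact list_prod_mul_inv fun k _ => by rw [← site1_mul, hL.mul, site1_one]
  · exact list_inv_mul_prod fun k _ => by rw [← site1_mul, hL.mul', site1_one]

section Link

variable {n : ℕ} {η μ : ℂ} {lam : Fin n → ℂ}

/-- As `G⁺` is upper triangular, the lower left entry of the gauged matrix is `q^{-D} (·) q^{-D}`
applied to the lower left entry of the ungauged one; hence the functional `sandwich`. -/
theorem cOp_eq (hμ : SpecReg η lam μ) (α : ℂ) (X : SpinOp n) :
    cOp η lam α μ X = (kindC η α).op η lam (List.finRange n).reverse μ X := by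
  have hG := gplus_inv (x := oscAstar) (isOsc η).uv (isOsc η).vu
  rw [← gplus_eq] at hG
  have e := fusedAdj_entry hG.1 hG.2 (isLax_Lp η) (Lplus_eq η) hμ X
  ext s t
  have h1 : CplusOp η lam μ X s t = toO (S := OscEnd) (fusedAdj (Gplus η) (Lplus η) η lam μ X)
    (ocons 1 s) (ocons 0 t) := rfl
  have h2 : CplusOp η lam μ X s t = qD η (-1) * (aOp (Complex.exp η) (Complex.exp μ)
      (fun k => Complex.exp (lam k)) (laxL (Lp η) (fun k => Complex.exp (lam k)) (Complex.exp μ))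
      (laxN (Np η) (fun k => Complex.exp (lam k)) (Complex.exp μ)) (List.finRange n).reverse
      1 0 X s t * qD η (-1)) := by
    rw [h1, e 1 0 s t, gplus_eq]
    simp [Fin.sum_univ_two, aOp, mul_assoc]
  simp only [cOp, Matrix.of_apply, h2, trPlus_eq, Kind.op, genOp, pref, Matrix.map_apply, kindC,
    sandwich_apply, mul_assoc]
  rfl

/-- The same for the lower triangular `G⁻` and the upper right entry. -/
theorem bOp_eq (hμ : SpecReg η lam μ) (α : ℂ) (X : SpinOp n) :
    bOp η lam α μ X = (kindB η α).op η lam (List.finRange n).reverse μ X := by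
  have hG := gminus_inv (x := oscAstar) (isOsc η).uv (isOsc η).vu
  rw [← gminus_eq] at hG
  have e := fusedAdj_entry hG.1 hG.2 (isLax_Lm η) (Lminus_eq η) hμ X
  ext s t
  have h1 : BminusOp η lam μ X s t = toO (S := OscEnd) (fusedAdj (Gminus η) (Lminus η) η lam μ X)
    (ocons 0 s) (ocons 1 t) := rfl
  have h2 : BminusOp η lam μ X s t = qD η (-1) * (aOp (Complex.exp η) (Complex.exp μ)
      (fun k => Complex.exp (lam k))
      (laxL (fun z => flip2 (Lp η z)) (fun k => Complex.exp (lam k)) (Complex.exp μ))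
      (laxN (fun z => flip2 (Np η z)) (fun k => Complex.exp (lam k)) (Complex.exp μ))
      (List.finRange n).reverse 0 1 X s t * qD η (-1)) := by
    rw [h1, e 0 1 s t, gminus_eq]
    simp [Fin.sum_univ_two, aOp, mul_assoc]
  simp only [bOp, Matrix.of_apply, h2, trMinus_eq, Kind.op, genOp, pref, Matrix.map_apply, kindB,
    sandwich_apply, mul_assoc]
  rfl

open scoped Kronecker in
-- The R-matrices are scalar with respect to the oscillator, so the oscillator trace may be taken
-- after conjugation by `T_a`. The Lax and R products then recombine into vertices.
theorem HOp_eq (hμ : SpecReg η lam μ) (α : ℂ) (X : SpinOp n) :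
    HOp η lam α μ X = ∑ i, (kindH η α i).op η lam (List.finRange n).reverse μ X := by
  set ξ : Fin n → ℂ := fun k => Complex.exp (lam k) with hξd
  set l := (List.finRange n).reverse with hl
  have hln : l.Nodup := List.nodup_reverse.2 (List.nodup_finRange n)
  have hξ' : ∀ o, oξ (Complex.exp μ) ξ o ≠ 0 := by
    rintro (_ | k)
    exacts [Complex.exp_ne_zero _, Complex.exp_ne_zero _]
  have hfam := (isLax_Lp η).fam (ξ := ξ) (fun k => Complex.exp_ne_zero _) hμ.lreg
  set L := laxL (Lp η) ξ (Complex.exp μ)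
  set N := laxN (Np η) ξ (Complex.exp μ)
  -- the inverse of the monodromy matrix on the quantum space
  have hQ : QOp η lam α μ X =
      (adL (fun k => site1 k (L k)) (fun k => site1 k (N k)) l (castM X)).map (wtr (wPlus η α)) := by
    have e := hfam.inverse_conj (c := fun k => lpre η (μ - lam k) ) (fun k => lpre_ne _ _) l
      (castM X) (monA (Lplus η) lam μ) (by
        rw [monA_eq]
        congr 1
        refine List.map_congr_left fun k _ => ?_
        rw [Lplus_eq, site1_smul, Complex.exp_sub]
        rfl)
    rw [← e]
    rfl
  set Y := (adL (fun k => site1 k (L k)) (fun k => site1 k (N k)) l (castM X)) with hY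
  set A := (l.map fun k => rr (Complex.exp η) (oξ (Complex.exp μ) ξ) none (some k)).prod with hA
  set A' := (l.reverse.map fun k => rri (Complex.exp η) (oξ (Complex.exp μ) ξ) none (some k)).prod
    with hA'
  have hR : toO (monR η lam μ) = A := monR_eq hμ.rmat
  have hR' : toO ((monR η lam μ)⁻¹) = A' := by
    have h1 : A * A' = 1 := list_prod_mul_inv fun k _ =>
      rr_mul_rri (Complex.exp_ne_zero η) hξ' (by simp) (hμ.rreg k)
    have : (monR η lam μ)⁻¹ = toO.symm A' := by
      refine Matrix.inv_eq_right_inv (toO.injective ?_)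
      rw [map_mul, AlgEquiv.apply_symm_apply, map_one, hR, h1]
    rw [this, AlgEquiv.apply_symm_apply]
  have hT : ∀ i s t, ((monR η lam μ)⁻¹ * ((1 : Matrix (Fin 2) (Fin 2) ℂ) ⊗ₖ QOp η lam α μ X) *
      monR η lam μ) (i, s) (i, t) = (kindH η α i).op η lam l μ X s t := by
    intro i s t
    have e1 : ((monR η lam μ)⁻¹ * ((1 : Matrix (Fin 2) (Fin 2) ℂ) ⊗ₖ QOp η lam α μ X) *
      monR η lam μ) (i, s) (i, t) = toO (S := ℂ) ((monR η lam μ)⁻¹ *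
        ((1 : Matrix (Fin 2) (Fin 2) ℂ) ⊗ₖ QOp η lam α μ X) * monR η lam μ)
        (ocons i s) (ocons i t) := rfl
    rw [e1, map_mul, map_mul, hR, hR', toO_snd, hQ]
    have e2 : embO (Y.map (wtr (wPlus η α))) = (embO Y).map (wtr (wPlus η α)) :=
      (emb_map some Y (wtr (wPlus η α))).symm
    rw [e2]
    have e3 : castM A' * embO Y * castM A =
        adL (vtx (Complex.exp η) (Complex.exp μ) ξ L) (vtxi (Complex.exp η) (Complex.exp μ) ξ N) l
          (embO (castM X)) := by
      rw [adL, vtx_prod _ _ hln, vtxi_prod _ _ (List.nodup_reverse.2 hln), hY, adL, map_mul,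
        map_mul]
      simp only [mul_assoc]
      rfl
    have e4 : A' * (embO Y).map (wtr (wPlus η α)) * A =
        (castM A' * embO Y * castM A).map (wtr (wPlus η α)) := by
      rw [map_mul_castM, map_castM_mul]
    refine (congrFun (congrFun e4 _) _).trans ?_
    rw [Matrix.map_apply, e3]
    simp only [Kind.op, genOp, pref, Matrix.of_apply, kindH, one_mul]
    rfl
  ext s t
  simp only [HOp, tOp, Matrix.of_apply, hT, Matrix.sum_apply]

end Link

/-! ### Simple poles -/

section Poles

variable {n : ℕ} {η : ℂ} {lam : Fin n → ℂ}

/-- Transfers the residue from `K.op` to an operator agreeing with it at regular spectral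
parameters; `Gen.sreg` shows that these fill a punctured neighbourhood of `λ_j`. -/
theorem Kind.pole (hG : Gen η lam) {K : Kind} (hK : K.Valid η) (j : Fin n) (X : SpinOp n)
    {f : ℂ → SpinOp n}
    (hf : ∀ μ, SpecReg η lam μ → f μ = K.op η lam (List.finRange n).reverse μ X) :
    HasSimplePole f (lam j) ∧
      simpleResidue f (lam j) = K.res η lam (List.finRange n).reverse j X := by
  have h := (Kind.tendsto_res hG hK (List.nodup_reverse.2 (List.nodup_finRange n)) j X).congr'
    (f₂ := fun μ => (μ - lam j) • f μ)
    ((hG.sreg j).mono fun μ hμ => by dsimp only; rw [hf μ hμ])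
  exact ⟨⟨_, h⟩, h.limUnder_eq⟩

theorem cOp_pole (hG : Gen η lam) (α : ℂ) (j : Fin n) (X : SpinOp n) :
    HasSimplePole (fun μ => cOp η lam α μ X) (lam j) ∧
      simpleResidue (fun μ => cOp η lam α μ X) (lam j) =
        (kindC η α).res η lam (List.finRange n).reverse j X :=
  Kind.pole hG (kindC_valid η α) j X fun _ hμ => cOp_eq hμ α X

theorem bOp_pole (hG : Gen η lam) (α : ℂ) (j : Fin n) (X : SpinOp n) :
    HasSimplePole (fun μ => bOp η lam α μ X) (lam j) ∧
      simpleResidue (fun μ => bOp η lam α μ X) (lam j) =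
        (kindB η α).res η lam (List.finRange n).reverse j X :=
  Kind.pole hG (kindB_valid η α) j X fun _ hμ => bOp_eq hμ α X

theorem HOp_pole (hG : Gen η lam) (α : ℂ) (j : Fin n) (X : SpinOp n) :
    HasSimplePole (fun μ => HOp η lam α μ X) (lam j) ∧
      simpleResidue (fun μ => HOp η lam α μ X) (lam j) =
        ∑ i, (kindH η α i).res η lam (List.finRange n).reverse j X := by
  have h := (tendsto_finsetSum Finset.univ fun i _ =>
    Kind.tendsto_res hG (kindH_valid η α i)
      (List.nodup_reverse.2 (List.nodup_finRange n)) j X).congr'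
    (f₂ := fun μ => (μ - lam j) • HOp η lam α μ X)
    ((hG.sreg j).mono fun μ hμ => by dsimp only; rw [HOp_eq hμ, Finset.smul_sum])
  exact ⟨⟨_, h⟩, h.limUnder_eq⟩

end Poles

/-! ### Entries in a subalgebra -/

section EntriesIn

variable {ι S : Type*} [Fintype ι] [DecidableEq ι] [Ring S] [Algebra ℂ S]

/-- All entries belong to the subalgebra `𝒜`. -/
def EntriesIn {κ : Type*} (𝒜 : Subalgebra ℂ S) (Z : Matrix κ κ S) : Prop := ∀ s t, Z s t ∈ 𝒜

variable {𝒜 : Subalgebra ℂ S}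

theorem EntriesIn.mul {κ : Type*} [Fintype κ] {Z W : Matrix κ κ S} (hZ : EntriesIn 𝒜 Z)
    (hW : EntriesIn 𝒜 W) : EntriesIn 𝒜 (Z * W) := fun s t => by
  rw [Matrix.mul_apply]
  exact Subalgebra.sum_mem _ fun r _ => 𝒜.mul_mem (hZ s r) (hW r t)

theorem EntriesIn.one {κ : Type*} [Fintype κ] [DecidableEq κ] :
    EntriesIn 𝒜 (1 : Matrix κ κ S) := fun s t => by
  rw [Matrix.one_apply]
  split_ifs
  exacts [𝒜.one_mem, 𝒜.zero_mem]

theorem EntriesIn.smul {κ : Type*} {Z : Matrix κ κ S} (hZ : EntriesIn 𝒜 Z) (c : ℂ) :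
    EntriesIn 𝒜 (c • Z) := fun s t => 𝒜.smul_mem (hZ s t) c

theorem EntriesIn.list_prod {κ : Type*} [Fintype κ] [DecidableEq κ] {l : List (Matrix κ κ S)}
    (h : ∀ Z ∈ l, EntriesIn 𝒜 Z) : EntriesIn 𝒜 l.prod := by
  induction l with
  | nil => exact EntriesIn.one
  | cons Z l ih =>
    rw [List.prod_cons]
    exact (h Z (by simp)).mul (ih fun W hW => h W (by simp [hW]))

theorem EntriesIn.castM (X : SiteMat ι ℂ) : EntriesIn 𝒜 (castM (S := S) X) := fun s t => by
  rw [castM_apply]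
  exact 𝒜.algebraMap_mem _

theorem EntriesIn.site1 {m : Matrix (Fin 2) (Fin 2) S} (h : EntriesIn 𝒜 m) (j : ι) :
    EntriesIn 𝒜 (site1 j m) := fun s t => by
  rw [site1_apply]
  split_ifs
  exacts [h _ _, 𝒜.zero_mem]

theorem EntriesIn.adL {κ : Type*} {X Xi : κ → SiteMat ι S} {l : List κ} {Z : SiteMat ι S}
    (hX : ∀ k, EntriesIn 𝒜 (X k)) (hXi : ∀ k, EntriesIn 𝒜 (Xi k)) (hZ : EntriesIn 𝒜 Z) :
    EntriesIn 𝒜 (adL X Xi l Z) := by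
  refine ((EntriesIn.list_prod ?_).mul hZ).mul (EntriesIn.list_prod ?_) <;>
    simp only [List.mem_map] <;> rintro _ ⟨k, -, rfl⟩
  exacts [hXi k, hX k]

theorem entriesIn_Lh {q z : ℂ} {u v x a : S} (hu : u ∈ 𝒜) (hv : v ∈ 𝒜) (hx : x ∈ 𝒜) (ha : a ∈ 𝒜) :
    EntriesIn 𝒜 (Lh q z u v x a) := by
  intro i j
  fin_cases i <;> fin_cases j
  · exact hu
  · exact 𝒜.neg_mem (𝒜.smul_mem (𝒜.mul_mem hx hv) _)
  · exact 𝒜.neg_mem (𝒜.smul_mem (𝒜.mul_mem ha hu) _)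
  · exact 𝒜.sub_mem hv (𝒜.smul_mem hu _)

theorem entriesIn_Nh {z : ℂ} {u v x a : S} (hu : u ∈ 𝒜) (hv : v ∈ 𝒜) (hx : x ∈ 𝒜) (ha : a ∈ 𝒜) :
    EntriesIn 𝒜 (Nh z u v x a) := by
  intro i j
  fin_cases i <;> fin_cases j
  · exact 𝒜.sub_mem hv (𝒜.smul_mem hu _)
  · exact 𝒜.smul_mem (𝒜.mul_mem hv hx) _
  · exact 𝒜.smul_mem (𝒜.mul_mem hu ha) _
  · exact hu

/-- At `z = 1` the matrix has rank one: the column `(1, -a)` times the row `(u, -x v)`. In the same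
way `Nh_one` is the column `(v x, u)` times the row `(a, 1)`. -/
theorem Lh_one {q : ℂ} {u v x a : S} (h : IsOsc q u v x a) :
    Lh q 1 u v x a = !![u, -(x * v); -(a * u), a * x * v] := by
  ext i j
  fin_cases i <;> fin_cases j <;> simp [Lh, h.ax, sub_mul, mul_assoc, h.uv]

theorem Nh_one {q : ℂ} {u v x a : S} (h : IsOsc q u v x a) :
    Nh 1 u v x a = !![v * x * a, v * x; u * a, u] := by
  ext i j
  fin_cases i <;> fin_cases j <;> simp [Nh, h.xa, mul_sub, mul_assoc, h.vu', h.vu]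

/-- For a functional that is cyclic on the oscillator algebra, the contribution of the site at the
degenerate point vanishes. -/
theorem trace_degenerate {q : ℂ} {u v x a : S} (h : IsOsc q u v x a) (hv : v ∈ 𝒜)
    (hx : x ∈ 𝒜) (ha : a ∈ 𝒜) {φ : S →ₗ[ℂ] ℂ} (cu : ∀ z ∈ 𝒜, φ (u * z) = φ (z * u))
    (cx : ∀ z ∈ 𝒜, φ (x * z) = φ (z * x)) {Y : Matrix (Fin 2) (Fin 2) S} (hY : EntriesIn 𝒜 Y) :
    φ (Nh 1 u v x a * Y * Lh q 1 u v x a).trace = 0 := by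
  rw [Lh_one h, Nh_one h]
  -- `W` is `Y` contracted with the row `(a, 1)` of `Nh 1` and the column `(1, -a)` of `Lh 1`; the
  -- remaining factors are brought together by cyclicity.
  set W := a * Y 0 0 + Y 1 0 - a * Y 0 1 * a - Y 1 1 * a with hW
  have hWm : W ∈ 𝒜 := 𝒜.sub_mem (𝒜.sub_mem (𝒜.add_mem (𝒜.mul_mem ha (hY _ _)) (hY _ _))
    (𝒜.mul_mem (𝒜.mul_mem ha (hY _ _)) ha)) (𝒜.mul_mem (hY _ _) ha)
  have e : (!![v * x * a, v * x; u * a, u] * Y * !![u, -(x * v); -(a * u), a * x * v] :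
      Matrix (Fin 2) (Fin 2) S).trace = v * x * W * u - u * (W * x * v) := by
    simp only [Matrix.trace, Matrix.diag, Fin.sum_univ_two, Matrix.mul_apply, hW]
    simp
    noncomm_ring
  rw [e, map_sub, ← cu _ (𝒜.mul_mem (𝒜.mul_mem hv hx) hWm), cu _ (𝒜.mul_mem (𝒜.mul_mem hWm hx) hv)]
  rw [show u * (v * x * W) = x * W by simp only [mul_assoc, h.uv'], mul_assoc (W * x), h.vu, mul_one,
    cx _ hWm, sub_self]

end EntriesIn

/-! ### Regularity of `H` -/

theorem qD_mem_oscAlg (η : ℂ) : qD η 1 ∈ oscAlg η := Algebra.subset_adjoin (by simp)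
theorem qD_neg_mem_oscAlg (η : ℂ) : qD η (-1) ∈ oscAlg η := Algebra.subset_adjoin (by simp)
theorem oscAstar_mem_oscAlg (η : ℂ) : oscAstar ∈ oscAlg η := Algebra.subset_adjoin (by simp)
theorem oscA_mem_oscAlg (η : ℂ) : oscA η ∈ oscAlg η := Algebra.subset_adjoin (by simp)

theorem entriesIn_Lp (η z : ℂ) : EntriesIn (oscAlg η) (Lp η z) :=
  entriesIn_Lh (qD_mem_oscAlg η) (qD_neg_mem_oscAlg η) (oscAstar_mem_oscAlg η) (oscA_mem_oscAlg η)

theorem entriesIn_Np (η z : ℂ) : EntriesIn (oscAlg η) (Np η z) :=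
  entriesIn_Nh (qD_mem_oscAlg η) (qD_neg_mem_oscAlg η) (oscAstar_mem_oscAlg η) (oscA_mem_oscAlg η)

/-- The functional that takes the coefficient of `q^{0·D}`. -/
def wZero (m : ℤ) : ℂ := if m = 0 then 1 else 0

/-- The difference equation with `A = 1` is nontrivial only at `m = 0` and `m = -2`. -/
theorem wZero_oscAstar {η : ℂ} {z : OscEnd} (hz : z ∈ oscAlg η) :
    wtr wZero (oscAstar * z) = wtr wZero (z * oscAstar) := by
  refine (wtr_oscAstar_comm η (A := 1) (fun m => ?_) hz).trans (one_mul _)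
  simp only [wZero]
  by_cases h0 : m = 0
  · subst h0; norm_num
  · by_cases h2 : m = -2
    · subst h2
      norm_num
      rw [← Complex.exp_add]
      ring_nf
      simp
    · rw [if_neg h0, if_neg (by omega)]; simp

/-- The weighted trace has at `α = 0` only the pole coming from the coefficient of `q^{0·D}`. -/
theorem tendsto_wPlus {η : ℂ} (hq : ∀ m : ℤ, m ≠ 0 → Complex.exp (η * m) ≠ 1) {z : OscEnd}
    (hz : wtr wZero z = 0) :
    ∃ c, Tendsto (fun α => wtr (wPlus η α) z) (𝓝[≠] 0) (𝓝 c) := by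
  have h0 : (diagL z).coeff 0 = 0 := by
    have : wtr wZero z = ((diagL z).coeff).sum fun m c => c * wZero m := rfl
    rw [this, Finsupp.sum, Finset.sum_eq_single 0] at hz
    · simpa [wZero] using hz
    · intro m _ hm; simp [wZero, hm]
    · intro h; simp at h; simp [h]
  refine ⟨_, tendsto_finsetSum (diagL z).coeff.support (a := fun m => (diagL z).coeff m *
    wPlus η 0 m) fun m hm => ?_⟩
  refine Tendsto.const_mul _ ?_
  have hm0 : m ≠ 0 := by
    rintro rfl
    simp [h0] at hm
  have hc : ContinuousAt (fun α => wPlus η α m) 0 := by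
    unfold wPlus
    refine ContinuousAt.inv₀ (by fun_prop) ?_
    rw [mul_zero, zero_add]
    exact sub_ne_zero.2 (hq m hm0).symm
  exact hc.tendsto.mono_left nhdsWithin_le_nhds

/-- Summing the diagonal elements at `j` gives a `2 × 2` trace, the form required by
`trace_degenerate`. -/
theorem sum_pe_site1 {ι S : Type*} [Fintype ι] [DecidableEq ι] [Ring S] [Algebra ℂ S] (j : ι)
    (m m' : Matrix (Fin 2) (Fin 2) S) (Y : SiteMat ι S) (s t : ι → Fin 2) :
    ∑ i, pe j i i (site1 j m * Y * site1 j m') s t = if s j = t j then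
      (m * Matrix.of (fun b c => Y (Function.update s j b) (Function.update t j c)) * m').trace
      else 0 := by
  simp only [pe, Matrix.of_apply]
  by_cases h : s j = t j
  · simp only [h, if_true, mul_site1_apply, site1_mul_apply]
    simp only [Matrix.trace, Matrix.diag, Matrix.mul_apply, Function.update_self, Function.update_idem, Matrix.of_apply]
  · simp [h]

/-! ### Finiteness of the residues of `H` at `α = 0`. -/

section Link

variable {ι : Type*} [Fintype ι] [DecidableEq ι] {η : ℂ} {lam : ι → ℂ}

/-- The pole coefficient of each entry is `wtr wZero` of a trace at the degenerate point `z = 1`,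
which vanishes by `trace_degenerate`. -/
theorem tendsto_sum_core_kindH (hq : ∀ m : ℤ, m ≠ 0 → Complex.exp (η * m) ≠ 1) (l : List ι) (j : ι)
    (X : SiteMat ι ℂ) :
    ∃ Z, Tendsto (fun α => ∑ i, (kindH η α i).core lam l j X) (𝓝[≠] 0) (𝓝 Z) := by
  set Y : SiteMat ι OscEnd :=
    adL (fun k => site1 k (laxL (Lp η) (fun k => Complex.exp (lam k)) (Complex.exp (lam j)) k))
      (fun k => site1 k (laxN (Np η) (fun k => Complex.exp (lam k)) (Complex.exp (lam j)) k)) l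
      (castM X) with hY
  have hYm : EntriesIn (oscAlg η) Y := EntriesIn.adL (fun k => (entriesIn_Lp _ _).site1 _)
    (fun k => ((entriesIn_Np _ _).smul _).site1 _) (EntriesIn.castM X)
  have key : ∀ s t : ι → Fin 2, ∃ c, Tendsto (fun α =>
      (∑ i, (kindH η α i).core lam l j X) s t) (𝓝[≠] 0) (𝓝 c) := by
    intro s t
    have e : ∀ α, (∑ i, (kindH η α i).core lam l j X) s t = wtr (wPlus η α)
        (∑ i, pe j i i (site1 j (Np η 1) * Y * site1 j (Lp η 1)) s t) := by
      intro α
      rw [map_sum, Matrix.sum_apply]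
      refine Finset.sum_congr rfl fun i _ => ?_
      exact one_mul _
    simp only [e]
    refine tendsto_wPlus hq ?_
    have e2 := sum_pe_site1 j (Np η 1) (Lp η 1) Y s t
    refine (congrArg (wtr wZero) e2).trans ?_
    split_ifs
    · exact trace_degenerate (𝒜 := oscAlg η) (isOsc η) (qD_neg_mem_oscAlg η)
        (oscAstar_mem_oscAlg η) (oscA_mem_oscAlg η) (φ := wtr wZero)
        (fun z hz => wtr_qD_comm η wZero 1 hz) (fun z hz => wZero_oscAstar hz)
        fun b c => hYm _ _
    · exact map_zero _
  choose c hc using key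
  exact ⟨Matrix.of c, tendsto_pi_nhds.2 fun s => tendsto_pi_nhds.2 fun t => hc s t⟩

theorem Kind.res_mem (hG : Gen η lam) {K : Kind} (hK : K.Valid η) {l₁ l₂ : List ι} {j : ι}
    (hl : (l₁ ++ j :: l₂).Nodup) (X : SiteMat ι ℂ) :
    K.res η lam (l₁ ++ j :: l₂) j X = rL (Complex.exp η) (fun k => Complex.exp (lam k)) l₂ j *
      ((-(1 / 2) : ℂ) • (rLi (Complex.exp η) (fun k => Complex.exp (lam k)) (l₁ ++ l₂) j *
        K.core lam (l₁ ++ l₂) j (rLi (Complex.exp η) (fun k => Complex.exp (lam k)) l₂ j * X *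
          rL (Complex.exp η) (fun k => Complex.exp (lam k)) l₂ j) *
        rL (Complex.exp η) (fun k => Complex.exp (lam k)) (l₁ ++ l₂) j)) *
      rLi (Complex.exp η) (fun k => Complex.exp (lam k)) l₂ j := by
  have hl' : (l₁ ++ l₂ ++ [j]).Nodup := by
    rw [List.append_assoc]
    exact (List.Perm.nodup_iff (List.Perm.append_left l₁
      (List.perm_append_comm (l₁ := [j]) (l₂ := l₂)))).1 hl
  rw [Kind.res_move hG hK hl, Kind.res_last hG hK hl']

theorem tendsto_sum_conj {κ : Type*} {F : Filter ℂ} {s : Finset κ} {f g : ℂ → κ → SiteMat ι ℂ}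
    {Z A B A' B' : SiteMat ι ℂ} {c : ℂ} (hf : Tendsto (fun α => ∑ i ∈ s, f α i) F (𝓝 Z))
    (hg : ∀ α i, g α i = A * (c • (A' * f α i * B')) * B) :
    Tendsto (fun α => ∑ i ∈ s, g α i) F (𝓝 (A * (c • (A' * Z * B')) * B)) := by
  have hc' : ∀ A B : SiteMat ι ℂ, Continuous fun Y : SiteMat ι ℂ => A * Y * B := fun A B =>
    (continuous_const.matrix_mul continuous_id).matrix_mul continuous_const
  have hc : Continuous fun Y : SiteMat ι ℂ => A * (c • (A' * Y * B')) * B :=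
    (hc' A B).comp ((continuous_const_smul c).comp (hc' A' B'))
  refine ((hc.tendsto Z).comp hf).congr fun α => ?_
  simp only [Function.comp_apply, hg, Finset.mul_sum, Finset.sum_mul, Finset.smul_sum]

/-- The residues of `H` are regular at `α = 0`. -/
theorem tendsto_sum_res_kindH (hG : Gen η lam)
    (hq : ∀ m : ℤ, m ≠ 0 → Complex.exp (η * m) ≠ 1) {l : List ι} (hl : l.Nodup) (j : ι)
    (X : SiteMat ι ℂ) :
    ∃ Z, Tendsto (fun α => ∑ i, (kindH η α i).res η lam l j X) (𝓝[≠] 0) (𝓝 Z) := by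
  by_cases hj : j ∈ l
  · obtain ⟨l₁, l₂, rfl⟩ := List.append_of_mem hj
    obtain ⟨Z, hZ⟩ := tendsto_sum_core_kindH (lam := lam) hq (l₁ ++ l₂) j
      (rLi (Complex.exp η) (fun k => Complex.exp (lam k)) l₂ j * X *
        rL (Complex.exp η) (fun k => Complex.exp (lam k)) l₂ j)
    have h1 := tendsto_sum_conj (f := fun α i => (kindH η α i).core lam (l₁ ++ l₂) j
      (rLi (Complex.exp η) (fun k => Complex.exp (lam k)) l₂ j * X *
        rL (Complex.exp η) (fun k => Complex.exp (lam k)) l₂ j)) (s := Finset.univ)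
      (g := fun α i => (kindH η α i).res η lam (l₁ ++ j :: l₂) j X) hZ
      fun α i => Kind.res_mem hG (kindH_valid η α i) hl X
    exact ⟨_, h1⟩
  · exact ⟨0, tendsto_const_nhds.congr fun α =>
      (Finset.sum_eq_zero fun i _ => Kind.res_not_mem hG (kindH_valid η α i) hj X).symm⟩

end Link

/-! ### A vanishing criterion for twisted traces -/

section TwoOsc

variable {S : Type*} [Ring S] [Algebra ℂ S]

/-- The relations satisfied by the entries of the product of two Lax operators. -/
structure IsTwo (q ξ₁ ξ₂ : ℂ) (F e a : S) (K : ℤ → S) : Prop where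
  K_zero : K 0 = 1
  K_mul : ∀ m k, K m * K k = K (m + k)
  KF : ∀ m, K m * F = q ^ m • (F * K m)
  Ka : ∀ m, K m * a = q ^ (-m) • (a * K m)
  Ke : ∀ m, K m * e = q ^ (-m) • (e * K m)
  ea : e * a = q • (a * e)
  aF : a * F = q • (F * a) + (ξ₁ * (1 - q ^ 2)) • K (-1)
  eF : e * F = q ^ (-2 : ℤ) • (F * e) + (ξ₂ * (q - q⁻¹)) • 1

variable {q ξ₁ ξ₂ : ℂ} {F e a : S} {K : ℤ → S}

namespace IsTwo

theorem K_pow {y : S} {c : ℂ} {m : ℤ} (hy : K m * y = c • (y * K m)) (j : ℕ) :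
    K m * y ^ j = c ^ j • (y ^ j * K m) := by
  induction j with
  | zero => simp
  | succ j ih =>
    rw [pow_succ, ← mul_assoc, ih, smul_mul_assoc, mul_assoc, hy, mul_smul_comm, smul_smul,
      mul_assoc, pow_succ]

theorem e_apow (h : IsTwo q ξ₁ ξ₂ F e a K) (j : ℕ) : e * a ^ j = q ^ j • (a ^ j * e) := by
  induction j with
  | zero => simp
  | succ j ih =>
    rw [pow_succ, ← mul_assoc, ih, smul_mul_assoc, mul_assoc, h.ea, mul_smul_comm, smul_smul,
      mul_assoc, pow_succ]

end IsTwo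

/-- The span of the monomials without `F`. -/
def lowSpan (e a : S) (K : ℤ → S) : Submodule ℂ S :=
  Submodule.span ℂ {z | ∃ (j k : ℕ) (m : ℤ), z = a ^ j * e ^ k * K m}

theorem mem_lowSpan (e a : S) (K : ℤ → S) (j k : ℕ) (m : ℤ) : a ^ j * e ^ k * K m ∈ lowSpan e a K :=
  Submodule.subset_span ⟨j, k, m, rfl⟩

theorem lowSpan_induction {e a : S} {K : ℤ → S} {p : S → Prop}
    (h0 : p 0) (hadd : ∀ x y, p x → p y → p (x + y)) (hsmul : ∀ (c : ℂ) x, p x → p (c • x))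
    (hm : ∀ j k m, p (a ^ j * e ^ k * K m)) {z : S} (hz : z ∈ lowSpan e a K) : p z := by
  induction hz using Submodule.span_induction with
  | zero => exact h0
  | add x y _ _ hx hy => exact hadd x y hx hy
  | smul c x _ hx => exact hsmul c x hx
  | mem x hx => obtain ⟨j, k, m, rfl⟩ := hx; exact hm j k m

/-- The span of the monomials with `F` to the left. -/
def fullSpan (F e a : S) (K : ℤ → S) : Submodule ℂ S :=
  Submodule.span ℂ {z | ∃ (i : ℕ) (y : S), y ∈ lowSpan e a K ∧ z = F ^ i * y}

theorem mem_fullSpan (i : ℕ) {y : S} (hy : y ∈ lowSpan e a K) :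
    F ^ i * y ∈ fullSpan F e a K := Submodule.subset_span ⟨i, y, hy, rfl⟩

theorem mul_fullSpan {g : S}
    (hg : ∀ (i : ℕ) (y : S), y ∈ lowSpan e a K → g * (F ^ i * y) ∈ fullSpan F e a K) {z : S}
    (hz : z ∈ fullSpan F e a K) : g * z ∈ fullSpan F e a K := by
  induction hz using Submodule.span_induction with
  | zero => simp
  | add x y _ _ hx hy => rw [mul_add]; exact Submodule.add_mem _ hx hy
  | smul c x _ hx => rw [mul_smul_comm]; exact Submodule.smul_mem _ _ hx
  | mem x hx => obtain ⟨i, y, hy, rfl⟩ := hx; exact hg i y hy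

theorem F_mul_full {z : S} (hz : z ∈ fullSpan F e a K) : F * z ∈ fullSpan F e a K :=
  mul_fullSpan (fun i y hy => by rw [← mul_assoc, ← pow_succ']; exact mem_fullSpan _ hy) hz

namespace IsTwo

theorem a_mul_low {z : S} (hz : z ∈ lowSpan e a K) : a * z ∈ lowSpan e a K := by
  refine lowSpan_induction (p := fun z => a * z ∈ lowSpan e a K) (by simp)
    (fun x y hx hy => by rw [mul_add]; exact Submodule.add_mem _ hx hy)
    (fun c x hx => by rw [mul_smul_comm]; exact Submodule.smul_mem _ _ hx) (fun j k m => ?_) hz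
  rw [← mul_assoc, ← mul_assoc, ← pow_succ']
  exact mem_lowSpan _ _ _ _ _ _

theorem e_mul_low (h : IsTwo q ξ₁ ξ₂ F e a K) {z : S}
    (hz : z ∈ lowSpan e a K) : e * z ∈ lowSpan e a K := by
  refine lowSpan_induction (p := fun z => e * z ∈ lowSpan e a K) (by simp)
    (fun x y hx hy => by rw [mul_add]; exact Submodule.add_mem _ hx hy)
    (fun c x hx => by rw [mul_smul_comm]; exact Submodule.smul_mem _ _ hx) (fun j k m => ?_) hz
  rw [← mul_assoc, ← mul_assoc, h.e_apow, smul_mul_assoc, smul_mul_assoc, mul_assoc (a ^ j) e,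
    ← pow_succ']
  exact Submodule.smul_mem _ _ (mem_lowSpan _ _ _ _ _ _)

theorem K_mul_low (h : IsTwo q ξ₁ ξ₂ F e a K) (m : ℤ)
    {z : S} (hz : z ∈ lowSpan e a K) : K m * z ∈ lowSpan e a K := by
  refine lowSpan_induction (p := fun z => K m * z ∈ lowSpan e a K) (by simp)
    (fun x y hx hy => by rw [mul_add]; exact Submodule.add_mem _ hx hy)
    (fun c x hx => by rw [mul_smul_comm]; exact Submodule.smul_mem _ _ hx) (fun j k n => ?_) hz
  rw [mul_assoc, ← mul_assoc, IsTwo.K_pow (h.Ka m) j, smul_mul_assoc, mul_assoc, ← mul_assoc (K m),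
    IsTwo.K_pow (h.Ke m) k, smul_mul_assoc, mul_assoc, h.K_mul, mul_smul_comm, ← mul_assoc]
  exact Submodule.smul_mem _ _ (Submodule.smul_mem _ _ (mem_lowSpan _ _ _ _ _ _))

/-- `F` can be moved through the monomials without `F`. -/
theorem low_mul_F (h : IsTwo q ξ₁ ξ₂ F e a K) (hq : q ≠ 0)
    (j k : ℕ) (m : ℤ) : ∃ c : ℤ, ∃ y ∈ lowSpan e a K,
    a ^ j * e ^ k * K m * F = q ^ c • (F * (a ^ j * e ^ k * K m)) + y := by
  induction j with
  | zero =>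
    induction k with
    | zero => exact ⟨m, 0, Submodule.zero_mem _, by simp [h.KF]⟩
    | succ k ih =>
      obtain ⟨c, y, hy, hc⟩ := ih
      refine ⟨c - 2, q ^ c • (ξ₂ * (q - q⁻¹)) • (a ^ 0 * e ^ k * K m) + e * y,
        Submodule.add_mem _ (Submodule.smul_mem _ _ (Submodule.smul_mem _ _
          (mem_lowSpan _ _ _ _ _ _))) (h.e_mul_low hy), ?_⟩
      simp only [pow_zero, one_mul] at hc ⊢
      rw [pow_succ', mul_assoc, mul_assoc, ← mul_assoc (e ^ k), hc, mul_add, mul_smul_comm,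
        ← mul_assoc e F, h.eF, sub_eq_add_neg c, zpow_add₀ hq]
      simp only [add_mul, smul_mul_assoc, one_mul, smul_add, smul_smul, mul_assoc]
      abel
  | succ j ih =>
    obtain ⟨c, y, hy, hc⟩ := ih
    refine ⟨c + 1, q ^ c • (ξ₁ * (1 - q ^ 2)) • (K (-1) * (a ^ j * e ^ k * K m)) + a * y,
      Submodule.add_mem _ (Submodule.smul_mem _ _ (Submodule.smul_mem _ _
        (h.K_mul_low _ (mem_lowSpan _ _ _ _ _ _)))) (IsTwo.a_mul_low hy), ?_⟩
    rw [pow_succ', mul_assoc a, mul_assoc a, mul_assoc a, hc, mul_add, mul_smul_comm,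
      ← mul_assoc a F, h.aF, zpow_add₀ hq, zpow_one]
    simp only [add_mul, smul_mul_assoc, smul_add, smul_smul, mul_assoc]
    abel

theorem K_mul_full (h : IsTwo q ξ₁ ξ₂ F e a K) (m : ℤ)
    {z : S} (hz : z ∈ fullSpan F e a K) : K m * z ∈ fullSpan F e a K :=
  mul_fullSpan (fun i y hy => by
    rw [← mul_assoc, IsTwo.K_pow (h.KF m), smul_mul_assoc, mul_assoc]
    exact Submodule.smul_mem _ _ (mem_fullSpan _ (h.K_mul_low m hy))) hz

theorem a_mul_full (h : IsTwo q ξ₁ ξ₂ F e a K) {z : S}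
    (hz : z ∈ fullSpan F e a K) : a * z ∈ fullSpan F e a K := by
  refine mul_fullSpan (fun i => ?_) hz
  induction i with
  | zero =>
    intro y hy
    rw [pow_zero, one_mul]
    simpa using mem_fullSpan (F := F) 0 (IsTwo.a_mul_low hy)
  | succ i ih =>
    intro y hy
    rw [pow_succ', mul_assoc, ← mul_assoc, h.aF, add_mul, smul_mul_assoc, smul_mul_assoc, mul_assoc]
    exact Submodule.add_mem _ (Submodule.smul_mem _ _ (F_mul_full (ih y hy)))
      (Submodule.smul_mem _ _ (h.K_mul_full _ (mem_fullSpan i hy)))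

theorem e_mul_full (h : IsTwo q ξ₁ ξ₂ F e a K) {z : S}
    (hz : z ∈ fullSpan F e a K) : e * z ∈ fullSpan F e a K := by
  refine mul_fullSpan (fun i => ?_) hz
  induction i with
  | zero =>
    intro y hy
    rw [pow_zero, one_mul]
    simpa using mem_fullSpan (F := F) 0 (h.e_mul_low hy)
  | succ i ih =>
    intro y hy
    rw [pow_succ', mul_assoc, ← mul_assoc, h.eF, add_mul, smul_mul_assoc, smul_mul_assoc, mul_assoc,
      one_mul]
    exact Submodule.add_mem _ (Submodule.smul_mem _ _ (F_mul_full (ih y hy)))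
      (Submodule.smul_mem _ _ (mem_fullSpan i hy))

/-- A functional that is twisted-cyclic for `F` and vanishes on the monomials without `F`
vanishes. -/
theorem functional_eq_zero (h : IsTwo q ξ₁ ξ₂ F e a K) (hq : q ≠ 0)
    {𝒜 : Subalgebra ℂ S}
    (h𝒜 : 𝒜 = Algebra.adjoin ℂ (insert F (insert e (insert a (Set.range K)))))
    {D : S →ₗ[ℂ] ℂ} {A : ℂ} (hA : ∀ m : ℤ, A * q ^ m ≠ 1)
    (hF : ∀ z ∈ 𝒜, D (F * z) = A * D (z * F))
    (h0 : ∀ (j k : ℕ) (m : ℤ), D (a ^ j * e ^ k * K m) = 0) {z : S} (hz : z ∈ 𝒜) : D z = 0 := by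
  have mF : F ∈ 𝒜 := h𝒜 ▸ Algebra.subset_adjoin (by simp)
  have me : e ∈ 𝒜 := h𝒜 ▸ Algebra.subset_adjoin (by simp)
  have ma : a ∈ 𝒜 := h𝒜 ▸ Algebra.subset_adjoin (by simp)
  have mK : ∀ m, K m ∈ 𝒜 := fun m => h𝒜 ▸ Algebra.subset_adjoin (by simp)
  have key : ∀ (i : ℕ) (y : S), y ∈ lowSpan e a K → D (F ^ i * y) = 0 := by
    intro i
    induction i with
    | zero =>
      intro y hy
      refine lowSpan_induction (p := fun y => D (F ^ 0 * y) = 0) (by simp)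
        (fun x y hx hy => by rw [mul_add, map_add, hx, hy, add_zero])
        (fun c x hx => by rw [mul_smul_comm, map_smul, hx, smul_zero]) (fun j k m => ?_) hy
      rw [pow_zero, one_mul, h0]
    | succ i ih =>
      intro y hy
      refine lowSpan_induction (p := fun y => D (F ^ (i + 1) * y) = 0) (by simp)
        (fun x y hx hy => by rw [mul_add, map_add, hx, hy, add_zero])
        (fun c x hx => by rw [mul_smul_comm, map_smul, hx, smul_zero]) (fun j k m => ?_) hy
      obtain ⟨c, y, hy, hc⟩ := h.low_mul_F hq j k m
      have hw := 𝒜.mul_mem (𝒜.mul_mem (𝒜.pow_mem ma j) (𝒜.pow_mem me k)) (mK m)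
      generalize a ^ j * e ^ k * K m = w at hc hw ⊢
      -- Twisted cyclicity moves one `F` from the front to the back, and `low_mul_F` brings it back
      -- through `w` with a factor `q^c`. The remainder carries only `F^i` and is killed by the
      -- induction hypothesis, leaving `(1 - A q^c) D(F^{i+1} w) = 0`.
      have e1 := hF (F ^ i * w) (𝒜.mul_mem (𝒜.pow_mem mF _) hw)
      rw [mul_assoc (F ^ i), hc, mul_add, mul_smul_comm, map_add, map_smul, ih y hy, add_zero,
        ← mul_assoc (F ^ i), ← pow_succ, ← mul_assoc F, ← pow_succ', smul_eq_mul] at e1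
      have e2 : (1 - A * q ^ c) * D (F ^ (i + 1) * w) = 0 := by
        linear_combination e1
      exact (mul_eq_zero.1 e2).resolve_left (sub_ne_zero.2 (hA c).symm)
  have hfull : z ∈ fullSpan F e a K := by
    have h1 : (1 : S) ∈ fullSpan F e a K := by
      have := mem_fullSpan (F := F) 0 (mem_lowSpan e a K 0 0 0)
      simpa [h.K_zero] using this
    have : ∀ y ∈ 𝒜, ∀ z ∈ fullSpan F e a K, y * z ∈ fullSpan F e a K := by
      intro y hy
      rw [h𝒜] at hy
      induction hy using Algebra.adjoin_induction with
      | mem g hg =>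
        intro z hz
        rcases hg with rfl | rfl | rfl | ⟨m, rfl⟩
        exacts [F_mul_full hz, h.e_mul_full hz, h.a_mul_full hz, h.K_mul_full m hz]
      | algebraMap c =>
        intro z hz
        rw [Algebra.algebraMap_eq_smul_one, smul_mul_assoc, one_mul]
        exact Submodule.smul_mem _ _ hz
      | add y y' _ _ h h' => intro z hz; rw [add_mul]; exact Submodule.add_mem _ (h z hz) (h' z hz)
      | mul y y' _ _ h h' => intro z hz; rw [mul_assoc]; exact h _ (h' z hz)
    simpa using this z hz 1 h1
  clear hz
  induction hfull using Submodule.span_induction with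
  | zero => simp
  | add x y _ _ hx hy => rw [map_add, hx, hy, add_zero]
  | smul c x _ hx => rw [map_smul, hx, smul_zero]
  | mem x hx => obtain ⟨i, y, hy, rfl⟩ := hx; exact key i y hy

end IsTwo

end TwoOsc

open scoped TensorProduct


/-! ### Two oscillators -/

section TwoOscillators

variable {S : Type*} [Ring S] [Algebra ℂ S]

/-- The `q`-oscillator relations, with all integral powers `p m` of `q^D`. -/
structure IsOscZ (q : ℂ) (p : ℤ → S) (x a : S) : Prop where
  p_zero : p 0 = 1
  p_mul : ∀ m k, p m * p k = p (m + k)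
  px : ∀ m, p m * x = q ^ m • (x * p m)
  pa : ∀ m, p m * a = q ^ (-m) • (a * p m)
  ax : a * x = 1 - q ^ 2 • p 2
  xa : x * a = 1 - p 2

variable {q : ℂ} {p : ℤ → S} {x a : S}

namespace IsOscZ

theorem p_mul' (h : IsOscZ q p x a) (m k : ℤ) (y : S) : p m * (p k * y) = p (m + k) * y := by
  rw [← mul_assoc, h.p_mul]

theorem px' (h : IsOscZ q p x a) (m : ℤ) (y : S) : p m * (x * y) = q ^ m • (x * (p m * y)) := by
  rw [← mul_assoc, h.px, smul_mul_assoc, mul_assoc]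

theorem pa' (h : IsOscZ q p x a) (m : ℤ) (y : S) :
    p m * (a * y) = q ^ (-m) • (a * (p m * y)) := by
  rw [← mul_assoc, h.pa, smul_mul_assoc, mul_assoc]

theorem ax' (h : IsOscZ q p x a) (y : S) : a * (x * y) = y - q ^ 2 • (p 2 * y) := by
  rw [← mul_assoc, h.ax, sub_mul, one_mul, smul_mul_assoc]

theorem xa' (h : IsOscZ q p x a) (y : S) : x * (a * y) = y - p 2 * y := by
  rw [← mul_assoc, h.xa, sub_mul, one_mul]

theorem isOsc (h : IsOscZ q p x a) : IsOsc q (p 1) (p (-1)) x a where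
  uv := by rw [h.p_mul, ← h.p_zero]; norm_num
  vu := by rw [h.p_mul, ← h.p_zero]; norm_num
  ux := by rw [h.px, zpow_one]
  ua := by rw [h.pa, zpow_neg, zpow_one]
  ax := by rw [h.ax, h.p_mul]; norm_num
  xa := by rw [h.xa, h.p_mul]; norm_num

end IsOscZ

/-- The generators of the algebra of two oscillators. -/
def twoF (ξ₁ ξ₂ : ℂ) (p : ℤ → S) (x a : S) : S ⊗[ℂ] S :=
  ξ₁ • ((x * p (-1)) ⊗ₜ p 1) + ξ₂ • (p 1 ⊗ₜ (a * p 1))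
def twoK (p : ℤ → S) (m : ℤ) : S ⊗[ℂ] S := p m ⊗ₜ p (-m)
def twoE (p : ℤ → S) (x : S) : S ⊗[ℂ] S := p (-1) ⊗ₜ (x * p (-1))
def twoA (a : S) : S ⊗[ℂ] S := a ⊗ₜ 1

/-- The generators in the graded module. -/
def grF (p : ℤ → S) (x : S) : S ⊗[ℂ] S := x ⊗ₜ p 1
def grK (q : ℂ) (p : ℤ → S) (m : ℤ) : S ⊗[ℂ] S := q ^ m • (p m ⊗ₜ p m)
def grE (q ξ₂ : ℂ) (p : ℤ → S) (a : S) : S ⊗[ℂ] S := (-(ξ₂ * q)) • ((a * p (-2)) ⊗ₜ p (-1))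
def grA (ξ₁ : ℂ) (p : ℤ → S) (a : S) : S ⊗[ℂ] S := ξ₁ • ((a * p (-1)) ⊗ₜ p (-2))

/-- The realisation arising from `b ∘ c`: the first tensor factor carries the oscillator of `c`, the
second that of `b`. -/
theorem isTwo_two (h : IsOscZ q p x a) (hq : q ≠ 0) (ξ₁ ξ₂ : ℂ) :
    IsTwo q ξ₁ ξ₂ (twoF ξ₁ ξ₂ p x a) (twoE p x) (twoA a) (twoK p) where
  K_zero := by simp [twoK, h.p_zero, Algebra.TensorProduct.one_def]
  K_mul m k := by
    simp only [twoK, Algebra.TensorProduct.tmul_mul_tmul, h.p_mul]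
    rw [neg_add]
  KF m := by
    simp only [twoK, twoF, Algebra.TensorProduct.tmul_mul_tmul, mul_add, add_mul, mul_smul_comm,
      smul_mul_assoc, smul_add, h.p_mul, h.px', h.pa', mul_assoc, TensorProduct.tmul_smul, neg_neg,
      ← TensorProduct.smul_tmul']
    rw [add_comm m, add_comm 1, add_comm m 1]
    match_scalars <;> ring
  Ka m := by
    simp only [twoK, twoA, Algebra.TensorProduct.tmul_mul_tmul, h.pa, one_mul, mul_one,
      ← TensorProduct.smul_tmul']
  Ke m := by
    simp only [twoK, twoE, Algebra.TensorProduct.tmul_mul_tmul, h.p_mul, h.px', mul_assoc,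
      TensorProduct.tmul_smul, add_comm]
  ea := by
    simp only [twoE, twoA, Algebra.TensorProduct.tmul_mul_tmul, h.pa, one_mul, mul_one,
      ← TensorProduct.smul_tmul']
    simp
  aF := by
    simp only [twoK, twoA, twoF, Algebra.TensorProduct.tmul_mul_tmul, mul_add, add_mul,
      mul_smul_comm, smul_mul_assoc, smul_add, h.p_mul, h.px', h.pa', h.pa, h.ax', h.xa', mul_assoc,
      TensorProduct.tmul_smul, ← TensorProduct.smul_tmul', TensorProduct.sub_tmul, one_mul, mul_one,
      smul_sub]
    norm_num
    match_scalars <;> field_simp <;> ring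
  eF := by
    simp only [twoE, twoF, Algebra.TensorProduct.tmul_mul_tmul, mul_add, add_mul,
      mul_smul_comm, smul_mul_assoc, smul_add, h.p_mul, h.px', h.px, h.pa', h.pa, h.ax', h.xa',
      mul_assoc, TensorProduct.tmul_smul, ← TensorProduct.smul_tmul', TensorProduct.tmul_sub,
      one_mul, mul_one, smul_sub]
    norm_num [h.p_zero, Algebra.TensorProduct.one_def]
    match_scalars <;> field_simp <;> ring

/-- A second realisation of the same relations, in which the second tensor factor is occupied only
by powers of `q^D`. -/
theorem isTwo_gr (h : IsOscZ q p x a) (hq : q ≠ 0) (ξ₁ ξ₂ : ℂ) :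
    IsTwo q ξ₁ ξ₂ (grF p x) (grE q ξ₂ p a) (grA ξ₁ p a) (grK q p) where
  K_zero := by simp [grK, h.p_zero, Algebra.TensorProduct.one_def]
  K_mul m k := by
    simp only [grK, Algebra.TensorProduct.tmul_mul_tmul, h.p_mul, smul_mul_smul_comm,
      zpow_add₀ hq]
  KF m := by
    simp only [grK, grF, Algebra.TensorProduct.tmul_mul_tmul, mul_smul_comm,
      smul_mul_assoc, h.p_mul, h.px, ← TensorProduct.smul_tmul', smul_smul, add_comm]
  Ka m := by
    simp only [grK, grA, Algebra.TensorProduct.tmul_mul_tmul, mul_smul_comm,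
      smul_mul_assoc, h.p_mul, h.pa', mul_assoc, ← TensorProduct.smul_tmul', smul_smul]
    rw [add_comm m, add_comm m]
    match_scalars
    field_simp
  Ke m := by
    simp only [grK, grE, Algebra.TensorProduct.tmul_mul_tmul, mul_smul_comm,
      smul_mul_assoc, h.p_mul, h.pa', mul_assoc, ← TensorProduct.smul_tmul', smul_smul]
    rw [add_comm m, add_comm m]
    match_scalars
    field_simp
  ea := by
    simp only [grE, grA, Algebra.TensorProduct.tmul_mul_tmul, mul_smul_comm,
      smul_mul_assoc, h.p_mul, h.pa', mul_assoc, ← TensorProduct.smul_tmul', smul_smul]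
    norm_num
    match_scalars <;> field_simp <;> ring
  aF := by
    simp only [grF, grA, grK, Algebra.TensorProduct.tmul_mul_tmul, mul_smul_comm, TensorProduct.sub_tmul,
      smul_mul_assoc, h.p_mul, h.px, h.ax', h.xa', mul_assoc, ← TensorProduct.smul_tmul', smul_smul,
      smul_sub]
    norm_num
    match_scalars <;> field_simp <;> ring
  eF := by
    simp only [grF, grE, grK, Algebra.TensorProduct.tmul_mul_tmul, mul_smul_comm, TensorProduct.sub_tmul,
      smul_mul_assoc, h.p_mul, h.px, h.ax', h.xa', mul_assoc, ← TensorProduct.smul_tmul', smul_smul,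
      smul_sub]
    norm_num [h.p_zero, Algebra.TensorProduct.one_def]
    match_scalars <;> field_simp <;> ring

/-- The product of the two Lax matrices in terms of the generators. -/
def twoL {R : Type*} [Ring R] [Algebra ℂ R] (q ξ₁ ξ₂ z : ℂ) (F e a K Ki : R) :
    Matrix (Fin 2) (Fin 2) R :=
  !![K - (z ^ 2) • (ξ₂ ^ 2 • K - (q⁻¹ * ξ₂) • (F * e * K)), -(z • F);
    -(z • (ξ₁ • (a * K) + ξ₂ • e)) + (z ^ 3 * ξ₁) •
      (ξ₂ ^ 2 • (a * K) - (q⁻¹ * ξ₂) • (a * F * e * K) + (ξ₁ * ξ₂) • e),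
    Ki - (z ^ 2) • (ξ₁ ^ 2 • Ki - ξ₁ • (a * F))]

/-- The product of the inverses of two Lax matrices in terms of the generators. -/
def twoN {R : Type*} [Ring R] [Algebra ℂ R] (q ξ₁ ξ₂ z : ℂ) (F e a K Ki : R) :
    Matrix (Fin 2) (Fin 2) R :=
  !![Ki - (z ^ 2 * q⁻¹ ^ 2) • (ξ₁ ^ 2 • Ki - ξ₁ • (a * F)), (z * q⁻¹) • F;
    (z * q⁻¹) • (ξ₁ • (a * K) + ξ₂ • e) - (z ^ 3 * q⁻¹ ^ 3 * ξ₁) •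
      (ξ₂ ^ 2 • (a * K) - (q⁻¹ * ξ₂) • (a * F * e * K) + (ξ₁ * ξ₂) • e),
    K - (z ^ 2 * q⁻¹ ^ 2) • (ξ₂ ^ 2 • K - (q⁻¹ * ξ₂) • (F * e * K))]

theorem twoL_map {R R' : Type*} [Ring R] [Algebra ℂ R] [Ring R'] [Algebra ℂ R'] (φ : R →ₐ[ℂ] R')
    (q ξ₁ ξ₂ z : ℂ) (F e a K Ki : R) :
    (twoL q ξ₁ ξ₂ z F e a K Ki).map φ = twoL q ξ₁ ξ₂ z (φ F) (φ e) (φ a) (φ K) (φ Ki) := by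
  ext i j
  fin_cases i <;> fin_cases j <;> simp [twoL]

theorem twoN_map {R R' : Type*} [Ring R] [Algebra ℂ R] [Ring R'] [Algebra ℂ R'] (φ : R →ₐ[ℂ] R')
    (q ξ₁ ξ₂ z : ℂ) (F e a K Ki : R) :
    (twoN q ξ₁ ξ₂ z F e a K Ki).map φ = twoN q ξ₁ ξ₂ z (φ F) (φ e) (φ a) (φ K) (φ Ki) := by
  ext i j
  fin_cases i <;> fin_cases j <;> simp [twoN]

theorem twoL_two (h : IsOscZ q p x a) (hq : q ≠ 0) (ξ₁ ξ₂ z : ℂ) :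
    (Lh q (ξ₁ * z) (p 1) (p (-1)) x a).map (Algebra.TensorProduct.includeLeft : S →ₐ[ℂ] S ⊗[ℂ] S) *
      (flip2 (Lh q (ξ₂ * z) (p 1) (p (-1)) x a)).map
        (Algebra.TensorProduct.includeRight : S →ₐ[ℂ] S ⊗[ℂ] S) =
      twoL q ξ₁ ξ₂ z (twoF ξ₁ ξ₂ p x a) (twoE p x) (twoA a) (twoK p 1) (twoK p (-1)) := by
  ext i j
  fin_cases i <;> fin_cases j <;>
    simp [Matrix.mul_apply, Fin.sum_univ_two, Lh, flip2, twoL, twoF, twoE, twoA, twoK,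
      mul_add, add_mul, mul_sub, sub_mul, smul_sub, smul_add, smul_smul, h.p_mul, h.p_mul', h.px', h.px,
      h.pa', h.pa, h.ax, h.ax', h.xa, h.xa', mul_assoc, TensorProduct.tmul_smul,
      ← TensorProduct.smul_tmul', TensorProduct.tmul_sub, TensorProduct.sub_tmul,
      TensorProduct.tmul_neg, TensorProduct.neg_tmul, h.p_zero] <;>
    match_scalars <;> field_simp <;> ring

theorem twoN_two (h : IsOscZ q p x a) (hq : q ≠ 0) (ξ₁ ξ₂ z : ℂ) :
    (flip2 (Nh (ξ₂ * z) (p 1) (p (-1)) x a)).map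
        (Algebra.TensorProduct.includeRight : S →ₐ[ℂ] S ⊗[ℂ] S) *
      (Nh (ξ₁ * z) (p 1) (p (-1)) x a).map (Algebra.TensorProduct.includeLeft : S →ₐ[ℂ] S ⊗[ℂ] S) =
      twoN q ξ₁ ξ₂ z (twoF ξ₁ ξ₂ p x a) (twoE p x) (twoA a) (twoK p 1) (twoK p (-1)) := by
  ext i j
  fin_cases i <;> fin_cases j <;>
    simp [Matrix.mul_apply, Fin.sum_univ_two, Nh, flip2, twoN, twoF, twoE, twoA, twoK,
      mul_add, add_mul, mul_sub, sub_mul, smul_sub, smul_add, smul_smul, h.p_mul, h.p_mul', h.px', h.px,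
      h.pa', h.pa, h.ax, h.ax', h.xa, h.xa', mul_assoc, TensorProduct.tmul_smul,
      ← TensorProduct.smul_tmul', TensorProduct.tmul_sub, TensorProduct.sub_tmul,
      TensorProduct.tmul_neg, TensorProduct.neg_tmul, h.p_zero] <;>
    match_scalars <;> field_simp <;> ring

/-- The Lax matrix of the graded module. -/
def vL (q ξ₁ ξ₂ z : ℂ) (u v x y : S) : Matrix (Fin 2) (Fin 2) S :=
  !![q • u - (z ^ 2 * ξ₂ ^ 2 * q) • v, -(z • x);
    -((z * q) • (y * ((ξ₁ ^ 2 + ξ₂ ^ 2) • 1 - ξ₁ ^ 2 • (u * u) - ξ₂ ^ 2 • (v * v)))),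
    q⁻¹ • v - (z ^ 2 * ξ₁ ^ 2 * q) • u]

/-- The numerator of the inverse of `vL`. -/
def vN (q ξ₁ ξ₂ z : ℂ) (u v x y : S) : Matrix (Fin 2) (Fin 2) S :=
  !![q⁻¹ • v - (z ^ 2 * ξ₁ ^ 2 * q⁻¹) • u, (z * q⁻¹) • x;
    z • (y * ((ξ₁ ^ 2 + ξ₂ ^ 2) • 1 - ξ₁ ^ 2 • (u * u) - ξ₂ ^ 2 • (v * v))),
    q • u - (z ^ 2 * ξ₂ ^ 2 * q⁻¹) • v]

/-- The powers of the central element of the graded module. -/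
def grT (p : ℤ → S) (m : ℤ) : S ⊗[ℂ] S := 1 ⊗ₜ p m

/-- In the graded realisation the second oscillator appears only through the powers `1 ⊗ q^{±D}`,
which commute with the first factor and split off as a diagonal matrix. What remains is one Lax
matrix over a quantum torus, with `a = y (1 - q^{2D})`. -/
theorem twoL_gr (h : IsOscZ q p x a) (hq : q ≠ 0) {y : S} (hy : a = y * (1 - p 2)) (ξ₁ ξ₂ z : ℂ) :
    twoL q ξ₁ ξ₂ z (grF p x) (grE q ξ₂ p a) (grA ξ₁ p a) (grK q p 1) (grK q p (-1)) =
      !![grT p 1, 0; 0, grT p (-1)] * (vL q ξ₁ ξ₂ z (p 1) (p (-1)) x y).map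
        (Algebra.TensorProduct.includeLeft : S →ₐ[ℂ] S ⊗[ℂ] S) := by
  have e : y * ((ξ₁ ^ 2 + ξ₂ ^ 2) • 1 - ξ₁ ^ 2 • (p 1 * p 1) - ξ₂ ^ 2 • (p (-1) * p (-1))) =
      ξ₁ ^ 2 • a - ξ₂ ^ 2 • (a * p (-2)) := by
    simp only [hy, h.p_mul, mul_sub, sub_mul, mul_assoc, mul_one, mul_smul_comm, one_mul]
    norm_num [h.p_zero]
    match_scalars <;> ring
  rw [vL, e]
  ext i j
  fin_cases i <;> fin_cases j <;>
    simp [Matrix.mul_apply, Fin.sum_univ_two, twoL, grF, grE, grA, grK, grT,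
      mul_add, add_mul, mul_sub, sub_mul, smul_sub, smul_add, smul_smul, h.p_mul, h.p_mul', h.px', h.px,
      h.pa', h.pa, h.ax, h.ax', h.xa, h.xa', mul_assoc, TensorProduct.tmul_smul,
      ← TensorProduct.smul_tmul', TensorProduct.tmul_sub, TensorProduct.sub_tmul,
      TensorProduct.tmul_neg, TensorProduct.neg_tmul, h.p_zero] <;>
    match_scalars <;> field_simp <;> ring

theorem twoN_gr (h : IsOscZ q p x a) (hq : q ≠ 0) {y : S} (hy : a = y * (1 - p 2)) (ξ₁ ξ₂ z : ℂ) :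
    twoN q ξ₁ ξ₂ z (grF p x) (grE q ξ₂ p a) (grA ξ₁ p a) (grK q p 1) (grK q p (-1)) =
      (vN q ξ₁ ξ₂ z (p 1) (p (-1)) x y).map
        (Algebra.TensorProduct.includeLeft : S →ₐ[ℂ] S ⊗[ℂ] S) * !![grT p (-1), 0; 0, grT p 1] := by
  have e : y * ((ξ₁ ^ 2 + ξ₂ ^ 2) • 1 - ξ₁ ^ 2 • (p 1 * p 1) - ξ₂ ^ 2 • (p (-1) * p (-1))) =
      ξ₁ ^ 2 • a - ξ₂ ^ 2 • (a * p (-2)) := by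
    simp only [hy, h.p_mul, mul_sub, sub_mul, mul_assoc, mul_one, mul_smul_comm, one_mul]
    norm_num [h.p_zero]
    match_scalars <;> ring
  rw [vN, e]
  ext i j
  fin_cases i <;> fin_cases j <;>
    simp [Matrix.mul_apply, Fin.sum_univ_two, twoN, grF, grE, grA, grK, grT,
      mul_add, add_mul, mul_sub, sub_mul, smul_sub, smul_add, smul_smul, h.p_mul, h.p_mul', h.px', h.px,
      h.pa', h.pa, h.ax, h.ax', h.xa, h.xa', mul_assoc, TensorProduct.tmul_smul,
      ← TensorProduct.smul_tmul', TensorProduct.tmul_sub, TensorProduct.sub_tmul,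
      TensorProduct.tmul_neg, TensorProduct.neg_tmul, h.p_zero] <;>
    match_scalars <;> field_simp <;> ring

end TwoOscillators

open scoped TensorProduct


/-! ### Functionals on the algebra of two oscillators -/

theorem exp_zpow (η : ℂ) (m : ℤ) : Complex.exp η ^ m = Complex.exp (η * m) := by
  rw [← Complex.exp_int_mul, mul_comm]

/-- The tensor product of two functionals. -/
def tens {S S' : Type*} [Ring S] [Algebra ℂ S] [Ring S'] [Algebra ℂ S'] (φ : S →ₗ[ℂ] ℂ)
    (ψ : S' →ₗ[ℂ] ℂ) : S ⊗[ℂ] S' →ₗ[ℂ] ℂ :=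
  LinearMap.mul' ℂ ℂ ∘ₗ TensorProduct.map φ ψ

section Tens

variable {S : Type*} [Ring S] [Algebra ℂ S] {φ ψ : S →ₗ[ℂ] ℂ} {𝒜 : Subalgebra ℂ S}

theorem tens_tmul (x y : S) : tens φ ψ (x ⊗ₜ y) = φ x * ψ y := rfl

/-- The subalgebra `𝒜 ⊗ 𝒜`. -/
def tsub (𝒜 : Subalgebra ℂ S) : Subalgebra ℂ (S ⊗[ℂ] S) :=
  (Algebra.TensorProduct.map 𝒜.val 𝒜.val).range

theorem tmul_mem_tsub {x y : S} (hx : x ∈ 𝒜) (hy : y ∈ 𝒜) : x ⊗ₜ y ∈ tsub 𝒜 :=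
  ⟨(⟨x, hx⟩ : 𝒜) ⊗ₜ (⟨y, hy⟩ : 𝒜), rfl⟩

theorem tsub_induction {p : S ⊗[ℂ] S → Prop} (h0 : p 0) (hadd : ∀ x y, p x → p y → p (x + y))
    (hm : ∀ x ∈ 𝒜, ∀ y ∈ 𝒜, p (x ⊗ₜ y)) {z : S ⊗[ℂ] S} (hz : z ∈ tsub 𝒜) : p z := by
  obtain ⟨w, rfl⟩ := hz
  induction w using TensorProduct.induction_on with
  | zero => simpa using h0
  | tmul x y => exact hm _ x.2 _ y.2
  | add x y hx hy =>
    have := hadd _ _ hx hy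
    rwa [← map_add] at this

theorem tens_comm {c d : S} {A B : ℂ} (hc : ∀ x ∈ 𝒜, φ (c * x) = A * φ (x * c))
    (hd : ∀ x ∈ 𝒜, ψ (d * x) = B * ψ (x * d)) {z : S ⊗[ℂ] S} (hz : z ∈ tsub 𝒜) :
    tens φ ψ ((c ⊗ₜ d) * z) = A * B * tens φ ψ (z * (c ⊗ₜ d)) := by
  refine tsub_induction (p := fun z => tens φ ψ ((c ⊗ₜ d) * z) =
    A * B * tens φ ψ (z * (c ⊗ₜ d))) (by simp) (fun x y hx hy => ?_) (fun x hx y hy => ?_) hz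
  · rw [mul_add, add_mul, map_add, map_add, hx, hy]; ring
  · rw [Algebra.TensorProduct.tmul_mul_tmul, Algebra.TensorProduct.tmul_mul_tmul, tens_tmul,
      tens_tmul, hc x hx, hd y hy]
    ring

end Tens

/-- A representation of the `q`-oscillator algebra with its family of weighted traces. -/
structure OscRep (S : Type*) [Ring S] [Algebra ℂ S] (η : ℂ) where
  p : ℤ → S
  x : S
  a : S
  y : S
  osc : IsOscZ (Complex.exp η) p x a
  xy : x * y = 1
  yx : y * x = 1
  alg : Subalgebra ℂ S
  p_mem : ∀ m, p m ∈ alg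
  x_mem : x ∈ alg
  a_mem : a ∈ alg
  deg : ℤ → Submodule ℂ S
  deg_one : 1 ∈ deg 0
  deg_mul : ∀ {d e y z}, y ∈ deg d → z ∈ deg e → y * z ∈ deg (d + e)
  deg_p : ∀ m, p m ∈ deg 0
  deg_x : x ∈ deg 1
  deg_a : a ∈ deg (-1)
  deg_y : y ∈ deg (-1)
  tr : (ℤ → ℂ) → S →ₗ[ℂ] ℂ
  tr_deg : ∀ w {d z}, d ≠ 0 → z ∈ deg d → tr w z = 0
  tr_p : ∀ w m, tr w (p m) = w m
  tr_p_comm : ∀ w k {z}, z ∈ alg → tr w (p k * z) = tr w (z * p k)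
  tr_x_comm : ∀ {w : ℤ → ℂ} {A : ℂ}, (∀ m : ℤ, w m - w (m + 2) =
      A * (Complex.exp (η * m) * (w m - Complex.exp (2 * η) * w (m + 2)))) →
    ∀ {z}, z ∈ alg → tr w (x * z) = A * tr w (z * x)
  tr_a_comm : ∀ {w : ℤ → ℂ} {A : ℂ}, (∀ m : ℤ, w m - Complex.exp (2 * η) * w (m + 2) =
      A * (Complex.exp (-(η * m)) * (w m - w (m + 2)))) →
    ∀ {z}, z ∈ alg → tr w (a * z) = A * tr w (z * a)
  tr_fin : ∀ z, ∃ (s : Finset ℤ) (c : ℤ → ℂ), ∀ w, tr w z = ∑ m ∈ s, c m * w m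

theorem OscRep.deg_pow {S : Type*} [Ring S] [Algebra ℂ S] {η : ℂ} (R : OscRep S η) {d : ℤ} {z : S}
    (hz : z ∈ R.deg d) (n : ℕ) : z ^ n ∈ R.deg (n * d) := by
  induction n with
  | zero => simpa using R.deg_one
  | succ n ih =>
    rw [pow_succ]
    have := R.deg_mul ih hz
    convert this using 2; push_cast; ring

/-- `α` is not a pole of any of the traces. -/
def Generic (η α : ℂ) : Prop := ∀ m : ℤ, Complex.exp (2 * η * α) * Complex.exp η ^ m ≠ 1

theorem Generic.ne {η α : ℂ} (h : Generic η α) (m : ℤ) :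
    1 - Complex.exp (2 * η * α) * Complex.exp η ^ m ≠ 0 := sub_ne_zero.2 (h m).symm

theorem wPlus_eq (η α : ℂ) (m : ℤ) :
    wPlus η α m = (1 - Complex.exp (2 * η * α) * Complex.exp η ^ m)⁻¹ := by
  rw [wPlus, exp_zpow, ← Complex.exp_add]
  ring_nf

theorem wMinus_eq (η α : ℂ) (m : ℤ) :
    wMinus η α m = Complex.exp η ^ (-m) * (1 - Complex.exp (2 * η * α) * Complex.exp η ^ (-m))⁻¹ := by
  rw [wMinus, exp_zpow, ← Complex.exp_add]
  push_cast
  ring_nf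

section Comm

variable {S : Type*} [Ring S] [Algebra ℂ S] {η α : ℂ} (R : OscRep S η)

/-- The difference equation of `tr_x_comm` holds with `A = q^{2α}`; genericity keeps the
denominators from vanishing. -/
theorem OscRep.wPlus_x (h : Generic η α) {z : S} (hz : z ∈ R.alg) :
    R.tr (wPlus η α) (R.x * z) = Complex.exp (2 * η * α) * R.tr (wPlus η α) (z * R.x) := by
  refine R.tr_x_comm (fun m => ?_) hz
  have h1 := h.ne m
  have h2 := h.ne (m + 2)
  have e2 : Complex.exp (2 * η) = Complex.exp η ^ 2 := by rw [← Complex.exp_nat_mul]; norm_num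
  have hq := Complex.exp_ne_zero η
  rw [wPlus_eq, wPlus_eq, ← exp_zpow, e2]
  rw [zpow_add₀ hq] at h2 ⊢
  norm_cast at h2 ⊢
  generalize Complex.exp η ^ m = X at *
  generalize Complex.exp (2 * η * α) = A at *
  generalize Complex.exp η = Q at *
  have h2 : 1 - A * (X * Q ^ 2) ≠ 0 := h2
  rw [inv_sub_inv h1 h2, inv_eq_one_div, inv_eq_one_div, mul_one_div, div_sub_div _ _ h1 h2,
    mul_div_assoc', mul_div_assoc', div_left_inj' (mul_ne_zero h1 h2)]
  ring

theorem OscRep.wMinus_a (h : Generic η α) {z : S} (hz : z ∈ R.alg) :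
    R.tr (wMinus η α) (R.a * z) = Complex.exp (2 * η * α) * R.tr (wMinus η α) (z * R.a) := by
  refine R.tr_a_comm (fun m => ?_) hz
  have h1 := h.ne (-m)
  have h2 := h.ne (-(m + 2))
  have e2 : Complex.exp (2 * η) = Complex.exp η ^ 2 := by rw [← Complex.exp_nat_mul]; norm_num
  have hq := Complex.exp_ne_zero η
  rw [wMinus_eq, wMinus_eq, show -(η * m) = η * ((-m : ℤ) : ℂ) by push_cast; ring, ← exp_zpow, e2]
  rw [neg_add, zpow_add₀ hq] at h2 ⊢
  have e3 : Complex.exp η ^ (-2 : ℤ) = (Complex.exp η ^ 2)⁻¹ := by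
    rw [zpow_neg]; norm_cast
  rw [e3] at h2 ⊢
  generalize Complex.exp η ^ (-m) = X at *
  generalize Complex.exp (2 * η * α) = A at *
  generalize Complex.exp η = Q at *
  have h2' : Q ^ 2 - A * X ≠ 0 := by
    intro h0
    apply h2
    field_simp
    linear_combination h0
  have e4 : (1 - A * (X * (Q ^ 2)⁻¹))⁻¹ = Q ^ 2 * (Q ^ 2 - A * X)⁻¹ := by
    field_simp
  rw [e4, show X * (Q ^ 2)⁻¹ * (Q ^ 2 * (Q ^ 2 - A * X)⁻¹) = X * (Q ^ 2 - A * X)⁻¹ by field_simp,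
    inv_eq_one_div, inv_eq_one_div, mul_one_div, mul_one_div, mul_div_assoc', div_sub_div _ _ h1 h2',
    div_sub_div _ _ h1 h2', mul_div_assoc', mul_div_assoc', div_left_inj' (mul_ne_zero h1 h2')]
  ring

/-- The functional `tr⁺ ⊗ tr⁻`. -/
def OscRep.trTwo (α : ℂ) : S ⊗[ℂ] S →ₗ[ℂ] ℂ := tens (R.tr (wPlus η α)) (R.tr (wMinus η α))

/-- The functional on the graded module. -/
def OscRep.trGr (α : ℂ) : S ⊗[ℂ] S →ₗ[ℂ] ℂ := tens (R.tr (wPlus η α)) (R.tr (wPlus η α))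

/-- The two summands of `F` acquire the same twist `q^{2α}`, one from `a*` under `tr⁺`, the other
from `a` under `tr⁻`. -/
theorem OscRep.trTwo_F (h : Generic η α) (ξ₁ ξ₂ : ℂ) {z : S ⊗[ℂ] S} (hz : z ∈ tsub R.alg) :
    R.trTwo α (twoF ξ₁ ξ₂ R.p R.x R.a * z) = Complex.exp (2 * η * α) *
      R.trTwo α (z * twoF ξ₁ ξ₂ R.p R.x R.a) := by
  have c1 : ∀ x ∈ R.alg, R.tr (wPlus η α) (R.x * R.p (-1) * x) =
      Complex.exp (2 * η * α) * R.tr (wPlus η α) (x * (R.x * R.p (-1))) := by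
    intro x hx
    rw [mul_assoc, R.wPlus_x h (R.alg.mul_mem (R.p_mem _) hx), mul_assoc (R.p _),
      R.tr_p_comm _ _ (R.alg.mul_mem hx R.x_mem), mul_assoc x]
  have c2 : ∀ x ∈ R.alg, R.tr (wMinus η α) (R.a * R.p 1 * x) =
      Complex.exp (2 * η * α) * R.tr (wMinus η α) (x * (R.a * R.p 1)) := by
    intro x hx
    rw [mul_assoc, R.wMinus_a h (R.alg.mul_mem (R.p_mem _) hx), mul_assoc (R.p _),
      R.tr_p_comm _ _ (R.alg.mul_mem hx R.a_mem), mul_assoc x]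
  have c3 : ∀ (w : ℤ → ℂ), ∀ x ∈ R.alg, R.tr w (R.p 1 * x) = 1 * R.tr w (x * R.p 1) := by
    intro w x hx
    rw [R.tr_p_comm w _ hx, one_mul]
  simp only [OscRep.trTwo, twoF, add_mul, mul_add, smul_mul_assoc, mul_smul_comm, map_add, map_smul,
    tens_comm c1 (c3 _) hz, tens_comm (c3 _) c2 hz, smul_eq_mul]
  ring

theorem OscRep.trGr_F (h : Generic η α) {z : S ⊗[ℂ] S} (hz : z ∈ tsub R.alg) :
    R.trGr α (grF R.p R.x * z) = Complex.exp (2 * η * α) *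
      R.trGr α (z * grF R.p R.x) := by
  have c3 : ∀ (w : ℤ → ℂ), ∀ x ∈ R.alg, R.tr w (R.p 1 * x) = 1 * R.tr w (x * R.p 1) := by
    intro w x hx
    rw [R.tr_p_comm w _ hx, one_mul]
  rw [OscRep.trGr, grF, tens_comm (fun x hx => R.wPlus_x h hx) (c3 _) hz, mul_one]

theorem tmul_pow (x y : S) (n : ℕ) :
    (x ⊗ₜ[ℂ] y) ^ n = (x ^ n) ⊗ₜ (y ^ n) := Algebra.TensorProduct.tmul_pow x y n

/-- The tensor factors have charges `-j` and `k`, and each trace sees only charge zero. -/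
theorem OscRep.trTwo_low (j k : ℕ) (m : ℤ) (hjk : ¬(j = 0 ∧ k = 0)) :
    R.trTwo α (twoA R.a ^ j * twoE R.p R.x ^ k * twoK R.p m) = 0 := by
  simp only [twoA, twoE, twoK, tmul_pow, Algebra.TensorProduct.tmul_mul_tmul, OscRep.trTwo, tens_tmul]
  by_cases hj : j = 0
  · rw [R.tr_deg _ (d := 0 + (k * (1 + 0)) + 0) (z := 1 ^ j * _ * _), mul_zero]
    · simp; intro hk; exact hjk ⟨hj, hk⟩
    · rw [one_pow]
      exact R.deg_mul (R.deg_mul R.deg_one (R.deg_pow (R.deg_mul R.deg_x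
        (R.deg_p _)) _)) (R.deg_p _)
  · rw [R.tr_deg _ (d := j * (-1) + (k * 0) + 0) (z := R.a ^ j * _ * _), zero_mul]
    · simp [hj]
    · exact R.deg_mul (R.deg_mul (R.deg_pow R.deg_a j) (R.deg_pow
        (R.deg_p _) _)) (R.deg_p _)

/-- Here the first tensor factor has charge `-(j + k)`, so its trace vanishes. -/
theorem OscRep.trGr_low (ξ₁ ξ₂ : ℂ) (j k : ℕ) (m : ℤ) (hjk : ¬(j = 0 ∧ k = 0)) :
    R.trGr α (grA ξ₁ R.p R.a ^ j * grE (Complex.exp η) ξ₂ R.p R.a ^ k *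
      grK (Complex.exp η) R.p m) = 0 := by
  simp only [grA, grE, grK, smul_pow, tmul_pow, Algebra.TensorProduct.tmul_mul_tmul, OscRep.trGr,
    smul_mul_assoc, mul_smul_comm, map_smul, tens_tmul]
  rw [R.tr_deg _ (d := j * (-1 + 0) + (k * (-1 + 0)) + 0) (z := (R.a * _) ^ j * _ * _)]
  · simp
  · have : 0 < j + k := by omega
    push_cast
    intro h0
    have : (j : ℤ) + k = 0 := by linarith
    omega
  · exact R.deg_mul (R.deg_mul (R.deg_pow (R.deg_mul R.deg_a (R.deg_p _)) j)
      (R.deg_pow (R.deg_mul R.deg_a (R.deg_p _)) _)) (R.deg_p _)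

/-- Since `wMinus` at `-m` is `q^m` times `wPlus` at `m`, the factor `q^m` in `grK` makes the two
functionals agree on the powers of `K`. -/
theorem OscRep.trTwo_K (m : ℤ) : R.trTwo α (twoK R.p m) =
    R.trGr α (grK (Complex.exp η) R.p m) := by
  simp only [twoK, grK, OscRep.trTwo, OscRep.trGr, map_smul, tens_tmul, R.tr_p, smul_eq_mul, wMinus_eq, wPlus_eq,
    neg_neg]
  ring

/-- The algebra of pairs of corresponding elements. -/
def OscRep.pairAlg (ξ₁ ξ₂ : ℂ) : Subalgebra ℂ ((S ⊗[ℂ] S) × (S ⊗[ℂ] S)) :=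
  Algebra.adjoin ℂ (insert (twoF ξ₁ ξ₂ R.p R.x R.a, grF R.p R.x)
    (insert (twoE R.p R.x, grE (Complex.exp η) ξ₂ R.p R.a)
      (insert (twoA R.a, grA ξ₁ R.p R.a)
        (Set.range fun m => (twoK R.p m, grK (Complex.exp η) R.p m)))))

theorem IsTwo.prod {B B' : Type*} [Ring B] [Algebra ℂ B] [Ring B'] [Algebra ℂ B'] {q ξ₁ ξ₂ : ℂ}
    {F e a : B} {K : ℤ → B} {F' e' a' : B'} {K' : ℤ → B'} (h : IsTwo q ξ₁ ξ₂ F e a K)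
    (h' : IsTwo q ξ₁ ξ₂ F' e' a' K') :
    IsTwo q ξ₁ ξ₂ (F, F') (e, e') (a, a') fun m => (K m, K' m) where
  K_zero := Prod.ext h.K_zero h'.K_zero
  K_mul m k := Prod.ext (h.K_mul m k) (h'.K_mul m k)
  KF m := Prod.ext (h.KF m) (h'.KF m)
  Ka m := Prod.ext (h.Ka m) (h'.Ka m)
  Ke m := Prod.ext (h.Ke m) (h'.Ke m)
  ea := Prod.ext h.ea h'.ea
  aF := Prod.ext h.aF h'.aF
  eF := Prod.ext h.eF h'.eF

theorem OscRep.pairAlg_mem {ξ₁ ξ₂ : ℂ} {z : (S ⊗[ℂ] S) × (S ⊗[ℂ] S)}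
    (hz : z ∈ R.pairAlg ξ₁ ξ₂) : z.1 ∈ tsub R.alg ∧ z.2 ∈ tsub R.alg := by
  have hq := R.p_mem
  have hx := R.x_mem
  have ha := R.a_mem
  have h1 := R.alg.one_mem
  have hm : ∀ {x y}, x ∈ R.alg → y ∈ R.alg → x * y ∈ R.alg := R.alg.mul_mem
  have key : R.pairAlg ξ₁ ξ₂ ≤ (tsub R.alg).prod (tsub R.alg) := by
    refine Algebra.adjoin_le ?_
    rintro g (rfl | rfl | rfl | ⟨m, rfl⟩)
    · exact ⟨Subalgebra.add_mem _ (Subalgebra.smul_mem _ (tmul_mem_tsub (hm hx (hq _)) (hq _)) _)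
        (Subalgebra.smul_mem _ (tmul_mem_tsub (hq _) (hm ha (hq _))) _), tmul_mem_tsub hx (hq _)⟩
    · exact ⟨tmul_mem_tsub (hq _) (hm hx (hq _)),
        Subalgebra.smul_mem _ (tmul_mem_tsub (hm ha (hq _)) (hq _)) _⟩
    · exact ⟨tmul_mem_tsub ha h1, Subalgebra.smul_mem _ (tmul_mem_tsub (hm ha (hq _)) (hq _)) _⟩
    · exact ⟨tmul_mem_tsub (hq _) (hq _), Subalgebra.smul_mem _ (tmul_mem_tsub (hq _) (hq _)) _⟩
  exact key hz

/-- The difference of the two functionals, on the algebra generated by pairs of corresponding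
generators, satisfies the vanishing criterion. Working with pairs dispenses with a homomorphism
between the two realisations. -/
theorem OscRep.trTwo_eq_of_generic (h : Generic η α) {ξ₁ ξ₂ : ℂ}
    {z : (S ⊗[ℂ] S) × (S ⊗[ℂ] S)} (hz : z ∈ R.pairAlg ξ₁ ξ₂) :
    R.trTwo α z.1 = R.trGr α z.2 := by
  have hD := ((isTwo_two R.osc (Complex.exp_ne_zero η) ξ₁ ξ₂).prod
    (isTwo_gr R.osc (Complex.exp_ne_zero η) ξ₁ ξ₂)).functional_eq_zero (Complex.exp_ne_zero η)
    (𝒜 := R.pairAlg ξ₁ ξ₂) rfl (D := R.trTwo α ∘ₗ LinearMap.fst ℂ _ _ -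
      R.trGr α ∘ₗ LinearMap.snd ℂ _ _) h (fun w hw => ?_) (fun j k m => ?_) hz
  · exact sub_eq_zero.1 hD
  · have := R.pairAlg_mem hw
    simp only [LinearMap.sub_apply, LinearMap.comp_apply, LinearMap.fst_apply, LinearMap.snd_apply,
      Prod.fst_mul, Prod.snd_mul, R.trTwo_F h ξ₁ ξ₂ this.1, R.trGr_F h this.2]
    ring
  · simp only [LinearMap.sub_apply, LinearMap.comp_apply, LinearMap.fst_apply, LinearMap.snd_apply,
      Prod.fst_mul, Prod.snd_mul, Prod.pow_fst, Prod.pow_snd]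
    by_cases hjk : j = 0 ∧ k = 0
    · obtain ⟨rfl, rfl⟩ := hjk
      simp only [pow_zero, one_mul, R.trTwo_K, sub_self]
    · rw [R.trTwo_low j k m hjk, R.trGr_low ξ₁ ξ₂ j k m hjk, sub_self]

/-! ### Dependence on `α` -/

theorem meromorphicAt_wPlus (η : ℂ) (m : ℤ) : MeromorphicAt (fun α => wPlus η α m) 0 := by
  have h : AnalyticAt ℂ (fun α => 1 - Complex.exp (η * (2 * α + m))) 0 := by fun_prop
  exact h.meromorphicAt.inv

theorem meromorphicAt_wMinus (η : ℂ) (m : ℤ) : MeromorphicAt (fun α => wMinus η α m) 0 := by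
  have h : AnalyticAt ℂ (fun α => 1 - Complex.exp (η * (2 * α - m))) 0 := by fun_prop
  exact (MeromorphicAt.const _ _).mul h.meromorphicAt.inv

theorem OscRep.meromorphicAt_tr {w : ℂ → ℤ → ℂ} (hw : ∀ m, MeromorphicAt (fun α => w α m) 0)
    (z : S) : MeromorphicAt (fun α => R.tr (w α) z) 0 := by
  obtain ⟨s, c, hc⟩ := R.tr_fin z
  simp only [hc]
  exact MeromorphicAt.fun_sum fun m _ => (MeromorphicAt.const _ _).mul (hw m)

theorem OscRep.meromorphicAt_tens {w w' : ℂ → ℤ → ℂ} (hw : ∀ m, MeromorphicAt (fun α => w α m) 0)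
    (hw' : ∀ m, MeromorphicAt (fun α => w' α m) 0) (z : S ⊗[ℂ] S) :
    MeromorphicAt (fun α => tens (R.tr (w α)) (R.tr (w' α)) z) 0 := by
  induction z using TensorProduct.induction_on with
  | zero => simp
  | tmul x y => exact (R.meromorphicAt_tr hw x).mul (R.meromorphicAt_tr hw' y)
  | add x y hx hy => simp only [map_add]; exact hx.add hy

/-- The excluded values of `α` form a countable set, so their complement is dense. -/
theorem frequently_generic {η : ℂ} (hη : η ≠ 0) : ∃ᶠ α in 𝓝[≠] (0 : ℂ), Generic η α := by
  set B : Set ℂ := ⋃ (m : ℤ) (k : ℤ), {(2 * Real.pi * Complex.I * k / η - m) / 2} with hB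
  have hc : (B ∪ {0}).Countable := by
    refine Set.Countable.union ?_ (Set.countable_singleton _)
    exact Set.countable_iUnion fun m => Set.countable_iUnion fun k => Set.countable_singleton _
  have hd := mem_closure_iff_frequently.1 (hc.dense_compl ℝ (0 : ℂ))
  rw [frequently_nhdsWithin_iff]
  refine hd.mono fun α hα => ?_
  simp only [Set.mem_compl_iff, Set.mem_union, not_or] at hα
  refine ⟨fun m h => hα.1 ?_, hα.2⟩
  rw [exp_zpow, ← Complex.exp_add, Complex.exp_eq_one_iff] at h
  obtain ⟨k, hk⟩ := h
  refine Set.mem_iUnion.2 ⟨m, Set.mem_iUnion.2 ⟨k, ?_⟩⟩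
  rw [Set.mem_singleton_iff]
  field_simp
  linear_combination hk

/-- The double trace is computed in the graded module. -/
theorem OscRep.trTwo_eventually_eq (hη : η ≠ 0) {ξ₁ ξ₂ : ℂ}
    {z : (S ⊗[ℂ] S) × (S ⊗[ℂ] S)} (hz : z ∈ R.pairAlg ξ₁ ξ₂) :
    ∀ᶠ α in 𝓝[≠] (0 : ℂ), R.trTwo α z.1 = R.trGr α z.2 := by
  -- Both sides are meromorphic at `0`, so agreement on a set accumulating there extends to a
  -- punctured neighbourhood.
  refine (MeromorphicAt.frequently_eq_iff_eventuallyEq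
    (R.meromorphicAt_tens (meromorphicAt_wPlus η) (meromorphicAt_wMinus η) z.1)
    (R.meromorphicAt_tens (meromorphicAt_wPlus η) (meromorphicAt_wPlus η) z.2)).1 ?_
  exact (frequently_generic hη).mono fun α hα => R.trTwo_eq_of_generic hα hz

end Comm

open scoped TensorProduct


/-! ### Composition of two transfer matrices -/

section Dress

variable {ι S : Type*} [Fintype ι] [DecidableEq ι] [Ring S] [Algebra ℂ S]

/-- Conjugation of `X` by the product of the `L k` over the list `l`. -/
def dress (L N : ι → Matrix (Fin 2) (Fin 2) S) (l : List ι) (X : SiteMat ι ℂ) : SiteMat ι S :=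
  adL (fun k => site1 k (L k)) (fun k => site1 k (N k)) l (castM X)

variable {L N : ι → Matrix (Fin 2) (Fin 2) S}

theorem dress_nil (X : SiteMat ι ℂ) : dress L N [] X = castM X := adL_nil _ _ _

theorem dress_append_singleton (l : List ι) (j : ι) (X : SiteMat ι ℂ) :
    dress L N (l ++ [j]) X = site1 j (N j) * dress L N l X * site1 j (L j) := by
  rw [dress, adL_append, adL_singleton]; rfl

theorem castM_map {B : Type*} [Ring B] [Algebra ℂ B] (φ : S →ₐ[ℂ] B) (X : SiteMat ι ℂ) :
    (castM (S := S) X).map φ = castM X := by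
  ext s t
  rw [Matrix.map_apply, castM_apply, castM_apply, AlgHom.commutes]

theorem list_site1_map {B : Type*} [Ring B] [Algebra ℂ B] (φ : S →ₐ[ℂ] B) (l : List ι) :
    ((l.map fun k => site1 k (L k)).prod).map φ =
      (l.map fun k => site1 (ι := ι) k ((L k).map φ)).prod := by
  have := map_list_prod φ.mapMatrix (l.map fun k => site1 (ι := ι) k (L k))
  rw [List.map_map] at this
  refine this.trans (congrArg List.prod (List.map_congr_left fun k _ => ?_))
  exact site1_map k _ φ

theorem dress_map {B : Type*} [Ring B] [Algebra ℂ B] (φ : S →ₐ[ℂ] B) (l : List ι)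
    (X : SiteMat ι ℂ) :
    (dress L N l X).map φ = dress (fun k => (L k).map φ) (fun k => (N k).map φ) l X := by
  rw [dress, adL, dress, adL, ← list_site1_map φ, ← list_site1_map φ, ← castM_map φ]
  exact (map_mul φ.mapMatrix _ _).trans (by rw [map_mul]; rfl)

theorem EntriesIn.dress {𝒜 : Subalgebra ℂ S} (hL : ∀ k, EntriesIn 𝒜 (L k))
    (hN : ∀ k, EntriesIn 𝒜 (N k)) (l : List ι) (X : SiteMat ι ℂ) : EntriesIn 𝒜 (dress L N l X) :=
  EntriesIn.adL (fun k => (hL k).site1 k) (fun k => (hN k).site1 k) (EntriesIn.castM X)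

theorem dress_smul_right (c : ι → ℂ) (l : List ι) (X : SiteMat ι ℂ) :
    dress L (fun k => c k • N k) l X = (l.map c).prod • dress L N l X := by
  have e : (fun k => site1 (ι := ι) k (c k • N k)) = fun k => c k • site1 k (N k) :=
    funext fun k => site1_smul k _ _
  rw [dress, adL, e, list_smul_prod, List.map_reverse, List.prod_reverse, smul_mul_assoc,
    smul_mul_assoc]
  rfl

theorem triv_list_site1 {l : List ι} {j : ι} (hj : j ∉ l) :
    Triv j (l.map fun k => site1 (ι := ι) k (L k)).prod := by
  refine triv_list_prod _ ?_
  simp only [List.mem_map]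
  rintro _ ⟨k, hk, rfl⟩
  exact triv_site1 (by rintro rfl; exact hj hk) _

/-- The inclusions of the two tensor factors. -/
abbrev incL : S →ₐ[ℂ] S ⊗[ℂ] S := Algebra.TensorProduct.includeLeft
abbrev incR : S →ₐ[ℂ] S ⊗[ℂ] S := Algebra.TensorProduct.includeRight

theorem commute_incL_incR (x y : S) : Commute (incL x) (incR y) := by
  simp [Commute, SemiconjBy, incL, incR]

/-- The inner functional returns scalars, so conjugating its result by `M` and applying `ψ` amounts
to placing `Z` and `M` in different tensor factors and applying `φ ⊗ ψ` once. -/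
theorem nested_functional (φ ψ : S →ₗ[ℂ] ℂ) (M M' Z : SiteMat ι S) :
    (M' * castM (Z.map φ) * M).map ψ =
      (M'.map incR * Z.map incL * M.map incR).map (tens φ ψ) := by
  ext s t
  simp only [Matrix.map_apply, Matrix.mul_apply, map_sum, Finset.sum_mul]
  refine Finset.sum_congr rfl fun r _ => Finset.sum_congr rfl fun r' _ => ?_
  have e : incR (M' s r') * incL (Z r' r) * incR (M r t) =
      (Z r' r) ⊗ₜ[ℂ] (M' s r' * M r t) := by
    simp [incL, incR, Algebra.TensorProduct.tmul_mul_tmul]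
  rw [castM_apply, e, tens_tmul, ← Algebra.commutes, mul_assoc, ← Algebra.smul_def, map_smul,
    Matrix.map_apply, smul_eq_mul]

/-- Composition of two transfer matrices as a transfer matrix with two oscillators. -/
theorem nested_dress (φ ψ : S →ₗ[ℂ] ℂ) (LA NA LB NB : ι → Matrix (Fin 2) (Fin 2) S)
    {l : List ι} {j : ι} (hl : (l ++ [j]).Nodup) (b c : Fin 2) (X : SiteMat ι ℂ) :
    (dress LB NB l ((pe j b c (dress LA NA (l ++ [j]) X)).map φ)).map ψ =
      (pe j b c (site1 j ((NA j).map incL) *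
        dress (fun k => (LA k).map incL * (LB k).map incR)
          (fun k => (NB k).map incR * (NA k).map incL) l X *
        site1 j ((LA j).map incL))).map (tens φ ψ) := by
  have h := List.nodup_append.1 hl
  have hj : j ∉ l := fun hj => h.2.2 j hj j (by simp) rfl
  have hj' : j ∉ l.reverse := by simpa using hj
  have hc : ∀ x y : S, Commute (incL x) (incR y) := commute_incL_incR
  rw [dress, adL, nested_functional, pe_map, dress_map, dress_append_singleton,
    -- The outer dressing runs over `l`, which avoids `j`; it is trivial at `j` and can be taken
    -- inside the matrix element there.
    ← pe_mul_left _ _ _ _ ((triv_list_site1 hj').map incR),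
    ← pe_mul_right _ _ _ _ ((triv_list_site1 hj).map incR)]
  congr 2
  have c1 := ((triv_list_site1 (L := NB) hj').map incR).commute_site1 ((NA j).map incL)
    fun _ _ _ _ => (hc _ _).symm
  have c2 := ((triv_list_site1 (L := LB) hj).map incR).commute_site1 ((LA j).map incL)
    fun _ _ _ _ => (hc _ _).symm
  have e : dress (fun k => (LA k).map incL * (LB k).map incR)
      (fun k => (NB k).map incR * (NA k).map incL) l X =
      (l.reverse.map fun k => site1 k (NB k)).prod.map incR *
        dress (fun k => (LA k).map incL) (fun k => (NA k).map incL) l X *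
        (l.map fun k => site1 k (LB k)).prod.map incR := by
    simp only [dress, adL, site1_mul]
    rw [list_prod_mul_of_commute (List.nodup_reverse.2 h.1), list_prod_mul_of_commute h.1,
      list_site1_map, list_site1_map]
    · simp only [mul_assoc]
    · exact fun k _ m _ hkm => site1_commute hkm _ _ fun _ _ _ _ => hc _ _
    · exact fun k _ m _ hkm => site1_commute hkm _ _ fun _ _ _ _ => (hc _ _).symm
  rw [e]
  generalize dress (fun k => (LA k).map incL) (fun k => (NA k).map incL) l X = Y
  rw [← mul_assoc, ← mul_assoc, c1.eq]
  simp only [mul_assoc]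
  rw [← c2.eq]

variable {B : Type*} [Ring B] [Algebra ℂ B]

/-- The contraction of the site `j` with a row `(A,1)` and a column `(1,-A)`. -/
def contr (A : S) (j : ι) (Y : SiteMat ι S) : SiteMat ι S :=
  lr A 1 (pe j 0 0 Y) + pe j 1 0 Y - lr A A (pe j 0 1 Y) - lr 1 A (pe j 1 1 Y)

theorem contr_map (φ : S →ₐ[ℂ] B) (A : S) (j : ι) (Y : SiteMat ι S) :
    (contr A j Y).map φ = contr (φ A) j (Y.map φ) := by
  ext s t
  simp only [contr, ← pe_map]
  simp [lr]

theorem EntriesIn.contr {𝒜 : Subalgebra ℂ S} {A : S} (hA : A ∈ 𝒜) {Y : SiteMat ι S}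
    (hY : EntriesIn 𝒜 Y) (j : ι) : EntriesIn 𝒜 (contr A j Y) := by
  intro s t
  have hp : ∀ b c, pe j b c Y s t ∈ 𝒜 := fun b c => by
    simp only [pe, Matrix.of_apply]
    split_ifs
    exacts [hY _ _, 𝒜.zero_mem]
  simp only [XXZ.contr, lr, Matrix.sub_apply, Matrix.add_apply, Matrix.of_apply, mul_one, one_mul]
  exact 𝒜.sub_mem (𝒜.sub_mem (𝒜.add_mem (𝒜.mul_mem hA (hp _ _)) (hp _ _))
    (𝒜.mul_mem (𝒜.mul_mem hA (hp _ _)) hA)) (𝒜.mul_mem (hp _ _) hA)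

/-- If the relevant row of `M` is proportional to `(A, 1)` and the relevant column of `M'` to `(1,
-A)`, the site `j` enters only through the contraction `contr A j`. This applies both to the
two-oscillator and to the graded Lax matrices, and so links the two. -/
theorem pe_eq_lr_contr {P Q A c d : S} {M M' : Matrix (Fin 2) (Fin 2) S} (b b' : Fin 2) (j : ι)
    (Y : SiteMat ι S) (h0 : c * M b 0 = P * A) (h1 : c * M b 1 = P)
    (h0' : M' 0 b' * d = Q) (h1' : M' 1 b' * d = -(A * Q)) :
    lr c d (pe j b b' (site1 j M * Y * site1 j M')) = lr P Q (contr A j Y) := by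
  rw [pe_site1_mul_site1]
  ext s t
  simp only [Fin.sum_univ_two, contr, lr, Matrix.of_apply, Matrix.add_apply, Matrix.sub_apply]
  have e : ∀ (x y z : S), c * (x * z * y) * d = (c * x) * z * (y * d) := fun x y z => by
    simp only [mul_assoc]
  simp only [mul_add, add_mul, e, h0, h1, h0', h1']
  simp only [mul_sub, sub_mul, mul_add, add_mul, mul_one, one_mul, mul_neg, mul_assoc]
  abel

theorem pe_Nh_Lh {q : ℂ} {u v x a : S} (j : ι) (Y : SiteMat ι S) :
    pe j 1 0 (site1 j (Nh 1 u v x a) * Y * site1 j (Lh q 1 u v x a)) =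
      lr u u (contr a j Y) := by
  have e : ∀ Z : SiteMat ι S, Z = lr 1 1 Z := fun Z => by ext s t; simp [lr]
  rw [e (pe _ _ _ _)]
  refine pe_eq_lr_contr 1 0 j Y ?_ ?_ ?_ ?_ <;> simp [Nh, Lh]

/-- The diagonal matrices that remove the central element. -/
def dg (T : ℤ → S) : Matrix (Fin 2) (Fin 2) S := !![T 1, 0; 0, T (-1)]
def dg' (T : ℤ → S) : Matrix (Fin 2) (Fin 2) S := !![T (-1), 0; 0, T 1]

theorem dg_apply (T : ℤ → S) (b c : Fin 2) :
    dg T b c = if b = c then T (1 - 2 * ((c : ℕ) : ℤ)) else 0 := by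
  fin_cases b <;> fin_cases c <;> simp [dg]

theorem dg'_apply (T : ℤ → S) (b c : Fin 2) :
    dg' T b c = if b = c then T (2 * ((b : ℕ) : ℤ) - 1) else 0 := by
  fin_cases b <;> fin_cases c <;> simp [dg']

/-- Diagonal central factors add up along the chain to `T` at `-2` times the spin carried by the
sites of the list. -/
theorem dress_dg {T : ℤ → S} (h0 : T 0 = 1) (hm : ∀ m k, T m * T k = T (m + k)) (l : List ι)
    (X : SiteMat ι ℂ) (s t : ι → Fin 2) :
    dress (fun _ => dg T) (fun _ => dg' T) l X s t =
      T (-2 * (l.map fun k => ((t k : ℕ) : ℤ) - ((s k : ℕ) : ℤ)).sum) *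
        algebraMap ℂ S (X s t) := by
  induction l using List.reverseRecOn with
  | nil => simp [dress_nil, castM_apply, h0]
  | append_singleton l j ih =>
    rw [dress_append_singleton, mul_site1_apply, Finset.sum_eq_single (t j), site1_mul_apply,
      Finset.sum_eq_single (s j), dg_apply, dg'_apply, if_pos rfl, if_pos rfl,
      Function.update_eq_self, Function.update_eq_self, ih, mul_assoc, mul_assoc,
      Algebra.commutes, ← mul_assoc, ← mul_assoc, hm, hm]
    · congr 2
      simp only [List.map_append, List.sum_append, List.map_cons, List.map_nil, List.sum_cons,
        List.sum_nil]
      ring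
    · intro b _ hb
      rw [dg'_apply, if_neg hb.symm, zero_mul]
    · simp
    · intro b _ hb
      rw [dg_apply, if_neg hb, mul_zero]
    · simp

/-- `X` has spin `m`. -/
def HasSpin (m : ℤ) (X : SiteMat ι ℂ) : Prop := ∀ s t, sd s t ≠ m → X s t = 0

theorem dress_dg_of_hasSpin {T : ℤ → S} (h0 : T 0 = 1) (hm : ∀ m k, T m * T k = T (m + k))
    {l : List ι} (hl : l.Nodup) (hmem : ∀ k, k ∈ l) {m : ℤ} {X : SiteMat ι ℂ} (hX : HasSpin m X) :
    dress (fun _ => dg T) (fun _ => dg' T) l X = lr (T (-2 * m)) 1 (castM X) := by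
  ext s t
  rw [dress_dg h0 hm, ← List.sum_toFinset _ hl,
    Finset.eq_univ_iff_forall.2 fun k => List.mem_toFinset.2 (hmem k)]
  change T (-2 * sd s t) * _ = T _ * _ * 1
  rw [mul_one, castM_apply]
  by_cases h : sd s t = m
  · rw [h]
  · rw [hX s t h, map_zero, mul_zero, mul_zero]

/-- As `T` commutes with the image of `φ`, the diagonal factors can be gathered next to `X`; on spin
`m` they reduce to the single factor `T (-2m)`. -/
theorem dress_dg_mul {T : ℤ → S} (h0 : T 0 = 1) (hm : ∀ m k, T m * T k = T (m + k))
    (φ : B →ₐ[ℂ] S) (hc : ∀ m b, Commute (T m) (φ b)) (L N : ι → Matrix (Fin 2) (Fin 2) B)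
    {l : List ι} (hl : l.Nodup) (hmem : ∀ k, k ∈ l) {m : ℤ} {X : SiteMat ι ℂ} (hX : HasSpin m X) :
    dress (fun k => dg T * (L k).map φ) (fun k => (N k).map φ * dg' T) l X =
      lr (T (-2 * m)) 1 ((dress L N l X).map φ) := by
  have c0 : ∀ b, Commute (0 : S) (φ b) := fun b => Commute.zero_left _
  have c1 : ∀ b c y, Commute (dg T b c) (φ y) := fun b c y => by
    rw [dg_apply]; split_ifs; exacts [hc _ _, c0 _]
  have c2 : ∀ b c y, Commute (dg' T b c) (φ y) := fun b c y => by
    rw [dg'_apply]; split_ifs; exacts [hc _ _, c0 _]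
  simp only [dress, adL, site1_mul]
  rw [list_prod_mul_of_commute (List.nodup_reverse.2 hl), list_prod_mul_of_commute hl]
  · have e := dress_dg_of_hasSpin h0 hm hl hmem hX
    rw [dress, adL] at e
    have e2 : ∀ (P D Z D' Q : SiteMat ι S), P * D * Z * (D' * Q) = P * (D * Z * D') * Q := by
      intros; simp only [mul_assoc]
    rw [e2, e, ← list_site1_map φ, ← list_site1_map φ]
    ext s t
    simp only [lr, Matrix.mul_apply, Matrix.of_apply, Matrix.map_apply, mul_one, map_sum, map_mul,
      castM_apply, AlgHom.commutes, Finset.mul_sum, Finset.sum_mul]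
    refine Finset.sum_congr rfl fun r _ => Finset.sum_congr rfl fun r' _ => ?_
    rw [← mul_assoc, ← (hc _ _).eq]
    simp only [mul_assoc]
  · exact fun k _ m _ hkm => site1_commute hkm _ _ fun _ _ _ _ => c1 _ _ _
  · exact fun k _ m _ hkm => site1_commute hkm _ _ fun _ _ _ _ => (c2 _ _ _).symm

end Dress

/-! ### Evaluation of the composition of `b` and `c` in the graded module. -/

section Composition

variable {ι S : Type*} [Fintype ι] [DecidableEq ι] [Ring S] [Algebra ℂ S] {η : ℂ}
  (R : OscRep S η)

/-- The Lax matrix and the numerator of its inverse. -/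
def OscRep.L (z : ℂ) : Matrix (Fin 2) (Fin 2) S :=
  Lh (Complex.exp η) z (R.p 1) (R.p (-1)) R.x R.a
def OscRep.N (z : ℂ) : Matrix (Fin 2) (Fin 2) S := Nh z (R.p 1) (R.p (-1)) R.x R.a

/-- The functional `x ↦ w(q^{-D} x q^{-D})`. -/
def OscRep.sand (w : ℤ → ℂ) : S →ₗ[ℂ] ℂ :=
  R.tr w ∘ₗ LinearMap.mulLeft ℂ (R.p (-1)) ∘ₗ LinearMap.mulRight ℂ (R.p (-1))

theorem OscRep.sand_apply (w : ℤ → ℂ) (z : S) :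
    R.sand w z = R.tr w (R.p (-1) * (z * R.p (-1))) := rfl

theorem OscRep.a_eq : R.a = R.y * (1 - R.p 2) := by
  rw [← R.osc.xa, ← mul_assoc, R.yx, one_mul]

/-- The two-oscillator Lax matrices over the algebra of pairs. -/
def OscRep.pL (ξ₁ ξ₂ z : ℂ) : Matrix (Fin 2) (Fin 2) ((S ⊗[ℂ] S) × (S ⊗[ℂ] S)) :=
  twoL (Complex.exp η) ξ₁ ξ₂ z (twoF ξ₁ ξ₂ R.p R.x R.a, grF R.p R.x)
    (twoE R.p R.x, grE (Complex.exp η) ξ₂ R.p R.a) (twoA R.a, grA ξ₁ R.p R.a)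
    (twoK R.p 1, grK (Complex.exp η) R.p 1) (twoK R.p (-1), grK (Complex.exp η) R.p (-1))
def OscRep.pN (ξ₁ ξ₂ z : ℂ) : Matrix (Fin 2) (Fin 2) ((S ⊗[ℂ] S) × (S ⊗[ℂ] S)) :=
  twoN (Complex.exp η) ξ₁ ξ₂ z (twoF ξ₁ ξ₂ R.p R.x R.a, grF R.p R.x)
    (twoE R.p R.x, grE (Complex.exp η) ξ₂ R.p R.a) (twoA R.a, grA ξ₁ R.p R.a)
    (twoK R.p 1, grK (Complex.exp η) R.p 1) (twoK R.p (-1), grK (Complex.exp η) R.p (-1))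

theorem entriesIn_two {B : Type*} [Ring B] [Algebra ℂ B] {𝒜 : Subalgebra ℂ B} {F e a K Ki : B}
    (hF : F ∈ 𝒜) (he : e ∈ 𝒜) (ha : a ∈ 𝒜) (hK : K ∈ 𝒜) (hKi : Ki ∈ 𝒜) (q ξ₁ ξ₂ z : ℂ) :
    EntriesIn 𝒜 (twoL q ξ₁ ξ₂ z F e a K Ki) ∧ EntriesIn 𝒜 (twoN q ξ₁ ξ₂ z F e a K Ki) := by
  have sm : ∀ {x} (c : ℂ), x ∈ 𝒜 → c • x ∈ 𝒜 := fun c h => 𝒜.smul_mem h c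
  have h1 := 𝒜.sub_mem (sm (ξ₂ ^ 2) hK) (sm (q⁻¹ * ξ₂) (𝒜.mul_mem (𝒜.mul_mem hF he) hK))
  have h2 := 𝒜.sub_mem (sm (ξ₁ ^ 2) hKi) (sm ξ₁ (𝒜.mul_mem ha hF))
  have h3 := 𝒜.add_mem (sm ξ₁ (𝒜.mul_mem ha hK)) (sm ξ₂ he)
  have h4 := 𝒜.add_mem (𝒜.sub_mem (sm (ξ₂ ^ 2) (𝒜.mul_mem ha hK)) (sm (q⁻¹ * ξ₂)
    (𝒜.mul_mem (𝒜.mul_mem (𝒜.mul_mem ha hF) he) hK))) (sm (ξ₁ * ξ₂) he)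
  constructor <;> intro i j <;> fin_cases i <;> fin_cases j
  · exact 𝒜.sub_mem hK (sm _ h1)
  · exact 𝒜.neg_mem (sm _ hF)
  · exact 𝒜.add_mem (𝒜.neg_mem (sm _ h3)) (sm _ h4)
  · exact 𝒜.sub_mem hKi (sm _ h2)
  · exact 𝒜.sub_mem hKi (sm _ h2)
  · exact sm _ hF
  · exact 𝒜.sub_mem (sm _ h3) (sm _ h4)
  · exact 𝒜.sub_mem hK (sm _ h1)

theorem OscRep.pairAlg_gen (ξ₁ ξ₂ : ℂ) :
    (twoF ξ₁ ξ₂ R.p R.x R.a, grF R.p R.x) ∈ R.pairAlg ξ₁ ξ₂ ∧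
    (twoE R.p R.x, grE (Complex.exp η) ξ₂ R.p R.a) ∈ R.pairAlg ξ₁ ξ₂ ∧
    (twoA R.a, grA ξ₁ R.p R.a) ∈ R.pairAlg ξ₁ ξ₂ ∧
    ∀ m, (twoK R.p m, grK (Complex.exp η) R.p m) ∈ R.pairAlg ξ₁ ξ₂ :=
  ⟨Algebra.subset_adjoin (Or.inl rfl), Algebra.subset_adjoin (Or.inr (Or.inl rfl)),
    Algebra.subset_adjoin (Or.inr (Or.inr (Or.inl rfl))),
    fun m => Algebra.subset_adjoin (Or.inr (Or.inr (Or.inr ⟨m, rfl⟩)))⟩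

theorem OscRep.entriesIn_p (ξ₁ ξ₂ z : ℂ) :
    EntriesIn (R.pairAlg ξ₁ ξ₂) (R.pL ξ₁ ξ₂ z) ∧ EntriesIn (R.pairAlg ξ₁ ξ₂) (R.pN ξ₁ ξ₂ z) := by
  obtain ⟨hF, he, ha, hK⟩ := R.pairAlg_gen ξ₁ ξ₂
  exact entriesIn_two hF he ha (hK 1) (hK (-1)) _ _ _ _

/-- In the first factor the two `q^D` undo the sandwich by `q^{-D}`. In the second the sandwich is
absorbed into a change of weight, by `hw`. -/
theorem OscRep.tens_sand {w w' w'' : ℤ → ℂ} {c : ℂ} (hw : ∀ z, R.sand w' z = c * R.tr w'' z)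
    (E : S ⊗[ℂ] S) :
    tens (R.sand w) (R.sand w') (incL (R.p 1) * E * incL (R.p 1)) =
      c * tens (R.tr w) (R.tr w'') E := by
  induction E using TensorProduct.induction_on with
  | zero => simp
  | tmul x y =>
    have e : incL (R.p 1) * (x ⊗ₜ[ℂ] y) * incL (R.p 1) = (R.p 1 * x * R.p 1) ⊗ₜ y := by
      simp [incL, Algebra.TensorProduct.tmul_mul_tmul]
    have e2 : R.p (-1) * (R.p 1 * x * R.p 1 * R.p (-1)) = x := by
      simp only [mul_assoc, R.osc.p_mul, R.osc.p_mul']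
      simp [R.osc.p_zero]
    rw [e, tens_tmul, tens_tmul, hw, R.sand_apply, e2]
    ring
  | add x y hx hy => simp only [mul_add, add_mul, map_add, hx, hy]

theorem OscRep.tens_sand_map {w w' w'' : ℤ → ℂ} {c : ℂ}
    (hw : ∀ z, R.sand w' z = c * R.tr w'' z) (E : SiteMat ι ((S ⊗[ℂ] S) × (S ⊗[ℂ] S))) :
    (lr (incL (R.p 1)) (incL (R.p 1)) (E.map (AlgHom.fst ℂ (S ⊗[ℂ] S) (S ⊗[ℂ] S)))).map
      (tens (R.sand w) (R.sand w')) = c • E.map fun z => tens (R.tr w) (R.tr w'') z.1 := by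
  ext s t
  simp only [Matrix.map_apply, lr, Matrix.of_apply, Matrix.smul_apply, smul_eq_mul]
  exact R.tens_sand hw _

theorem Lh_map {B : Type*} [Ring B] [Algebra ℂ B] (φ : S →ₐ[ℂ] B) (q z : ℂ) (u v x a : S) :
    (Lh q z u v x a).map φ = Lh q z (φ u) (φ v) (φ x) (φ a) := by
  ext i j; fin_cases i <;> fin_cases j <;> simp [Lh]

theorem Nh_map {B : Type*} [Ring B] [Algebra ℂ B] (φ : S →ₐ[ℂ] B) (z : ℂ) (u v x a : S) :
    (Nh z u v x a).map φ = Nh z (φ u) (φ v) (φ x) (φ a) := by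
  ext i j; fin_cases i <;> fin_cases j <;> simp [Nh]

/-- Writes the composition as the first component of a matrix over `pairAlg`, which gives access to
its graded counterpart, the second component. -/
theorem OscRep.nested_eq (ξ : ι → ℂ) (hξ : ∀ k, ξ k ≠ 0) {l : List ι} {i j : ι}
    (hl : (l ++ [j]).Nodup) {w w' w'' : ℤ → ℂ} {c : ℂ}
    (hw : ∀ z, R.sand w' z = c * R.tr w'' z) (ζ : ℂ) (X : SiteMat ι ℂ) :
    (pe i 0 1 (dress (fun k => flip2 (R.L (ζ / ξ k))) (fun k => flip2 (R.N (ζ / ξ k))) l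
      ((pe j 1 0 (dress (fun k => R.L (ξ j / ξ k)) (fun k => R.N (ξ j / ξ k)) (l ++ [j]) X)).map
        (R.sand w)))).map (R.sand w') =
    c • (pe i 0 1 (contr (twoA R.a, grA (ξ j) R.p R.a) j
      (dress (fun k => R.pL (ξ j) ζ (ξ k)⁻¹) (fun k => R.pN (ξ j) ζ (ξ k)⁻¹) l X))).map
        fun z => tens (R.tr w) (R.tr w'') z.1 := by
  rw [pe_map, nested_dress _ _ _ _ _ _ hl, ← pe_map]
  have hq := Complex.exp_ne_zero η
  have e1 : (fun k => (R.L (ξ j / ξ k)).map incL * (flip2 (R.L (ζ / ξ k))).map incR) =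
      fun k => (R.pL (ξ j) ζ (ξ k)⁻¹).map (AlgHom.fst ℂ (S ⊗[ℂ] S) (S ⊗[ℂ] S)) := funext fun k => by
    rw [OscRep.pL, twoL_map]
    exact twoL_two R.osc hq _ _ _
  have e2 : (fun k => (flip2 (R.N (ζ / ξ k))).map incR * (R.N (ξ j / ξ k)).map incL) =
      fun k => (R.pN (ξ j) ζ (ξ k)⁻¹).map (AlgHom.fst ℂ (S ⊗[ℂ] S) (S ⊗[ℂ] S)) := funext fun k => by
    rw [OscRep.pN, twoN_map]
    exact twoN_two R.osc hq _ _ _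
  have e3 : (R.N (ξ j / ξ j)).map (incL (S := S)) = Nh 1 (incL (R.p 1)) (incL (R.p (-1)))
      (incL R.x) (incL R.a) := by
    rw [div_self (hξ j), OscRep.N, Nh_map]
  have e4 : (R.L (ξ j / ξ j)).map (incL (S := S)) = Lh (Complex.exp η) 1 (incL (R.p 1))
      (incL (R.p (-1))) (incL R.x) (incL R.a) := by
    rw [div_self (hξ j), OscRep.L, Lh_map]
  rw [e1, e2, e3, e4, ← dress_map, pe_Nh_Lh]
  rw [pe_lr, show incL R.a = (AlgHom.fst ℂ (S ⊗[ℂ] S) (S ⊗[ℂ] S)) (twoA R.a, grA (ξ j) R.p R.a) from rfl]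
  rw [← contr_map]
  rw[← pe_map]
  generalize pe i 0 1 (contr (twoA R.a, grA (ξ j) R.p R.a) j (dress (fun k => R.pL (ξ j) ζ (ξ k)⁻¹) (fun k => R.pN (ξ j) ζ (ξ k)⁻¹) l X)) = E

  exact R.tens_sand_map (w := w) hw E

/-- The graded Lax matrices. -/
def OscRep.vL (ξ₁ ξ₂ z : ℂ) : Matrix (Fin 2) (Fin 2) S :=
  XXZ.vL (Complex.exp η) ξ₁ ξ₂ z (R.p 1) (R.p (-1)) R.x R.y
def OscRep.vN (ξ₁ ξ₂ z : ℂ) : Matrix (Fin 2) (Fin 2) S :=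
  XXZ.vN (Complex.exp η) ξ₁ ξ₂ z (R.p 1) (R.p (-1)) R.x R.y

/-- At `z = ξ₁⁻¹` the first row of the graded inverse is, up to a left factor, `(A, 1)` with `A =
grA`. With the column of `gr_col`, this lets the contraction left over from `c` be read as a matrix
element at `j`, which restores the site `j` to the chain. -/
theorem OscRep.gr_row {ξ₁ : ℂ} (hξ : ξ₁ ≠ 0) (ξ₂ : ℂ) :
    ((Complex.exp η * ξ₁) • (R.y ⊗ₜ[ℂ] R.p (-1))) *
        ((R.vN ξ₁ ξ₂ ξ₁⁻¹).map (incL (S := S)) * dg' (grT R.p)) 0 0 = 1 * grA ξ₁ R.p R.a ∧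
    ((Complex.exp η * ξ₁) • (R.y ⊗ₜ[ℂ] R.p (-1))) *
        ((R.vN ξ₁ ξ₂ ξ₁⁻¹).map (incL (S := S)) * dg' (grT R.p)) 0 1 = 1 := by
  have hq := Complex.exp_ne_zero η
  have hp := R.osc.p_mul
  have h1 : R.a * R.p (-1) = R.y * (R.p (-1) - R.p 1) := by
    rw [R.a_eq, mul_assoc, sub_mul, one_mul, hp]; norm_num
  constructor
  · rw [grA, h1, one_mul]
    simp [Matrix.mul_apply, Fin.sum_univ_two, OscRep.vN, XXZ.vN, dg', grT, incL,
      Algebra.TensorProduct.tmul_mul_tmul, hp, TensorProduct.tmul_sub, TensorProduct.sub_tmul,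
      mul_sub, sub_mul, smul_sub, ← TensorProduct.smul_tmul', smul_smul]
    match_scalars <;> field_simp
  · simp [Matrix.mul_apply, Fin.sum_univ_two, OscRep.vN, XXZ.vN, dg', grT, incL,
      Algebra.TensorProduct.tmul_mul_tmul, hp, R.yx, R.osc.p_zero,
      ← TensorProduct.smul_tmul', smul_smul, Algebra.TensorProduct.one_def]
    match_scalars
    field_simp

theorem OscRep.gr_col {ξ₁ : ℂ} (hξ : ξ₁ ≠ 0) (ξ₂ : ℂ) :
    (dg (grT R.p) * (R.vL ξ₁ ξ₂ ξ₁⁻¹).map (incL (S := S))) 0 1 *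
      ((-ξ₁) • (R.y ⊗ₜ[ℂ] R.p (-1))) = 1 ∧
    (dg (grT R.p) * (R.vL ξ₁ ξ₂ ξ₁⁻¹).map (incL (S := S))) 1 1 *
      ((-ξ₁) • (R.y ⊗ₜ[ℂ] R.p (-1))) = -(grA ξ₁ R.p R.a * 1) := by
  have hq := Complex.exp_ne_zero η
  have hp := R.osc.p_mul
  have h1 : R.a * R.p (-1) = R.y * (R.p (-1) - R.p 1) := by
    rw [R.a_eq, mul_assoc, sub_mul, one_mul, hp]; norm_num
  have h2 : ∀ m, R.p m * R.y = (Complex.exp η) ^ (-m) • (R.y * R.p m) := fun m => by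
    have : R.p m * R.y = R.y * (R.x * R.p m) * R.y := by rw [← mul_assoc, R.yx, one_mul]
    have h3 : R.x * R.p m = Complex.exp η ^ (-m) • (R.p m * R.x) := by
      rw [R.osc.px, smul_smul, ← zpow_add₀ hq]; simp
    rw [this, h3, mul_smul_comm, smul_mul_assoc, mul_assoc, mul_assoc, R.xy, mul_one]
  constructor
  · simp [Matrix.mul_apply, Fin.sum_univ_two, OscRep.vL, XXZ.vL, dg, grT, incL,
      Algebra.TensorProduct.tmul_mul_tmul, hp, R.xy, R.osc.p_zero, TensorProduct.neg_tmul,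
      ← TensorProduct.smul_tmul', smul_smul, Algebra.TensorProduct.one_def]
    match_scalars
    field_simp
  · rw [grA, h1, mul_one]
    simp [Matrix.mul_apply, Fin.sum_univ_two, OscRep.vL, XXZ.vL, dg, grT, incL,
      Algebra.TensorProduct.tmul_mul_tmul, hp, TensorProduct.tmul_sub, TensorProduct.sub_tmul,
      mul_sub, sub_mul, smul_sub, ← TensorProduct.smul_tmul', smul_smul, h2]
    match_scalars <;> field_simp

theorem dress_eq_of {L L' N N' : ι → Matrix (Fin 2) (Fin 2) S} (h : ∀ k, L k = L' k)
    (h' : ∀ k, N k = N' k) (l : List ι) (X : SiteMat ι ℂ) : dress L N l X = dress L' N' l X := by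
  rw [funext h, funext h']

/-- The chain `l ++ [j]` must contain every site: then the central factors combine into a function
of the total spin `m` alone. -/
theorem OscRep.contr_gr {ξ : ι → ℂ} (hξ : ∀ k, ξ k ≠ 0) (ζ : ℂ) {l : List ι} {j : ι}
    (hl : (l ++ [j]).Nodup) (hmem : ∀ k, k ∈ l ++ [j]) {m : ℤ} {X : SiteMat ι ℂ}
    (hX : HasSpin m X) :
    (contr (twoA R.a, grA (ξ j) R.p R.a) j
      (dress (fun k => R.pL (ξ j) ζ (ξ k)⁻¹) (fun k => R.pN (ξ j) ζ (ξ k)⁻¹) l X)).map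
        (AlgHom.snd ℂ (S ⊗[ℂ] S) (S ⊗[ℂ] S)) =
    lr ((Complex.exp η * ξ j) • (R.y ⊗ₜ[ℂ] R.p (-1))) ((-ξ j) • (R.y ⊗ₜ[ℂ] R.p (-1)))
      (pe j 0 1 (lr (grT R.p (-2 * m)) 1
        ((dress (fun k => R.vL (ξ j) ζ (ξ k)⁻¹) (fun k => R.vN (ξ j) ζ (ξ k)⁻¹)
          (l ++ [j]) X).map incL))) := by
  have hq := Complex.exp_ne_zero η
  have e1 : ∀ k, (R.pL (ξ j) ζ (ξ k)⁻¹).map (AlgHom.snd ℂ (S ⊗[ℂ] S) (S ⊗[ℂ] S)) =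
      dg (grT R.p) * (R.vL (ξ j) ζ (ξ k)⁻¹).map incL := fun k => by
    rw [OscRep.pL, twoL_map]
    exact twoL_gr R.osc hq R.a_eq _ _ _
  have e2 : ∀ k, (R.pN (ξ j) ζ (ξ k)⁻¹).map (AlgHom.snd ℂ (S ⊗[ℂ] S) (S ⊗[ℂ] S)) =
      (R.vN (ξ j) ζ (ξ k)⁻¹).map incL * dg' (grT R.p) := fun k => by
    rw [OscRep.pN, twoN_map]
    exact twoN_gr R.osc hq R.a_eq _ _ _
  have T0 : grT R.p 0 = 1 := by rw [grT, R.osc.p_zero, Algebra.TensorProduct.one_def]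
  have Tm : ∀ m k, grT R.p m * grT R.p k = grT R.p (m + k) := fun m k => by
    rw [grT, grT, Algebra.TensorProduct.tmul_mul_tmul, R.osc.p_mul, one_mul, grT]
  rw [contr_map, dress_map, dress_eq_of e1 e2, ← dress_dg_mul T0 Tm incL
    (fun m b => (commute_incL_incR b (R.p m)).symm) _ _ hl hmem hX, dress_append_singleton,
    pe_eq_lr_contr (P := 1) (Q := 1) (A := grA (ξ j) R.p R.a) 0 1 j _ (R.gr_row (hξ j) ζ).1
    (R.gr_row (hξ j) ζ).2 (R.gr_col (hξ j) ζ).1 (R.gr_col (hξ j) ζ).2]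
  ext s t
  simp only [lr, Matrix.of_apply, one_mul, mul_one]
  rfl

/-- The second tensor factor is now only a power of `q^D`. The two factors `y ⊗ q^{-D}` shift its
exponent by `-2`, and its trace is the scalar weight. -/
theorem OscRep.trGr_lr (α c d : ℂ) (m : ℤ) (Z : SiteMat ι S) :
    (lr (c • (R.y ⊗ₜ[ℂ] R.p (-1))) (d • (R.y ⊗ₜ[ℂ] R.p (-1)))
      (lr (grT R.p m) 1 (Z.map (incL (S := S))))).map (R.trGr α) =
    (c * d * wPlus η α (m - 2)) • (lr R.y R.y Z).map (R.tr (wPlus η α)) := by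
  ext s t
  have e : c • (R.y ⊗ₜ[ℂ] R.p (-1)) * (grT R.p m * incL (Z s t) * 1) *
      (d • (R.y ⊗ₜ[ℂ] R.p (-1))) = (c * d) • ((R.y * Z s t * R.y) ⊗ₜ[ℂ] R.p (m - 2)) := by
    have e2 : R.p (-1) * R.p m * R.p (-1) = R.p (m - 2) := by
      rw [R.osc.p_mul, R.osc.p_mul]; congr 1; ring
    rw [mul_one, smul_mul_assoc, smul_mul_smul_comm, ← e2]
    simp [incL, grT, Algebra.TensorProduct.tmul_mul_tmul, mul_assoc]
  simp only [Matrix.map_apply, Matrix.smul_apply, lr, Matrix.of_apply] at e ⊢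
  rw [e, map_smul, OscRep.trGr, tens_tmul, R.tr_p, smul_eq_mul, smul_eq_mul]
  ring

/-- The composition of two transfer matrices, evaluated in the graded module. -/
theorem OscRep.nested_eventually (hη : η ≠ 0) {ξ : ι → ℂ} (hξ : ∀ k, ξ k ≠ 0) (ζ : ℂ) {l : List ι}
    {i j : ι} (hl : (l ++ [j]).Nodup) (hmem : ∀ k, k ∈ l ++ [j]) {c : ℂ}
    (hw : ∀ α z, R.sand (wMinus η (α - 1)) z = c * R.tr (wMinus η α) z) {m : ℤ} {X : SiteMat ι ℂ}
    (hX : HasSpin m X) :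
    ∀ᶠ α in 𝓝[≠] (0 : ℂ),
      (pe i 0 1 (dress (fun k => flip2 (R.L (ζ / ξ k))) (fun k => flip2 (R.N (ζ / ξ k))) l
        ((pe j 1 0 (dress (fun k => R.L (ξ j / ξ k)) (fun k => R.N (ξ j / ξ k)) (l ++ [j]) X)).map
          (R.sand (wPlus η α))))).map (R.sand (wMinus η (α - 1))) =
      (-(c * (Complex.exp η * ξ j ^ 2)) * wPlus η α (-2 * m - 2)) •
        (pe i 0 1 (pe j 0 1 (lr R.y R.y (dress (fun k => R.vL (ξ j) ζ (ξ k)⁻¹)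
          (fun k => R.vN (ξ j) ζ (ξ k)⁻¹) (l ++ [j]) X)))).map (R.tr (wPlus η α)) := by
  set E := contr (twoA R.a, grA (ξ j) R.p R.a) j
      (dress (fun k => R.pL (ξ j) ζ (ξ k)⁻¹) (fun k => R.pN (ξ j) ζ (ξ k)⁻¹) l X) with hE
  have hmemE : EntriesIn (R.pairAlg (ξ j) ζ) E :=
    EntriesIn.contr (R.pairAlg_gen (ξ j) ζ).2.2.1 (EntriesIn.dress
      (fun k => (R.entriesIn_p _ _ _).1) (fun k => (R.entriesIn_p _ _ _).2) _ _) j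
  -- There are finitely many matrix entries, so one punctured neighbourhood serves them all.
  have hev : ∀ᶠ α in 𝓝[≠] (0 : ℂ), ∀ s t, R.trTwo α (E s t).1 = R.trGr α (E s t).2 :=
    Filter.eventually_all.2 fun s => Filter.eventually_all.2 fun t =>
      R.trTwo_eventually_eq hη (hmemE s t)
  filter_upwards [hev] with α hα
  rw [R.nested_eq ξ hξ hl (hw α) ζ X, ← hE]
  have e1 : (pe i 0 1 E).map (fun z => tens (R.tr (wPlus η α)) (R.tr (wMinus η α)) z.1) =
      pe i 0 1 ((E.map (AlgHom.snd ℂ (S ⊗[ℂ] S) (S ⊗[ℂ] S))).map (R.trGr α)) := by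
    ext s t
    simp only [Matrix.map_apply, pe, Matrix.of_apply]
    split_ifs
    · exact hα _ _
    · simp
  rw [e1, hE, R.contr_gr hξ ζ hl hmem hX, pe_lr j, ← pe_map j, R.trGr_lr, pe_smul, smul_smul,
    ← pe_map i, pe_lr j]
  congr 1
  ring


end Composition

open scoped TensorProduct


/-! ### The quantum torus -/

/-- The relations of the quantum torus. -/
structure IsTorus {S : Type*} [Ring S] [Algebra ℂ S] (q : ℂ) (u v x y : S) : Prop where
  uv : u * v = 1
  vu : v * u = 1
  xy : x * y = 1
  yx : y * x = 1
  ux : u * x = q • (x * u)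
  vx : v * x = q⁻¹ • (x * v)
  uy : u * y = q⁻¹ • (y * u)
  vy : v * y = q • (y * v)

namespace IsTorus

variable {S : Type*} [Ring S] [Algebra ℂ S] {q : ℂ} {u v x y : S}

theorem uv' (h : IsTorus q u v x y) (w : S) : u * (v * w) = w := by
  rw [← mul_assoc, h.uv, one_mul]

theorem vu' (h : IsTorus q u v x y) (w : S) : v * (u * w) = w := by
  rw [← mul_assoc, h.vu, one_mul]

theorem xy' (h : IsTorus q u v x y) (w : S) : x * (y * w) = w := by
  rw [← mul_assoc, h.xy, one_mul]

theorem yx' (h : IsTorus q u v x y) (w : S) : y * (x * w) = w := by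
  rw [← mul_assoc, h.yx, one_mul]

theorem ux' (h : IsTorus q u v x y) (w : S) : u * (x * w) = q • (x * (u * w)) := by
  rw [← mul_assoc, h.ux, smul_mul_assoc, mul_assoc]

theorem vx' (h : IsTorus q u v x y) (w : S) : v * (x * w) = q⁻¹ • (x * (v * w)) := by
  rw [← mul_assoc, h.vx, smul_mul_assoc, mul_assoc]

theorem uy' (h : IsTorus q u v x y) (w : S) : u * (y * w) = q⁻¹ • (y * (u * w)) := by
  rw [← mul_assoc, h.uy, smul_mul_assoc, mul_assoc]

theorem vy' (h : IsTorus q u v x y) (w : S) : v * (y * w) = q • (y * (v * w)) := by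
  rw [← mul_assoc, h.vy, smul_mul_assoc, mul_assoc]

end IsTorus

section Torus

variable {S : Type*} [Ring S] [Algebra ℂ S] {q : ℂ} {u v x y f : S}

/-- The relations between the entries of `vL`. -/
structure IsTorusLax (q c₁ c₂ : ℂ) (u v x f : S) : Prop where
  uv : u * v = 1
  vu : v * u = 1
  ux : u * x = q • (x * u)
  vx : v * x = q⁻¹ • (x * v)
  uf : u * f = q⁻¹ • (f * u)
  vf : v * f = q • (f * v)
  xf : x * f = (c₁ + c₂) • 1 - c₁ • (u * u) - c₂ • (v * v)
  fx : f * x = (c₁ + c₂) • 1 - (c₁ * q ^ 2) • (u * u) - (c₂ * q⁻¹ ^ 2) • (v * v)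

/-- The lower left entry of `vL` is treated as a new generator `f`, known only through its relations
with `u`, `v`, `x`; this makes the exchange relations a normal-ordering computation. -/
theorem IsTorus.isTorusLax (h : IsTorus q u v x y) (hq : q ≠ 0) (c₁ c₂ : ℂ) :
    IsTorusLax q c₁ c₂ u v x (y * ((c₁ + c₂) • 1 - c₁ • (u * u) - c₂ • (v * v))) where
  uv := h.uv
  vu := h.vu
  ux := h.ux
  vx := h.vx
  uf := by
    simp only [mul_sub, sub_mul, mul_smul_comm, smul_mul_assoc, mul_one, mul_assoc, h.uy', h.uy,
      h.uv, h.vu, h.uv', h.vu', smul_sub]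
    match_scalars <;> field_simp
  vf := by
    simp only [mul_sub, sub_mul, mul_smul_comm, smul_mul_assoc, mul_one, mul_assoc, h.vy', h.vy,
      h.uv, h.vu, h.uv', h.vu', smul_sub]
    match_scalars <;> field_simp
  xf := by rw [h.xy']
  fx := by
    simp only [mul_sub, sub_mul, mul_smul_comm, smul_mul_assoc, mul_one, mul_assoc, h.ux, h.vx,
      h.ux', h.vx', h.yx', h.yx, one_mul, smul_sub, smul_smul]
    match_scalars <;> field_simp

namespace IsTorusLax

variable {c₁ c₂ : ℂ}

theorem uv' (h : IsTorusLax q c₁ c₂ u v x f) (w : S) : u * (v * w) = w := by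
  rw [← mul_assoc, h.uv, one_mul]

theorem vu' (h : IsTorusLax q c₁ c₂ u v x f) (w : S) : v * (u * w) = w := by
  rw [← mul_assoc, h.vu, one_mul]

theorem ux' (h : IsTorusLax q c₁ c₂ u v x f) (w : S) : u * (x * w) = q • (x * (u * w)) := by
  rw [← mul_assoc, h.ux, smul_mul_assoc, mul_assoc]

theorem vx' (h : IsTorusLax q c₁ c₂ u v x f) (w : S) : v * (x * w) = q⁻¹ • (x * (v * w)) := by
  rw [← mul_assoc, h.vx, smul_mul_assoc, mul_assoc]

theorem uf' (h : IsTorusLax q c₁ c₂ u v x f) (w : S) : u * (f * w) = q⁻¹ • (f * (u * w)) := by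
  rw [← mul_assoc, h.uf, smul_mul_assoc, mul_assoc]

theorem vf' (h : IsTorusLax q c₁ c₂ u v x f) (w : S) : v * (f * w) = q • (f * (v * w)) := by
  rw [← mul_assoc, h.vf, smul_mul_assoc, mul_assoc]

end IsTorusLax

set_option maxHeartbeats 400000 in
-- Needed because the order of the sites `i` and `j` must also be exchanged in the torus dressing;
-- see `dress_swap`.
theorem vL_rll (h : IsTorus q u v x y) (hq : q ≠ 0) (ξ₁ ξ₂ : ℂ) {w : ℂ} (hw : w ≠ 0) (z : ℂ) :
    (Rp q w).map (algebraMap ℂ S) * onSnd (vL q ξ₁ ξ₂ (w * z) u v x y) *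
        onFst (vL q ξ₁ ξ₂ z u v x y) =
      onFst (vL q ξ₁ ξ₂ z u v x y) * onSnd (vL q ξ₁ ξ₂ (w * z) u v x y) *
        (Rp q w).map (algebraMap ℂ S) := by
  have h := h.isTorusLax hq (ξ₁ ^ 2) (ξ₂ ^ 2)
  simp only [vL]
  generalize y * ((ξ₁ ^ 2 + ξ₂ ^ 2) • 1 - ξ₁ ^ 2 • (u * u) - ξ₂ ^ 2 • (v * v)) = f at h ⊢
  ext ⟨i, i'⟩ ⟨j, j'⟩
  fin_cases i <;> fin_cases i' <;> fin_cases j <;> fin_cases j' <;>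
    simp [Rp, onFst, onSnd, Matrix.mul_apply, Fintype.sum_prod_type, Fin.sum_univ_two,
      Algebra.algebraMap_eq_smul_one, mul_add, add_mul, mul_sub, sub_mul,
      mul_assoc, smul_smul, smul_sub, smul_add, h.uv, h.vu, h.ux, h.vx, h.uf, h.vf, h.xf, h.fx,
      h.uv', h.vu', h.ux', h.vx', h.uf', h.vf'] <;>
    match_scalars <;> field_simp <;> ring

set_option maxHeartbeats 400000 in
theorem vN_rll (h : IsTorus q u v x y) (hq : q ≠ 0) (ξ₁ ξ₂ : ℂ) {w : ℂ} (hw : w ≠ 0) (z : ℂ) :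
    (Rp q w).map (algebraMap ℂ S) * onFst (vN q ξ₁ ξ₂ z u v x y) *
        onSnd (vN q ξ₁ ξ₂ (w * z) u v x y) =
      onSnd (vN q ξ₁ ξ₂ (w * z) u v x y) * onFst (vN q ξ₁ ξ₂ z u v x y) *
        (Rp q w).map (algebraMap ℂ S) := by
  have h := h.isTorusLax hq (ξ₁ ^ 2) (ξ₂ ^ 2)
  simp only [vN]
  generalize y * ((ξ₁ ^ 2 + ξ₂ ^ 2) • 1 - ξ₁ ^ 2 • (u * u) - ξ₂ ^ 2 • (v * v)) = f at h ⊢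
  ext ⟨i, i'⟩ ⟨j, j'⟩
  fin_cases i <;> fin_cases i' <;> fin_cases j <;> fin_cases j' <;>
    simp [Rp, onFst, onSnd, Matrix.mul_apply, Fintype.sum_prod_type, Fin.sum_univ_two,
      Algebra.algebraMap_eq_smul_one, mul_add, add_mul, mul_sub, sub_mul,
      mul_assoc, smul_smul, smul_sub, smul_add, h.uv, h.vu, h.ux, h.vx, h.uf, h.vf, h.xf, h.fx,
      h.uv', h.vu', h.ux', h.vx', h.uf', h.vf'] <;>
    match_scalars <;> field_simp <;> ring

end Torus

open scoped TensorProduct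


/-! ### Exchange of two sites and of two oscillators -/

section Swap

variable {ι S : Type*} [Fintype ι] [DecidableEq ι] [Ring S] [Algebra ℂ S] {q : ℂ} {ξ : ι → ℂ}

/-- By the ice rule, a row with equal spins at `i` and `j` has only its diagonal entry. -/
theorem rr_row {i j : ι} (b : Fin 2) {s : ι → Fin 2} (hi : s i = b) (hj : s j = b)
    (t : ι → Fin 2) :
    rr q ξ i j s t = if s = t then q * (ξ i / ξ j) - q⁻¹ * (ξ i / ξ j)⁻¹ else 0 := by
  rw [rr, site2_apply]
  by_cases h : s = t
  · subst h
    simp [Rp, hi, hj]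
  · rw [if_neg h]
    split_ifs with h1
    · simp only [Rp, Matrix.of_apply, hi, hj, if_true]
      rw [if_neg]
      intro h2
      refine h (funext fun k => ?_)
      have h3 := Prod.mk.inj h2
      by_cases hki : k = i
      · rw [hki, hi, h3.1]
      · by_cases hkj : k = j
        · rw [hkj, hj, h3.2]
        · exact h1 k hki hkj
    · rfl

theorem rr_symm (i j : ι) (s t : ι → Fin 2) : rr q ξ i j s t = rr q ξ i j t s := by
  rw [rr, site2_apply, site2_apply]
  refine if_congr (by simp only [eq_comm]) ?_ rfl
  generalize s i = a
  generalize s j = b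
  generalize t i = c
  generalize t j = d
  fin_cases a <;> fin_cases b <;> fin_cases c <;> fin_cases d <;> simp [Rp]

theorem rr_mul_apply {i j : ι} (b : Fin 2) {s : ι → Fin 2} (hi : s i = b) (hj : s j = b)
    (W : SiteMat ι S) (t : ι → Fin 2) :
    (castM (S := S) (rr q ξ i j) * W) s t = (q * (ξ i / ξ j) - q⁻¹ * (ξ i / ξ j)⁻¹) • W s t := by
  rw [Matrix.mul_apply, Finset.sum_eq_single s]
  · rw [castM_apply, rr_row b hi hj, if_pos rfl, ← Algebra.smul_def]
  · intro r _ hr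
    rw [castM_apply, rr_row b hi hj, if_neg hr.symm, map_zero, zero_mul]
  · simp

theorem mul_rr_apply {i j : ι} (b : Fin 2) {t : ι → Fin 2} (hi : t i = b) (hj : t j = b)
    (W : SiteMat ι S) (s : ι → Fin 2) :
    (W * castM (S := S) (rr q ξ i j)) s t = (q * (ξ i / ξ j) - q⁻¹ * (ξ i / ξ j)⁻¹) • W s t := by
  rw [Matrix.mul_apply, Finset.sum_eq_single t]
  · rw [castM_apply, rr_row b hi hj, if_pos rfl, ← Algebra.commutes, ← Algebra.smul_def]
  · intro r _ hr
    rw [castM_apply, rr_symm, rr_row b hi hj, if_neg hr.symm, map_zero, mul_zero]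
  · simp

/-- The selected matrix elements have equal row spins at `i` and `j` and equal column spins there.
On these the R-matrix acts as a scalar, which cancels against its inverse. -/
theorem pe_pe_conj (hq : q ≠ 0) (hξ : ∀ k, ξ k ≠ 0) {i j : ι} (hij : i ≠ j)
    (hr : RReg q ξ i j) (b c : Fin 2) (W : SiteMat ι S) :
    pe i b c (pe j b c (castM (rri q ξ i j) * W * castM (rr q ξ i j))) =
      pe i b c (pe j b c W) := by
  have key : ∀ s t : ι → Fin 2, s i = b → s j = b → t i = c → t j = c →
      (castM (S := S) (rri q ξ i j) * W * castM (S := S) (rr q ξ i j)) s t = W s t := by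
    intro s t h1 h2 h3 h4
    have e1 : castM (rr q ξ i j) * (castM (rri q ξ i j) * W) = W := by
      rw [← mul_assoc, ← map_mul, rr_mul_rri hq hξ hij hr, map_one, one_mul]
    have e2 := congrFun (congrFun e1 s) t
    rw [rr_mul_apply b h1 h2] at e2
    rw [mul_rr_apply c h3 h4, e2]
  ext s t
  simp only [pe, Matrix.of_apply]
  split_ifs
  · apply key <;> simp [hij, hij.symm]
  · rfl
  · rfl

/-- The exchange relations for `L` and for `N` are separate hypotheses, so `N` need not be an
inverse of `L`. -/
theorem dress_swap {L N : ι → Matrix (Fin 2) (Fin 2) S} {l : List ι} {i j : ι}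
    (hi : i ∉ l) (hj : j ∉ l) (hij : i ≠ j) (hq : q ≠ 0) (hξ : ∀ k, ξ k ≠ 0) (hr : RReg q ξ i j)
    (hL : (Rp q (ξ i / ξ j)).map (algebraMap ℂ S) * onSnd (L j) * onFst (L i) =
      onFst (L i) * onSnd (L j) * (Rp q (ξ i / ξ j)).map (algebraMap ℂ S))
    (hN : (Rp q (ξ i / ξ j)).map (algebraMap ℂ S) * onFst (N i) * onSnd (N j) =
      onSnd (N j) * onFst (N i) * (Rp q (ξ i / ξ j)).map (algebraMap ℂ S)) (X : SiteMat ι ℂ) :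
    dress L N (l ++ [j] ++ [i]) (rri q ξ i j * X * rr q ξ i j) =
      castM (rri q ξ i j) * dress L N (l ++ [i] ++ [j]) X * castM (rr q ξ i j) := by
  have hL' := congrArg (site2 i j) hL
  have hN' := congrArg (site2 i j) hN
  rw [site2_mul hij, site2_mul hij, site2_mul hij, site2_mul hij, site2_onFst hij,
    site2_onSnd hij, ← castM_rr] at hL' hN'
  have hRi : castM (S := S) (rri q ξ i j) * castM (rr q ξ i j) = 1 := by
    rw [← map_mul, rri_mul_rr hq hξ hij hr, map_one]
  have hRi' : castM (S := S) (rr q ξ i j) * castM (rri q ξ i j) = 1 := by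
    rw [← map_mul, rr_mul_rri hq hξ hij hr, map_one]
  simp only [dress_append_singleton]
  simp only [dress, adL, map_mul]
  set A := castM (S := S) (rr q ξ i j)
  set Ai := castM (S := S) (rri q ξ i j)
  have cA : ∀ (M : ι → Matrix (Fin 2) (Fin 2) S) (l' : List ι), i ∉ l' → j ∉ l' →
      Commute A (l'.map fun k => site1 k (M k)).prod := fun M l' h h' =>
    Commute.list_prod_right _ _ (by
      simp only [List.mem_map]
      rintro _ ⟨k, hk, rfl⟩
      exact castM_rr_commute_site1 (by rintro rfl; exact h hk) (by rintro rfl; exact h' hk) _)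
  have cL := cA L l hi hj
  have cN := cA N l.reverse (by simpa using hi) (by simpa using hj)
  set PL := (l.map fun k => site1 k (L k)).prod
  set PN := (l.reverse.map fun k => site1 k (N k)).prod
  have cN' : PN * Ai = Ai * PN := by
    calc PN * Ai = Ai * (A * PN) * Ai := by rw [← mul_assoc, hRi, one_mul]
      _ = Ai * PN := by rw [cN.eq, mul_assoc, mul_assoc, hRi', mul_one]
  have hN2 : site1 i (N i) * site1 j (N j) * Ai = Ai * (site1 j (N j) * site1 i (N i)) := by
    calc site1 i (N i) * site1 j (N j) * Ai
        = Ai * (A * site1 i (N i) * site1 j (N j)) * Ai := by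
          rw [mul_assoc A, ← mul_assoc, hRi, one_mul]
      _ = Ai * (site1 j (N j) * site1 i (N i)) := by rw [hN']; simp only [mul_assoc, hRi', mul_one]
  calc site1 i (N i) * (site1 j (N j) * (PN * (Ai * castM X * A) * PL) * site1 j (L j)) *
        site1 i (L i)
      = site1 i (N i) * site1 j (N j) * (PN * Ai) * castM X * (A * PL) * site1 j (L j) *
        site1 i (L i) := by simp only [mul_assoc]
    _ = (site1 i (N i) * site1 j (N j) * Ai) * PN * castM X * PL * (A * site1 j (L j) *
        site1 i (L i)) := by rw [cN', cL.eq]; simp only [mul_assoc]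
    _ = _ := by rw [hN2, hL']; simp only [mul_assoc]

/-- The powers of a scalar. -/
def scT (S : Type*) [Ring S] [Algebra ℂ S] (r : ℂ) (m : ℤ) : S := algebraMap ℂ S (r ^ m)

/-- Rescaling the torus generators by `r = ξ₂/ξ₁` interchanges `ξ₁` and `ξ₂`, up to a diagonal
matrix of scalars. -/
theorem vL_scale {r ξ₁ ξ₂ : ℂ} (hr : r ≠ 0) (h : ξ₂ = r * ξ₁) (z : ℂ) (u v x y : S) :
    vL q ξ₁ ξ₂ z (r • u) (r⁻¹ • v) (r • x) (r⁻¹ • y) = dg (scT S r) * vL q ξ₂ ξ₁ z u v x y := by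
  subst h
  ext i j
  fin_cases i <;> fin_cases j <;>
    simp [vL, dg, scT, Matrix.mul_apply, Fin.sum_univ_two, Algebra.algebraMap_eq_smul_one,
      mul_sub, mul_add, smul_sub, smul_add, smul_smul] <;>
    match_scalars <;> field_simp <;> ring

theorem vN_scale {r ξ₁ ξ₂ : ℂ} (hr : r ≠ 0) (h : ξ₂ = r * ξ₁) (z : ℂ) (u v x y : S) :
    vN q ξ₁ ξ₂ z (r • u) (r⁻¹ • v) (r • x) (r⁻¹ • y) = vN q ξ₂ ξ₁ z u v x y * dg' (scT S r) := by
  subst h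
  ext i j
  fin_cases i <;> fin_cases j <;>
    simp [vN, dg', scT, Matrix.mul_apply, Fin.sum_univ_two, Algebra.algebraMap_eq_smul_one,
      mul_sub, mul_add, smul_sub, smul_add, smul_smul] <;>
    match_scalars <;> field_simp <;> ring

theorem dress_scale {r ξ₁ ξ₂ : ℂ} (hr : r ≠ 0) (h : ξ₂ = r * ξ₁) (z : ι → ℂ) (u v x y : S)
    {l : List ι} (hl : l.Nodup) (hmem : ∀ k, k ∈ l) {m : ℤ} {X : SiteMat ι ℂ} (hX : HasSpin m X) :
    dress (fun k => vL q ξ₁ ξ₂ (z k) (r • u) (r⁻¹ • v) (r • x) (r⁻¹ • y))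
      (fun k => vN q ξ₁ ξ₂ (z k) (r • u) (r⁻¹ • v) (r • x) (r⁻¹ • y)) l X =
    r ^ (-2 * m) • dress (fun k => vL q ξ₂ ξ₁ (z k) u v x y)
      (fun k => vN q ξ₂ ξ₁ (z k) u v x y) l X := by
  have e := dress_dg_mul (T := scT S r) (by simp [scT])
    (fun m k => by rw [scT, scT, ← map_mul, ← zpow_add₀ hr, scT]) (AlgHom.id ℂ S)
    (fun m b => Algebra.commutes _ _) (fun k => vL q ξ₂ ξ₁ (z k) u v x y)
    (fun k => vN q ξ₂ ξ₁ (z k) u v x y) hl hmem hX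
  rw [dress_eq_of (fun k => vL_scale hr h (z k) u v x y) (fun k => vN_scale hr h (z k) u v x y)]
  refine e.trans ?_
  ext s t
  simp only [lr, Matrix.of_apply, mul_one, Matrix.smul_apply, scT, ← Algebra.smul_def]
  rfl

end Swap

/-! ### Symmetry of the leading coefficient under exchange of the two sites. -/

section TorusTrace

variable {ι S : Type*} [Fintype ι] [DecidableEq ι] [Ring S] [Algebra ℂ S] {η : ℂ}
  (R : OscRep S η)

theorem OscRep.isTorus : IsTorus (Complex.exp η) (R.p 1) (R.p (-1)) R.x R.y := by
  have hq := Complex.exp_ne_zero η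
  have hy : ∀ m : ℤ, R.p m * R.y = Complex.exp η ^ (-m) • (R.y * R.p m) := fun m => by
    have : R.p m * R.y = R.y * (R.x * R.p m) * R.y := by rw [← mul_assoc, R.yx, one_mul]
    have h3 : R.x * R.p m = Complex.exp η ^ (-m) • (R.p m * R.x) := by
      rw [R.osc.px, smul_smul, ← zpow_add₀ hq]; simp
    rw [this, h3, mul_smul_comm, smul_mul_assoc, mul_assoc, mul_assoc, R.xy, mul_one]
  have hx := R.osc.px
  exact ⟨R.osc.isOsc.uv, R.osc.isOsc.vu, R.xy, R.yx, by simpa using hx 1, by simpa using hx (-1),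
    by simpa using hy 1, by simpa using hy (-1)⟩

/-- The pairs `(g, c g)` of generators of the quantum torus and their multiples. -/
def OscRep.scaleAlg (r : ℂ) : Subalgebra ℂ (S × S) :=
  Algebra.adjoin ℂ {(R.p 1, r • R.p 1), (R.p (-1), r⁻¹ • R.p (-1)), (R.x, r • R.x),
    (R.y, r⁻¹ • R.y)}

/-- A torus monomial `x^k q^{mD}` is multiplied by `r^{k+m}` under the rescaling, and the functional
sees only `k = m = 0`, where the factor is `1`. -/
theorem OscRep.trZero_scale {r : ℂ} (hr : r ≠ 0) {z : S × S} (hz : z ∈ R.scaleAlg r) :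
    R.tr wZero z.1 = R.tr wZero z.2 := by
  have hq := Complex.exp_ne_zero η
  set X : Sˣ := ⟨R.x, R.y, R.xy, R.yx⟩ with hX
  have hXs : ∀ k : ℤ, R.x * (X ^ k : Sˣ) = (X ^ (k + 1) : Sˣ) := fun k => by
    rw [add_comm, zpow_add, zpow_one]; rfl
  have hYs : ∀ k : ℤ, R.y * (X ^ k : Sˣ) = (X ^ (k - 1) : Sˣ) := fun k => by
    rw [sub_eq_add_neg, add_comm, zpow_add, zpow_neg_one]; rfl
  have hdeg : ∀ k : ℤ, ((X ^ k : Sˣ) : S) ∈ R.deg k := fun k => by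
    induction k using Int.induction_on with
    | zero => simpa using R.deg_one
    | succ n ih => rw [← hXs, add_comm]; exact R.deg_mul R.deg_x ih
    | pred n ih => rw [← hYs, sub_eq_add_neg, add_comm]; exact R.deg_mul R.deg_y ih
  have hcomm : ∀ m k : ℤ, R.p m * (X ^ k : Sˣ) =
      Complex.exp η ^ (m * k) • ((X ^ k : Sˣ) * R.p m) := by
    intro m k
    have hy : R.p m * R.y = Complex.exp η ^ (-m) • (R.y * R.p m) := by
      have : R.p m * R.y = R.y * (R.x * R.p m) * R.y := by rw [← mul_assoc, R.yx, one_mul]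
      have h3 : R.x * R.p m = Complex.exp η ^ (-m) • (R.p m * R.x) := by
        rw [R.osc.px, smul_smul, ← zpow_add₀ hq]; simp
      rw [this, h3, mul_smul_comm, smul_mul_assoc, mul_assoc, mul_assoc, R.xy, mul_one]
    induction k using Int.induction_on with
    | zero => simp
    | succ n ih =>
      rw [← hXs, R.osc.px', ih, mul_smul_comm, smul_smul, ← zpow_add₀ hq, mul_assoc]
      congr 2; ring
    | pred n ih =>
      rw [← hYs, ← mul_assoc, hy, smul_mul_assoc, mul_assoc, ih, mul_smul_comm, smul_smul,
        ← zpow_add₀ hq, mul_assoc]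
      congr 2; ring
  -- The `W k m` pair each monomial with its rescaled version; their span contains `1` and is stable
  -- under the generators of `scaleAlg`.
  set W : ℤ → ℤ → S × S := fun k m => ((X ^ k : Sˣ) * R.p m, r ^ (k + m) • ((X ^ k : Sˣ) * R.p m))
    with hW
  set M := Submodule.span ℂ (Set.range fun km : ℤ × ℤ => W km.1 km.2) with hM
  have hWm : ∀ k m, W k m ∈ M := fun k m => Submodule.subset_span ⟨(k, m), rfl⟩
  have hmul : ∀ g : S × S, (∀ k m, g * W k m ∈ M) → ∀ w ∈ M, g * w ∈ M := by
    intro g hg w hw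
    refine Submodule.span_induction (p := fun w _ => g * w ∈ M) ?_ ?_ ?_ ?_ hw
    · rintro _ ⟨km, rfl⟩; exact hg _ _
    · rw [mul_zero]; exact M.zero_mem
    · intro a b _ _ ha hb; rw [mul_add]; exact M.add_mem ha hb
    · intro c a _ ha; rw [mul_smul_comm]; exact M.smul_mem c ha
  have hp : ∀ e k m : ℤ, (R.p e, r ^ e • R.p e) * W k m =
      Complex.exp η ^ (e * k) • W k (e + m) := by
    intro e k m
    have e1 : R.p e * ((X ^ k : Sˣ) * R.p m) =
        Complex.exp η ^ (e * k) • ((X ^ k : Sˣ) * R.p (e + m)) := by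
      rw [← mul_assoc, hcomm, smul_mul_assoc, mul_assoc, R.osc.p_mul]
    refine Prod.ext e1 ?_
    simp only [hW, Prod.snd_mul, Prod.smul_snd, smul_mul_smul_comm, e1]
    rw [smul_comm, ← zpow_add₀ hr]
    congr 3; ring
  have hx : ∀ k m : ℤ, (R.x, r • R.x) * W k m = W (k + 1) m := by
    intro k m
    refine Prod.ext ?_ ?_
    · simp only [hW, Prod.fst_mul, ← mul_assoc, hXs]
    · simp only [hW, Prod.snd_mul, smul_mul_smul_comm, ← mul_assoc, hXs]
      rw [show k + 1 + m = 1 + (k + m) by ring, zpow_add₀ hr 1, zpow_one]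
  have hy : ∀ k m : ℤ, (R.y, r⁻¹ • R.y) * W k m = W (k - 1) m := by
    intro k m
    refine Prod.ext ?_ ?_
    · simp only [hW, Prod.fst_mul, ← mul_assoc, hYs]
    · simp only [hW, Prod.snd_mul, smul_mul_smul_comm, ← mul_assoc, hYs]
      rw [show k - 1 + m = -1 + (k + m) by ring, zpow_add₀ hr (-1), zpow_neg_one]
  have hle : ∀ g ∈ R.scaleAlg r, ∀ w ∈ M, g * w ∈ M := by
    intro g hg
    refine Algebra.adjoin_induction (p := fun g _ => ∀ w ∈ M, g * w ∈ M) ?_ ?_ ?_ ?_ hg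
    · rintro g (rfl | rfl | rfl | rfl)
      · refine hmul _ fun k m => ?_
        have := hp 1 k m
        rw [zpow_one] at this
        rw [this]; exact M.smul_mem _ (hWm _ _)
      · refine hmul _ fun k m => ?_
        have := hp (-1) k m
        rw [zpow_neg_one] at this
        rw [this]; exact M.smul_mem _ (hWm _ _)
      · refine hmul _ fun k m => ?_
        rw [hx]; exact hWm _ _
      · refine hmul _ fun k m => ?_
        rw [hy]; exact hWm _ _
    · intro c w hw
      rw [← Algebra.smul_def]; exact M.smul_mem c hw
    · intro a b _ _ ha hb w hw
      rw [add_mul]; exact M.add_mem (ha w hw) (hb w hw)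
    · intro a b _ _ ha hb w hw
      rw [mul_assoc]; exact ha _ (hb w hw)
  have h1 : (1 : S × S) ∈ M := by
    have : W 0 0 = 1 := by simp [hW, R.osc.p_zero]
    rw [← this]; exact hWm _ _
  have hzM : z ∈ M := by simpa using hle z hz 1 h1
  refine Submodule.span_induction (p := fun z _ => R.tr wZero z.1 = R.tr wZero z.2)
    ?_ ?_ ?_ ?_ hzM
  · rintro _ ⟨⟨k, m⟩, rfl⟩
    simp only [hW, map_smul]
    by_cases hk : k = 0
    · subst hk
      rw [zpow_zero, Units.val_one, one_mul, R.tr_p, wZero]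
      split_ifs with hm
      · subst hm; simp
      · simp
    · have : R.tr wZero ((X ^ k : Sˣ) * R.p m) = 0 :=
        R.tr_deg _ (d := k + 0) (by simpa using hk) (R.deg_mul (hdeg k) (R.deg_p m))
      rw [this, smul_zero]
  · simp
  · intro a b _ _ ha hb; simp only [Prod.fst_add, Prod.snd_add, map_add, ha, hb]
  · intro c a _ ha; simp only [Prod.smul_fst, Prod.smul_snd, map_smul, ha]

theorem EntriesIn.lr {𝒜 : Subalgebra ℂ S} {a b : S} (ha : a ∈ 𝒜) (hb : b ∈ 𝒜) {Y : SiteMat ι S}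
    (hY : EntriesIn 𝒜 Y) : EntriesIn 𝒜 (lr a b Y) := fun s t =>
  𝒜.mul_mem (𝒜.mul_mem ha (hY s t)) hb

theorem entriesIn_v {B : Type*} [Ring B] [Algebra ℂ B] {𝒜 : Subalgebra ℂ B} {u v x y : B}
    (hu : u ∈ 𝒜) (hv : v ∈ 𝒜) (hx : x ∈ 𝒜) (hy : y ∈ 𝒜) (q ξ₁ ξ₂ z : ℂ) :
    EntriesIn 𝒜 (vL q ξ₁ ξ₂ z u v x y) ∧ EntriesIn 𝒜 (vN q ξ₁ ξ₂ z u v x y) := by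
  have sm : ∀ {x} (c : ℂ), x ∈ 𝒜 → c • x ∈ 𝒜 := fun c h => 𝒜.smul_mem h c
  have h1 := 𝒜.mul_mem hy (𝒜.sub_mem (𝒜.sub_mem (sm (ξ₁ ^ 2 + ξ₂ ^ 2) 𝒜.one_mem)
    (sm (ξ₁ ^ 2) (𝒜.mul_mem hu hu))) (sm (ξ₂ ^ 2) (𝒜.mul_mem hv hv)))
  constructor <;> intro i j <;> fin_cases i <;> fin_cases j
  · exact 𝒜.sub_mem (sm _ hu) (sm _ hv)
  · exact 𝒜.neg_mem (sm _ hx)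
  · exact 𝒜.neg_mem (sm _ h1)
  · exact 𝒜.sub_mem (sm _ hv) (sm _ hu)
  · exact 𝒜.sub_mem (sm _ hv) (sm _ hu)
  · exact sm _ hx
  · exact sm _ h1
  · exact 𝒜.sub_mem (sm _ hu) (sm _ hv)

theorem vL_map {B : Type*} [Ring B] [Algebra ℂ B] (φ : S →ₐ[ℂ] B) (q ξ₁ ξ₂ z : ℂ) (u v x y : S) :
    (vL q ξ₁ ξ₂ z u v x y).map φ = vL q ξ₁ ξ₂ z (φ u) (φ v) (φ x) (φ y) := by
  ext i j
  fin_cases i <;> fin_cases j <;> simp [vL]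

theorem vN_map {B : Type*} [Ring B] [Algebra ℂ B] (φ : S →ₐ[ℂ] B) (q ξ₁ ξ₂ z : ℂ) (u v x y : S) :
    (vN q ξ₁ ξ₂ z u v x y).map φ = vN q ξ₁ ξ₂ z (φ u) (φ v) (φ x) (φ y) := by
  ext i j
  fin_cases i <;> fin_cases j <;> simp [vN]

/-- The exponent collects `-2m` from `dress_scale` and `-2` from the two outer factors `y`, each
rescaled by `r⁻¹`. -/
theorem OscRep.trZero_symm {ξ₁ ξ₂ : ℂ} (h₁ : ξ₁ ≠ 0) (h₂ : ξ₂ ≠ 0) (z : ι → ℂ) {l : List ι}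
    (hl : l.Nodup) (hmem : ∀ k, k ∈ l) {m : ℤ} {X : SiteMat ι ℂ} (hX : HasSpin m X) :
    (lr R.y R.y (dress (fun k => R.vL ξ₁ ξ₂ (z k)) (fun k => R.vN ξ₁ ξ₂ (z k)) l X)).map
      (R.tr wZero) = (ξ₂ / ξ₁) ^ (-2 * (m + 1)) •
    (lr R.y R.y (dress (fun k => R.vL ξ₂ ξ₁ (z k)) (fun k => R.vN ξ₂ ξ₁ (z k)) l X)).map
      (R.tr wZero) := by
  set r := ξ₂ / ξ₁ with hrd
  have hr : r ≠ 0 := div_ne_zero h₂ h₁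
  have hξ : ξ₂ = r * ξ₁ := by rw [hrd, div_mul_cancel₀ _ h₁]
  have g : ∀ {w}, w ∈ ({(R.p 1, r • R.p 1), (R.p (-1), r⁻¹ • R.p (-1)), (R.x, r • R.x),
    (R.y, r⁻¹ • R.y)} : Set (S × S)) → w ∈ R.scaleAlg r := fun h => Algebra.subset_adjoin h
  have gu := g (w := (R.p 1, r • R.p 1)) (by simp)
  have gv := g (w := (R.p (-1), r⁻¹ • R.p (-1))) (by simp)
  have gx := g (w := (R.x, r • R.x)) (by simp)
  have gy := g (w := (R.y, r⁻¹ • R.y)) (by simp)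
  set D := dress (fun k => XXZ.vL (Complex.exp η) ξ₁ ξ₂ (z k) (R.p 1, r • R.p 1)
      (R.p (-1), r⁻¹ • R.p (-1)) (R.x, r • R.x) (R.y, r⁻¹ • R.y))
    (fun k => XXZ.vN (Complex.exp η) ξ₁ ξ₂ (z k) (R.p 1, r • R.p 1)
      (R.p (-1), r⁻¹ • R.p (-1)) (R.x, r • R.x) (R.y, r⁻¹ • R.y)) l X with hD
  have hDm : EntriesIn (R.scaleAlg r) (lr (R.y, r⁻¹ • R.y) (R.y, r⁻¹ • R.y) D) :=
    EntriesIn.lr gy gy (EntriesIn.dress (fun k => (entriesIn_v gu gv gx gy _ _ _ _).1)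
      (fun k => (entriesIn_v gu gv gx gy _ _ _ _).2) l X)
  have e1 : D.map (AlgHom.fst ℂ S S) = dress (fun k => R.vL ξ₁ ξ₂ (z k))
      (fun k => R.vN ξ₁ ξ₂ (z k)) l X := by
    rw [hD, dress_map]
    exact dress_eq_of (fun k => vL_map _ _ _ _ _ _ _ _ _) (fun k => vN_map _ _ _ _ _ _ _ _ _) l X
  have e2 : D.map (AlgHom.snd ℂ S S) = r ^ (-2 * m) • dress (fun k => R.vL ξ₂ ξ₁ (z k))
      (fun k => R.vN ξ₂ ξ₁ (z k)) l X := by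
    refine Eq.trans ?_ (dress_scale hr hξ z (R.p 1) (R.p (-1)) R.x R.y hl hmem hX)
    rw [hD, dress_map]
    exact dress_eq_of (fun k => vL_map _ _ _ _ _ _ _ _ _) (fun k => vN_map _ _ _ _ _ _ _ _ _) l X
  ext s t
  have e3 := R.trZero_scale hr (hDm s t)
  have e1' := congrFun (congrFun e1 s) t
  have e2' := congrFun (congrFun e2 s) t
  simp only [Matrix.map_apply, AlgHom.fst_apply, AlgHom.snd_apply, Matrix.smul_apply] at e1' e2'
  simp only [lr, Matrix.map_apply, Matrix.of_apply, Matrix.smul_apply, Prod.fst_mul, Prod.snd_mul,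
    e1', e2'] at e3 ⊢
  rw [e3, smul_mul_smul_comm, smul_mul_smul_comm, map_smul]
  congr 1
  rw [← zpow_neg_one, ← zpow_add₀ hr, ← zpow_add₀ hr]
  congr 1; ring

theorem pe_pe_comm {i j : ι} (h : i ≠ j) (b c b' c' : Fin 2) (Z : SiteMat ι S) :
    pe i b c (pe j b' c' Z) = pe j b' c' (pe i b c Z) := by
  ext s t
  simp only [pe, Matrix.of_apply, Function.update_of_ne h, Function.update_of_ne h.symm]
  rw [Function.update_comm h, Function.update_comm h]
  split_ifs <;> rfl

theorem lr_castM_conj (a b : S) (A B : SiteMat ι ℂ) (W : SiteMat ι S) :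
    lr a b (castM A * W * castM B) = castM A * lr a b W * castM B := by
  ext s t
  simp only [lr, Matrix.of_apply, Matrix.mul_apply, Finset.mul_sum, Finset.sum_mul, castM_apply]
  refine Finset.sum_congr rfl fun r _ => Finset.sum_congr rfl fun r' _ => ?_
  generalize A s r' = c
  generalize B r t = d
  simp only [← Algebra.smul_def, ← Algebra.commutes d, mul_smul_comm, smul_mul_assoc]

/-- The leading coefficients for the two orders of `i` and `j`. -/
theorem OscRep.trZero_swap {ξ : ι → ℂ} (hξ : ∀ k, ξ k ≠ 0) {l : List ι} {i j : ι}
    (hl : (l ++ [i] ++ [j]).Nodup) (hmem : ∀ k, k ∈ l ++ [i] ++ [j])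
    (hr : RReg (Complex.exp η) ξ i j) {m : ℤ} {X : SiteMat ι ℂ} (hX : HasSpin m X) :
    (pe i 0 1 (pe j 0 1 (lr R.y R.y (dress (fun k => R.vL (ξ j) (ξ i) (ξ k)⁻¹)
      (fun k => R.vN (ξ j) (ξ i) (ξ k)⁻¹) (l ++ [i] ++ [j]) X)))).map (R.tr wZero) =
    (ξ i / ξ j) ^ (-2 * (m + 1)) •
      (pe j 0 1 (pe i 0 1 (lr R.y R.y (dress (fun k => R.vL (ξ i) (ξ j) (ξ k)⁻¹)
        (fun k => R.vN (ξ i) (ξ j) (ξ k)⁻¹) (l ++ [j] ++ [i])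
          (rri (Complex.exp η) ξ i j * X * rr (Complex.exp η) ξ i j))))).map (R.tr wZero) := by
  have hq := Complex.exp_ne_zero η
  have h1 := List.nodup_append.1 hl
  have h2 := List.nodup_append.1 h1.1
  have hi : i ∉ l := fun h => h2.2.2 i h i (by simp) rfl
  have hj : j ∉ l := fun h => h1.2.2 j (by simp [h]) j (by simp) rfl
  have hij : i ≠ j := fun h => h1.2.2 i (by simp) j (by simp) h
  have hz : (ξ j)⁻¹ = ξ i / ξ j * (ξ i)⁻¹ := by field_simp [hξ i, hξ j]
  have hw : ξ i / ξ j ≠ 0 := div_ne_zero (hξ i) (hξ j)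
  rw [dress_swap hi hj hij hq hξ hr ?_ ?_, lr_castM_conj, pe_pe_comm hij.symm,
    pe_pe_conj hq hξ hij hr, pe_map, pe_map, R.trZero_symm (hξ j) (hξ i) _ hl hmem hX, pe_smul,
    pe_smul, pe_map, pe_map]
  · rw [hz]; exact vL_rll R.isTorus hq _ _ hw _
  · rw [hz]; exact vN_rll R.isTorus hq _ _ hw _

end TorusTrace

/-! ### The composition of `b` and `c` -/

theorem qD_mem (η : ℂ) (m : ℤ) : qD η m ∈ oscAlg η := by
  have h : ∀ n : ℕ, qD η n ∈ oscAlg η ∧ qD η (-n) ∈ oscAlg η := by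
    intro n
    induction n with
    | zero =>
      have : qD η 0 ∈ oscAlg η := by rw [qD_zero]; exact (oscAlg η).one_mem
      simpa using this
    | succ n ih =>
      constructor
      · have := (oscAlg η).mul_mem ih.1 (qD_mem_oscAlg η)
        rw [qD_mul] at this
        exact_mod_cast this
      · have := (oscAlg η).mul_mem ih.2 (qD_neg_mem_oscAlg η)
        rw [qD_mul] at this
        rw [show -((n + 1 : ℕ) : ℤ) = -n + -1 by push_cast; ring]
        exact this
  obtain ⟨n, rfl | rfl⟩ := m.eq_nat_or_neg
  exacts [(h n).1, (h n).2]

theorem isOscZ_qD (η : ℂ) : IsOscZ (Complex.exp η) (qD η) oscAstar (oscA η) where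
  p_zero := qD_zero η
  p_mul := qD_mul η
  px m := by rw [exp_zpow]; exact qD_mul_oscAstar η m
  pa m := by
    rw [exp_zpow, show η * ((-m : ℤ) : ℂ) = -(η * m) by push_cast; ring]; exact qD_mul_oscA η m
  ax := by
    rw [← Complex.exp_nat_mul]; exact_mod_cast oscA_mul_oscAstar η
  xa := oscAstar_mul_oscA η

/-- The operators on the universal `q`-oscillator module. -/
def oscRep (η : ℂ) : OscRep OscEnd η where
  p := qD η
  x := oscAstar
  a := oscA η
  y := band (-1) fun _ => 1
  osc := isOscZ_qD η
  xy := by rw [oscAstar, band_mul, one_eq_band]; simp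
  yx := by rw [oscAstar, band_mul, one_eq_band]; simp
  alg := oscAlg η
  p_mem := qD_mem η
  x_mem := oscAstar_mem_oscAlg η
  a_mem := oscA_mem_oscAlg η
  deg := Deg
  deg_one := one_mem_Deg
  deg_mul := mul_mem_Deg
  deg_p := qD_mem_Deg η
  deg_x := oscAstar_mem_Deg
  deg_a := oscA_mem_Deg η
  deg_y := band_mem_Deg _ _
  tr := wtr
  tr_deg w _ _ hd hz := wtr_of_mem_Deg w hd hz
  tr_p w m := wtr_qD w η m
  tr_p_comm w k _ hz := wtr_qD_comm η w k hz
  tr_x_comm hw _ hz := wtr_oscAstar_comm η hw hz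
  tr_a_comm hw _ hz := wtr_oscA_comm η hw hz
  tr_fin z := ⟨(diagL z).coeff.support, fun m => (diagL z).coeff m, fun w => rfl⟩

/-- Multiplication by `q^{mD}` multiplies the diagonal part by `T m`, hence shifts the index of
every weight by `m`. -/
theorem diagL_qD_mul (η : ℂ) (m : ℤ) (z : OscEnd) :
    diagL (qD η m * z) = diagL z * LaurentPolynomial.T m := by
  have key : ∀ v : ℤ →₀ LPoly, (qD η m v) 0 = v 0 * LaurentPolynomial.T m := by
    intro v
    induction v using Finsupp.induction_linear with
    | zero => simp
    | add v w hv hw => rw [map_add, Finsupp.add_apply, hv, hw, Finsupp.add_apply, add_mul]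
    | single k c =>
      rw [qD, band_single, add_zero, Finsupp.single_apply, Finsupp.single_apply]
      split_ifs with h
      · subst h; simp
      · simp
  exact key _

theorem diagL_mul_qD (η : ℂ) (m : ℤ) (z : OscEnd) :
    diagL (z * qD η m) = diagL z * LaurentPolynomial.T m := by
  have e : qD η m (Finsupp.single 0 1) =
      (LaurentPolynomial.T m : LPoly) • Finsupp.single 0 (1 : LPoly) := by
    rw [qD, band_single]; simp
  change (z (qD η m (Finsupp.single 0 1))) 0 = _
  rw [e, map_smul, Finsupp.smul_apply, smul_eq_mul, mul_comm]
  rfl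

theorem wt_mul_T (w : ℤ → ℂ) (f : LPoly) (m : ℤ) :
    wt w (f * LaurentPolynomial.T m) = wt (fun k => w (k + m)) f := by
  induction f using LaurentPolynomial.induction_on' with
  | add p q hp hq => rw [add_mul, map_add, hp, hq, map_add]
  | C_mul_T n a =>
    rw [mul_assoc, ← LaurentPolynomial.T_add, wt_C_mul_T, wt_C_mul_T]

theorem wt_smul (w : ℤ → ℂ) (c : ℂ) (f : LPoly) : wt (fun k => c * w k) f = c * wt w f := by
  change f.coeff.sum (fun m a => a * (c * w m)) = c * f.coeff.sum fun m a => a * w m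
  rw [Finsupp.mul_sum]
  exact Finsupp.sum_congr fun m _ => by ring

/-- The two factors `q^{-D}` shift the weight index by `-2`, which compensates the shift from `α` to
`α - 1` up to `q²`. Thus the argument `α - 1` of `b` is what matches it to the trace of `c` at `α`.
-/
theorem sand_wMinus (η α : ℂ) (z : OscEnd) :
    (oscRep η).sand (wMinus η (α - 1)) z = Complex.exp η ^ 2 * (oscRep η).tr (wMinus η α) z := by
  have e2 : (fun k => wMinus η (α - 1) (k + -1 + -1)) =
      fun k => Complex.exp η ^ 2 * wMinus η α k := by
    funext k
    rw [wMinus, wMinus, ← mul_assoc, ← Complex.exp_nat_mul, ← Complex.exp_add]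
    push_cast
    congr 2
    · ring
    · congr 2
      ring
  refine Eq.trans ?_ (wt_smul (wMinus η α) _ (diagL z))
  rw [← e2]
  change wt _ (diagL (qD η (-1) * (z * qD η (-1)))) = _
  rw [diagL_qD_mul, diagL_mul_qD, wt_mul_T, wt_mul_T]

/-! ### Spin -/

section HasSpin

variable {ι S : Type*} [Fintype ι] [DecidableEq ι] [Ring S] [Algebra ℂ S] {η : ℂ}
  (R : OscRep S η)

theorem OscRep.zero_mem_deg (d : ℤ) : (0 : S) ∈ R.deg d := Submodule.zero_mem _

/-- The charge of the entries of `Z` is determined by the spin. -/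
def OscRep.Graded (ε m : ℤ) (Z : SiteMat ι S) : Prop := ∀ s t, Z s t ∈ R.deg (ε * (sd s t - m))

theorem OscRep.graded_castM {ε m : ℤ} {X : SiteMat ι ℂ} (hX : HasSpin m X) :
    R.Graded ε m (castM X) := by
  intro s t
  rw [castM_apply]
  by_cases h : sd s t = m
  · rw [h, sub_self, mul_zero, Algebra.algebraMap_eq_smul_one]
    exact Submodule.smul_mem _ _ R.deg_one
  · rw [hX s t h, map_zero]
    exact R.zero_mem_deg _

theorem OscRep.Graded.mul {ε m m' : ℤ} {Z W : SiteMat ι S} (hZ : R.Graded ε m Z)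
    (hW : R.Graded ε m' W) : R.Graded ε (m + m') (Z * W) := by
  intro s t
  rw [Matrix.mul_apply]
  refine Submodule.sum_mem _ fun r _ => ?_
  have := R.deg_mul (hZ s r) (hW r t)
  rwa [← mul_add, show sd s r - m + (sd r t - m') = sd s t - (m + m') by
    rw [← sd_add s r t]; ring] at this

theorem OscRep.graded_site1 {ε : ℤ} {M : Matrix (Fin 2) (Fin 2) S}
    (hM : ∀ b c : Fin 2, M b c ∈ R.deg (ε * (((c : ℕ) : ℤ) - ((b : ℕ) : ℤ)))) (j : ι) :
    R.Graded ε 0 (site1 j M) := by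
  intro s t
  rw [site1_apply]
  split_ifs with h
  · have : sd s t = ((t j : ℕ) : ℤ) - ((s j : ℕ) : ℤ) := by
      rw [sd, Finset.sum_eq_single j]
      · intro k _ hk
        rw [h k hk, sub_self]
      · simp
    rw [this, sub_zero]
    exact hM _ _
  · exact R.zero_mem_deg _

theorem OscRep.graded_dress {ε m : ℤ} {L N : ι → Matrix (Fin 2) (Fin 2) S}
    (hL : ∀ k, ∀ b c : Fin 2, L k b c ∈ R.deg (ε * (((c : ℕ) : ℤ) - ((b : ℕ) : ℤ))))
    (hN : ∀ k, ∀ b c : Fin 2, N k b c ∈ R.deg (ε * (((c : ℕ) : ℤ) - ((b : ℕ) : ℤ))))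
    (l : List ι) {X : SiteMat ι ℂ} (hX : HasSpin m X) : R.Graded ε m (dress L N l X) := by
  induction l using List.reverseRecOn with
  | nil => rw [dress_nil]; exact R.graded_castM hX
  | append_singleton l j ih =>
    rw [dress_append_singleton]
    simpa using OscRep.Graded.mul R (OscRep.Graded.mul R (R.graded_site1 (hN j) j) ih)
      (R.graded_site1 (hL j) j)

theorem sd_update {j : ι} {s t : ι → Fin 2} (h : s j = t j) (b c : Fin 2) :
    sd (Function.update s j b) (Function.update t j c) =
      sd s t + (((c : ℕ) : ℤ) - ((b : ℕ) : ℤ)) := by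
  rw [sd, sd, ← Finset.add_sum_erase _ _ (Finset.mem_univ j),
    ← Finset.add_sum_erase Finset.univ (fun k => ((t k : ℕ) : ℤ) - (s k : ℕ)) (Finset.mem_univ j)]
  rw [Finset.sum_congr rfl fun k hk => by
    rw [Function.update_of_ne (Finset.ne_of_mem_erase hk),
      Function.update_of_ne (Finset.ne_of_mem_erase hk)]]
  simp [h]
  ring

/-- The trace retains only charge zero, and in a graded matrix the charge fixes the spin. With `ε =
1` for `L⁺` and `ε = -1` for `L⁻`, this makes `c` raise the spin by one and `b` lower it by one. -/
theorem OscRep.hasSpin_pe {ε m : ℤ} (hε : ε ≠ 0) {Z : SiteMat ι S} (hZ : R.Graded ε m Z) (j : ι)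
    (b c : Fin 2) (w : ℤ → ℂ) :
    HasSpin (m - (((c : ℕ) : ℤ) - ((b : ℕ) : ℤ))) ((pe j b c Z).map (R.sand w)) := by
  intro s t h
  simp only [Matrix.map_apply, pe, Matrix.of_apply]
  split_ifs with hst
  · rw [R.sand_apply]
    refine R.tr_deg w ?_ (R.deg_mul (R.deg_p (-1)) (R.deg_mul (hZ _ _) (R.deg_p (-1))))
    rw [sd_update hst, zero_add, add_zero]
    exact mul_ne_zero hε (by omega)
  · exact map_zero _

theorem OscRep.deg_L (z : ℂ) (b c : Fin 2) :
    R.L z b c ∈ R.deg (1 * (((c : ℕ) : ℤ) - ((b : ℕ) : ℤ))) := by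
  fin_cases b <;> fin_cases c
  · exact R.deg_p 1
  · exact Submodule.neg_mem _ (Submodule.smul_mem _ _ (by simpa using R.deg_mul R.deg_x (R.deg_p (-1))))
  · exact Submodule.neg_mem _ (Submodule.smul_mem _ _ (by simpa using R.deg_mul R.deg_a (R.deg_p 1)))
  · exact Submodule.sub_mem _ (R.deg_p (-1)) (Submodule.smul_mem _ _ (R.deg_p 1))

theorem OscRep.deg_N (z : ℂ) (b c : Fin 2) :
    R.N z b c ∈ R.deg (1 * (((c : ℕ) : ℤ) - ((b : ℕ) : ℤ))) := by
  fin_cases b <;> fin_cases c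
  · exact Submodule.sub_mem _ (R.deg_p (-1)) (Submodule.smul_mem _ _ (R.deg_p 1))
  · exact Submodule.smul_mem _ _ (by simpa using R.deg_mul (R.deg_p (-1)) R.deg_x)
  · exact Submodule.smul_mem _ _ (by simpa using R.deg_mul (R.deg_p 1) R.deg_a)
  · exact R.deg_p 1

theorem OscRep.deg_flip {M : Matrix (Fin 2) (Fin 2) S}
    (h : ∀ b c : Fin 2, M b c ∈ R.deg (1 * (((c : ℕ) : ℤ) - ((b : ℕ) : ℤ)))) (b c : Fin 2) :
    flip2 M b c ∈ R.deg (-1 * (((c : ℕ) : ℤ) - ((b : ℕ) : ℤ))) := by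
  fin_cases b <;> fin_cases c
  · exact h 1 1
  · exact h 1 0
  · exact h 0 1
  · exact h 0 0

theorem HasSpin.smul {m : ℤ} {X : SiteMat ι ℂ} (hX : HasSpin m X) (c : ℂ) :
    HasSpin m (c • X) := fun s t h => by rw [Matrix.smul_apply, hX s t h, smul_zero]

theorem HasSpin.pref {m : ℤ} {X : SiteMat ι ℂ} (hX : HasSpin m X) (f : ℤ → ℂ) :
    pref f X = f m • X := by
  ext s t
  simp only [XXZ.pref, Matrix.of_apply, Matrix.smul_apply, smul_eq_mul]
  by_cases h : sd s t = m
  · rw [h]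
  · rw [hX s t h, mul_zero, mul_zero]

theorem dress_smul (L N : ι → Matrix (Fin 2) (Fin 2) S) (l : List ι) (c : ℂ) (X : SiteMat ι ℂ) :
    dress L N l (c • X) = c • dress L N l X := by
  simp only [dress, adL, castM_smul, mul_smul_comm, smul_mul_assoc]

end HasSpin

/-! ### The iterated core as a single torus trace. -/

section CoreCore

variable {ι : Type*} [Fintype ι] [DecidableEq ι] {lam : ι → ℂ} {η : ℂ}

/-- The product of the normalizing factors of the inverse Lax matrices. -/
def normProd (lam : ι → ℂ) (l : List ι) (j : ι) : ℂ :=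
  (l.map fun k => (1 - (Complex.exp (lam j) / Complex.exp (lam k)) ^ 2)⁻¹).prod

theorem genRes_eq {S : Type*} [Ring S] [Algebra ℂ S] (Lz Nz : ℂ → Matrix (Fin 2) (Fin 2) S)
    (l : List ι) (j : ι) (b c : Fin 2) (φ : S →ₗ[ℂ] ℂ) (X : SiteMat ι ℂ) :
    genRes lam Lz Nz l j b c φ X = normProd lam l j •
      (pe j b c (dress (fun k => Lz (Complex.exp (lam j) / Complex.exp (lam k)))
        (fun k => Nz (Complex.exp (lam j) / Complex.exp (lam k))) (l ++ [j]) X)).map φ := by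
  have e : adL (fun k => site1 k (laxL Lz (fun k => Complex.exp (lam k)) (Complex.exp (lam j)) k))
      (fun k => site1 k (laxN Nz (fun k => Complex.exp (lam k)) (Complex.exp (lam j)) k)) l
      (castM X) = normProd lam l j • dress
        (fun k => Lz (Complex.exp (lam j) / Complex.exp (lam k)))
        (fun k => Nz (Complex.exp (lam j) / Complex.exp (lam k))) l X :=
    dress_smul_right (fun k => (1 - (Complex.exp (lam j) / Complex.exp (lam k)) ^ 2)⁻¹) l X
  rw [genRes, e, dress_append_singleton, div_self (Complex.exp_ne_zero _), mul_smul_comm,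
    smul_mul_assoc, pe_smul]
  ext s t
  simp only [Matrix.map_apply, Matrix.smul_apply, map_smul]

/-- The operator whose trace is the composition of the residues of `b` and `c`. -/
def pairOp (η : ℂ) (lam : ι → ℂ) (l : List ι) (i j : ι) (X : SiteMat ι ℂ) : SiteMat ι OscEnd :=
  pe i 0 1 (pe j 0 1 (lr (oscRep η).y (oscRep η).y
    (dress (fun k => (oscRep η).vL (Complex.exp (lam j)) (Complex.exp (lam i))
        (Complex.exp (lam k))⁻¹)
      (fun k => (oscRep η).vN (Complex.exp (lam j)) (Complex.exp (lam i))
        (Complex.exp (lam k))⁻¹) (l ++ [i] ++ [j]) X)))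

/-- The scalar in front of the trace of `pairOp`. -/
def pairCoef (η : ℂ) (lam : ι → ℂ) (l : List ι) (i j : ι) (m : ℤ) (α : ℂ) : ℂ :=
  Complex.exp (2 * η * m) * Complex.exp (lam i * (-(α - 1) + m)) * normProd lam l i *
    (Complex.exp (η * (α - (m + 1 : ℤ))) * Complex.exp (lam j * (α - (m + 1 : ℤ))) *
      normProd lam (l ++ [i]) j) *
    (-(Complex.exp η ^ 2 * (Complex.exp η * Complex.exp (lam j) ^ 2)))

/-- The function is analytic in `α` and nonzero at generic `α`, which accumulate at `0`; so its
zeros cannot. -/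
theorem eventually_pole (hη : η ≠ 0) (m : ℤ) :
    ∀ᶠ α in 𝓝[≠] (0 : ℂ), 1 - Complex.exp (2 * η * (α - m)) ≠ 0 := by
  have hA : AnalyticAt ℂ (fun α : ℂ => 1 - Complex.exp (2 * η * (α - m))) 0 := by fun_prop
  refine hA.eventually_eq_zero_or_eventually_ne_zero.resolve_left fun h0 => ?_
  have h1 := (frequently_generic hη).and_eventually (h0.filter_mono nhdsWithin_le_nhds)
  obtain ⟨α, h2, h3⟩ := h1.exists
  refine h2.ne (-2 * m) ?_
  rw [exp_zpow, ← Complex.exp_add]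
  push_cast
  rw [← h3]
  ring_nf

/-- The scalar weight from the second oscillator is the inverse of the prefactor `1 - q^{2(α-𝕊)}` of
`c` on spin `m + 1`. After they cancel, the `α`-dependence is a differentiable scalar times one
trace with simple poles. -/
theorem core_core_eventually (hη : η ≠ 0) {l : List ι} {i j : ι} (hl : (l ++ [i] ++ [j]).Nodup)
    (hmem : ∀ k, k ∈ l ++ [i] ++ [j]) {m : ℤ} {X : SiteMat ι ℂ} (hX : HasSpin m X) :
    ∀ᶠ α in 𝓝[≠] (0 : ℂ),
      (kindB η (α - 1)).core lam l i ((kindC η α).core lam (l ++ [i]) j X) =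
        pairCoef η lam l i j m α • (pairOp η lam l i j X).map (wtr (wPlus η α)) := by
  have hn := (oscRep η).nested_eventually hη (ξ := fun k => Complex.exp (lam k))
    (fun k => Complex.exp_ne_zero _) (Complex.exp (lam i)) (i := i) hl hmem
    (sand_wMinus η) hX
  filter_upwards [hn, eventually_pole hη (m + 1)] with α hα hp
  set R := oscRep η
  set Mc := (pe j 1 0 (dress (fun k => R.L (Complex.exp (lam j) / Complex.exp (lam k)))
    (fun k => R.N (Complex.exp (lam j) / Complex.exp (lam k))) (l ++ [i] ++ [j]) X)).map
      (R.sand (wPlus η α)) with hMc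
  have hMcs : HasSpin (m + 1) Mc := by
    have := R.hasSpin_pe one_ne_zero (R.graded_dress
      (fun k => R.deg_L (Complex.exp (lam j) / Complex.exp (lam k)))
      (fun k => R.deg_N (Complex.exp (lam j) / Complex.exp (lam k))) (l ++ [i] ++ [j]) hX) j 1 0 (wPlus η α)
    convert this using 1
    simp
  have ec : (kindC η α).core lam (l ++ [i]) j X =
      ((kindC η α).p (lam j) (m + 1) * normProd lam (l ++ [i]) j) • Mc := by
    have e1 : (kindC η α).core lam (l ++ [i]) j X = pref ((kindC η α).p (lam j))
      (normProd lam (l ++ [i]) j • Mc) := congrArg _ (genRes_eq _ _ _ _ _ _ _ _)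
    rw [e1, (hMcs.smul _).pref, smul_smul]
  set κ := (kindC η α).p (lam j) (m + 1) * normProd lam (l ++ [i]) j with hκ
  set Mb := (pe i 0 1 (dress (fun k => flip2 (R.L (Complex.exp (lam i) / Complex.exp (lam k))))
    (fun k => flip2 (R.N (Complex.exp (lam i) / Complex.exp (lam k)))) (l ++ [i]) (κ • Mc))).map
      (R.sand (wMinus η (α - 1))) with hMb
  have hMbs : HasSpin m Mb := by
    have := R.hasSpin_pe (neg_ne_zero.2 one_ne_zero) (R.graded_dress
      (fun k => R.deg_flip (R.deg_L (Complex.exp (lam i) / Complex.exp (lam k))))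
      (fun k => R.deg_flip (R.deg_N (Complex.exp (lam i) / Complex.exp (lam k))))
      (l ++ [i]) (hMcs.smul κ)) i 0 1 (wMinus η (α - 1))
    convert this using 1
    simp
  have eb : (kindB η (α - 1)).core lam l i (κ • Mc) =
      ((kindB η (α - 1)).p (lam i) m * normProd lam l i) • Mb := by
    have e1 : (kindB η (α - 1)).core lam l i (κ • Mc) = pref ((kindB η (α - 1)).p (lam i))
      (normProd lam l i • Mb) := congrArg _ (genRes_eq _ _ _ _ _ _ _ _)
    rw [e1, (hMbs.smul _).pref, smul_smul]
  have eM : Mb = κ • ((-(Complex.exp η ^ 2 * (Complex.exp η * Complex.exp (lam j) ^ 2)) *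
      wPlus η α (-2 * m - 2)) • (pairOp η lam l i j X).map (wtr (wPlus η α))) := by
    rw [hMb, dress_smul, pe_smul]
    refine Eq.trans ?_ (congrArg (κ • ·) hα)
    ext s t
    simp only [Matrix.map_apply, Matrix.smul_apply, map_smul]
  rw [ec, eb, eM, smul_smul, smul_smul]
  congr 1
  have ew : wPlus η α (-2 * m - 2) = (1 - Complex.exp (2 * η * (α - (m + 1 : ℤ))))⁻¹ := by
    rw [wPlus]; push_cast; ring_nf
  rw [hκ, ew, pairCoef]
  simp only [kindC, kindB]
  field_simp

end CoreCore

/-! ### Pairs of residues -/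

section Pairs

variable {ι : Type*} [Fintype ι] [DecidableEq ι] {q : ℂ} {ξ : ι → ℂ}

theorem site2_eq_sum {i j : ι} (h : i ≠ j) (r : Matrix (Fin 2 × Fin 2) (Fin 2 × Fin 2) ℂ) :
    site2 i j r = ∑ x, ∑ y, r x y • (site1 i (Matrix.single x.1 y.1 (1 : ℂ)) *
      site1 j (Matrix.single x.2 y.2 (1 : ℂ))) := by
  ext s t
  simp only [Matrix.sum_apply, Matrix.smul_apply, site1,
    emb_mul_emb_apply (f := fun _ : Fin 1 => i) (g := fun _ : Fin 1 => j) fun _ _ => h,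
    Matrix.of_apply, Function.comp_def, site2_apply]
  have e : (∀ k, (∀ _ : Fin 1, i ≠ k) → (∀ _ : Fin 1, j ≠ k) → s k = t k) ↔
      ∀ l, l ≠ i → l ≠ j → s l = t l := by
    simp [eq_comm]
  simp only [e]
  split_ifs
  · rw [Finset.sum_eq_single (s i, s j), Finset.sum_eq_single (t i, t j)]
    · simp
    · intro y _ hy
      have : ¬(y.1 = t i ∧ y.2 = t j) := fun h => hy (Prod.ext h.1 h.2)
      by_cases h1 : y.1 = t i <;> by_cases h2 : y.2 = t j <;> simp_all [Matrix.single]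
    · simp
    · intro x _ hx
      refine Finset.sum_eq_zero fun y _ => ?_
      have : ¬(x.1 = s i ∧ x.2 = s j) := fun h => hx (Prod.ext h.1 h.2)
      by_cases h1 : x.1 = s i <;> by_cases h2 : x.2 = s j <;> simp_all [Matrix.single]
    · simp
  · simp

/-- Triviality at each of the two sites suffices, since the R-matrix is a sum of products of
one-site operators. -/
theorem Triv.commute_rr {i j : ι} (h : i ≠ j) {W : SiteMat ι ℂ} (hi : Triv i W) (hj : Triv j W) :
    Commute W (rr q ξ i j) := by
  rw [rr, site2_eq_sum h]
  refine Commute.sum_right _ _ _ fun x _ => Commute.sum_right _ _ _ fun y _ =>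
    Commute.smul_right (Commute.mul_right ?_ ?_) _
  · exact hi.commute_site1 _ fun _ _ _ _ => Commute.all _ _
  · exact hj.commute_site1 _ fun _ _ _ _ => Commute.all _ _

/-- The Yang-Baxter equation for products of R-matrices along a list, by induction on the list. It
identifies the conjugations obtained by removing `i` and `j` in either order. -/
theorem rL_ybe (hq : q ≠ 0) (hξ : ∀ k, ξ k ≠ 0) {l : List ι} {i j : ι} (hl : l.Nodup) (hi : i ∉ l)
    (hj : j ∉ l) (hij : i ≠ j) :
    rL q ξ l i * rL q ξ l j * rr q ξ j i = rr q ξ j i * (rL q ξ l j * rL q ξ l i) := by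
  induction l with
  | nil => simp [rL]
  | cons k l ih =>
    have hk := List.nodup_cons.1 hl
    have hik : i ≠ k := fun h => hi (by simp [h])
    have hjk : j ≠ k := fun h => hj (by simp [h])
    have hi' : i ∉ l := fun h => hi (by simp [h])
    have hj' : j ∉ l := fun h => hj (by simp [h])
    have comm : ∀ a b : ι, a ≠ b → a ≠ k → b ≠ k → a ∉ l → b ∉ l →
        Commute (rr q ξ a k) (rL q ξ l b) := by
      intro a b hab hak hbk ha hb
      refine Commute.list_prod_right _ _ ?_
      simp only [List.mem_map]
      rintro _ ⟨m, hm, rfl⟩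
      exact rr_commute hab hbk.symm (by rintro rfl; exact ha hm) (by rintro rfl; exact hk.1 hm)
    have e : ∀ a, rL q ξ (k :: l) a = rr q ξ a k * rL q ξ l a := fun a => by simp [rL]
    have c1 := comm j i hij.symm hjk hik hj' hi'
    have c2 := comm i j hij hik hjk hi' hj'
    have ih' := ih hk.2 hi' hj'
    have y := rr_ybe hq hξ (a := j) (j := i) (k := k) hij.symm hjk hik
    rw [e, e]
    calc rr q ξ i k * rL q ξ l i * (rr q ξ j k * rL q ξ l j) * rr q ξ j i
        = rr q ξ i k * (rL q ξ l i * rr q ξ j k) * rL q ξ l j * rr q ξ j i := by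
          simp only [mul_assoc]
      _ = rr q ξ i k * rr q ξ j k * (rL q ξ l i * rL q ξ l j * rr q ξ j i) := by
          rw [← c1.eq]; simp only [mul_assoc]
      _ = (rr q ξ i k * rr q ξ j k * rr q ξ j i) * (rL q ξ l j * rL q ξ l i) := by
          rw [ih']; simp only [mul_assoc]
      _ = rr q ξ j i * rr q ξ j k * (rr q ξ i k * rL q ξ l j) * rL q ξ l i := by
          rw [y]; simp only [mul_assoc]
      _ = _ := by rw [c2.eq]; simp only [mul_assoc]

end Pairs

/-! ### Leading behaviour at `α = 0`. -/

section Leading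

variable {ι : Type*} [Fintype ι] [DecidableEq ι] {lam : ι → ℂ} {η : ℂ}

/-- At `α = 0` the extra factor turns `(ξ_i/ξ_j)^{m+1}` into its inverse. The sign comes from `ξ_j²
(1 - ξ_j²/ξ_i²)⁻¹ = ξ_i² ξ_j²/(ξ_i² - ξ_j²)`, which is antisymmetric. -/
theorem pairCoef_antisymm (hG : Gen η lam) {l : List ι} {i j : ι} (hij : i ≠ j) (m : ℤ) :
    pairCoef η lam l i j m 0 * (Complex.exp (lam i) / Complex.exp (lam j)) ^ (-2 * (m + 1)) =
      -pairCoef η lam l j i m 0 := by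
  have hn : ∀ a b, normProd lam (l ++ [a]) b =
      normProd lam l b * (1 - (Complex.exp (lam b) / Complex.exp (lam a)) ^ 2)⁻¹ := fun a b => by
    simp [normProd]
  have e1 : ∀ a : ι, Complex.exp (lam a * (-(0 - 1) + m)) = Complex.exp (lam a) ^ (m + 1) :=
    fun a => by rw [exp_zpow]; push_cast; ring_nf
  have e2 : ∀ a : ι, Complex.exp (lam a * (0 - (m + 1 : ℤ))) = Complex.exp (lam a) ^ (-(m + 1)) :=
    fun a => by rw [exp_zpow]; push_cast; ring_nf
  have h1 := hG.lreg i j hij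
  have h2 := hG.lreg j i hij.symm
  have ha := Complex.exp_ne_zero (lam i)
  have hb := Complex.exp_ne_zero (lam j)
  rw [pairCoef, pairCoef, hn, hn, e1, e1, e2, e2, show -2 * (m + 1) = -(m + 1) + -(m + 1) by ring,
    zpow_add₀ (div_ne_zero ha hb)]
  generalize m + 1 = M
  rw [div_zpow, zpow_neg, zpow_neg]
  have hA := zpow_ne_zero M ha
  have hB := zpow_ne_zero M hb
  generalize Complex.exp (lam i) ^ M = A at *
  generalize Complex.exp (lam j) ^ M = B at *
  generalize Complex.exp (lam i) = a at *
  generalize Complex.exp (lam j) = b at *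
  have h3 : a ^ 2 - b ^ 2 ≠ 0 := by
    intro h0
    apply h1
    field_simp
    linear_combination -h0
  have h4 : b ^ 2 - a ^ 2 ≠ 0 := by
    intro h0
    apply h3
    linear_combination -h0
  have e3 : (1 - (a / b) ^ 2)⁻¹ = -(b ^ 2 * (a ^ 2 - b ^ 2)⁻¹) := by
    rw [show 1 - (a / b) ^ 2 = -((a ^ 2 - b ^ 2) / b ^ 2) by field_simp; ring, inv_neg, inv_div,
      div_eq_mul_inv]
  have e4 : (1 - (b / a) ^ 2)⁻¹ = a ^ 2 * (a ^ 2 - b ^ 2)⁻¹ := by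
    rw [show 1 - (b / a) ^ 2 = (a ^ 2 - b ^ 2) / a ^ 2 by field_simp, inv_div, div_eq_mul_inv]
  rw [e3, e4]
  generalize (a ^ 2 - b ^ 2)⁻¹ = c
  field_simp

theorem differentiableAt_pairCoef (l : List ι) (i j : ι) (m : ℤ) :
    DifferentiableAt ℂ (pairCoef η lam l i j m) 0 := by
  unfold pairCoef
  fun_prop

/-- The traces over `W⁺` have a simple pole at `α = 0`. -/
theorem wPlus_expansion (hη : η ≠ 0) (hq : ∀ m : ℤ, m ≠ 0 → Complex.exp (η * m) ≠ 1) (m : ℤ) :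
    ∃ g : ℂ → ℂ, DifferentiableAt ℂ g 0 ∧ g 0 = -(1 / (2 * η)) * wZero m ∧
      ∀ α ≠ 0, wPlus η α m = α⁻¹ * g α := by
  by_cases hm : m = 0
  · subst hm
    -- Writing `1 - e^{2ηα} = α · dslope h 0 α`, the second factor is differentiable with value
    -- `-2η` at `0`, so the regular part may be taken as its inverse.
    set h : ℂ → ℂ := fun α => 1 - Complex.exp (2 * η * α) with hh
    have hd : HasDerivAt h (-(2 * η)) 0 := by
      have := ((hasDerivAt_id (0 : ℂ)).const_mul (2 * η)).cexp.const_sub 1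
      simpa using this
    have h0 : dslope h 0 0 = -(2 * η) := by rw [dslope_same, hd.deriv]
    refine ⟨fun α => (dslope h 0 α)⁻¹, ?_, ?_, fun α hα => ?_⟩
    · refine DifferentiableAt.inv ?_ (by rw [h0]; simpa using hη)
      have hdiff : DifferentiableOn ℂ h Set.univ := by fun_prop
      exact ((Complex.differentiableOn_dslope Filter.univ_mem).2 hdiff).differentiableAt
        Filter.univ_mem
    · simp only [h0, wZero, if_true]; field_simp
    · show wPlus η α 0 = α⁻¹ * (dslope h 0 α)⁻¹
      rw [dslope_of_ne _ hα, slope_def_field, wPlus]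
      simp only [hh]
      simp only [mul_zero, Complex.exp_zero, sub_self, sub_zero, Int.cast_zero, add_zero, inv_div]
      rw [div_eq_mul_inv α, inv_mul_cancel_left₀ hα]
      ring_nf
  · refine ⟨fun α => α * wPlus η α m, ?_, ?_, fun α hα => ?_⟩
    · have : 1 - Complex.exp (η * (2 * 0 + m)) ≠ 0 := by
        exact sub_ne_zero.2 (by simpa using (hq m hm).symm)
      unfold wPlus
      fun_prop (disch := exact this)
    · simp [wZero, hm]
    · rw [← mul_assoc, inv_mul_cancel₀ hα, one_mul]

theorem wtr_expansion (hη : η ≠ 0) (hq : ∀ m : ℤ, m ≠ 0 → Complex.exp (η * m) ≠ 1) (z : OscEnd) :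
    ∃ g : ℂ → ℂ, DifferentiableAt ℂ g 0 ∧ g 0 = -(1 / (2 * η)) * wtr wZero z ∧
      ∀ α ≠ 0, wtr (wPlus η α) z = α⁻¹ * g α := by
  choose g hg h0 hα using wPlus_expansion hη hq
  obtain ⟨s, c, hc⟩ := (oscRep η).tr_fin z
  have hc' : ∀ w, wtr w z = ∑ m ∈ s, c m * w m := hc
  refine ⟨fun α => ∑ m ∈ s, c m * g m α, by fun_prop, ?_, fun α ha => ?_⟩
  · simp only [hc', h0, Finset.mul_sum]
    exact Finset.sum_congr rfl fun m _ => by ring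
  · simp only [hc', hα _ α ha, Finset.mul_sum]
    exact Finset.sum_congr rfl fun m _ => by ring

end Leading

/-! ### Cancellation of the poles at `α = 0` -/

section PolesCancel

variable {ι : Type*} [Fintype ι] [DecidableEq ι]

/-- The entries are differentiable at `0`. -/
def EDiff (P : ℂ → SiteMat ι ℂ) : Prop := ∀ s t, DifferentiableAt ℂ (fun α => P α s t) 0

theorem EDiff.add {P Q : ℂ → SiteMat ι ℂ} (hP : EDiff P) (hQ : EDiff Q) :
    EDiff fun α => P α + Q α := fun s t => (hP s t).add (hQ s t)

theorem EDiff.smul {P : ℂ → SiteMat ι ℂ} {f : ℂ → ℂ} (hf : DifferentiableAt ℂ f 0) (hP : EDiff P) :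
    EDiff fun α => f α • P α := fun s t => hf.mul (hP s t)

theorem EDiff.conj {P : ℂ → SiteMat ι ℂ} (hP : EDiff P) (A B : SiteMat ι ℂ) :
    EDiff fun α => A * P α * B := fun s t => by
  simp only [Matrix.mul_apply]
  exact DifferentiableAt.fun_sum fun r _ => (DifferentiableAt.fun_sum fun r' _ =>
    (hP r' r).const_mul _).mul_const _

/-- `U` and `V` have at most simple poles at `0`, with opposite residues. -/
def PolesCancel (U V : ℂ → SiteMat ι ℂ) : Prop :=
  ∃ P Q : ℂ → SiteMat ι ℂ, EDiff P ∧ EDiff Q ∧ P 0 + Q 0 = 0 ∧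
    (∀ᶠ α in 𝓝[≠] (0 : ℂ), U α = α⁻¹ • P α) ∧ ∀ᶠ α in 𝓝[≠] (0 : ℂ), V α = α⁻¹ • Q α

variable {U V U' V' : ℂ → SiteMat ι ℂ}

theorem PolesCancel.add (h : PolesCancel U V) (h' : PolesCancel U' V') :
    PolesCancel (fun α => U α + U' α) fun α => V α + V' α := by
  obtain ⟨P, Q, hP, hQ, h0, hU, hV⟩ := h
  obtain ⟨P', Q', hP', hQ', h0', hU', hV'⟩ := h'
  refine ⟨_, _, hP.add hP', hQ.add hQ', ?_, ?_, ?_⟩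
  · rw [add_add_add_comm, h0, h0', add_zero]
  · filter_upwards [hU, hU'] with α h h' using by rw [h, h', smul_add]
  · filter_upwards [hV, hV'] with α h h' using by rw [h, h', smul_add]

theorem PolesCancel.conj (h : PolesCancel U V) (A B : SiteMat ι ℂ) :
    PolesCancel (fun α => A * U α * B) fun α => A * V α * B := by
  obtain ⟨P, Q, hP, hQ, h0, hU, hV⟩ := h
  refine ⟨_, _, hP.conj A B, hQ.conj A B, ?_, ?_, ?_⟩
  · rw [← add_mul, ← mul_add, h0, mul_zero, zero_mul]
  · filter_upwards [hU] with α h using by rw [h, mul_smul_comm, smul_mul_assoc]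
  · filter_upwards [hV] with α h using by rw [h, mul_smul_comm, smul_mul_assoc]

theorem PolesCancel.congr (h : PolesCancel U V) (hU : U =ᶠ[𝓝[≠] 0] U') (hV : V =ᶠ[𝓝[≠] 0] V') :
    PolesCancel U' V' := by
  obtain ⟨P, Q, hP, hQ, h0, hU₁, hV₁⟩ := h
  exact ⟨P, Q, hP, hQ, h0, by filter_upwards [hU, hU₁] with α h h' using h ▸ h',
    by filter_upwards [hV, hV₁] with α h h' using h ▸ h'⟩

theorem PolesCancel.zero : PolesCancel (fun _ => (0 : SiteMat ι ℂ)) fun _ => 0 :=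
  ⟨fun _ => 0, fun _ => 0, fun _ _ => differentiableAt_const _, fun _ _ => differentiableAt_const _,
    add_zero _, .of_forall fun _ => (smul_zero _).symm, .of_forall fun _ => (smul_zero _).symm⟩

variable {lam : ι → ℂ} {η : ℂ}

theorem map_wtr_expansion (hη : η ≠ 0) (hq : ∀ m : ℤ, m ≠ 0 → Complex.exp (η * m) ≠ 1)
    (Z : SiteMat ι OscEnd) :
    ∃ g : ℂ → SiteMat ι ℂ, EDiff g ∧ g 0 = -(1 / (2 * η)) • Z.map (wtr wZero) ∧
      ∀ α ≠ 0, Z.map (wtr (wPlus η α)) = α⁻¹ • g α := by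
  choose g hg h0 hα using fun s t => wtr_expansion hη hq (Z s t)
  exact ⟨fun α => Matrix.of fun s t => g s t α, hg, by ext s t; exact h0 s t,
    fun α h => by ext s t; exact hα s t α h⟩

theorem SP.conj_hasSpin {m : ℤ} {X A B : SiteMat ι ℂ} (hX : HasSpin m X) (hA : SP A) (hB : SP B) :
    HasSpin m (A * X * B) := by
  intro s t h
  rw [Matrix.mul_apply]
  refine Finset.sum_eq_zero fun r _ => ?_
  by_cases h1 : sd r t = 0
  · rw [Matrix.mul_apply, Finset.sum_eq_zero, zero_mul]
    intro r' _
    by_cases h2 : sd s r' = 0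
    · rw [hX, mul_zero]
      rw [← sd_add s r' t, ← sd_add r' r t, h1, h2, zero_add, add_zero] at h
      exact h
    · rw [hA _ _ h2, zero_mul]
  · rw [hB _ _ h1, mul_zero]

/-- Both iterated cores are a scalar `pairCoef` times a trace with a simple pole. `trZero_swap`
relates the leading traces by a power of `ξ_i/ξ_j`, and `pairCoef_antisymm` turns that power into a
sign. -/
theorem polesCancel_core (hG : Gen η lam) (hη : η ≠ 0)
    (hq : ∀ m : ℤ, m ≠ 0 → Complex.exp (η * m) ≠ 1) {l : List ι} {i j : ι}
    (hl : (l ++ [i] ++ [j]).Nodup) (hl' : (l ++ [j] ++ [i]).Nodup)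
    (hmem : ∀ k, k ∈ l ++ [i] ++ [j]) (hij : i ≠ j) {m : ℤ} {X : SiteMat ι ℂ} (hX : HasSpin m X) :
    PolesCancel
      (fun α => (kindB η (α - 1)).core lam l i ((kindC η α).core lam (l ++ [i]) j X))
      fun α => (kindB η (α - 1)).core lam l j ((kindC η α).core lam (l ++ [j]) i
        (rri (Complex.exp η) (fun k => Complex.exp (lam k)) i j * X *
          rr (Complex.exp η) (fun k => Complex.exp (lam k)) i j)) := by
  have hX' : HasSpin m (rri (Complex.exp η) (fun k => Complex.exp (lam k)) i j * X *
      rr (Complex.exp η) (fun k => Complex.exp (lam k)) i j) :=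
    SP.conj_hasSpin hX ((sp_site2 hij _ _).smul _) (sp_site2 hij _ _)
  have hmem' : ∀ k, k ∈ l ++ [j] ++ [i] := fun k => by
    have := hmem k; simp only [List.mem_append, List.mem_singleton] at this ⊢; tauto
  obtain ⟨g, hg, hg0, hgα⟩ := map_wtr_expansion hη hq (pairOp η lam l i j X)
  obtain ⟨g', hg', hg0', hgα'⟩ := map_wtr_expansion hη hq (pairOp η lam l j i
    (rri (Complex.exp η) (fun k => Complex.exp (lam k)) i j * X *
      rr (Complex.exp η) (fun k => Complex.exp (lam k)) i j))
  refine ⟨_, _, hg.smul (differentiableAt_pairCoef (η := η) (lam := lam) l i j m),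
    hg'.smul (differentiableAt_pairCoef (η := η) (lam := lam) l j i m), ?_, ?_, ?_⟩
  · have hs : (pairOp η lam l i j X).map (wtr wZero) =
        (Complex.exp (lam i) / Complex.exp (lam j)) ^ (-2 * (m + 1)) •
          (pairOp η lam l j i (rri (Complex.exp η) (fun k => Complex.exp (lam k)) i j * X *
            rr (Complex.exp η) (fun k => Complex.exp (lam k)) i j)).map (wtr wZero) :=
      (oscRep η).trZero_swap (ξ := fun k => Complex.exp (lam k)) (fun k => Complex.exp_ne_zero _)
        hl hmem (hG.rreg i j hij) hX
    rw [hg0, hg0', hs, smul_comm (-(1 / (2 * η))), smul_smul, pairCoef_antisymm hG hij, neg_smul,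
      neg_add_cancel]
  · filter_upwards [core_core_eventually hη hl hmem hX, self_mem_nhdsWithin] with α h hα
    rw [h, hgα α hα, smul_comm]
  · filter_upwards [core_core_eventually hη hl' hmem' hX', self_mem_nhdsWithin] with α h hα
    rw [h, hgα' α hα, smul_comm]

theorem triv_pe_pe {S : Type*} [Zero S] {i j : ι} (h : i ≠ j) (b c b' c' : Fin 2)
    (Z : SiteMat ι S) : Triv j (pe i b c (pe j b' c' Z)) := by
  intro s t d d'
  simp only [pe, Matrix.of_apply, Function.update_of_ne h, Function.update_comm h.symm,
    Function.update_idem, Function.update_self]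
  split_ifs <;> rfl

/-- The iterated core is trivial at its own site `i` by construction; triviality at `j` is visible
from the torus form. Both are needed to commute it with the R-matrix of `i` and `j`. -/
theorem triv_core_core (hη : η ≠ 0) {l : List ι} {i j : ι} (hl : (l ++ [i] ++ [j]).Nodup)
    (hmem : ∀ k, k ∈ l ++ [i] ++ [j]) (hij : i ≠ j) {m : ℤ} {X : SiteMat ι ℂ} (hX : HasSpin m X) :
    ∀ᶠ α in 𝓝[≠] (0 : ℂ),
      Triv j ((kindB η (α - 1)).core lam l i ((kindC η α).core lam (l ++ [i]) j X)) := by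
  filter_upwards [core_core_eventually (lam := lam) hη hl hmem hX] with α h
  have hp : Triv j (pairOp η lam l i j X) := by
    exact triv_pe_pe hij 0 1 0 1 _
  rw [h]
  intro s t b c
  have := hp.map (wtr (wPlus η α)) s t b c
  simp only [Matrix.smul_apply]
  rw [this]
  split_ifs <;> simp

/-- The two iterated residues come with conjugations in opposite orders. The Yang-Baxter relation
for products and triviality at both sites bring them to a common conjugation of the two cores. -/
theorem polesCancel_last (hG : Gen η lam) (hη : η ≠ 0)
    (hq : ∀ m : ℤ, m ≠ 0 → Complex.exp (η * m) ≠ 1) {l : List ι} {i j : ι}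
    (hl : (l ++ [i] ++ [j]).Nodup) (hmem : ∀ k, k ∈ l ++ [i] ++ [j]) (hij : i ≠ j) {m : ℤ}
    {X : SiteMat ι ℂ} (hX : HasSpin m X) :
    PolesCancel
      (fun α => (kindB η (α - 1)).res η lam (l ++ [i] ++ [j]) i
        ((kindC η α).res η lam (l ++ [i] ++ [j]) j X))
      fun α => (kindB η (α - 1)).res η lam (l ++ [i] ++ [j]) j
        ((kindC η α).res η lam (l ++ [i] ++ [j]) i X) := by
  have hl' : (l ++ [j] ++ [i]).Nodup := by
    rw [List.append_assoc] at hl ⊢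
    exact (List.Perm.append_left l (List.perm_append_comm (l₁ := [j]) (l₂ := [i]))).nodup_iff.2 hl
  have h1 := List.nodup_append.1 hl
  have h2 := List.nodup_append.1 h1.1
  have hi : i ∉ l := fun h => h2.2.2 i h i (by simp) rfl
  have hj : j ∉ l := fun h => h1.2.2 j (by simp [h]) j (by simp) rfl
  have hqq := Complex.exp_ne_zero η
  have hξ : ∀ k, (fun k => Complex.exp (lam k)) k ≠ 0 := fun k => Complex.exp_ne_zero _
  have c := (polesCancel_core hG hη hq hl hl' hmem hij hX).conj
    -- The square of the factor `-1/2` that each simple residue carries.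
    ((1 / 4 : ℂ) • (rLi (Complex.exp η) (fun k => Complex.exp (lam k)) l i *
      rLi (Complex.exp η) (fun k => Complex.exp (lam k)) l j))
    (rL (Complex.exp η) (fun k => Complex.exp (lam k)) l j *
      rL (Complex.exp η) (fun k => Complex.exp (lam k)) l i)
  set q := Complex.exp η
  set ξ : ι → ℂ := fun k => Complex.exp (lam k)
  have eL : ∀ a b : ι, rL q ξ (l ++ [a]) b = rL q ξ l b * rr q ξ b a := fun a b => by simp [rL]
  have eLi : ∀ a b : ι, rLi q ξ (l ++ [a]) b = rri q ξ b a * rLi q ξ l b := fun a b => by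
    simp [rLi]
  have r1 : rri q ξ i j * rr q ξ i j = 1 := rri_mul_rr hqq hξ hij (hG.rreg i j hij)
  have r2 : rri q ξ j i * rr q ξ j i = 1 := rri_mul_rr hqq hξ hij.symm (hG.rreg j i hij.symm)
  have r3 : rr q ξ j i * rri q ξ j i = 1 := rr_mul_rri hqq hξ hij.symm (hG.rreg j i hij.symm)
  have s1 : rLi q ξ l i * rL q ξ l i = 1 := rLi_mul_rL hqq hξ hG.rreg hi
  have s2 : rLi q ξ l j * rL q ξ l j = 1 := rLi_mul_rL hqq hξ hG.rreg hj
  have hA := rL_ybe hqq hξ h2.1 hi hj hij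
  have hAi : rri q ξ j i * rLi q ξ l j * rLi q ξ l i = rLi q ξ l i * rLi q ξ l j * rri q ξ j i := by
    refine left_inv_eq_right_inv (a := rL q ξ l i * rL q ξ l j * rr q ξ j i) ?_ ?_
    · calc _ = rri q ξ j i * (rLi q ξ l j * (rLi q ξ l i * rL q ξ l i) * rL q ξ l j) *
          rr q ξ j i := by simp only [mul_assoc]
        _ = 1 := by rw [s1, mul_one, s2, mul_one, r2]
    · rw [mul_eq_one_comm, hA]
      calc _ = rLi q ξ l i * (rLi q ξ l j * (rri q ξ j i * rr q ξ j i) * rL q ξ l j) *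
          rL q ξ l i := by simp only [mul_assoc]
        _ = 1 := by rw [r2, mul_one, s2, mul_one, s1]
  refine c.congr ?_ (.of_forall fun α => ?_)
  · filter_upwards [triv_core_core (lam := lam) hη hl hmem hij hX] with α hα
    rw [Kind.res_res_last hG (kindB_valid η _) (kindC_valid η _) hl]
    have hc := Triv.commute_rr (q := q) (ξ := ξ) hij.symm hα (Kind.triv_core _ _ _)
    generalize (kindB η (α - 1)).core lam l i _ = W at hc ⊢
    rw [smul_mul_assoc, smul_mul_assoc]
    congr 1
    rw [eL, eLi]
    symm
    change rri q ξ j i * rLi q ξ l j * (rLi q ξ l i * W * rL q ξ l i) *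
      (rL q ξ l j * rr q ξ j i) = _
    calc _ = rri q ξ j i * rLi q ξ l j * rLi q ξ l i * W * (rL q ξ l i * rL q ξ l j * rr q ξ j i) := by
          simp only [mul_assoc]
      _ = rLi q ξ l i * rLi q ξ l j * (rri q ξ j i * (W * rr q ξ j i)) *
          (rL q ξ l j * rL q ξ l i) := by rw [hAi, hA]; simp only [mul_assoc]
      _ = _ := by rw [hc.eq, ← mul_assoc (rri q ξ j i), r2, one_mul]
  · dsimp only
    rw [Kind.res_swap hG (kindB_valid η _) hl, Kind.res_swap hG (kindC_valid η _) hl]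
    have e : ∀ Y, rri q ξ i j * (rr q ξ i j * Y * rri q ξ i j) * rr q ξ i j = Y := fun Y => by
      calc _ = (rri q ξ i j * rr q ξ i j) * Y * (rri q ξ i j * rr q ξ i j) := by
            simp only [mul_assoc]
        _ = Y := by rw [r1, one_mul, mul_one]
    rw [e, Kind.res_res_last hG (kindB_valid η _) (kindC_valid η _) hl']
    generalize (kindB η (α - 1)).core lam l j _ = W
    have r4 : rr q ξ i j * rri q ξ i j = 1 := rr_mul_rri hqq hξ hij (hG.rreg i j hij)
    rw [smul_mul_assoc, smul_mul_assoc, mul_smul_comm, smul_mul_assoc]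
    congr 1
    change _ = rr q ξ i j * (rLi q ξ (l ++ [j]) i * (rLi q ξ l j * W * rL q ξ l j) *
      rL q ξ (l ++ [j]) i) * rri q ξ i j
    rw [eL, eLi]
    symm
    calc _ = (rr q ξ i j * rri q ξ i j) * (rLi q ξ l i * rLi q ξ l j * W *
          (rL q ξ l j * rL q ξ l i)) * (rr q ξ i j * rri q ξ i j) := by simp only [mul_assoc]
      _ = _ := by rw [r4, one_mul, mul_one]

/-- The poles at `α = 0` of `b_i c_j` and `b_j c_i` cancel. -/
theorem polesCancel_res (hG : Gen η lam) (hη : η ≠ 0)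
    (hq : ∀ m : ℤ, m ≠ 0 → Complex.exp (η * m) ≠ 1) {l : List ι} (hl : l.Nodup)
    (hmem : ∀ k, k ∈ l) {i j : ι} (hij : i ≠ j) (X : SiteMat ι ℂ) :
    PolesCancel
      (fun α => (kindB η (α - 1)).res η lam l i ((kindC η α).res η lam l j X))
      fun α => (kindB η (α - 1)).res η lam l j ((kindC η α).res η lam l i X) := by
  have lB := fun α k => Kind.isLinear_res hG (kindB_valid η (α - 1)) hl k
  have lC := fun α k => Kind.isLinear_res hG (kindC_valid η α) hl k
  induction X using Matrix.induction_on' with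
  | h_zero => simpa only [(lC _ _).map_zero, (lB _ _).map_zero] using PolesCancel.zero
  | h_add X Y hX hY => simpa only [(lC _ _).map_add, (lB _ _).map_add] using hX.add hY
  -- A matrix unit has definite spin, as the torus evaluation requires; linearity extends the result
  -- to all operators.
  | h_std_basis s t x =>
    have hX : HasSpin (sd s t) (Matrix.single s t x) := fun s' t' h => by
      rw [Matrix.single_apply]
      exact if_neg fun ⟨h1, h2⟩ => h (by rw [h1, h2])
    obtain ⟨l', ρ, ρ', hp, hρ, hρ', h1, h⟩ := exists_reorder hG hl (hmem i) (hmem j) hij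
    have c := (polesCancel_last hG hη hq (hp.nodup_iff.2 hl) (fun k => hp.mem_iff.2 (hmem k)) hij
      (SP.conj_hasSpin hX hρ' hρ)).conj ρ ρ'
    have e : ∀ Y, ρ' * (ρ * Y * ρ') * ρ = Y := fun Y => by
      calc _ = (ρ' * ρ) * Y * (ρ' * ρ) := by simp only [mul_assoc]
        _ = Y := by rw [h1, one_mul, mul_one]
    refine c.congr (.of_forall fun α => ?_) (.of_forall fun α => ?_) <;>
    · dsimp only
      rw [h _ (kindB_valid η (α - 1)), h _ (kindC_valid η α), e]

/-- If the weights agree at `α = 0`, the weighted sum of the two products converges. -/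
theorem PolesCancel.tendsto (h : PolesCancel U V) {f g : ℂ → ℂ} (hf : DifferentiableAt ℂ f 0)
    (hg : DifferentiableAt ℂ g 0) (h0 : f 0 = g 0) :
    ∃ Z, Tendsto (fun α => f α • U α + g α • V α) (𝓝[≠] 0) (𝓝 Z) := by
  obtain ⟨P, Q, hP, hQ, hPQ, hU, hV⟩ := h
  have hd : EDiff fun α => f α • P α + g α • Q α := (hP.smul hf).add (hQ.smul hg)
  -- The numerator `f P + g Q` vanishes at `0`, so its quotient by `α` tends to its derivative
  -- there.
  refine ⟨Matrix.of fun s t => deriv (fun α => (f α • P α + g α • Q α) s t) 0, ?_⟩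
  refine tendsto_pi_nhds.2 fun s => tendsto_pi_nhds.2 fun t => ?_
  refine ((hasDerivAt_iff_tendsto_slope.1 (hd s t).hasDerivAt).congr' ?_)
  filter_upwards [hU, hV] with α hα hα'
  have e : (f 0 • P 0 + g 0 • Q 0) s t = 0 := by
    rw [← h0, ← smul_add, hPQ, smul_zero]; rfl
  rw [slope_def_field, e, hα, hα']
  simp only [Matrix.add_apply, Matrix.smul_apply, smul_eq_mul, sub_zero]
  ring

end PolesCancel

/-! ### Integral operators with continuous kernels -/

section KerOp

variable {X : Type*} [TopologicalSpace X] [CompactSpace X]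

/-- The operator `f ↦ (z ↦ Λ (f · κ z))`. -/
def kerOp (Λ : C(X, ℂ) →L[ℂ] ℂ) (κ : C(X, C(X, ℂ))) : C(X, ℂ) →L[ℂ] C(X, ℂ) :=
  LinearMap.mkContinuous
    { toFun := fun f => ⟨fun z => Λ (f * κ z), by fun_prop⟩
      map_add' := fun f g => by ext z; simp [add_mul]
      map_smul' := fun c f => by ext z; simp }
    (‖Λ‖ * ‖κ‖) fun f => by
      refine (ContinuousMap.norm_le _ (by positivity)).2 fun z => ?_
      calc ‖Λ (f * κ z)‖ ≤ ‖Λ‖ * ‖f * κ z‖ := Λ.le_opNorm _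
        _ ≤ ‖Λ‖ * (‖f‖ * ‖κ‖) := by
          gcongr
          exact (norm_mul_le _ _).trans (by gcongr; exact κ.norm_coe_le_norm z)
        _ = ‖Λ‖ * ‖κ‖ * ‖f‖ := by ring

/-- Arzelà-Ascoli: the image of the unit ball is bounded, and equicontinuous because `z ↦ κ z` is
continuous for the uniform norm. -/
theorem isCompactOperator_kerOp (Λ : C(X, ℂ) →L[ℂ] ℂ) (κ : C(X, C(X, ℂ))) :
    IsCompactOperator (kerOp Λ κ) := by
  let e := ContinuousMap.isometryEquivBoundedOfCompact X ℂ
  set A : Set (BoundedContinuousFunction X ℂ) := (fun f => e (kerOp Λ κ f)) '' Metric.ball 0 1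
  have hA : IsCompact (closure A) := by
    refine BoundedContinuousFunction.arzela_ascoli (Metric.closedBall 0 (‖kerOp Λ κ‖))
      (isCompact_closedBall _ _) A ?_ ?_
    · rintro _ x ⟨f, hf, rfl⟩
      rw [mem_closedBall_zero_iff]
      calc ‖kerOp Λ κ f x‖ ≤ ‖kerOp Λ κ f‖ := ContinuousMap.norm_coe_le_norm _ x
        _ ≤ ‖kerOp Λ κ‖ * ‖f‖ := (kerOp Λ κ).le_opNorm f
        _ ≤ ‖kerOp Λ κ‖ * 1 := by
          gcongr
          exact (mem_ball_zero_iff.1 hf).le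
        _ = _ := mul_one _
    · intro x₀
      rw [Metric.equicontinuousAt_iff_right]
      intro ε hε
      have hκ : ∀ᶠ x in 𝓝 x₀, dist (κ x₀) (κ x) < ε / (‖Λ‖ + 1) := by
        have := Metric.tendsto_nhds.1 (κ.continuous.tendsto x₀) (ε / (‖Λ‖ + 1)) (by positivity)
        filter_upwards [this] with x hx
        rwa [dist_comm]
      filter_upwards [hκ] with x hx
      rintro ⟨_, f, hf, rfl⟩
      change dist (Λ (f * κ x₀)) (Λ (f * κ x)) < ε
      rw [dist_eq_norm, ← map_sub, ← mul_sub]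
      calc ‖Λ (f * (κ x₀ - κ x))‖ ≤ ‖Λ‖ * ‖f * (κ x₀ - κ x)‖ := Λ.le_opNorm _
        _ ≤ ‖Λ‖ * (1 * ‖κ x₀ - κ x‖) := by
          gcongr
          refine (norm_mul_le _ _).trans ?_
          gcongr
          exact (mem_ball_zero_iff.1 hf).le
        _ ≤ (‖Λ‖ + 1) * ‖κ x₀ - κ x‖ := by
          rw [one_mul]; gcongr; linarith
        _ < (‖Λ‖ + 1) * (ε / (‖Λ‖ + 1)) := by
          rw [dist_eq_norm] at hx
          gcongr
        _ = ε := by field_simp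
  refine ⟨e.symm '' closure A, hA.image e.symm.continuous, ?_⟩
  filter_upwards [Metric.ball_mem_nhds (0 : C(X, ℂ)) one_pos] with f hf
  exact ⟨e (kerOp Λ κ f), subset_closure ⟨f, hf, rfl⟩, e.symm_apply_apply _⟩

/-- A Fredholm equation `f = d + (u α A + v α B) f` which has at most one solution at `α = 0` is
solved, for small `α`, by an operator differentiable in `α`. -/
theorem exists_resolvent {E : Type*} [NormedAddCommGroup E] [NormedSpace ℂ E] [CompleteSpace E]
    {A B : E →L[ℂ] E} (hA : IsCompactOperator A) (hB : IsCompactOperator B) {u v : ℂ → ℂ}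
    (hu : DifferentiableAt ℂ u 0) (hv : DifferentiableAt ℂ v 0)
    (h : ∀ f, f = u 0 • A f + v 0 • B f → f = 0) :
    ∃ R : ℂ → E →L[ℂ] E, DifferentiableAt ℂ R 0 ∧
      ∀ᶠ α in 𝓝 (0 : ℂ), ∀ f d, f = d + (u α • A f + v α • B f) → f = R α d := by
  set M : ℂ → E →L[ℂ] E := fun α => 1 - (u α • A + v α • B) with hM
  have hMd : DifferentiableAt ℂ M 0 := by fun_prop
  have hc : IsCompactOperator (u 0 • A + v 0 • B : E →L[ℂ] E) := (hA.smul _).add (hB.smul _)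
  have hunit : IsUnit (M 0) := by
    -- The Fredholm alternative: if `1` is not an eigenvalue of a compact operator, it lies in its
    -- resolvent set.
    have := (hc.hasEigenvalue_or_mem_resolventSet one_ne_zero).resolve_left ?_
    · simpa [resolventSet, hM] using this
    · intro hev
      obtain ⟨f, hf, hne⟩ := hev.exists_hasEigenvector
      rw [Module.End.mem_eigenspace_iff, one_smul] at hf
      exact hne (h f hf.symm)
  -- Units are open and inversion is differentiable at a unit, so the resolvent exists for small `α`
  -- and is differentiable at `0`.
  refine ⟨fun α => Ring.inverse (M α), (differentiableAt_inverse hunit).comp 0 hMd, ?_⟩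
  filter_upwards [hMd.continuousAt.eventually (Units.isOpen.mem_nhds hunit)] with α hα f d hf
  have e : M α f = d := by
    have : M α f = f - (u α • A f + v α • B f) := rfl
    rw [this]; nth_rewrite 1 [hf]; abel
  rw [← e]
  change f = (Ring.inverse (M α) * M α) f
  rw [Ring.inverse_mul_cancel _ hα]
  rfl

end KerOp

/-! ### Integrals along a contour -/

section Contour

open MeasureTheory

variable {γ : ℝ → ℂ}

/-- The parametrisation of the contour as a map onto its point set. -/
def contourMap (γ : ℝ → ℂ) (t : ℝ) : contourSet γ :=
  ⟨γ (Set.projIcc 0 1 zero_le_one t), _, (Set.projIcc 0 1 zero_le_one t).2, rfl⟩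

theorem contourMap_of_mem {t : ℝ} (ht : t ∈ Set.Icc (0 : ℝ) 1) : (contourMap γ t : ℂ) = γ t := by
  change γ (Set.projIcc 0 1 zero_le_one t) = γ t
  rw [Set.projIcc_of_mem _ ht]

theorem continuous_contourMap (hγ : ContinuousOn γ (Set.Icc 0 1)) : Continuous (contourMap γ) :=
  (hγ.domRestrict.comp continuous_projIcc).subtype_mk _

/-- The Lipschitz constant bounds `deriv γ` at every interior point, including those where `γ` is
not differentiable and `deriv` takes the default value `0`. -/
theorem integrableOn_deriv (hγ : ∃ M, LipschitzOnWith M γ (Set.Icc 0 1)) :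
    IntegrableOn (deriv γ) (Set.Ioo 0 1) := by
  obtain ⟨M, hM⟩ := hγ
  refine Measure.integrableOn_of_bounded (M := M) (by simp) (measurable_deriv γ).aestronglyMeasurable
    ?_
  filter_upwards [ae_restrict_mem measurableSet_Ioo] with t ht
  exact norm_deriv_le_of_lipschitzOn (Icc_mem_nhds ht.1 ht.2) hM

variable [CompactSpace (contourSet γ)]

theorem integrable_contour (hγ : ∃ M, LipschitzOnWith M γ (Set.Icc 0 1)) (F : C(contourSet γ, ℂ)) :
    IntegrableOn (fun t => F (contourMap γ t) * deriv γ t) (Set.Ioo 0 1) := by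
  have hc := hγ.choose_spec.continuousOn
  exact (integrableOn_deriv hγ).bdd_mul (c := ‖F‖)
    (F.continuous.comp (continuous_contourMap hc)).aestronglyMeasurable
    (.of_forall fun t => F.norm_coe_le_norm _)

/-- The contour integral as a functional on continuous functions. -/
def contourFun (hγ : ∃ M, LipschitzOnWith M γ (Set.Icc 0 1)) : C(contourSet γ, ℂ) →L[ℂ] ℂ :=
  LinearMap.mkContinuous
    { toFun := fun F => ∫ t in Set.Ioo (0 : ℝ) 1, F (contourMap γ t) * deriv γ t
      map_add' := fun F G => by
        rw [← integral_add (integrable_contour hγ F) (integrable_contour hγ G)]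
        simp [add_mul]
      map_smul' := fun c F => by
        simp only [ContinuousMap.smul_apply, smul_eq_mul, mul_assoc, integral_const_mul,
          RingHom.id_apply] }
    (∫ t in Set.Ioo (0 : ℝ) 1, ‖deriv γ t‖) fun F => by
      rw [mul_comm, ← integral_const_mul]
      refine norm_integral_le_of_norm_le ((integrableOn_deriv hγ).norm.const_mul _)
        (.of_forall fun t => ?_)
      rw [norm_mul]
      gcongr
      exact F.norm_coe_le_norm _

theorem contourIntegral_eq (hγ : ∃ M, LipschitzOnWith M γ (Set.Icc 0 1)) {h : ℂ → ℂ}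
    {F : C(contourSet γ, ℂ)} (hF : ∀ x : contourSet γ, h x = F x) :
    contourIntegral γ h = contourFun hγ F := by
  rw [contourIntegral, intervalIntegral.integral_of_le zero_le_one, integral_Ioc_eq_integral_Ioo]
  refine setIntegral_congr_fun measurableSet_Ioo fun t ht => ?_
  have := hF (contourMap γ t)
  rw [contourMap_of_mem (Set.Ioo_subset_Icc_self ht)] at this
  simp only [this]

/-- Fubini: the integrand is a bounded continuous kernel times the integrable product of two
derivatives. -/
theorem contourFun_swap (hγ : ∃ M, LipschitzOnWith M γ (Set.Icc 0 1))
    (κ : C(contourSet γ, C(contourSet γ, ℂ))) (κ' : C(contourSet γ, C(contourSet γ, ℂ)))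
    (h : ∀ x y, κ x y = κ' y x) :
    contourFun hγ ⟨fun x => contourFun hγ (κ x), by fun_prop⟩ =
      contourFun hγ ⟨fun x => contourFun hγ (κ' x), by fun_prop⟩ := by
  have hc := continuous_contourMap hγ.choose_spec.continuousOn
  change ∫ t in Set.Ioo (0 : ℝ) 1, (∫ s in Set.Ioo (0 : ℝ) 1, κ (contourMap γ t) (contourMap γ s) *
    deriv γ s) * deriv γ t = ∫ s in Set.Ioo (0 : ℝ) 1, (∫ t in Set.Ioo (0 : ℝ) 1,
    κ' (contourMap γ s) (contourMap γ t) * deriv γ t) * deriv γ s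
  simp only [← integral_mul_const]
  rw [integral_integral_swap]
  · refine integral_congr_ae (.of_forall fun s => integral_congr_ae (.of_forall fun t => ?_))
    simp only [h]
    ring
  · have h1 := (integrableOn_deriv hγ).mul_prod (integrableOn_deriv hγ)
    have h2 := h1.bdd_mul (c := ‖κ‖)
      (f := fun p : ℝ × ℝ => κ (contourMap γ p.1) (contourMap γ p.2)) ?_ (.of_forall fun p => ?_)
    · refine h2.congr (.of_forall fun p => ?_)
      simp only [Function.uncurry]
      ring
    · refine Continuous.aestronglyMeasurable ?_
      exact (ContinuousMap.continuous_uncurry_of_continuous κ).comp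
        ((hc.comp continuous_fst).prodMk (hc.comp continuous_snd))
    · exact ((κ _).norm_coe_le_norm _).trans (κ.norm_coe_le_norm _)

end Contour

/-! ### The functions `φ` and `ω` near `α = 0` -/

section PhysicalPart

theorem coth_neg (z : ℂ) : coth (-z) = -coth z := by
  rw [coth, coth, Complex.cosh_neg, Complex.sinh_neg, div_neg]

theorem continuous_coth {Y : Type*} [TopologicalSpace Y] {f : Y → ℂ} (hf : Continuous f)
    (h : ∀ y, Complex.sinh (f y) ≠ 0) : Continuous fun y => coth (f y) := by
  unfold coth
  exact (Complex.continuous_cosh.comp hf).div (Complex.continuous_sinh.comp hf) h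

variable {n : ℕ} {η : ℂ} {lam : Fin n → ℂ} {γ : ℝ → ℂ} {a : ℂ → ℂ} {G : ℂ → ℂ → ℂ → ℂ}
  {J T h : ℝ}

theorem IsContour.isCompact (hγ : IsContour η lam γ) : IsCompact (contourSet γ) :=
  isCompact_Icc.image_of_continuousOn hγ.lipschitz.choose_spec.continuousOn

/-- The continuous logarithm of `1 + a` shows at once that `1 + a` is continuous and has no zeros on
the contour. -/
theorem IsAuxiliary.exists_weight (ha : IsAuxiliary γ η J T h a) :
    ∃ W : C(contourSet γ, ℂ), ∀ x : contourSet γ,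
      W x = (2 * Real.pi * Complex.I * (1 + a x))⁻¹ := by
  obtain ⟨ℓ, hℓ, he, -⟩ := ha
  refine ⟨⟨fun x => (2 * Real.pi * Complex.I * Complex.exp (ℓ x))⁻¹, ?_⟩, fun x => ?_⟩
  · refine Continuous.inv₀ (continuous_const.mul hℓ.domRestrict.cexp) fun x => ?_
    exact mul_ne_zero Complex.two_pi_I_ne_zero (Complex.exp_ne_zero _)
  · rw [← he x x.2]; rfl

/-- For small `α` the integral equation has the unique solution `R α (d j α)`, so regularity in `α`
is inherited from the resolvent and is not assumed of `G`. At `α = 0` the driving terms in the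
equation and in `ψ` coincide and the kernel is symmetric, whence the symmetry of `ψ`. -/
theorem regular_density (hγ : IsContour η lam γ) (ha : IsAuxiliary γ η J T h a)
    (huniq : UniquelySolvable γ η a)
    (hG : ∀ᶠ α in 𝓝 (0 : ℂ), ∀ j, IsDensity γ η a (lam j) α fun z => G z (lam j) α) :
    (∀ j, ContinuousAt (phi γ a G (lam j)) 0) ∧
    (∀ i j, DifferentiableAt ℂ (psi γ η a G (lam i) (lam j)) 0) ∧
    ∀ i j, psi γ η a G (lam i) (lam j) 0 = psi γ η a G (lam j) (lam i) 0 := by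
  have : CompactSpace (contourSet γ) := isCompact_iff_compactSpace.1 hγ.isCompact
  obtain ⟨W, hW⟩ := ha.exists_weight
  set I := contourFun hγ.lipschitz
  set Λ : C(contourSet γ, ℂ) →L[ℂ] ℂ := I.comp (ContinuousLinearMap.mul ℂ _ W)
  have hΛ : ∀ F, Λ F = I (W * F) := fun F => rfl
  have rA : ∀ x y : contourSet γ, Complex.sinh (x - y - η) ≠ 0 := fun x y => by
    rw [show (x : ℂ) - y - η = -(y - x + η) by ring, Complex.sinh_neg]
    exact neg_ne_zero.2 (hγ.kernel_regular y y.2 x x.2)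
  have rB : ∀ x y : contourSet γ, Complex.sinh (x - y + η) ≠ 0 :=
    fun x y => hγ.kernel_regular x x.2 y y.2
  set κA : C(contourSet γ, C(contourSet γ, ℂ)) :=
    ContinuousMap.curry ⟨fun p : contourSet γ × contourSet γ => coth (p.1 - p.2 - η),
      continuous_coth (by fun_prop) fun p => rA p.1 p.2⟩ with hκA
  set κB : C(contourSet γ, C(contourSet γ, ℂ)) :=
    ContinuousMap.curry ⟨fun p : contourSet γ × contourSet γ => coth (p.1 - p.2 + η),
      continuous_coth (by fun_prop) fun p => rB p.1 p.2⟩ with hκB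
  have aA : ∀ x y, κA x y = coth (x - y - η) := fun _ _ => rfl
  have aB : ∀ x y, κB x y = coth (x - y + η) := fun _ _ => rfl
  set m : Fin n → C(contourSet γ, ℂ) := fun j => ⟨fun x => coth (x - lam j),
    continuous_coth (by fun_prop) fun x => (hγ.lam_regular x x.2 j).1⟩
  set m' : Fin n → C(contourSet γ, ℂ) := fun j => ⟨fun x => coth (x - lam j - η),
    continuous_coth (by fun_prop) fun x => (hγ.lam_regular x x.2 j).2.1⟩
  set u : ℂ → ℂ := fun α => Complex.exp (α * η) with hu
  set v : ℂ → ℂ := fun α => -Complex.exp (-(α * η)) with hv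
  have hK : ∀ (f : ℂ → ℂ) (F : C(contourSet γ, ℂ)), (∀ x : contourSet γ, f x = F x) →
      ∀ (α : ℂ) (z : contourSet γ), kernelOp γ η a α f z =
        (u α • kerOp Λ κA F + v α • kerOp Λ κB F) z := by
    intro f F hf α z
    have := contourIntegral_eq hγ.lipschitz (h := fun w =>
      f w / (2 * Real.pi * Complex.I * (1 + a w)) * kernelK η (z - w) α)
      (F := W * (F * (u α • κA z + v α • κB z))) fun x => by
        simp only [ContinuousMap.mul_apply, ContinuousMap.add_apply, ContinuousMap.smul_apply,
          aA, aB, hW, hf, smul_eq_mul, kernelK, hu, hv]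
        ring
    rw [kernelOp, this, mul_add, mul_smul_comm, mul_smul_comm]
    change Λ _ = _
    rw [map_add, map_smul, map_smul]
    rfl
  -- A continuous function on the contour is extended by zero to `ℂ`, since the uniqueness
  -- hypothesis speaks of functions on `ℂ`.
  have hinj : ∀ F, F = u 0 • kerOp Λ κA F + v 0 • kerOp Λ κB F → F = 0 := by
    intro F hF
    have he : ∀ x : contourSet γ, Function.extend Subtype.val F 0 (x : ℂ) = F x :=
      fun x => Subtype.val_injective.extend_apply _ _ _
    have h0 := huniq (Function.extend Subtype.val F 0) ?_ ?_
    · ext x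
      rw [← he, h0 x x.2]; rfl
    · rw [continuousOn_iff_continuous_domRestrict]
      exact F.continuous.congr fun x => (he x).symm
    · intro z hz
      rw [hK _ F he 0 ⟨z, hz⟩, ← hF]
      exact he ⟨z, hz⟩
  obtain ⟨R, hR, hRα⟩ := exists_resolvent (isCompactOperator_kerOp Λ κA)
    (isCompactOperator_kerOp Λ κB) (u := u) (v := v) (by fun_prop) (by fun_prop) hinj
  set d : Fin n → ℂ → C(contourSet γ, ℂ) := fun j α => -m j + u α • m' j with hd
  have hdd : ∀ j, DifferentiableAt ℂ (d j) 0 := fun j => by fun_prop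
  have hgd : ∀ j, DifferentiableAt ℂ (fun α => R α (d j α)) 0 := fun j => hR.clm_apply (hdd j)
  have hdens : ∀ {α : ℂ} {j : Fin n}, IsDensity γ η a (lam j) α (fun z => G z (lam j) α) →
      ∃ F : C(contourSet γ, ℂ), (∀ x : contourSet γ, G x (lam j) α = F x) ∧
        F = d j α + (u α • kerOp Λ κA F + v α • kerOp Λ κB F) := by
    intro α j hα
    obtain ⟨hc, he⟩ := hα
    set F : C(contourSet γ, ℂ) := ⟨_, hc.domRestrict⟩
    have hF : ∀ x : contourSet γ, G x (lam j) α = F x := fun x => rfl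
    refine ⟨F, hF, ?_⟩
    ext x
    have := he x x.2
    rw [hK _ F hF] at this
    exact this
  have hsol : ∀ᶠ α in 𝓝 (0 : ℂ), ∀ j, ∀ x : contourSet γ, G x (lam j) α = R α (d j α) x := by
    filter_upwards [hG, hRα] with α hα hr j x
    obtain ⟨F, hF, hFe⟩ := hdens (hα j)
    rw [hF, hr F _ hFe]
  have hpi := Complex.two_pi_I_ne_zero
  have hpsi : ∀ {α : ℂ} {i : Fin n} {F : C(contourSet γ, ℂ)},
      (∀ x : contourSet γ, G x (lam i) α = F x) → ∀ j,
      psi γ η a G (lam i) (lam j) α = 2 * Λ (F * (-m j + Complex.exp (-(α * η)) • m' j)) := by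
    intro α i F hF j
    -- The factor `2` comes from `1/(πi) = 2/(2πi)`, the weight `W` containing `1/(2πi)`.
    rw [psi, contourIntegral_eq hγ.lipschitz
      (F := (2 : ℂ) • (W * (F * (-m j + Complex.exp (-(α * η)) • m' j))))]
    · rw [map_smul]; rfl
    · intro x
      change _ = (2 : ℂ) * (W x * (F x * (-coth (x - lam j) + _ * coth (x - lam j - η))))
      rw [hW, hF, mul_assoc 2 (Real.pi : ℂ), mul_assoc 2 (_ * _), mul_inv, div_eq_mul_inv]
      ring
  refine ⟨fun j => ?_, fun i j => ?_, fun i j => ?_⟩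
  · have : ContinuousAt (fun α => 1 + 2 * Λ (R α (d j α))) 0 := by
      have := (Λ.differentiableAt.comp (0 : ℂ) (hgd j)).continuousAt
      exact continuousAt_const.add (continuousAt_const.mul this)
    refine this.congr ?_
    filter_upwards [hsol] with α hα
    rw [phi, contourIntegral_eq hγ.lipschitz (F := (2 : ℂ) • (W * R α (d j α)))]
    · rw [map_smul]; rfl
    · intro x
      change _ = (2 : ℂ) * (W x * R α (d j α) x)
      rw [hW, hα, mul_assoc 2 (Real.pi : ℂ), mul_assoc 2 (_ * _), mul_inv, div_eq_mul_inv]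
      ring
  · have : DifferentiableAt ℂ (fun α => 2 * Λ (R α (d i α) *
        (-m j + Complex.exp (-(α * η)) • m' j))) 0 := by
      have h1 : DifferentiableAt ℂ (fun α : ℂ => -m j + Complex.exp (-(α * η)) • m' j) 0 := by
        fun_prop
      exact (Λ.differentiableAt.comp (0 : ℂ) ((hgd i).mul h1)).const_mul 2
    refine this.congr_of_eventuallyEq ?_
    filter_upwards [hsol] with α hα using hpsi (hα i) j
  · obtain ⟨F, hF, hFe⟩ := hdens (hG.self_of_nhds i)
    obtain ⟨F', hF', hFe'⟩ := hdens (hG.self_of_nhds j)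
    rw [hpsi hF j, hpsi hF' i]
    have e : ∀ j, -m j + Complex.exp (-(0 * η)) • m' j = d j 0 := fun j => by
      simp [hd, hu]
    set k : C(contourSet γ, C(contourSet γ, ℂ)) := κA - κB with hk
    -- At `α = 0` the kernel is `coth(x - η) - coth(x + η)`, which is even because `coth` is odd.
    have hs : ∀ x y, k x y = k y x := fun x y => by
      change κA x y - κB x y = κA y x - κB y x
      rw [aA, aA, aB, aB, show (x : ℂ) - y + η = -(y - x - η) by ring,
        show (y : ℂ) - x + η = -(x - y - η) by ring, coth_neg, coth_neg]
      ring
    have hE : ∀ f : C(contourSet γ, ℂ), u 0 • kerOp Λ κA f + v 0 • kerOp Λ κB f = kerOp Λ k f := by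
      intro f
      ext x
      change u 0 * Λ (f * κA x) + v 0 * Λ (f * κB x) = Λ (f * (κA x - κB x))
      rw [mul_sub, map_sub]
      simp [hu, hv, sub_eq_add_neg]
    have hsym : Λ (F * kerOp Λ k F') = Λ (F' * kerOp Λ k F) := by
      have key : ∀ f g : C(contourSet γ, ℂ), Λ (f * kerOp Λ k g) =
          I ⟨fun x => I (((W * f) x) • (W * (g * k x))), by fun_prop⟩ := fun f g => by
        rw [hΛ]
        congr 1
        ext x
        change W x * (f x * Λ (g * k x)) = I (((W * f) x) • (W * (g * k x)))
        rw [map_smul, hΛ, smul_eq_mul, ContinuousMap.mul_apply, mul_assoc]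
      rw [key, key]
      refine contourFun_swap hγ.lipschitz ⟨fun x => ((W * F) x) • (W * (F' * k x)), by fun_prop⟩
        ⟨fun x => ((W * F') x) • (W * (F * k x)), by fun_prop⟩ fun x y => ?_
      change W x * F x * (W y * (F' y * k x y)) = W y * F' y * (W x * (F x * k y x))
      rw [hs x y]
      ring
    -- With `d = F - kF`, the pairing of `F` with `d j 0` is that of `F` with `F'` minus that of `F`
    -- with `kF'`; both terms are symmetric.
    have e1 : d i 0 = F - kerOp Λ k F := by rw [← hE]; exact eq_sub_of_add_eq hFe.symm
    have e2 : d j 0 = F' - kerOp Λ k F' := by rw [← hE]; exact eq_sub_of_add_eq hFe'.symm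
    rw [e, e, e1, e2, mul_sub, mul_sub, map_sub, map_sub, hsym, mul_comm F F']

theorem differentiableAt_omega {μ₁ μ₂ : ℂ} (h : DifferentiableAt ℂ (psi γ η a G μ₁ μ₂) 0) :
    DifferentiableAt ℂ (omega γ η a G μ₁ μ₂) 0 := by
  unfold omega kernelK
  fun_prop (disch := simp)

/-- The exponential factors are `1` at `α = 0` and the remaining explicit term is the even function
`K(·;0)`. -/
theorem omega_zero_symm {μ₁ μ₂ : ℂ} (h : psi γ η a G μ₁ μ₂ 0 = psi γ η a G μ₂ μ₁ 0) :
    omega γ η a G μ₁ μ₂ 0 = omega γ η a G μ₂ μ₁ 0 := by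
  have e1 : coth (μ₂ - μ₁ - η) = -coth (μ₁ - μ₂ + η) := by rw [← coth_neg]; ring_nf
  have e2 : coth (μ₂ - μ₁ + η) = -coth (μ₁ - μ₂ - η) := by rw [← coth_neg]; ring_nf
  simp only [omega, h, kernelK, e1, e2]
  simp
  ring

end PhysicalPart

/-! ### The limits -/

section Limits

variable {n : ℕ} {η : ℂ} {lam : Fin n → ℂ}

theorem exp_int_ne_one (hq : ∀ m : ℕ, 0 < m → Complex.exp η ^ m ≠ 1) (m : ℤ) (hm : m ≠ 0) :
    Complex.exp (η * m) ≠ 1 := by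
  rw [mul_comm, Complex.exp_int_mul]
  intro h
  rcases Int.natAbs_eq m with e | e <;> rw [e] at h
  · exact hq _ (Int.natAbs_pos.2 hm) (by exact_mod_cast h)
  · rw [zpow_neg, inv_eq_one] at h
    exact hq _ (Int.natAbs_pos.2 hm) (by exact_mod_cast h)

theorem gen_of_sinh (hq : ∀ m : ℕ, 0 < m → Complex.exp η ^ m ≠ 1)
    (hlam : ∀ i j, i ≠ j →
      Complex.sinh (lam i - lam j) ≠ 0 ∧ Complex.sinh (lam i - lam j + η) ≠ 0) : Gen η lam := by
  have e : ∀ z : ℂ, Complex.exp z - (Complex.exp z)⁻¹ = 2 * Complex.sinh z := fun z => by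
    rw [← Complex.exp_neg, Complex.two_sinh]
  have e' : ∀ j k, Complex.exp η * (Complex.exp (lam j) / Complex.exp (lam k)) =
      Complex.exp (lam j - lam k + η) := fun j k => by
    rw [← Complex.exp_sub, ← Complex.exp_add, add_comm]
  have hr : ∀ j k, j ≠ k → Complex.exp η * (Complex.exp (lam j) / Complex.exp (lam k)) -
      (Complex.exp η)⁻¹ * (Complex.exp (lam j) / Complex.exp (lam k))⁻¹ ≠ 0 := fun j k h => by
    rw [← mul_inv, e', e]
    exact mul_ne_zero two_ne_zero (hlam j k h).2
  refine ⟨?_, fun j k h => ⟨hr j k h, hr k j h.symm⟩, fun j k h => ?_⟩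
  · intro h
    -- Vanishing of `q - q⁻¹` would mean `q² = 1`, so `q` would be a root of unity.
    refine hq 2 two_pos ?_
    have h0 := Complex.exp_ne_zero η
    field_simp at h
    linear_combination h
  · rw [← Complex.exp_sub]
    intro h0
    apply (hlam j k h).1
    have h1 := Complex.exp_ne_zero (lam j - lam k)
    have := e (lam j - lam k)
    have h2 : Complex.exp (lam j - lam k) - (Complex.exp (lam j - lam k))⁻¹ = 0 := by
      field_simp
      linear_combination -h0
    rw [h2] at this
    simpa using this.symm

/-- A pointwise limit of linear maps is linear. -/
theorem exists_linear_limit {V : Type*} [AddCommGroup V] [Module ℂ V] [TopologicalSpace V]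
    [T2Space V] [ContinuousAdd V] [ContinuousConstSMul ℂ V] {l : Filter ℂ} [l.NeBot]
    {F : ℂ → V → V} (hF : ∀ α, IsLinearMap ℂ (F α)) (h : ∀ X, ∃ Z, Tendsto (fun α => F α X) l (𝓝 Z)) :
    ∃ Ω : V →ₗ[ℂ] V, ∀ X, Tendsto (fun α => F α X) l (𝓝 (Ω X)) := by
  choose Ω hΩ using h
  refine ⟨⟨⟨Ω, fun X Y => ?_⟩, fun c X => ?_⟩, hΩ⟩
  · refine tendsto_nhds_unique (hΩ (X + Y)) (((hΩ X).add (hΩ Y)).congr fun α => ?_)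
    rw [(hF α).map_add]
  · refine tendsto_nhds_unique (hΩ (c • X)) (((hΩ X).const_smul c).congr fun α => ?_)
    rw [(hF α).map_smul]

theorem isLinearMap_sum_smul {V κ : Type*} [AddCommGroup V] [Module ℂ V] (s : Finset κ)
    {F : κ → V → V} (hF : ∀ k ∈ s, IsLinearMap ℂ (F k)) (c : κ → ℂ) :
    IsLinearMap ℂ fun X => ∑ k ∈ s, c k • F k X where
  map_add X Y := by
    rw [← Finset.sum_add_distrib]
    exact Finset.sum_congr rfl fun k hk => by rw [(hF k hk).map_add, smul_add]
  map_smul b X := by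
    rw [Finset.smul_sum]
    exact Finset.sum_congr rfl fun k hk => by rw [(hF k hk).map_smul, smul_comm]

theorem Omega1At_eq (hG : Gen η lam) (w : ℂ → ℂ → ℂ → ℂ) (α : ℂ) (X : SpinOp n) :
    Omega1At η lam w α X = ∑ p : Fin n × Fin n, (-w (lam p.1) (lam p.2) α) •
      (kindB η (α - 1)).res η lam (List.finRange n).reverse p.1
        ((kindC η α).res η lam (List.finRange n).reverse p.2 X) := by
  rw [Omega1At, Fintype.sum_prod_type, ← Finset.sum_neg_distrib]
  refine Finset.sum_congr rfl fun i _ => ?_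
  rw [← Finset.sum_neg_distrib]
  refine Finset.sum_congr rfl fun j _ => ?_
  rw [(bOp_pole hG _ i _).2, (cOp_pole hG _ j _).2, neg_smul]

theorem Omega2At_eq (hG : Gen η lam) (p : ℂ → ℂ → ℂ) (α : ℂ) (X : SpinOp n) :
    Omega2At η lam p α X = ∑ j, (-p (lam j) α) •
      ∑ i, (kindH η α i).res η lam (List.finRange n).reverse j X := by
  rw [Omega2At, ← Finset.sum_neg_distrib]
  refine Finset.sum_congr rfl fun j _ => ?_
  rw [(HOp_pole hG _ j _).2, neg_smul]

/-- Individual terms of the double sum may diverge. The terms `(i,j)` and `(j,i)` are added first: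
diagonal ones vanish, and the poles of the others cancel by the symmetry of `w` at `α = 0`. -/
theorem exists_limit_Omega1 (hG : Gen η lam) (hη : η ≠ 0)
    (hq : ∀ m : ℤ, m ≠ 0 → Complex.exp (η * m) ≠ 1) {w : ℂ → ℂ → ℂ → ℂ}
    (hw : ∀ i j, DifferentiableAt ℂ (w (lam i) (lam j)) 0)
    (hs : ∀ i j, w (lam i) (lam j) 0 = w (lam j) (lam i) 0) :
    ∃ Ω : SpinOp n →ₗ[ℂ] SpinOp n, ∀ X,
      Tendsto (fun α => Omega1At η lam w α X) (𝓝[≠] 0) (𝓝 (Ω X)) := by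
  have hl : (List.finRange n).reverse.Nodup := List.nodup_reverse.2 (List.nodup_finRange n)
  have hmem : ∀ k, k ∈ (List.finRange n).reverse := fun k => by simp
  simp only [Omega1At_eq hG]
  refine exists_linear_limit (fun α => isLinearMap_sum_smul _ (fun p _ => ?_) _) fun X => ?_
  · have h1 := Kind.isLinear_res hG (kindB_valid η (α - 1)) hl p.1
    have h2 := Kind.isLinear_res hG (kindC_valid η α) hl p.2
    exact ⟨fun X Y => by rw [h2.map_add, h1.map_add], fun c X => by rw [h2.map_smul, h1.map_smul]⟩
  · set F : Fin n × Fin n → ℂ → SpinOp n := fun p α => (-w (lam p.1) (lam p.2) α) •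
      (kindB η (α - 1)).res η lam (List.finRange n).reverse p.1
        ((kindC η α).res η lam (List.finRange n).reverse p.2 X)
    have hp : ∀ p : Fin n × Fin n, ∃ Z, Tendsto (fun α => F p α + F p.swap α) (𝓝[≠] 0) (𝓝 Z) := by
      rintro ⟨i, j⟩
      by_cases hij : i = j
      · subst hij
        refine ⟨0, tendsto_const_nhds.congr fun α => ?_⟩
        simp only [F, Prod.swap_prod_mk]
        rw [Kind.res_res_self hG (kindB_valid η _) (kindC_valid η _) hl, smul_zero, add_zero]
      · exact (polesCancel_res hG hη hq hl hmem hij X).tendsto (hw i j).neg (hw j i).neg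
          (congrArg Neg.neg (hs i j))
    choose Z hZ using hp
    -- Summing the symmetrised terms over all ordered pairs counts each term twice.
    refine ⟨(1 / 2 : ℂ) • ∑ p, Z p,
      ((tendsto_finsetSum _ fun p _ => hZ p).const_smul (1 / 2 : ℂ)).congr fun α => ?_⟩
    have e : ∑ p : Fin n × Fin n, F p.swap α = ∑ p, F p α :=
      (Equiv.prodComm (Fin n) (Fin n)).sum_comp fun p => F p α
    rw [Finset.sum_add_distrib, e, ← two_smul ℂ, smul_smul, one_div,
      inv_mul_cancel₀ two_ne_zero, one_smul]

/-- Every residue of `H` has a limit by itself, so continuity of the weights at `0` is enough. -/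
theorem exists_limit_Omega2 (hG : Gen η lam)
    (hq : ∀ m : ℤ, m ≠ 0 → Complex.exp (η * m) ≠ 1) {p : ℂ → ℂ → ℂ}
    (hp : ∀ j, ContinuousAt (p (lam j)) 0) :
    ∃ Ω : SpinOp n →ₗ[ℂ] SpinOp n, ∀ X,
      Tendsto (fun α => Omega2At η lam p α X) (𝓝[≠] 0) (𝓝 (Ω X)) := by
  have hl : (List.finRange n).reverse.Nodup := List.nodup_reverse.2 (List.nodup_finRange n)
  simp only [Omega2At_eq hG]
  refine exists_linear_limit (fun α => isLinearMap_sum_smul _ (fun j _ => ?_) _) fun X => ?_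
  · have h := fun i => Kind.isLinear_res hG (kindH_valid η α i) hl j
    exact ⟨fun X Y => by simp only [(h _).map_add, Finset.sum_add_distrib],
      fun c X => by simp only [(h _).map_smul, Finset.smul_sum]⟩
  · choose Z hZ using fun j => tendsto_sum_res_kindH hG hq hl j X
    exact ⟨_, tendsto_finsetSum _ fun j _ =>
      ((hp j).tendsto.mono_left nhdsWithin_le_nhds).neg.smul (hZ j)⟩

end Limits

end XXZ

end

theorem mainTheorem3 (n : ℕ) (J T h Δ : ℝ) (η : ℂ) (lam : Fin n → ℂ)
    (γ : ℝ → ℂ) (a : ℂ → ℂ) (G : ℂ → ℂ → ℂ → ℂ)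
    (hJ : 0 < J) (hT : 0 < T) (hΔ : -1 < Δ) (hη : Complex.cosh η = Δ)
    (hq : ∀ m : ℕ, 0 < m → Complex.exp η ^ m ≠ 1)
    (hlam : ∀ i j, i ≠ j →
      Complex.sinh (lam i - lam j) ≠ 0 ∧ Complex.sinh (lam i - lam j + η) ≠ 0)
    (hγ : XXZ.IsContour η lam γ)
    (ha : XXZ.IsAuxiliary γ η J T h a)
    (huniq : XXZ.UniquelySolvable γ η a)
    (hG : ∀ᶠ α in 𝓝 (0 : ℂ), ∀ j,
      XXZ.IsDensity γ η a (lam j) α (fun z => G z (lam j) α)) :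
    (∀ᶠ α in 𝓝[≠] (0 : ℂ), ∀ (j : Fin n) (X : XXZ.SpinOp n),
      XXZ.HasSimplePole (fun μ => XXZ.bOp η lam (α - 1) μ X) (lam j) ∧
      XXZ.HasSimplePole (fun μ => XXZ.cOp η lam α μ X) (lam j) ∧
      XXZ.HasSimplePole (fun μ => XXZ.HOp η lam α μ X) (lam j)) ∧
    (∃ Ω₁ : XXZ.SpinOp n →ₗ[ℂ] XXZ.SpinOp n, ∀ X,
      Tendsto (fun α => XXZ.Omega1At η lam (XXZ.omega γ η a G) α X) (𝓝[≠] 0) (𝓝 (Ω₁ X))) ∧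
    (∃ Ω₂ : XXZ.SpinOp n →ₗ[ℂ] XXZ.SpinOp n, ∀ X,
      Tendsto (fun α => XXZ.Omega2At η lam (XXZ.phi γ a G) α X) (𝓝[≠] 0) (𝓝 (Ω₂ X))) := by
  have hZ := XXZ.exp_int_ne_one hq
  have hη0 : η ≠ 0 := by
    rintro rfl
    exact hq 1 one_pos (by simp)
  have hgen : XXZ.Gen η lam := XXZ.gen_of_sinh hq hlam
  obtain ⟨hφ, hψ, hsym⟩ := XXZ.regular_density hγ ha huniq hG
  -- The simple poles in `μ` are present for every `α`: they come from the Lax matrices, which do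
  -- not involve `α`.
  exact ⟨.of_forall fun α j X => ⟨(XXZ.bOp_pole hgen _ j X).1, (XXZ.cOp_pole hgen _ j X).1,
      (XXZ.HOp_pole hgen _ j X).1⟩,
    XXZ.exists_limit_Omega1 hgen hη0 hZ (fun i j => XXZ.differentiableAt_omega (hψ i j))
      fun i j => XXZ.omega_zero_symm (hsym i j),
    XXZ.exists_limit_Omega2 hgen hZ hφ⟩
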